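/- Let $k$ be a field of characteristic zero. A dg vector space has a differential of degree $+1$; all signs follow the Koszul rule, and $\operatorname{tr}_{n+1}$ denotes the (super)trace over the last input. For $I\sqcup J=[n]$ let $\sigma_{I,J}$ be the permutation rearranging $x_1\otimes\cdots\otimes x_n$ into $x_I\otimes x_J$ (both blocks in increasing order, with Koszul signs), and $(-1)^{\sigma_{I,J}}$ its sign. For a map $\varphi$ of degree $p$ from $n$ inputs put $\partial\varphi=d\varphi-(-1)^p\varphi d_\otimes$ (with $d=0$ on $k$). A *unimodular $L_\infty$-algebra* is a finite dimensional dg vector space $V$ with graded skew-symmetric maps $\ell_n:\wedge^nV\to V$ ($n\ge 2$) of degree $2-n$ and $q_n:\wedge^nV\to k$ ($n\ge 1$) of degree $-n$ such that $$\partial\ell_n=\sum_{\substack{I\sqcup J=[n]\\ 1\le|I|\le n-2}}(-1)^{\sigma_{I,J}+|I||J|}\,\ell_{|I|+1}(\mathrm{id}\otimes\cdots\otimes\mathrm{id}\otimes\ell_{|J|})\,\sigma_{I,J}\quad(n\ge2),$$ $$\partial q_n=\sum_{\substack{I\sqcup J=[n]\\ 0\le|I|\le n-2}}(-1)^{\sigma_{I,J}+|I||J|}\,q_{|I|+1}(\mathrm{id}\otimes\cdots\otimes\mathrm{id}\otimes\ell_{|J|})\,\sigma_{I,J}+\operatorname{tr}_{n+1}\ell_{n+1}\quad(n\ge1).$$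 Let $s:V[1]\to V$ be the degree $1$ identification, $\tilde\ell_n=s^{-1}\ell_n s^{\otimes n}$ and $\tilde q_n=q_ns^{\otimes n}$; a map $\varphi$ of degree $p$ acts on shifted spaces as $(-1)^ps^{-1}\varphi s$ (in particular for $\varphi=d,h,f,g$). Let $\Pi\mathrm{ULie}_\infty$ be the free wheeled operad on symmetric generators $\lambda_n$ ($n\ge2$, one output, degree $1$) and $\kappa_n$ ($n\ge1$, no output, degree $0$) with the differential given by $$\partial\lambda_n=-\sum_{\substack{I\sqcup J=[n]\\ 1\le|I|\le n-2}}\lambda_{|I|+1}(\mathrm{id}\otimes\cdots\otimes\mathrm{id}\otimes\lambda_{|J|})\sigma_{I,J},$$ $$\partial\kappa_n=\sum_{\substack{I\sqcup J=[n]\\ 0\le|I|\le n-2}}\kappa_{|I|+1}(\mathrm{id}\otimes\cdots\otimes\mathrm{id}\otimes\lambda_{|J|})\sigma_{I,J}+\operatorname{tr}_{n+1}\lambda_{n+1}.$$ For a finite dimensional dg vector space $W$ let $\mathrm{End}^{\circlearrowleft}_W$ be its wheeled endomorphism operad, with $\mathrm{Hom}(W^{\otimes n},W)$ and $\mathrm{Hom}(W^{\otimes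 n},k)$ in arity $n$, with composition of maps and contraction by the trace. Let $\mathfrak G_1(n)$, respectively $\mathfrak G_0(n)$, be the set of isomorphism classes of directed rooted trees with at least one vertex and with $n$ ingoing legs labelled by $1,\dots,n$, with, respectively without, a root leg, in which every vertex has at least two inputs, except that the root vertex of a tree in $\mathfrak G_0(n)$ needs only at least one. Let $\mathfrak G_1^{\circlearrowleft}(n)$ be the set of isomorphism classes of graphs obtained from a tree in $\mathfrak G_1(n+1)$ by grafting the root leg to one of the ingoing legs, the remaining legs being labelled by $1,\dots,n$. **Theorem.** Let $V$ be a unimodular $L_\infty$-algebra, let $U$ be a finite dimensional dg vector space, let $f:U\to V$ and $g:V\to U$ be morphisms of dg vector spaces and $h:V\to V$ a map of degree $-1$ with $fg-\mathrm{id}_V=d_Vh+hd_V$. For $G\in\mathfrak G_1(n)$ let $\theta_G:V[1]^{\otimes n}\to V[1]$ be the composite along $G$ obtained by decorating the root vertex $v$ with $\tilde\ell_{|in(v)|}$ and every other vertex $v$ with $h\tilde\ell_{|in(v)|}$; for $G\in\mathfrak G_0(n)$ let $\theta_G:V[1]^{\otimes n}\to k$ be obtained by decorating the root vertex $v$ with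 $\tilde q_{|in(v)|}$ and every other vertex $v$ with $h\tilde\ell_{|in(v)|}$; for $G\in\mathfrak G^{\circlearrowleft}_1(n)$ let $\theta_G:V[1]^{\otimes n}\to k$ be obtained by decorating all vertices $v$ with $h\tilde\ell_{|in(v)|}$ and taking the trace along the cycle. Then the assignment $$\lambda_n\mapsto\sum_{G\in\mathfrak G_1(n)}g\,\theta_G f^{\otimes n},\qquad \kappa_n\mapsto\sum_{G\in\mathfrak G_0(n)\sqcup\mathfrak G_1^{\circlearrowleft}(n)}\theta_G f^{\otimes n}$$ defines a morphism of dg wheeled operads $\Pi\mathrm{ULie}_\infty\to\mathrm{End}^{\circlearrowleft}_{U[1]}$. Hence there are maps $\ell^U_n$ ($n\ge2$) and $q^U_n$ ($n\ge1$) that form a unimodular $L_\infty$-algebra structure on $U$ and whose images $\tilde\ell^U_n$ and $\tilde q^U_n$ are the two sums above. -/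

import Mathlib

open Finset

universe u v w

noncomputable section

/-! ## Finite dimensional dg vector spaces -/

/-- A finite dimensional dg vector space over `k`: a finite dimensional space with a decomposition
into homogeneous components `gr i`, `i : ℤ`, and a differential `d` of degree `+1`. -/
structure DGSpace (k : Type u) [Field k] where
  carrier : Type v
  [addCommGroup : AddCommGroup carrier]
  [module : Module k carrier]
  [finite : FiniteDimensional k carrier]
  gr : ℤ → Submodule k carrier
  [decomposition : DirectSum.Decomposition gr]
  d : carrier →ₗ[k] carrier
  d_mem : ∀ (i : ℤ) (x : carrier), x ∈ gr i → d x ∈ gr (i + 1)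
  d_d : ∀ x, d (d x) = 0

namespace DGSpace

variable {k : Type u} [Field k]

instance : CoeSort (DGSpace.{u, v} k) (Type v) := ⟨DGSpace.carrier⟩

instance (V : DGSpace.{u, v} k) : AddCommGroup V := V.addCommGroup
instance (V : DGSpace.{u, v} k) : Module k V := V.module
instance (V : DGSpace.{u, v} k) : FiniteDimensional k V := V.finite
instance (V : DGSpace.{u, v} k) : DirectSum.Decomposition V.gr := V.decomposition

/-- The endomorphism acting on the component of degree `i` as multiplication by `c i`. -/
def weight (V : DGSpace.{u, v} k) (c : ℤ → k) : V →ₗ[k] V :=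
  (DirectSum.toModule k ℤ V fun i => c i • (V.gr i).subtype) ∘ₗ
    (DirectSum.decomposeLinearEquiv V.gr).toLinearMap

theorem weight_apply_of_mem (V : DGSpace.{u, v} k) (c : ℤ → k) {i : ℤ} {x : V}
    (hx : x ∈ V.gr i) : V.weight c x = c i • x := by
  classical
  have h : DirectSum.decompose V.gr x = DirectSum.of (fun i => V.gr i) i ⟨x, hx⟩ :=
    DirectSum.decompose_of_mem V.gr hx
  simp only [weight, LinearMap.comp_apply, LinearEquiv.coe_coe,
    DirectSum.decomposeLinearEquiv_apply, h]
  exact (DirectSum.toModule_lof k i _).trans rfl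

/-- The sign `(-1)^p` as an element of `k`. -/
def sgn (k : Type u) [Field k] (p : ℤ) : k := ((p.negOnePow : ℤ) : k)

/-- `twist p x = (-1)^(p * |x|) x`: the Koszul sign for moving an object of degree `p` past `x`. -/
def twist (V : DGSpace.{u, v} k) (p : ℤ) : V →ₗ[k] V := V.weight fun i => sgn k (p * i)

/-- The projection to the even (`p = 0`) or odd (`p = 1`) part. -/
def parityProj (V : DGSpace.{u, v} k) (p : ZMod 2) : V →ₗ[k] V :=
  V.weight fun i => if (i : ZMod 2) = p then 1 else 0

/-- The (super)trace of an endomorphism of a graded vector space. -/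
def strace (V : DGSpace.{u, v} k) : (V →ₗ[k] V) →ₗ[k] k :=
  LinearMap.trace k V ∘ₗ LinearMap.mulLeft k (V.twist 1 : Module.End k V)

/-- A linear map is homogeneous of degree `p`. -/
def IsHomogeneous (V : DGSpace.{u, v} k) (W : DGSpace.{u, w} k) (p : ℤ) (φ : V →ₗ[k] W) : Prop :=
  ∀ (i : ℤ) (x : V), x ∈ V.gr i → φ x ∈ W.gr (i + p)

/-- A morphism of dg vector spaces: a degree `0` map commuting with the differentials. -/
def IsChainMap (V : DGSpace.{u, v} k) (W : DGSpace.{u, w} k) (φ : V →ₗ[k] W) : Prop :=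
  IsHomogeneous V W 0 φ ∧ ∀ x, φ (V.d x) = W.d (φ x)

/-! ### The shift `V[1]` -/

theorem isInternal_shift (V : DGSpace.{u, v} k) :
    DirectSum.IsInternal fun i : ℤ => V.gr (i + 1) := by
  have h0 := DirectSum.Decomposition.isInternal V.gr
  rw [DirectSum.isInternal_submodule_iff_iSupIndep_and_iSup_eq_top] at h0 ⊢
  refine ⟨h0.1.comp (add_left_injective (1 : ℤ)), ?_⟩
  rw [← h0.2]
  exact (Equiv.addRight (1 : ℤ)).iSup_comp (g := V.gr)

/-- The shifted dg vector space `V[1]`, with `V[1]^i = V^(i+1)` and differential `-d`. -/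
def shift (V : DGSpace.{u, v} k) : DGSpace.{u, v} k :=
  { carrier := V
    gr := fun i => V.gr (i + 1)
    decomposition := V.isInternal_shift.chooseDecomposition
    d := -V.d
    d_mem := fun i x hx => by
      simpa using (V.gr (i + 1 + 1)).neg_mem (V.d_mem (i + 1) x hx)
    d_d := fun x => by simp [V.d_d] }

/-- The degree one identification `s : V[1] → V`. -/
def susp (V : DGSpace.{u, v} k) : V.shift ≃ₗ[k] V := LinearEquiv.refl k V.carrier

/-- The map `(-1)^p s⁻¹ φ s : V[1] → W[1]` induced by a map `φ : V → W` of degree `p`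
(thus the differential of `V[1]` is `shiftMap 1 V.d`). -/
def shiftMap {V : DGSpace.{u, v} k} {W : DGSpace.{u, w} k} (p : ℤ) (φ : V →ₗ[k] W) :
    V.shift →ₗ[k] W.shift :=
  sgn k p • (W.susp.symm.toLinearMap ∘ₗ φ ∘ₗ V.susp.toLinearMap)

/-! ## The wheeled endomorphism operad -/

/-- Multilinear maps `V^n → T`. The wheeled endomorphism operad of `V` has operadic part
`Multi V V n = Hom(V^{⊗ n}, V)` and wheeled part `Multi V k n = Hom(V^{⊗ n}, k)`. -/
abbrev Multi (V : DGSpace.{u, v} k) (T : Type w) [AddCommGroup T] [Module k T] (n : ℕ) :=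
  MultilinearMap k (fun _ : Fin n => V) T

variable {V : DGSpace.{u, v} k} {T : Type w} [AddCommGroup T] [Module k T]

/-- Homogeneity of degree `p` for maps `V^{⊗ n} → V`. -/
def HasDegree {n : ℕ} (p : ℤ) (f : Multi V V n) : Prop :=
  ∀ (i : Fin n → ℤ) (x : Fin n → V), (∀ j, x j ∈ V.gr (i j)) → f x ∈ V.gr (∑ j, i j + p)

/-- Homogeneity of degree `p` for maps `V^{⊗ n} → k`, with `k` in degree `0`. -/
def HasScalarDegree {n : ℕ} (p : ℤ) (f : Multi V k n) : Prop :=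
  ∀ (i : Fin n → ℤ) (x : Fin n → V), (∀ j, x j ∈ V.gr (i j)) → ∑ j, i j + p ≠ 0 → f x = 0

/-- `f ∘ d_⊗`, where
`d_⊗ (x₁ ⊗ ⋯ ⊗ xₙ) = ∑ᵢ (-1)^(|x₁| + ⋯ + |xᵢ₋₁|) x₁ ⊗ ⋯ ⊗ d xᵢ ⊗ ⋯ ⊗ xₙ`. -/
def compTensorD {n : ℕ} (f : Multi V T n) : Multi V T n :=
  ∑ i : Fin n, f.compLinearMap fun j =>
    if j < i then V.twist 1 else if j = i then V.d else LinearMap.id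

/-- The differential `∂ f = d f - (-1)^p f d_⊗` of a map `f : V^{⊗ n} → V` of degree `p`. -/
def del {n : ℕ} (p : ℤ) (f : Multi V V n) : Multi V V n :=
  V.d.compMultilinearMap f - sgn k p • compTensorD f

/-- The differential `∂ f = - (-1)^p f d_⊗` of a map `f : V^{⊗ n} → k` of degree `p`. -/
def delScalar {n : ℕ} (p : ℤ) (f : Multi V k n) : Multi V k n :=
  - (sgn k p • compTensorD f)

/-- The Koszul sign for sorting factors `x₁ ⊗ ⋯ ⊗ xₙ` of parities `p₁, …, pₙ` (stably) by the
values of `r`: a factor `-1` for every pair of odd factors that changes its relative order. -/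
def koszulSign {n : ℕ} {α : Type*} [LinearOrder α] (r : Fin n → α) (p : Fin n → ZMod 2) : ℤ :=
  ∏ i : Fin n, ∏ j : Fin n,
    if i < j ∧ r j < r i ∧ p i = 1 ∧ p j = 1 then -1 else 1

/-- The sign `(-1)^(number of inversions)` of a bijection `Fin n ≃ Fin m` (so `n = m`). -/
def inversionSign {n m : ℕ} (e : Fin n ≃ Fin m) : ℤ :=
  koszulSign e fun _ => 1

/-- The action of bijections on the inputs, with Koszul signs: `relabel e f` feeds its `i`-th
input to the `e i`-th input of `f`, i.e. it sends `x₁ ⊗ ⋯ ⊗ xₙ` to `± f (y)`, `y_{e i} = x_i`. -/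
def relabel {n m : ℕ} (e : Fin n ≃ Fin m) (f : Multi V T m) : Multi V T n :=
  ∑ p : Fin n → ZMod 2, koszulSign e p •
    (f.compLinearMap fun j => V.parityProj (p (e.symm j))).domDomCongr e.symm

/-- `L ↦ L ∘ g` as a linear map. -/
def precomp {b : ℕ} (g : Multi V V b) : (V →ₗ[k] T) →ₗ[k] Multi V T b where
  toFun L := L.compMultilinearMap g
  map_add' _ _ := rfl
  map_smul' _ _ := rfl

/-- The composition `f (id ⊗ ⋯ ⊗ id ⊗ g)` grafting a map `g` of degree `q` into the last input
of `f`; the Koszul sign comes from moving `g` past the first inputs. -/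
def compLast {a b : ℕ} (q : ℤ) (f : Multi V T (a + 1)) (g : Multi V V b) : Multi V T (a + b) :=
  (MultilinearMap.uncurrySum
    ((precomp g).compMultilinearMap
      ((MultilinearMap.curryRight f).compLinearMap fun _ => V.twist q))).domDomCongr
    finSumFinEquiv

theorem compLast_apply {a b : ℕ} (q : ℤ) (f : Multi V T (a + 1)) (g : Multi V V b)
    (x : Fin (a + b) → V) :
    compLast q f g x =
      f (Fin.snoc (α := fun _ => V) (fun i : Fin a => V.twist q (x (Fin.castAdd b i)))
        (g fun j : Fin b => x (Fin.natAdd a j))) := rfl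

/-- The contraction `tr_{n+1} f : (x₁, …, xₙ) ↦ tr (f (x₁, …, xₙ, -))`. -/
def traceLast {n : ℕ} (f : Multi V V (n + 1)) : Multi V k n :=
  V.strace.compMultilinearMap (MultilinearMap.curryRight f)

/-- For `I ⊔ J = [n]`, the bijection under which `x₁ ⊗ ⋯ ⊗ xₙ` becomes `x_I ⊗ x_J`
(both blocks in increasing order). Here `J = Iᶜ`. -/
def shuffle {n : ℕ} (I : Finset (Fin n)) : Fin n ≃ Fin (#I + #Iᶜ) :=
  (finSumEquivOfFinset (s := I) rfl rfl).symm.trans finSumFinEquiv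

/-! ## Unimodular L∞-algebras -/

/-- The families `ℓ_n : ∧ⁿ V → V` (`n ≥ 2`) and `q_n : ∧ⁿ V → k` (`n ≥ 1`) are a structure of
unimodular L∞-algebra on `V`. The values `ℓ 0`, `ℓ 1`, `q 0` play no role. -/
structure IsUnimodularLInfty (V : DGSpace.{u, v} k) (ℓ : ∀ n, Multi V V n)
    (q : ∀ n, Multi V k n) : Prop where
  ell_degree : ∀ n : ℕ, 2 ≤ n → HasDegree (2 - n) (ℓ n)
  q_degree : ∀ n : ℕ, 1 ≤ n → HasScalarDegree (-n) (q n)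
  ell_skew : ∀ n, 2 ≤ n → ∀ σ : Fin n ≃ Fin n, relabel σ (ℓ n) = inversionSign σ • ℓ n
  q_skew : ∀ n, 1 ≤ n → ∀ σ : Fin n ≃ Fin n, relabel σ (q n) = inversionSign σ • q n
  ell_eq : ∀ n : ℕ, 2 ≤ n → del (2 - (n : ℤ)) (ℓ n) =
    ∑ I : {I : Finset (Fin n) // 1 ≤ #I ∧ 2 ≤ #Iᶜ},
      (inversionSign (shuffle I.1) * (-1) ^ (#I.1 * #I.1ᶜ)) •
        relabel (shuffle I.1) (compLast (2 - #I.1ᶜ) (ℓ (#I.1 + 1)) (ℓ #I.1ᶜ))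
  q_eq : ∀ n : ℕ, 1 ≤ n → delScalar (-(n : ℤ)) (q n) =
    (∑ I : {I : Finset (Fin n) // 2 ≤ #Iᶜ},
      (inversionSign (shuffle I.1) * (-1) ^ (#I.1 * #I.1ᶜ)) •
        relabel (shuffle I.1) (compLast (2 - #I.1ᶜ) (q (#I.1 + 1)) (ℓ #I.1ᶜ)))
    + traceLast (ℓ (n + 1))

/-- The parity change `ℓ̃ = s⁻¹ ℓ (s ⊗ ⋯ ⊗ s)`. As `s` has degree one,
`(s ⊗ ⋯ ⊗ s)(x₁ ⊗ ⋯ ⊗ xₙ) = (-1)^(∑ᵢ (n - i)|xᵢ|) s x₁ ⊗ ⋯ ⊗ s xₙ`. -/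
def tilde {n : ℕ} (f : Multi V V n) : Multi V.shift V.shift n :=
  V.susp.symm.toLinearMap.compMultilinearMap
    (f.compLinearMap fun i => V.susp.toLinearMap ∘ₗ V.shift.twist (i.rev : ℕ))

/-- The parity change `q̃ = q (s ⊗ ⋯ ⊗ s)`. -/
def tildeScalar {n : ℕ} (f : Multi V k n) : Multi V.shift k n :=
  f.compLinearMap fun i => V.susp.toLinearMap ∘ₗ V.shift.twist (i.rev : ℕ)

end DGSpace

/-! ## The dg wheeled operad `ΠULie_∞`

Elements of the free wheeled operad on generators `ℓ_n` (degree `1`) and `q_n` (degree `0`)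
are written as formal expressions in the generators, built from the wheeled operad operations
(composition, contraction, relabelling of inputs, linear combinations). Grafting into the last
input and contraction of the last input suffice because of relabelling. -/

/-- Expressions of arity `n` and degree `p` in the operadic part of the free wheeled operad. -/
inductive OperadicExpr (k : Type u) : ℕ → ℤ → Type (max 1 u)
  | ell (n : ℕ) (hn : 2 ≤ n) : OperadicExpr k n 1
  | one : OperadicExpr k 1 0
  | comp {a b : ℕ} {p q r : ℤ} (s : OperadicExpr k (a + 1) p) (t : OperadicExpr k b q)
      (h : p + q = r) : OperadicExpr k (a + b) r
  | relabel {n m : ℕ} {p : ℤ} (e : Fin n ≃ Fin m) (t : OperadicExpr k m p) : OperadicExpr k n p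
  | lin {n : ℕ} {p : ℤ} {ι : Type} (fin : Fintype ι) (c : ι → k) (t : ι → OperadicExpr k n p) :
      OperadicExpr k n p

/-- Expressions of arity `n` and degree `p` in the wheeled part of the free wheeled operad. -/
inductive WheeledExpr (k : Type u) : ℕ → ℤ → Type (max 1 u)
  | gen (n : ℕ) (hn : 1 ≤ n) : WheeledExpr k n 0
  | comp {a b : ℕ} {p q r : ℤ} (s : WheeledExpr k (a + 1) p) (t : OperadicExpr k b q)
      (h : p + q = r) : WheeledExpr k (a + b) r
  | trace {n : ℕ} {p : ℤ} (t : OperadicExpr k (n + 1) p) : WheeledExpr k n p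
  | relabel {n m : ℕ} {p : ℤ} (e : Fin n ≃ Fin m) (t : WheeledExpr k m p) : WheeledExpr k n p
  | lin {n : ℕ} {p : ℤ} {ι : Type} (fin : Fintype ι) (c : ι → k) (t : ι → WheeledExpr k n p) :
      WheeledExpr k n p

section Differential

variable {k : Type u} [Field k]

/-- The differential of `ΠULie_∞` on the operadic part: the derivation with
`∂ ℓ_n = - ∑ (ℓ_{|I|+1} ∘ ℓ_{|J|}) σ_{I,J}`, over `I ⊔ J = [n]`, `1 ≤ |I| ≤ n - 2`. -/
def OperadicExpr.diff : ∀ {n : ℕ} {p : ℤ}, OperadicExpr k n p → OperadicExpr k n (p + 1)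
  | _, _, .ell n _ =>
    .lin (ι := {I : Finset (Fin n) // 1 ≤ #I ∧ 2 ≤ #Iᶜ}) inferInstance (fun _ => -1) fun I =>
      .relabel (DGSpace.shuffle I.1)
        (.comp (.ell (#I.1 + 1) (Nat.succ_le_succ I.2.1)) (.ell #I.1ᶜ I.2.2) rfl)
  | _, _, .one => .lin (ι := Empty) inferInstance (fun i => i.elim) fun i => i.elim
  | _, _, .comp (p := p) (q := q) (r := r) s t h =>
    .lin (ι := Fin 2) inferInstance ![1, DGSpace.sgn k p]
      ![.comp s.diff t (by omega), .comp s t.diff (by omega)]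
  | _, _, .relabel e t => .relabel e t.diff
  | _, _, .lin fin c t => .lin fin c fun i => (t i).diff

/-- The differential of `ΠULie_∞` on the wheeled part: the derivation commuting with contractions
with `∂ q_n = ∑ (q_{|I|+1} ∘ ℓ_{|J|}) σ_{I,J} + tr ℓ_{n+1}`, over `I ⊔ J = [n]`,
`0 ≤ |I| ≤ n - 2`. -/
def WheeledExpr.diff : ∀ {n : ℕ} {p : ℤ}, WheeledExpr k n p → WheeledExpr k n (p + 1)
  | _, _, .gen n hn =>
    .lin (ι := Option {I : Finset (Fin n) // 2 ≤ #Iᶜ}) inferInstance (fun _ => 1) fun o =>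
      match o with
      | some I => .relabel (DGSpace.shuffle I.1)
          (.comp (.gen (#I.1 + 1) (Nat.le_add_left 1 _)) (.ell #I.1ᶜ I.2) rfl)
      | none => .trace (.ell (n + 1) (Nat.succ_le_succ hn))
  | _, _, .comp (p := p) (q := q) (r := r) s t h =>
    .lin (ι := Fin 2) inferInstance ![1, DGSpace.sgn k p]
      ![.comp s.diff t (by omega), .comp s t.diff (by omega)]
  | _, _, .trace t => .trace t.diff
  | _, _, .relabel e t => .relabel e t.diff
  | _, _, .lin fin c t => .lin fin c fun i => (t i).diff

/-- The operadic part of the morphism of wheeled operads from the free wheeled operad to the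
wheeled endomorphism operad of `W` that maps the generators `ℓ_n` to `L n`. -/
def OperadicExpr.eval {W : DGSpace.{u, v} k} (L : ∀ n, DGSpace.Multi W W n) :
    ∀ {n : ℕ} {p : ℤ}, OperadicExpr k n p → DGSpace.Multi W W n
  | _, _, .ell n _ => L n
  | _, _, .one => MultilinearMap.ofSubsingleton k W W 0 LinearMap.id
  | _, _, .comp (q := q) s t _ => DGSpace.compLast q (s.eval L) (t.eval L)
  | _, _, .relabel e t => DGSpace.relabel e (t.eval L)
  | _, _, .lin (ι := ι) fin c t => ∑ i ∈ @Finset.univ ι fin, c i • (t i).eval L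

/-- The wheeled part of the morphism of wheeled operads from the free wheeled operad to the
wheeled endomorphism operad of `W` that maps the generators `ℓ_n` to `L n` and `q_n` to `Q n`. -/
def WheeledExpr.eval {W : DGSpace.{u, v} k} (L : ∀ n, DGSpace.Multi W W n)
    (Q : ∀ n, DGSpace.Multi W k n) :
    ∀ {n : ℕ} {p : ℤ}, WheeledExpr k n p → DGSpace.Multi W k n
  | _, _, .gen n _ => Q n
  | _, _, .comp (q := q) s t _ => DGSpace.compLast q (s.eval L Q) (t.eval L)
  | _, _, .trace t => DGSpace.traceLast (t.eval L)
  | _, _, .relabel e t => DGSpace.relabel e (t.eval L Q)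
  | _, _, .lin (ι := ι) fin c t => ∑ i ∈ @Finset.univ ι fin, c i • (t i).eval L Q

/-- The assignment `ℓ_n ↦ L n`, `q_n ↦ Q n` defines a morphism of dg wheeled operads from
`ΠULie_∞` to the wheeled endomorphism operad of `W`: the images of the generators are symmetric
and of degrees `1` and `0`, and the induced map commutes with the differentials on all elements
of the free wheeled operad. -/
structure IsDGMorphism (W : DGSpace.{u, v} k) (L : ∀ n, DGSpace.Multi W W n)
    (Q : ∀ n, DGSpace.Multi W k n) : Prop where
  ell_degree : ∀ n, 2 ≤ n → DGSpace.HasDegree 1 (L n)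
  q_degree : ∀ n, 1 ≤ n → DGSpace.HasScalarDegree 0 (Q n)
  ell_symm : ∀ n, 2 ≤ n → ∀ σ : Fin n ≃ Fin n, DGSpace.relabel σ (L n) = L n
  q_symm : ∀ n, 1 ≤ n → ∀ σ : Fin n ≃ Fin n, DGSpace.relabel σ (Q n) = Q n
  map_diff : ∀ (n : ℕ) (p : ℤ) (t : OperadicExpr k n p),
    t.diff.eval L = DGSpace.del p (t.eval L)
  map_diff_wheeled : ∀ (n : ℕ) (p : ℤ) (t : WheeledExpr k n p),
    t.diff.eval L Q = DGSpace.delScalar p (t.eval L Q)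

end Differential

/-! ## Trees and wheels -/

/-- Isomorphism classes of directed trees with root leg whose ingoing legs are labelled by `Fin n`
and all of whose vertices have at least two inputs, including the trivial tree `leaf` without
vertices. Such a nontrivial tree is a partition of the labels into the (unordered) set of branches
at the root vertex, together with a tree for each block, the labels in a block being
renumbered increasingly. (`OrderedFinpartition` lists the blocks of a set partition in the order
of their greatest elements, so every set partition occurs exactly once.) -/
inductive LTree : ℕ → Type
  | leaf : LTree 1
  | node {n : ℕ} (c : OrderedFinpartition n) (hc : 2 ≤ c.length)
      (branch : ∀ m, LTree (c.partSize m)) : LTree n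

/-- The class `𝔊₁(n)`: trees with root leg and at least one vertex. -/
abbrev TreeWithLeg (n : ℕ) : Type :=
  Σ c : {c : OrderedFinpartition n // 2 ≤ c.length}, ∀ m, LTree (c.1.partSize m)

/-- The class `𝔊₀(n)`: trees without root leg. The root vertex has at least one input (this is
automatic for `n ≥ 1`), all other vertices have at least two. -/
abbrev TreeWithoutLeg (n : ℕ) : Type :=
  Σ c : OrderedFinpartition n, ∀ m, LTree (c.partSize m)

/-- The class `𝔊₁^↻(n)`, `n ≥ 1`: graphs obtained from a tree with `n + 1` ingoing legs by grafting
the root leg to the ingoing leg labelled `Fin.last n`. Cutting such a graph at any edge of its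
cycle yields such a tree, so each graph is obtained from as many trees as its cycle has vertices.
Exactly one of them has the following property, by which we select it: the leg `0` and the leg
`Fin.last n` lie on different branches at the root vertex. -/
abbrev WheelGraph (n : ℕ) : Type :=
  {t : TreeWithLeg (n + 1) // t.1.1.index 0 ≠ t.1.1.index (Fin.last n)}

theorem OrderedFinpartition.partSize_lt_of_two_le {n : ℕ} (c : OrderedFinpartition n)
    (hc : 2 ≤ c.length) (m : Fin c.length) : c.partSize m < n := by
  have h := c.sum_sigma_eq_sum (fun _ => (1 : ℕ))
  simp only [Finset.sum_const, Finset.card_univ, Fintype.card_fin, smul_eq_mul, mul_one] at h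
  have : Nontrivial (Fin c.length) := Fin.nontrivial_iff_two_le.2 hc
  obtain ⟨m', hm'⟩ := exists_ne m
  have h2 : c.partSize m + c.partSize m' ≤ ∑ i, c.partSize i := by
    rw [← Finset.sum_pair hm'.symm]
    exact Finset.sum_le_sum_of_subset (Finset.subset_univ _)
  have := c.partSize_pos m'
  omega

/-- A tree is either trivial or given by its root vertex and the branches there. -/
def LTree.unfold {n : ℕ} : LTree n → Option (TreeWithLeg n)
  | .leaf => none
  | .node c hc b => some ⟨⟨c, hc⟩, b⟩

theorem LTree.eq_of_unfold_eq : ∀ {n : ℕ} (s t : LTree n), s.unfold = t.unfold → s = t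
  | _, .leaf, .leaf, _ => rfl
  | _, .leaf, .node _ _ _, h => by simp [LTree.unfold] at h
  | _, .node _ _ _, .leaf, h => by simp [LTree.unfold] at h
  | _, .node c hc b, .node c' hc' b', h => by
    simp only [LTree.unfold, Option.some.injEq] at h
    cases h
    rfl

instance LTree.instFinite (n : ℕ) : Finite (LTree n) := by
  induction n using Nat.strong_induction_on with
  | _ n ih =>
    have : ∀ c : {c : OrderedFinpartition n // 2 ≤ c.length},
        Finite (∀ m, LTree (c.1.partSize m)) := fun c => by
      have := fun m => ih _ (c.1.partSize_lt_of_two_le c.2 m)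
      exact inferInstance
    exact Finite.of_injective _ fun s t => LTree.eq_of_unfold_eq s t

instance (n : ℕ) : Fintype (LTree n) := Fintype.ofFinite _

/-! ## The transferred structure -/

namespace DGSpace

variable {k : Type u} [Field k] {W : DGSpace.{u, v} k} {T : Type w} [AddCommGroup T] [Module k T]

/-- The map `W^{⊗ n} → T` obtained by grafting maps `G m` of degree `0` into the inputs of `F`, the
`m`-th map receiving the inputs with labels in the `m`-th block of `c`. The Koszul sign comes from
sorting the inputs by blocks. -/
def graft {n : ℕ} (c : OrderedFinpartition n) (F : Multi W T c.length)
    (G : ∀ m, Multi W W (c.partSize m)) : Multi W T n :=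
  ∑ p : Fin n → ZMod 2, koszulSign c.index p •
    ((F.compMultilinearMap G).domDomCongr c.equivSigma).compLinearMap fun i => W.parityProj (p i)

theorem graft_apply {n : ℕ} (c : OrderedFinpartition n) (F : Multi W T c.length)
    (G : ∀ m, Multi W W (c.partSize m)) (x : Fin n → W) :
    graft c F G x = ∑ p : Fin n → ZMod 2, koszulSign c.index p •
      F fun m => G m fun j => W.parityProj (p (c.emb m j)) (x (c.emb m j)) := by
  simp only [graft, _root_.sum_apply]
  rfl

/-- All vertices `v` of the tree are decorated by `h ℓ̃_{|in(v)|}`. -/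
def thetaInner (L : ∀ n, Multi W W n) (h : W →ₗ[k] W) : ∀ {n : ℕ}, LTree n → Multi W W n
  | _, .leaf => MultilinearMap.ofSubsingleton k W W 0 LinearMap.id
  | _, .node c _ b => h.compMultilinearMap (graft c (L c.length) fun m => thetaInner L h (b m))

/-- `θ_G` for `G ∈ 𝔊₁(n)`: the root vertex `v` is decorated by `ℓ̃_{|in(v)|}`, every other
vertex `v` by `h ℓ̃_{|in(v)|}`. -/
def thetaRooted (L : ∀ n, Multi W W n) (h : W →ₗ[k] W) {n : ℕ} (t : TreeWithLeg n) : Multi W W n :=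
  graft t.1.1 (L t.1.1.length) fun m => thetaInner L h (t.2 m)

/-- `θ_G` for `G ∈ 𝔊₀(n)`: the root vertex `v` is decorated by `q̃_{|in(v)|}`, every other
vertex `v` by `h ℓ̃_{|in(v)|}`. -/
def thetaUnrooted (L : ∀ n, Multi W W n) (Q : ∀ n, Multi W k n) (h : W →ₗ[k] W) {n : ℕ}
    (t : TreeWithoutLeg n) : Multi W k n :=
  graft t.1 (Q t.1.length) fun m => thetaInner L h (t.2 m)

/-- `θ_G` for `G ∈ 𝔊₁^↻(n)`: all vertices `v` are decorated by `h ℓ̃_{|in(v)|}`. -/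
def thetaWheel (L : ∀ n, Multi W W n) (h : W →ₗ[k] W) {n : ℕ} (t : WheelGraph n) : Multi W k n :=
  traceLast (h.compMultilinearMap (thetaRooted L h t.1))

variable {V : DGSpace.{u, v} k} {U : DGSpace.{u, w} k}

/-- The image `∑_{G ∈ 𝔊₁(n)} g θ_G f^{⊗ n}` of the generator `ℓ_n` of `ΠULie_∞`, where `V[1]`
carries the maps `ℓ̃_n` and `f`, `g`, `h` (of degrees `0`, `0`, `-1`) act on the shifted spaces. -/
def transferEll (ℓ : ∀ n, Multi V V n) (f : U →ₗ[k] V) (g : V →ₗ[k] U) (h : V →ₗ[k] V) (n : ℕ) :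
    Multi U.shift U.shift n :=
  ∑ G : TreeWithLeg n, (shiftMap 0 g).compMultilinearMap
    ((thetaRooted (fun m => tilde (ℓ m)) (shiftMap (-1) h) G).compLinearMap fun _ => shiftMap 0 f)

/-- The image `∑_{G ∈ (𝔊₀ ⊔ 𝔊₁^↻)(n)} θ_G f^{⊗ n}` of the generator `q_n` of `ΠULie_∞`. -/
def transferQ (ℓ : ∀ n, Multi V V n) (q : ∀ n, Multi V k n) (f : U →ₗ[k] V) (h : V →ₗ[k] V)
    (n : ℕ) : Multi U.shift k n :=
  (∑ G : TreeWithoutLeg n, (thetaUnrooted (fun m => tilde (ℓ m)) (fun m => tildeScalar (q m))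
    (shiftMap (-1) h) G).compLinearMap fun _ => shiftMap 0 f) +
  ∑ G : WheelGraph n, (thetaWheel (fun m => tilde (ℓ m)) (shiftMap (-1) h) G).compLinearMap
    fun _ => shiftMap 0 f

end DGSpace

end

open scoped TensorProduct

noncomputable section

set_option linter.unusedSectionVars false

/-! After the parity change, the structure on `V[1]` consists of graded symmetric maps L_n of degree
1 and Q_n of degree 0. The Koszul signs are then removed by extending scalars to a Grassmann algebra
A and evaluating on even points: sums of tensors x ⊗ a with x and a of the same parity and a of
square zero. On these, the sign from permuting the x's cancels the sign from permuting the a's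
(`gext_relabel`, `gext_graft`, `gext_compLast`, `gext_compTensorD`). As A contains fresh elements of
either parity, independent of any finite set of coefficients, identities of multilinear maps can be
tested on even points (`multi_ext_of_valid`).

Write E(x) = ∑ L_n(x,…,x)/n!, let E'(x) be its derivative (an operator with coefficients in A),
define q(x) and q'(x) from the Q_n in the same way, put D(x) = dx + E(x), and let η ∈ A be odd. The
axioms become η dE(x) + E'(x)(ηD(x)) = 0, which says that the odd vector field D squares to zero,
and q'(x)(ηD(x)) + η str E'(x) = 0, a divergence equation (`ell_point`, `q_point`).

By the exponential formula (`subsum_compFam`), the sum over trees decorated by hL is the solution x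
= x(v) of x = v + hE(x). The operator hE' is nilpotent, so this solution is unique, and v ↦ x(v) has
derivative R = (1 - hE'(x))⁻¹. The transferred bracket has generating function gE(x(fu)). From fg =
1 + dh + hd one gets R f η(du + gE(x)) = ηD(x) (`act_treeOp_differential`): the map u ↦ x(fu)
carries the transferred vector field to D. The transferred L∞ equation is then g applied to the
original one.

The wheels sum to W(x) = ∑ⱼ str((hE'(x))^j)/j = -log sdet(1 - hE'(x)), because both sides vanish on
the empty family and have the same increment when one more point is adjoined (`subsum_wheelTrees`).
Along ηD the variation of W is η str E'(x) - η str(fgE'(x)R), by the derivative of the structure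
equation (`op_eq`), the homotopy relation and cyclicity of the supertrace (`straceA_variation`). The
first term cancels the variation of q. The second is the supertrace of the derivative gE'(x)Rf of
the transferred bracket, which is what unimodularity of the transferred structure requires.

Trees are enumerated with the help of the order of the labels, so their sums are not visibly
symmetric, and diagonal values alone would not determine them. Diagonal values are therefore
replaced by `subsum`, the sum of the values on all subfamilies of a family of square-zero points.
For symmetric maps this is the exponential sum at the total of the family; in general it still
determines the maps, and if it depends on that total only, then the maps are symmetric
(`perm_of_subsum`). -/

/-! ## Grassmann algebras -/

/-- The Koszul sign for exchanging two homogeneous factors. -/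
def paritySign (i j : ZMod 2) : ℤ := if i = 1 ∧ j = 1 then -1 else 1

theorem paritySign_mul_self (i j : ZMod 2) : paritySign i j * paritySign i j = 1 := by
  unfold paritySign; split_ifs <;> simp

theorem paritySign_comm (i j : ZMod 2) : paritySign i j = paritySign j i := by
  unfold paritySign; simp only [and_comm]

/-- A supercommutative algebra with enough square-zero elements of either parity. -/
class Grassmann (k : Type u) [Field k] (A : Type w) [Ring A] [Algebra k A] where
  P : ZMod 2 → Submodule k A
  one_mem : (1 : A) ∈ P 0
  mul_mem : ∀ {i j : ZMod 2} {a b : A}, a ∈ P i → b ∈ P j → a * b ∈ P (i + j)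
  comm : ∀ {i j : ZMod 2} {a b : A}, a ∈ P i → b ∈ P j → a * b = paritySign i j • (b * a)
  span : P 0 ⊔ P 1 = ⊤
  fresh : ∀ (s : Finset A) (p : ZMod 2), ∃ ζ ∈ P p, ζ * ζ = 0 ∧
    ∃ c : A →ₗ[k] A, ∀ a ∈ s, c (a * ζ) = a

/-- The homogeneous components of a Grassmann algebra. -/
abbrev Grassmann.par (k : Type u) [Field k] {A : Type w} [Ring A] [Algebra k A] [Grassmann k A]
    (p : ZMod 2) : Submodule k A := Grassmann.P p

theorem zmod_two_cases : ∀ p : ZMod 2, p = 0 ∨ p = 1 := by decide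

/-! ### The exterior algebra on countably many generators -/

namespace ExteriorAlgebra

variable {k : Type u} [Field k]

/-- An element involves only finitely many generators, and contraction with a later coordinate
functional kills each of them. -/
theorem contractRight_lapply_eventually_zero (a : ExteriorAlgebra k (ℕ →₀ k)) :
    ∃ J : ℕ, ∀ j, J ≤ j →
      CliffordAlgebra.contractRight a (Finsupp.lapply j : Module.Dual k (ℕ →₀ k)) = 0 := by
  induction a using CliffordAlgebra.right_induction with
  | algebraMap r => exact ⟨0, fun j _ => CliffordAlgebra.contractRight_algebraMap (Q := 0) _ r⟩
  | add a b ha hb =>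
    obtain ⟨J, hJ⟩ := ha
    obtain ⟨J', hJ'⟩ := hb
    refine ⟨max J J', fun j hj => ?_⟩
    rw [map_add, LinearMap.add_apply, hJ j (le_trans (le_max_left _ _) hj),
      hJ' j (le_trans (le_max_right _ _) hj), add_zero]
  | mul_ι m a ha =>
    obtain ⟨J, hJ⟩ := ha
    refine ⟨max J (m.support.sup id + 1), fun j hj => ?_⟩
    rw [CliffordAlgebra.contractRight_mul_ι, hJ j (le_trans (le_max_left _ _) hj), zero_mul,
      sub_zero]
    have : m j = 0 := by
      by_contra h
      have h1 := Finset.le_sup (f := id) (Finsupp.mem_support_iff.2 h)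
      have h2 := le_trans (le_max_right _ _) hj
      simp only [id] at h1
      omega
    simp [this]

theorem exists_contractRight_zero (s : Finset (ExteriorAlgebra k (ℕ →₀ k))) :
    ∃ J : ℕ, ∀ a ∈ s, ∀ j, J ≤ j →
      CliffordAlgebra.contractRight a (Finsupp.lapply j : Module.Dual k (ℕ →₀ k)) = 0 := by
  choose J hJ using contractRight_lapply_eventually_zero (k := k)
  exact ⟨s.sup J, fun a ha j hj => hJ a j (le_trans (Finset.le_sup ha) hj)⟩

/-- Contraction is an antiderivation, so when it annihilates a it strips the last factor off the
product. This is the linear map that undoes multiplication by a fresh generator. -/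
theorem contractRight_mul_single (a : ExteriorAlgebra k (ℕ →₀ k)) (j : ℕ)
    (h : CliffordAlgebra.contractRight a (Finsupp.lapply j : Module.Dual k (ℕ →₀ k)) = 0) :
    CliffordAlgebra.contractRight (a * ExteriorAlgebra.ι k (Finsupp.single j 1))
      (Finsupp.lapply j : Module.Dual k (ℕ →₀ k)) = a := by
  have := CliffordAlgebra.contractRight_mul_ι (Q := (0 : QuadraticForm k (ℕ →₀ k)))
    (d := (Finsupp.lapply j : Module.Dual k (ℕ →₀ k))) (Finsupp.single j 1) a
  rw [h, zero_mul, sub_zero] at this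
  refine this.trans ?_
  simp

/-- For the zero form all vectors are mutually orthogonal, so the graded commutation rule for
orthogonal Clifford algebras applies with both isometries equal to the identity. -/
theorem supercommutative {M : Type*} [AddCommGroup M] [Module k M] {i j : ZMod 2}
    {a b : ExteriorAlgebra k M}
    (ha : a ∈ CliffordAlgebra.evenOdd (0 : QuadraticForm k M) i)
    (hb : b ∈ CliffordAlgebra.evenOdd (0 : QuadraticForm k M) j) :
    a * b = paritySign i j • (b * a) := by
  have h := CliffordAlgebra.map_mul_map_of_isOrtho_of_mem_evenOdd
    (Qₙ := (0 : QuadraticForm k M)) (QuadraticMap.Isometry.id _) (QuadraticMap.Isometry.id _)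
    (fun x y => by simp [QuadraticMap.IsOrtho]) a b ha hb
  simp only [CliffordAlgebra.map_id, AlgHom.id_apply] at h
  rw [h]
  have h1 : (-1 : ℤˣ) ^ (1 : ZMod 2) = -1 := by decide
  rcases zmod_two_cases i with rfl | rfl <;> rcases zmod_two_cases j with rfl | rfl <;>
    simp [paritySign, Units.smul_def, h1]

instance grassmann : Grassmann k (ExteriorAlgebra k (ℕ →₀ k)) where
  P := CliffordAlgebra.evenOdd (0 : QuadraticForm k (ℕ →₀ k))
  one_mem := CliffordAlgebra.one_le_evenOdd_zero _ (Submodule.one_le.1 le_rfl)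
  mul_mem ha hb := CliffordAlgebra.evenOdd_mul_le _ _ _ (Submodule.mul_mem_mul ha hb)
  comm ha hb := supercommutative ha hb
  span := (CliffordAlgebra.evenOdd_isCompl (0 : QuadraticForm k (ℕ →₀ k))).sup_eq_top
  fresh s p := by
    obtain ⟨J, hJ⟩ := exists_contractRight_zero s
    rcases zmod_two_cases p with rfl | rfl
    -- An even fresh element must be a product of two unused generators; the contractions below
    -- strip off the generator J + 1 first and then the generator J.
    · refine ⟨ExteriorAlgebra.ι k (Finsupp.single J 1) *
        ExteriorAlgebra.ι k (Finsupp.single (J + 1) 1),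
        CliffordAlgebra.ι_mul_ι_mem_evenOdd_zero _ _ _, ?_, ?_⟩
      · have h : ExteriorAlgebra.ι k (Finsupp.single (J + 1) 1 : ℕ →₀ k) *
            ExteriorAlgebra.ι k (Finsupp.single J 1) = -(ExteriorAlgebra.ι k (Finsupp.single J 1) *
              ExteriorAlgebra.ι k (Finsupp.single (J + 1) 1)) := by
          have := supercommutative (k := k)
            (CliffordAlgebra.ι_mem_evenOdd_one _ (Finsupp.single (J + 1) 1 : ℕ →₀ k))
            (CliffordAlgebra.ι_mem_evenOdd_one _ (Finsupp.single J 1 : ℕ →₀ k))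
          simpa [paritySign] using this
        rw [mul_assoc, ← mul_assoc (ExteriorAlgebra.ι k (Finsupp.single (J + 1) 1)), h, neg_mul,
          mul_assoc, ExteriorAlgebra.ι_sq_zero, mul_zero, neg_zero, mul_zero]
      · refine ⟨(CliffordAlgebra.contractRight.flip (Finsupp.lapply J : Module.Dual k (ℕ →₀ k))) ∘ₗ
          (CliffordAlgebra.contractRight.flip (Finsupp.lapply (J + 1) : Module.Dual k (ℕ →₀ k))),
          fun a ha => ?_⟩
        rw [LinearMap.comp_apply, LinearMap.flip_apply, LinearMap.flip_apply, ← mul_assoc]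
        have h1 : CliffordAlgebra.contractRight (a * ExteriorAlgebra.ι k (Finsupp.single J 1))
            (Finsupp.lapply (J + 1) : Module.Dual k (ℕ →₀ k)) = 0 := by
          have := CliffordAlgebra.contractRight_mul_ι (Q := (0 : QuadraticForm k (ℕ →₀ k)))
            (d := (Finsupp.lapply (J + 1) : Module.Dual k (ℕ →₀ k))) (Finsupp.single J 1) a
          rw [hJ a ha (J + 1) (Nat.le_succ _), zero_mul, sub_zero] at this
          refine this.trans ?_
          simp
        rw [contractRight_mul_single _ _ h1, contractRight_mul_single _ _ (hJ a ha J le_rfl)]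
    · exact ⟨ExteriorAlgebra.ι k (Finsupp.single J 1), CliffordAlgebra.ι_mem_evenOdd_one _ _,
        ExteriorAlgebra.ι_sq_zero _,
        CliffordAlgebra.contractRight.flip (Finsupp.lapply J : Module.Dual k (ℕ →₀ k)),
        fun a ha => contractRight_mul_single _ _ (hJ a ha J le_rfl)⟩

end ExteriorAlgebra

/-! ### Square-zero homogeneous elements -/

namespace Grassmann

variable {k : Type u} [Field k] {A : Type w} [Ring A] [Algebra k A] [Grassmann k A]

theorem sq_zero_of_odd [CharZero k] {a : A} (ha : a ∈ par k 1) : a * a = 0 := by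
  have h := comm ha ha
  simp only [paritySign, and_self, if_true, neg_smul, one_smul] at h
  have h2 : (2 : k) • (a * a) = 0 := by
    rw [two_smul]; nth_rewrite 1 [h]; exact neg_add_cancel _
  exact (smul_eq_zero.1 h2).resolve_left two_ne_zero

/-- Homogeneous elements. -/
def Hom (k : Type u) [Field k] {A : Type w} [Ring A] [Algebra k A] [Grassmann k A] (a : A) : Prop :=
  ∃ p, a ∈ par k p

variable (k) in
@[elab_as_elim]
theorem hom_induction {C : A → Prop} (hom : ∀ p, ∀ a ∈ par k p, C a)
    (add : ∀ a b, C a → C b → C (a + b)) (a : A) : C a := by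
  have h : a ∈ par k (A := A) 0 ⊔ par k 1 := by rw [span]; trivial
  obtain ⟨x, hx, y, hy, rfl⟩ := Submodule.mem_sup.1 h
  exact add _ _ (hom _ _ hx) (hom _ _ hy)

/-- The homogeneous parts of c commute with a up to sign, so the two copies of a can be brought
together. Thus the ideal generated by a has square zero. -/
theorem mul_mul_self_eq_zero {a : A} (ha : Hom k a) (h : a * a = 0) (c : A) : a * c * a = 0 := by
  induction c using hom_induction k (A := A) with
  | hom p c hc =>
    obtain ⟨q, hq⟩ := ha
    rw [comm hq hc, smul_mul_assoc, mul_assoc, h, mul_zero, smul_zero]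
  | add x y hx hy => rw [mul_add, add_mul, hx, hy, add_zero]

/-- Left multiples of a homogeneous element are also right multiples, so divisibility by it does not
depend on the side. -/
theorem exists_mul_comm {a : A} (ha : Hom k a) (c : A) : ∃ c', c * a = a * c' := by
  induction c using hom_induction k (A := A) with
  | hom p c hc =>
    obtain ⟨q, hq⟩ := ha
    exact ⟨paritySign p q • c, by rw [comm hc hq, mul_smul_comm]⟩
  | add x y hx hy =>
    obtain ⟨x', hx⟩ := hx
    obtain ⟨y', hy⟩ := hy
    exact ⟨x' + y', by rw [add_mul, hx, hy, mul_add]⟩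

theorem mul_self_mul {a b : A} (ha : Hom k a) (hb : Hom k b) (h : a * a = 0 ∨ b * b = 0) :
    a * b * (a * b) = 0 := by
  rcases h with h | h
  · rw [← mul_assoc, mul_mul_self_eq_zero ha h, zero_mul]
  · rw [mul_assoc, ← mul_assoc b, mul_mul_self_eq_zero hb h, mul_zero]

theorem prod_ofFn_mem {n : ℕ} (a : Fin n → A) (p : Fin n → ZMod 2) (h : ∀ i, a i ∈ par k (p i)) :
    (List.ofFn a).prod ∈ par k (∑ i, p i) := by
  induction n with
  | zero => simpa using one_mem
  | succ n ih =>
    rw [List.ofFn_succ, List.prod_cons, Fin.sum_univ_succ]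
    exact mul_mem (h 0) (ih _ _ fun i => h i.succ)

theorem hom_prod_ofFn {n : ℕ} (a : Fin n → A) (h : ∀ i, Hom k (a i)) :
    Hom k (List.ofFn a).prod := by
  choose p hp using h
  exact ⟨_, prod_ofFn_mem a p hp⟩

theorem prod_ofFn_mul_self {n : ℕ} (a : Fin n → A) (h : ∀ i, Hom k (a i)) (i : Fin n)
    (hi : a i * a i = 0) : (List.ofFn a).prod * (List.ofFn a).prod = 0 := by
  induction n with
  | zero => exact i.elim0
  | succ n ih =>
    rw [List.ofFn_succ, List.prod_cons]
    refine mul_self_mul (h 0) (hom_prod_ofFn _ fun i => h i.succ) ?_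
    rcases Fin.eq_zero_or_eq_succ i with rfl | ⟨j, rfl⟩
    · exact .inl hi
    · exact .inr (ih _ (fun i => h i.succ) j hi)

theorem exists_prod_ofFn_eq {n : ℕ} (a : Fin n → A) (i : Fin n) :
    ∃ c c', ∀ x, (List.ofFn (Function.update a i x)).prod = c * x * c' := by
  induction n with
  | zero => exact i.elim0
  | succ n ih =>
    rcases Fin.eq_zero_or_eq_succ i with rfl | ⟨j, rfl⟩
    · refine ⟨1, (List.ofFn fun j : Fin n => a j.succ).prod, fun x => ?_⟩
      rw [List.ofFn_succ, List.prod_cons, Function.update_self, one_mul]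
      congr
    · obtain ⟨c, c', hc⟩ := ih (fun j => a j.succ) j
      refine ⟨a 0 * c, c', fun x => ?_⟩
      rw [List.ofFn_succ, List.prod_cons, Function.update_of_ne (Fin.succ_ne_zero j).symm,
        mul_assoc, mul_assoc, ← mul_assoc c, ← hc]
      congr 3
      ext l
      by_cases h : l = j
      · subst h; simp
      · rw [Function.update_of_ne (by simpa using h), Function.update_of_ne h]

theorem mul_mem_left_ideal {a : A} (ha : Hom k a) (c c' x : A) :
    ∃ y, c * (a * x) * c' = a * y := by
  obtain ⟨d, hd⟩ := exists_mul_comm ha c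
  exact ⟨d * x * c', by rw [← mul_assoc, hd]; simp only [mul_assoc]⟩

theorem prod_ofFn_mem_ideal {n : ℕ} {e : A} (he : Hom k e) (a : Fin n → A) (i : Fin n)
    (hi : ∃ x, a i = e * x) : ∃ y, (List.ofFn a).prod = e * y := by
  obtain ⟨x, hx⟩ := hi
  obtain ⟨c, c', h⟩ := exists_prod_ofFn_eq a i
  obtain ⟨y, hy⟩ := mul_mem_left_ideal he c c' x
  refine ⟨y, ?_⟩
  rw [← hy, ← hx, ← h, Function.update_eq_self]

/-- Two of the factors lie in the ideal of e, whose square is zero. Every vanishing statement for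
multilinear maps below goes back to this. -/
theorem prod_ofFn_eq_zero {n : ℕ} {e : A} (he : Hom k e) (hee : e * e = 0) (a : Fin n → A)
    {i j : Fin n} (hij : i ≠ j) (hi : ∃ x, a i = e * x) (hj : ∃ x, a j = e * x) :
    (List.ofFn a).prod = 0 := by
  induction n with
  | zero => exact i.elim0
  | succ n ih =>
    rw [List.ofFn_succ, List.prod_cons]
    have key : ∀ l : Fin n, (∃ x, a 0 = e * x) → (∃ x, a l.succ = e * x) →
        a 0 * (List.ofFn fun i : Fin n => a i.succ).prod = 0 := by
      rintro l ⟨x, hx⟩ hl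
      obtain ⟨y, hy⟩ := prod_ofFn_mem_ideal he (fun i : Fin n => a i.succ) l hl
      rw [hx, hy, ← mul_assoc, mul_mul_self_eq_zero he hee, zero_mul]
    rcases Fin.eq_zero_or_eq_succ i with rfl | ⟨i', rfl⟩
    · rcases Fin.eq_zero_or_eq_succ j with rfl | ⟨j', rfl⟩
      · exact absurd rfl hij
      · exact key j' hi hj
    · rcases Fin.eq_zero_or_eq_succ j with rfl | ⟨j', rfl⟩
      · exact key i' hj hi
      · rw [ih (fun i => a i.succ) (i := i') (j := j') (fun h => hij (by rw [h])) hi hj, mul_zero]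

end Grassmann

/-! ### Koszul signs and products -/

section Koszul

variable {X α : Type*} [LinearOrder α]

/-- The Koszul sign for sorting a list by the values of `r`. -/
def listSign (r : X → α) (p : X → ZMod 2) : List X → ℤ
  | [] => 1
  | x :: l => (l.map fun y => if r y < r x then paritySign (p x) (p y) else 1).prod *
      listSign r p l

theorem listSign_mul_self (r : X → α) (p : X → ZMod 2) (l : List X) :
    listSign r p l * listSign r p l = 1 := by
  induction l with
  | nil => rfl
  | cons x l ih =>
    rw [listSign, mul_mul_mul_comm, ih, mul_one, ← List.prod_map_mul]
    apply List.prod_eq_one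
    simp only [List.mem_map, forall_exists_index, and_imp, forall_apply_eq_imp_iff₂]
    intro y _
    split_ifs
    · exact paritySign_mul_self _ _
    · rfl

theorem listSign_eq_one (r : X → α) (p : X → ZMod 2) (l : List X)
    (h : l.Pairwise fun x y => r x < r y) : listSign r p l = 1 := by
  induction l with
  | nil => rfl
  | cons x l ih =>
    rw [List.pairwise_cons] at h
    rw [listSign, ih h.2, mul_one]
    apply List.prod_eq_one
    simp only [List.mem_map, forall_exists_index, and_imp, forall_apply_eq_imp_iff₂]
    intro y hy
    rw [if_neg (not_lt.2 (h.1 y hy).le)]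

theorem listSign_ofFn {n : ℕ} (r : X → α) (p : X → ZMod 2) (g : Fin n → X) :
    listSign r p (List.ofFn g) =
      DGSpace.koszulSign (fun i => r (g i)) (fun i => p (g i)) := by
  unfold DGSpace.koszulSign
  induction n with
  | zero => rfl
  | succ n ih =>
    rw [List.ofFn_succ, listSign, ih, Fin.prod_univ_succ, Fin.prod_univ_succ]
    congr 1
    · rw [if_neg (by simp), one_mul, List.map_ofFn, List.prod_ofFn]
      refine Finset.prod_congr rfl fun j _ => ?_
      simp only [Function.comp, paritySign, Fin.succ_pos, true_and]
      split_ifs <;> simp_all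
    · refine Finset.prod_congr rfl fun i _ => ?_
      rw [Fin.prod_univ_succ, if_neg (by simp), one_mul]
      simp only [Fin.succ_lt_succ_iff]

variable {k : Type u} [Field k] {A : Type w} [Ring A] [Algebra k A] [Grassmann k A]

/-- An exchange of neighbours changes the sorting sign and the product by the same factor, so their
combination depends only on the underlying set. Injectivity of r ensures that in an exchange exactly
one of the two orders is an inversion. -/
theorem listSign_smul_prod_perm (r : X → α) (hr : Function.Injective r) (p : X → ZMod 2)
    (a : X → A) (ha : ∀ x, a x ∈ Grassmann.par k (p x)) {l l' : List X} (h : l.Perm l')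
    (hl : l.Nodup) :
    listSign r p l • (l.map a).prod = listSign r p l' • (l'.map a).prod := by
  induction h with
  | nil => rfl
  | @cons x l l' h ih =>
    simp only [listSign, List.map_cons, List.prod_cons]
    rw [mul_smul, mul_smul, ← mul_smul_comm, ← mul_smul_comm (listSign r p l'),
      ih (List.nodup_cons.1 hl).2, (h.map _).prod_eq]
  | swap x y l =>
    simp only [listSign, List.map_cons, List.prod_cons]
    have hxy : r x ≠ r y := by
      simp only [List.nodup_cons, List.mem_cons, not_or] at hl
      exact fun e => hl.1.1 (hr e).symm
    rw [← mul_assoc (a x), ← mul_assoc (a y), Grassmann.comm (ha y) (ha x), smul_mul_assoc,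
      smul_smul]
    congr 1
    rw [paritySign_comm (p y) (p x)]
    have h1 := paritySign_mul_self (p x) (p y)
    rcases lt_or_gt_of_ne hxy with h | h
    · rw [if_pos h, if_neg (not_lt.2 h.le)]
      linear_combination (List.map (fun z => if r z < r y then paritySign (p y) (p z) else 1) l).prod * (List.map (fun z => if r z < r x then paritySign (p x) (p z) else 1) l).prod * listSign r p l * h1 
    · rw [if_neg (not_lt.2 h.le), if_pos h]
      ring
  | trans h1 h2 ih1 ih2 => rw [ih1 hl, ih2 (h1.nodup_iff.1 hl)]

theorem koszulSign_mul_self {n : ℕ} (r : Fin n → α) (p : Fin n → ZMod 2) :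
    DGSpace.koszulSign r p * DGSpace.koszulSign r p = 1 := by
  have := listSign_mul_self r p (List.ofFn id)
  rwa [listSign_ofFn] at this

/-- This is how signs disappear on even points: reordering the coefficients produces exactly the
Koszul sign that the operadic operations put on the arguments. -/
theorem prod_ofFn_eq_koszulSign_smul {n : ℕ} (r : Fin n → α) (hr : Function.Injective r)
    (p : Fin n → ZMod 2) (a : Fin n → A) (ha : ∀ x, a x ∈ Grassmann.par k (p x)) (l : List (Fin n))
    (hl : l.Nodup) (hmem : ∀ i, i ∈ l) (hs : l.Pairwise fun x y => r x < r y) :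
    (l.map a).prod = DGSpace.koszulSign r p • (List.ofFn a).prod := by
  have h := listSign_smul_prod_perm r hr p a ha (l := List.ofFn id) (l' := l)
    ((List.perm_ext_iff_of_nodup (List.nodup_ofFn.2 Function.injective_id) hl).2
      fun i => by simp [hmem, List.mem_ofFn])
    (List.nodup_ofFn.2 Function.injective_id)
  rw [listSign_eq_one r p l hs, one_smul, listSign_ofFn, List.map_ofFn] at h
  exact h.symm

end Koszul

/-! ## Extension of scalars of multilinear maps -/

section Ext

variable {k : Type u} [Field k] {A : Type*} [Ring A] [Algebra k A]
  {M T T' : Type*} [AddCommGroup M] [Module k M] [AddCommGroup T] [Module k T]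
  [AddCommGroup T'] [Module k T']

/-- Left multiplication by an element of `A` on `T ⊗ A`. -/
def lact (T : Type*) [AddCommGroup T] [Module k T] (a : A) : T ⊗[k] A →ₗ[k] T ⊗[k] A :=
  LinearMap.lTensor T (LinearMap.mulLeft k a)

/-- Right multiplication by an element of `A` on `T ⊗ A`. -/
def ract (T : Type*) [AddCommGroup T] [Module k T] (a : A) : T ⊗[k] A →ₗ[k] T ⊗[k] A :=
  LinearMap.lTensor T (LinearMap.mulRight k a)

@[simp] theorem lact_tmul (a b : A) (t : T) : lact T a (t ⊗ₜ[k] b) = t ⊗ₜ (a * b) := rfl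
@[simp] theorem ract_tmul (a b : A) (t : T) : ract T a (t ⊗ₜ[k] b) = t ⊗ₜ (b * a) := rfl

/-- The extension of scalars
`(x₁ ⊗ a₁, …, xₙ ⊗ aₙ) ↦ F (x₁, …, xₙ) ⊗ a₁ ⋯ aₙ` as a linear map in `F`. -/
def gextL (k : Type u) [Field k] (A : Type*) [Ring A] [Algebra k A] (M T : Type*)
    [AddCommGroup M] [Module k M] [AddCommGroup T] [Module k T] :
    ∀ n : ℕ, MultilinearMap k (fun _ : Fin n => M) T →ₗ[k]
      MultilinearMap k (fun _ : Fin n => M ⊗[k] A) (T ⊗[k] A)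
  | 0 =>
    { toFun := fun F => MultilinearMap.constOfIsEmpty k _ (F (fun i => i.elim0) ⊗ₜ 1)
      map_add' := fun F G => by ext; simp [TensorProduct.add_tmul]
      map_smul' := fun c F => by ext; simp [TensorProduct.smul_tmul'] }
  | n + 1 =>
    { toFun := fun F => LinearMap.uncurryLeft (TensorProduct.lift (LinearMap.mk₂ k
        (fun (x : M) (a : A) => (lact T a).compMultilinearMap (gextL k A M T n (F.curryLeft x)))
        (fun x y a => by ext; simp)
        (fun c x a => by ext; simp)
        (fun x a b => by
          ext; simp [lact, show LinearMap.mulLeft k (a + b) = LinearMap.mulLeft k a +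
            LinearMap.mulLeft k b from (LinearMap.mul k A).map_add a b, LinearMap.lTensor_add])
        (fun c x a => by
          ext; simp [lact, show LinearMap.mulLeft k (c • a) = c • LinearMap.mulLeft k a from
            (LinearMap.mul k A).map_smul c a, LinearMap.lTensor_smul])))
      map_add' := fun F G => by
        ext y
        simp only [LinearMap.uncurryLeft_apply, _root_.add_apply]
        generalize y 0 = z
        induction z using TensorProduct.induction_on with
        | zero => simp
        | tmul x a =>
          simp only [TensorProduct.lift.tmul, LinearMap.mk₂_apply,
            LinearMap.compMultilinearMap_apply, ← map_add]
          rw [← _root_.add_apply, ← map_add]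
          rfl
        | add z z' h h' => 
          simp only [map_add, _root_.add_apply, h, h']
          abel
      map_smul' := fun c F => by
        ext y
        simp only [LinearMap.uncurryLeft_apply, _root_.smul_apply, RingHom.id_apply]
        generalize y 0 = z
        induction z using TensorProduct.induction_on with
        | zero => simp
        | tmul x a =>
          simp only [TensorProduct.lift.tmul, LinearMap.mk₂_apply,
            LinearMap.compMultilinearMap_apply, ← map_smul]
          rw [← _root_.smul_apply, ← map_smul]
          rfl
        | add z z' h h' => 
          simp only [map_add, _root_.add_apply, h, h', smul_add] }

/-- The extension of scalars
`(x₁ ⊗ a₁, …, xₙ ⊗ aₙ) ↦ F (x₁, …, xₙ) ⊗ a₁ ⋯ aₙ` of a multilinear map. -/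
def gext (A : Type*) [Ring A] [Algebra k A] {n : ℕ} (F : MultilinearMap k (fun _ : Fin n => M) T) :
    MultilinearMap k (fun _ : Fin n => M ⊗[k] A) (T ⊗[k] A) :=
  gextL k A M T n F

theorem gext_tmul {n : ℕ} (F : MultilinearMap k (fun _ : Fin n => M) T) (x : Fin n → M)
    (a : Fin n → A) : gext A F (fun i => x i ⊗ₜ a i) = F x ⊗ₜ (List.ofFn a).prod := by
  induction n with
  | zero =>
    change F _ ⊗ₜ[k] (1 : A) = _
    rw [List.ofFn_zero, List.prod_nil]
    congr 2
    ext i; exact i.elim0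
  | succ n ih =>
    change (lact T (a 0)) (gext A (F.curryLeft (x 0)) fun i => x i.succ ⊗ₜ a i.succ) = _
    rw [ih, lact_tmul, List.ofFn_succ, List.prod_cons, MultilinearMap.curryLeft_apply]
    congr 2
    ext i
    refine Fin.cases ?_ (fun j => ?_) i <;> simp

theorem gext_add {n : ℕ} (F G : MultilinearMap k (fun _ : Fin n => M) T) :
    gext A (F + G) = gext A F + gext A G := map_add _ _ _

theorem gext_zero {n : ℕ} : gext A (0 : MultilinearMap k (fun _ : Fin n => M) T) = 0 := map_zero _

theorem gext_sum {n : ℕ} {ι : Type*} (s : Finset ι)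
    (F : ι → MultilinearMap k (fun _ : Fin n => M) T) :
    gext A (∑ i ∈ s, F i) = ∑ i ∈ s, gext A (F i) := map_sum _ _ _

/-- Two multilinear maps that agree on families from given sets agree on families from
their spans. -/
theorem MultilinearMap.eq_of_mem_span {ι N : Type*} [Fintype ι] [AddCommGroup N] [Module k N]
    (f g : MultilinearMap k (fun _ : ι => M) N) (s : ι → Set M)
    (h : ∀ x : ι → M, (∀ i, x i ∈ s i) → f x = g x) (x : ι → M)
    (hx : ∀ i, x i ∈ Submodule.span k (s i)) : f x = g x := by
  classical
  have key : ∀ (t : Finset ι) (x : ι → M), (∀ i ∈ t, x i ∈ Submodule.span k (s i)) →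
      (∀ i ∉ t, x i ∈ s i) → f x = g x := by
    intro t
    induction t using Finset.induction_on with
    | empty => exact fun x _ hx => h x fun i => hx i (Finset.notMem_empty i)
    | insert j t hj ih =>
      intro x hx1 hx2
      have : ∀ z ∈ Submodule.span k (s j),
          f (Function.update x j z) = g (Function.update x j z) := by
        intro z hz
        induction hz using Submodule.span_induction with
        | mem z hz =>
          refine ih _ (fun i hi => ?_) (fun i hi => ?_)
          · have hij : i ≠ j := fun e => hj (e ▸ hi)
            rw [Function.update_of_ne hij]
            exact hx1 i (Finset.mem_insert_of_mem hi)
          · by_cases hij : i = j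
            · subst hij; rwa [Function.update_self]
            · rw [Function.update_of_ne hij]
              exact hx2 i (by simp [hij, hi])
        | zero => rw [f.map_update_zero, g.map_update_zero]
        | add y z _ _ hy hz => rw [f.map_update_add, g.map_update_add, hy, hz]
        | smul c y _ hy => rw [f.map_update_smul, g.map_update_smul, hy]
      have := this (x j) (hx1 j (Finset.mem_insert_self _ _))
      rwa [Function.update_eq_self] at this
  exact key Finset.univ x (fun i _ => hx i) (fun i hi => absurd (Finset.mem_univ i) hi)

theorem MultilinearMap.mem_of_mem_span {ι N : Type*} [Fintype ι] [AddCommGroup N] [Module k N]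
    (f : MultilinearMap k (fun _ : ι => M) N) (s : ι → Set M) (S : Submodule k N)
    (h : ∀ x : ι → M, (∀ i, x i ∈ s i) → f x ∈ S) (x : ι → M)
    (hx : ∀ i, x i ∈ Submodule.span k (s i)) : f x ∈ S := by
  rw [← Submodule.Quotient.mk_eq_zero, ← Submodule.mkQ_apply, ← LinearMap.compMultilinearMap_apply]
  refine MultilinearMap.eq_of_mem_span _ 0 s (fun y hy => ?_) x hx
  simpa using h y hy

theorem mem_span_range_tmul (z : M ⊗[k] A) :
    z ∈ Submodule.span k (Set.range fun p : M × A => p.1 ⊗ₜ[k] p.2) := by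
  have : z ∈ (⊤ : Submodule k (M ⊗[k] A)) := trivial
  rw [← TensorProduct.span_tmul_eq_top] at this
  refine Submodule.span_mono ?_ this
  rintro _ ⟨m, a, rfl⟩
  exact ⟨(m, a), rfl⟩

theorem multilinear_eq_of_tmul {ι N : Type*} [Fintype ι] [AddCommGroup N] [Module k N]
    (f g : MultilinearMap k (fun _ : ι => M ⊗[k] A) N)
    (h : ∀ (x : ι → M) (a : ι → A), f (fun i => x i ⊗ₜ a i) = g (fun i => x i ⊗ₜ a i)) :
    f = g := by
  ext z
  refine MultilinearMap.eq_of_mem_span f g (fun _ => Set.range fun p : M × A => p.1 ⊗ₜ[k] p.2) ?_ z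
    fun i => mem_span_range_tmul _
  intro y hy
  choose p hp using hy
  have := h (fun i => (p i).1) (fun i => (p i).2)
  simp only at hp
  simpa only [hp] using this

theorem gext_postcomp {n : ℕ} (φ : T →ₗ[k] T') (F : MultilinearMap k (fun _ : Fin n => M) T)
    (x : Fin n → M ⊗[k] A) :
    gext A (φ.compMultilinearMap F) x = φ.rTensor A (gext A F x) := by
  have : gext A (φ.compMultilinearMap F) = (φ.rTensor A).compMultilinearMap (gext A F) := by
    refine multilinear_eq_of_tmul _ _ fun x a => ?_
    rw [gext_tmul, LinearMap.compMultilinearMap_apply, LinearMap.compMultilinearMap_apply,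
      gext_tmul]
    rfl
  rw [this]; rfl

theorem gext_precomp {M' : Type*} [AddCommGroup M'] [Module k M'] {n : ℕ}
    (F : MultilinearMap k (fun _ : Fin n => M) T) (φ : Fin n → M' →ₗ[k] M)
    (x : Fin n → M' ⊗[k] A) :
    gext A (F.compLinearMap φ) x = gext A F fun i => (φ i).rTensor A (x i) := by
  have : gext A (F.compLinearMap φ) = (gext A F).compLinearMap fun i => (φ i).rTensor A := by
    refine multilinear_eq_of_tmul _ _ fun x a => ?_
    rw [gext_tmul, MultilinearMap.compLinearMap_apply, MultilinearMap.compLinearMap_apply]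
    simp only [LinearMap.rTensor_tmul, gext_tmul]
  rw [this]; rfl

/-- The action of operators with coefficients in `A`. -/
def act : (M →ₗ[k] T) ⊗[k] A →ₗ[k] M ⊗[k] A →ₗ[k] T ⊗[k] A :=
  TensorProduct.lift (LinearMap.mk₂ k
    (fun (φ : M →ₗ[k] T) (a : A) => TensorProduct.map φ (LinearMap.mulLeft k a))
    (fun φ ψ a => TensorProduct.map_add_left _ _ _)
    (fun c φ a => TensorProduct.map_smul_left _ _ _)
    (fun φ a b => by
      rw [show LinearMap.mulLeft k (a + b) = LinearMap.mulLeft k a +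
            LinearMap.mulLeft k b from (LinearMap.mul k A).map_add a b]
      exact TensorProduct.map_add_right _ _ _)
    (fun c φ a => by
      rw [show LinearMap.mulLeft k (c • a) = c • LinearMap.mulLeft k a from
            (LinearMap.mul k A).map_smul c a]
      exact TensorProduct.map_smul_right _ _ _))

@[simp] theorem act_tmul (φ : M →ₗ[k] T) (a b : A) (x : M) :
    act (φ ⊗ₜ[k] a) (x ⊗ₜ[k] b) = φ x ⊗ₜ (a * b) := rfl

/-- The coefficient of the last argument is the rightmost factor of the product, so leaving this
argument free costs no sign. This is what makes the last input the convenient one for grafting and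
for traces. -/
theorem gext_snoc {n : ℕ} (F : MultilinearMap k (fun _ : Fin (n + 1) => M) T)
    (x : Fin n → M ⊗[k] A) (y : M ⊗[k] A) :
    gext A F (Fin.snoc (α := fun _ => M ⊗[k] A) x y) = act (gext A F.curryRight x) y := by
  have : (gext A F).curryRight = act.compMultilinearMap (gext A F.curryRight) := by
    refine multilinear_eq_of_tmul _ _ fun x a => ?_
    refine TensorProduct.ext' fun y b => ?_
    rw [LinearMap.compMultilinearMap_apply, gext_tmul, act_tmul, MultilinearMap.curryRight_apply,
      MultilinearMap.curryRight_apply]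
    have h : (Fin.snoc (α := fun _ => M ⊗[k] A) (fun i => x i ⊗ₜ a i) (y ⊗ₜ b)) =
        fun i => (Fin.snoc (α := fun _ => M) x y i) ⊗ₜ[k] (Fin.snoc (α := fun _ => A) a b i) := by
      ext i
      refine Fin.lastCases ?_ (fun i => ?_) i <;> simp
    rw [h, gext_tmul, List.ofFn_succ']
    simp
  have h := congrArg (fun G => G x y) this
  simpa using h

theorem act_mul (P Q : Module.End k M ⊗[k] A) (y : M ⊗[k] A) :
    act (P * Q) y = act P (act Q y) := by
  induction P using TensorProduct.induction_on with
  | zero => simp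
  | add P P' h h' => rw [add_mul, map_add, LinearMap.add_apply, h, h', map_add, LinearMap.add_apply]
  | tmul φ a =>
    induction Q using TensorProduct.induction_on with
    | zero => simp
    | add P P' h h' => rw [mul_add, map_add, LinearMap.add_apply, h, h', map_add,
        LinearMap.add_apply, map_add]
    | tmul ψ b =>
      induction y using TensorProduct.induction_on with
      | zero => simp
      | add P P' h h' => rw [map_add, h, h', map_add, map_add]
      | tmul y c =>
        rw [Algebra.TensorProduct.tmul_mul_tmul]
        rw [act_tmul, act_tmul]
        simp only [act_tmul, mul_assoc]
        rfl

theorem act_one (y : M ⊗[k] A) : act (1 : Module.End k M ⊗[k] A) y = y := by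
  induction y using TensorProduct.induction_on with
  | zero => simp
  | add P P' h h' => rw [map_add, h, h']
  | tmul y c =>
    rw [Algebra.TensorProduct.one_def, act_tmul, one_mul]
    rfl

theorem act_comp_left (φ : T →ₗ[k] T') (P : (M →ₗ[k] T) ⊗[k] A) (y : M ⊗[k] A) :
    act ((LinearMap.compRight k φ).rTensor A P) y = φ.rTensor A (act P y) := by
  induction P using TensorProduct.induction_on with
  | zero => simp
  | add P P' h h' => simp only [map_add, LinearMap.add_apply, h, h']
  | tmul ψ a =>
    induction y using TensorProduct.induction_on with
    | zero => simp
    | add P P' h h' => simp only [map_add, h, h']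
    | tmul y c => simp

theorem act_ract (P : (M →ₗ[k] T) ⊗[k] A) (y : M ⊗[k] A) (b : A) :
    act P (ract M b y) = ract T b (act P y) := by
  induction P using TensorProduct.induction_on with
  | zero => simp
  | add P P' h h' => simp only [map_add, LinearMap.add_apply, h, h']
  | tmul ψ a =>
    induction y using TensorProduct.induction_on with
    | zero => simp
    | add P P' h h' => simp only [map_add, h, h']
    | tmul y c => simp [mul_assoc]

/-- In finite dimensions P is recovered from its values at a basis as the sum of the b_i^* ⊗ P(b_i ⊗
1). -/
theorem act_apply_one_tmul_injective [FiniteDimensional k M] (P : (M →ₗ[k] T) ⊗[k] A)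
    (h : ∀ x : M, act P (x ⊗ₜ 1) = 0) : P = 0 := by
  let b := Module.finBasis k M
  have key : ∀ P : (M →ₗ[k] T) ⊗[k] A, P = ∑ i,
      ((LinearMap.smulRightₗ (b.coord i)).rTensor A) (act P (b i ⊗ₜ 1)) := by
    intro P
    induction P using TensorProduct.induction_on with
    | zero => simp
    | add P P' h h' =>
      simp only [map_add, LinearMap.add_apply, Finset.sum_add_distrib]
      rw [← h, ← h']
    | tmul ψ a =>
      simp only [act_tmul, mul_one, LinearMap.rTensor_tmul]
      rw [← TensorProduct.sum_tmul]
      congr 1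
      refine b.ext fun j => ?_
      simp [Finsupp.single_apply]
  rw [key P]
  simp [h]

end Ext

namespace DGSpace

/-! ## Parity -/

section Parity

variable {k : Type u} [Field k] (V : DGSpace.{u, v} k) {U : DGSpace.{u, w} k}
  {T : Type*} [AddCommGroup T] [Module k T]

/-- The even or odd part of a graded vector space. -/
def par (p : ZMod 2) : Submodule k V := LinearMap.eqLocus (V.parityProj p) LinearMap.id

variable {V}

theorem mem_par {p : ZMod 2} {x : V} : x ∈ V.par p ↔ V.parityProj p x = x := Iff.rfl

theorem linearMap_ext_gr {f g : V →ₗ[k] T} (h : ∀ i, ∀ x ∈ V.gr i, f x = g x) : f = g := by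
  ext x
  induction x using DirectSum.Decomposition.inductionOn V.gr with
  | zero => simp
  | homogeneous m => exact h _ _ m.2
  | add m m' h h' => rw [map_add, map_add, h, h']

theorem weight_weight (c c' : ℤ → k) (x : V) :
    V.weight c (V.weight c' x) = V.weight (fun i => c i * c' i) x := by
  rw [← LinearMap.comp_apply]
  congr 1
  refine linearMap_ext_gr fun i x hx => ?_
  rw [LinearMap.comp_apply, V.weight_apply_of_mem c' hx, map_smul, V.weight_apply_of_mem c hx,
    V.weight_apply_of_mem _ hx, smul_smul, mul_comm]

theorem parityProj_of_mem_gr {i : ℤ} {x : V} (hx : x ∈ V.gr i) (p : ZMod 2) :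
    V.parityProj p x = if (i : ZMod 2) = p then x else 0 := by
  rw [parityProj, V.weight_apply_of_mem _ hx]
  split_ifs <;> simp

theorem mem_par_of_mem_gr {i : ℤ} {x : V} (hx : x ∈ V.gr i) : x ∈ V.par i := by
  rw [mem_par, parityProj_of_mem_gr hx, if_pos rfl]

theorem parityProj_mem (p : ZMod 2) (x : V) : V.parityProj p x ∈ V.par p := by
  rw [mem_par, parityProj, weight_weight]
  congr 2
  ext i
  split_ifs <;> simp

theorem parityProj_of_mem_par {p : ZMod 2} {x : V} (hx : x ∈ V.par p) (q : ZMod 2) :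
    V.parityProj q x = if q = p then x else 0 := by
  split_ifs with h
  · rw [h]; exact hx
  · rw [← mem_par.1 hx, parityProj, parityProj, weight_weight,
      ← LinearMap.zero_apply (σ₁₂ := RingHom.id k) (M₂ := V) x]
    congr 1
    refine linearMap_ext_gr fun i y hy => ?_
    rw [V.weight_apply_of_mem _ hy]
    by_cases h1 : (i : ZMod 2) = q
    · rw [if_neg (fun e : (i : ZMod 2) = p => h (h1.symm.trans e)), mul_zero, zero_smul]; rfl
    · rw [if_neg h1, zero_mul, zero_smul]; rfl

theorem sum_parityProj (x : V) : ∑ p : ZMod 2, V.parityProj p x = x := by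
  rw [← LinearMap.sum_apply]
  conv_rhs => rw [← LinearMap.id_apply (R := k) x]
  congr 1
  refine linearMap_ext_gr fun i y hy => ?_
  rw [LinearMap.sum_apply]
  simp only [parityProj_of_mem_gr hy]
  simp

theorem sgn_eq (q i : ℤ) : sgn k (q * i) = (paritySign q i : k) := by
  unfold sgn paritySign
  have hq : ((q : ZMod 2) = 1) ↔ Odd q := by
    rw [← Int.not_even_iff_odd, ← ZMod.intCast_eq_zero_iff_even]
    rcases zmod_two_cases q with h | h <;> simp [h]
  have hi : ((i : ZMod 2) = 1) ↔ Odd i := by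
    rw [← Int.not_even_iff_odd, ← ZMod.intCast_eq_zero_iff_even]
    rcases zmod_two_cases i with h | h <;> simp [h]
  by_cases h : Odd (q * i)
  · rw [if_pos (by rwa [hq, hi, ← Int.odd_mul]), Int.negOnePow_odd _ h]; rfl
  · rw [if_neg (by rwa [hq, hi, ← Int.odd_mul]),
      Int.negOnePow_even _ (Int.not_odd_iff_even.1 h)]; rfl

theorem twist_of_mem_par {p : ZMod 2} {x : V} (hx : x ∈ V.par p) (q : ℤ) :
    V.twist q x = paritySign q p • x := by
  have : V.twist q ∘ₗ V.parityProj p = (paritySign q p : k) • V.parityProj p := by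
    refine linearMap_ext_gr fun i y hy => ?_
    rw [LinearMap.comp_apply, LinearMap.smul_apply, parityProj_of_mem_gr hy]
    split_ifs with h
    · rw [twist, V.weight_apply_of_mem _ hy, sgn_eq, h]
    · simp
  have h := congrArg (fun f => f x) this
  simp only [LinearMap.comp_apply, LinearMap.smul_apply, mem_par.1 hx] at h
  rw [h, Int.cast_smul_eq_zsmul]

theorem twist_of_mem_gr {i : ℤ} {x : V} (hx : x ∈ V.gr i) (q : ℤ) :
    V.twist q x = sgn k (q * i) • x := V.weight_apply_of_mem _ hx

theorem sgn_add (p q : ℤ) : sgn k (p + q) = sgn k p * sgn k q := by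
  simp [sgn, Int.negOnePow_add]

theorem sgn_mul_self (p : ℤ) : sgn k p * sgn k p = 1 := by
  rw [← sgn_add, sgn, Int.negOnePow_even _ ⟨p, rfl⟩]; simp

theorem sgn_zero : sgn k 0 = 1 := by simp [sgn]
theorem sgn_one : sgn k 1 = -1 := by simp [sgn]
theorem sgn_neg (p : ℤ) : sgn k (-p) = sgn k p := by simp [sgn]

theorem twist_twist (p q : ℤ) (x : V) : V.twist p (V.twist q x) = V.twist (p + q) x := by
  rw [twist, twist, weight_weight, twist]
  congr 2
  ext i
  rw [add_mul, sgn_add]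

theorem twist_zero : V.twist 0 = LinearMap.id := by
  refine linearMap_ext_gr fun i x hx => ?_
  rw [twist_of_mem_gr hx, zero_mul, sgn_zero, one_smul, LinearMap.id_apply]

theorem twist_of_even {p : ℤ} (hp : Even p) : V.twist p = LinearMap.id := by
  refine linearMap_ext_gr fun i x hx => ?_
  rw [twist_of_mem_gr hx, sgn, Int.negOnePow_even _ (hp.mul_right i), Units.val_one, Int.cast_one,
    one_smul, LinearMap.id_apply]

theorem twist_comm_of_isHomogeneous {p : ℤ} {φ : V →ₗ[k] U} (hφ : IsHomogeneous V U p φ) (q : ℤ)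
    (x : V) : U.twist q (φ x) = sgn k (q * p) • φ (V.twist q x) := by
  have : U.twist q ∘ₗ φ = sgn k (q * p) • φ ∘ₗ V.twist q := by
    refine linearMap_ext_gr fun i x hx => ?_
    rw [LinearMap.comp_apply, twist_of_mem_gr (hφ i x hx), LinearMap.smul_apply,
      LinearMap.comp_apply, twist_of_mem_gr hx, map_smul, smul_smul, ← sgn_add]
    ring_nf
  exact congrArg (fun f => f x) this

variable (V) in
theorem isHomogeneous_d : IsHomogeneous V V 1 V.d := fun i x hx => V.d_mem i x hx

theorem d_twist (q : ℤ) (x : V) : V.d (V.twist q x) = sgn k q • V.twist q (V.d x) := by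
  rw [twist_comm_of_isHomogeneous (isHomogeneous_d V), smul_smul, mul_one, sgn_mul_self, one_smul]

theorem par_le_span (p : ZMod 2) :
    V.par p ≤ Submodule.span k {x | ∃ i : ℤ, (i : ZMod 2) = p ∧ x ∈ V.gr i} := by
  intro x hx
  rw [← mem_par.1 hx]
  clear hx
  induction x using DirectSum.Decomposition.inductionOn V.gr with
  | zero => simp
  | homogeneous m =>
    rw [parityProj_of_mem_gr m.2]
    split_ifs with h
    · exact Submodule.subset_span ⟨_, h, m.2⟩
    · exact zero_mem _
  | add m m' h h' => rw [map_add]; exact add_mem h h'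

theorem IsHomogeneous.mem_par {q : ℤ} {φ : V →ₗ[k] U} (hφ : IsHomogeneous V U q φ) {p : ZMod 2}
    {x : V} (hx : x ∈ V.par p) : φ x ∈ U.par (p + q) := by
  have h : V.par p ≤ (U.par (p + q)).comap φ := by
    refine (par_le_span p).trans (Submodule.span_le.2 ?_)
    rintro y ⟨i, rfl, hy⟩
    have := mem_par_of_mem_gr (hφ i y hy)
    rwa [Int.cast_add] at this
  exact h hx

theorem HasDegree.mem_par {n : ℕ} {q : ℤ} {F : Multi V V n} (hF : HasDegree q F)
    {p : Fin n → ZMod 2} {x : Fin n → V} (hx : ∀ i, x i ∈ V.par (p i)) :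
    F x ∈ V.par (∑ i, p i + q) := by
  refine MultilinearMap.mem_of_mem_span F
    (fun j => {x | ∃ i : ℤ, (i : ZMod 2) = p j ∧ x ∈ V.gr i}) _ (fun y hy => ?_) x
    fun i => par_le_span _ (hx i)
  choose i hi hy using hy
  have := mem_par_of_mem_gr (hF i y hy)
  simpa only [Int.cast_add, Int.cast_sum, hi] using this

theorem mem_span_iUnion_par (x : V) : x ∈ Submodule.span k {y : V | ∃ p, y ∈ V.par p} := by
  rw [← sum_parityProj x]
  exact Submodule.sum_mem _ fun p _ => Submodule.subset_span ⟨p, parityProj_mem p x⟩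

theorem multi_ext_par {n : ℕ} {F G : Multi V T n}
    (h : ∀ (p : Fin n → ZMod 2) (x : Fin n → V), (∀ i, x i ∈ V.par (p i)) → F x = G x) :
    F = G := by
  ext x
  refine MultilinearMap.eq_of_mem_span F G (fun _ => {y : V | ∃ p, y ∈ V.par p}) (fun y hy => ?_) x
    fun i => mem_span_iUnion_par _
  choose p hp using hy
  exact h p y hp

theorem mem_span_iUnion_gr (x : V) : x ∈ Submodule.span k {y : V | ∃ i, y ∈ V.gr i} := by
  induction x using DirectSum.Decomposition.inductionOn V.gr with
  | zero => simp
  | homogeneous m => exact Submodule.subset_span ⟨_, m.2⟩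
  | add m m' h h' => exact add_mem h h'

theorem multi_ext_gr {n : ℕ} {F G : Multi V T n}
    (h : ∀ (p : Fin n → ℤ) (x : Fin n → V), (∀ i, x i ∈ V.gr (p i)) → F x = G x) :
    F = G := by
  ext x
  refine MultilinearMap.eq_of_mem_span F G (fun _ => {y : V | ∃ p, y ∈ V.gr p}) (fun y hy => ?_) x
    fun i => mem_span_iUnion_gr _
  choose p hp using hy
  exact h p y hp

/-- On homogeneous arguments the parity projections annihilate every summand except the one for the
actual parities. This turns the definitions of `relabel` and `graft` into the usual formulas with a
single Koszul sign. -/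
theorem sum_koszulSign_smul_eq {n : ℕ} {α : Type*} [LinearOrder α] (r : Fin n → α)
    (p : Fin n → ZMod 2) (x : Fin n → V) (hx : ∀ i, x i ∈ V.par (p i)) (F : Multi V T n) :
    ∑ q : Fin n → ZMod 2, koszulSign r q • F (fun i => V.parityProj (q i) (x i)) =
      koszulSign r p • F x := by
  rw [Finset.sum_eq_single p]
  · congr 2
    ext i
    exact hx i
  · intro q _ hq
    obtain ⟨i, hi⟩ := Function.ne_iff.1 hq
    rw [F.map_coord_zero i, smul_zero]
    rw [parityProj_of_mem_par (hx i), if_neg hi]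
  · simp

theorem relabel_apply_of_mem_par {n m : ℕ} (e : Fin n ≃ Fin m) (F : Multi V T m)
    (p : Fin n → ZMod 2) (x : Fin n → V) (hx : ∀ i, x i ∈ V.par (p i)) :
    relabel e F x = koszulSign e p • F fun j => x (e.symm j) := by
  have := sum_koszulSign_smul_eq e p x hx (F.domDomCongr e.symm)
  rw [MultilinearMap.domDomCongr_apply] at this
  rw [← this, relabel, _root_.sum_apply]
  refine Finset.sum_congr rfl fun q _ => ?_
  rfl

theorem graft_apply_of_mem_par {n : ℕ} (c : OrderedFinpartition n) (F : Multi V T c.length)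
    (G : ∀ m, Multi V V (c.partSize m)) (p : Fin n → ZMod 2) (x : Fin n → V)
    (hx : ∀ i, x i ∈ V.par (p i)) :
    graft c F G x = koszulSign c.index p • F fun m => G m fun j => x (c.emb m j) := by
  have := sum_koszulSign_smul_eq c.index p x hx ((F.compMultilinearMap G).domDomCongr c.equivSigma)
  rw [graft_apply]
  exact this

end Parity

end DGSpace

/-! ### Moving coefficients past products, and cancelling fresh coefficients -/

namespace Grassmann

variable {k : Type u} [Field k] {A : Type*} [Ring A] [Algebra k A] [Grassmann k A]

theorem mul_prod_ofFn {n : ℕ} {q : ZMod 2} {θ : A} (hθ : θ ∈ par k q) (p : Fin n → ZMod 2)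
    (a : Fin n → A) (ha : ∀ i, a i ∈ par k (p i)) :
    θ * (List.ofFn a).prod = (∏ i, paritySign q (p i)) • ((List.ofFn a).prod * θ) := by
  induction n with
  | zero => simp
  | succ n ih =>
    rw [List.ofFn_succ, List.prod_cons, Fin.prod_univ_succ, ← mul_assoc, comm hθ (ha 0),
      smul_mul_assoc, mul_assoc, ih _ _ fun i => ha i.succ, mul_smul_comm, smul_smul, mul_assoc]

/-- Moving θ to position i passes exactly the factors before i. For odd θ this is the sign that the
twists in `compTensorD` produce on the arguments. -/
theorem mul_prod_ofFn_update {n : ℕ} {q : ZMod 2} {θ : A} (hθ : θ ∈ par k q) (p : Fin n → ZMod 2)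
    (a : Fin n → A) (ha : ∀ i, a i ∈ par k (p i)) (i : Fin n) :
    θ * (List.ofFn a).prod = (∏ j, if j < i then paritySign q (p j) else 1) •
      (List.ofFn (Function.update a i (θ * a i))).prod := by
  induction n with
  | zero => exact i.elim0
  | succ n ih =>
    rw [List.ofFn_succ, List.ofFn_succ, List.prod_cons, List.prod_cons, Fin.prod_univ_succ]
    rcases Fin.eq_zero_or_eq_succ i with rfl | ⟨l, rfl⟩
    · simp [mul_assoc]
    · rw [← mul_assoc, comm hθ (ha 0), smul_mul_assoc, mul_assoc, ih _ _ (fun i => ha i.succ) l,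
        mul_smul_comm, smul_smul, Function.update_of_ne (Fin.succ_ne_zero l).symm,
        if_pos (Fin.succ_pos l)]
      simp only [Fin.succ_lt_succ_iff]
      congr 4
      ext j
      by_cases h : j = l
      · subst h; simp
      · rw [Function.update_of_ne h, Function.update_of_ne (by simpa using h)]

/-- A tensor involves finitely many coefficients; multiplication by an element ζ fresh for these is
undone by a linear map. -/
theorem eq_zero_of_ract {T : Type*} [AddCommGroup T] [Module k T] (p : ZMod 2) (z : T ⊗[k] A)
    (h : ∀ ζ ∈ par k p, ζ * ζ = 0 → ract T ζ z = 0) : z = 0 := by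
  obtain ⟨s, hs⟩ : ∃ s : Finset A, ∀ c : A →ₗ[k] A, ∀ ζ, (∀ a ∈ s, c (a * ζ) = a) →
      c.lTensor T (ract T ζ z) = z := by
    classical
    clear h
    induction z using TensorProduct.induction_on with
    | zero => exact ⟨∅, by simp⟩
    | tmul t a => exact ⟨{a}, fun c ζ h => by simp [h a]⟩
    | add z z' h h' =>
      obtain ⟨s, hs⟩ := h
      obtain ⟨s', hs'⟩ := h'
      refine ⟨s ∪ s', fun c ζ h => ?_⟩
      rw [map_add, map_add, hs c ζ fun a ha => h a (Finset.mem_union_left _ ha),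
        hs' c ζ fun a ha => h a (Finset.mem_union_right _ ha)]
  obtain ⟨ζ, hζ, hζζ, c, hc⟩ := fresh (k := k) s p
  rw [← hs c ζ hc, h ζ hζ hζζ, map_zero]

/-- The last coefficient is cancelled as a fresh element, one at a time; at the end η is cancelled
in the same way, and a functional with value 1 at the unit of A recovers t. -/
theorem eq_zero_of_tmul_prod [Nontrivial A] {T : Type*} [AddCommGroup T] [Module k T] {n : ℕ}
    (p : Fin n → ZMod 2) (t : T)
    (h : ∀ η ∈ par k (1 : ZMod 2), ∀ a : Fin n → A, (∀ i, a i ∈ par k (p i) ∧ a i * a i = 0) →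
      t ⊗ₜ[k] (η * (List.ofFn a).prod) = (0 : T ⊗[k] A)) : t = 0 := by
  induction n with
  | zero =>
    have h1 : t ⊗ₜ[k] (1 : A) = 0 := by
      refine eq_zero_of_ract 1 _ fun ζ hζ _ => ?_
      have := h ζ hζ (fun i => i.elim0) fun i => i.elim0
      simpa using this
    obtain ⟨f, hf⟩ := Module.Projective.exists_dual_eq_one k (one_ne_zero (α := A))
    have h2 := congrArg (TensorProduct.rid k T ∘ f.lTensor T) h1
    simpa [hf] using h2
  | succ n ih =>
    refine ih (fun i => p i.castSucc) fun η hη a ha => ?_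
    refine eq_zero_of_ract (p (Fin.last n)) _ fun ζ hζ hζζ => ?_
    have := h η hη (Fin.snoc (α := fun _ => A) a ζ) fun i => by
      refine Fin.lastCases ?_ (fun i => ?_) i
      · simpa using ⟨hζ, hζζ⟩
      · simpa using ha i
    rw [List.ofFn_succ', List.prod_concat] at this
    simp only [Fin.snoc_castSucc, Fin.snoc_last] at this
    rw [ract_tmul, mul_assoc, this]

end Grassmann

/-- The multilinear map `(x, y) ↦ f (x, g y)`. -/
def MultilinearMap.graftLast {k M T : Type*} [Field k] [AddCommGroup M] [Module k M]
    [AddCommGroup T] [Module k T] {a b : ℕ} (f : MultilinearMap k (fun _ : Fin (a + 1) => M) T)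
    (g : MultilinearMap k (fun _ : Fin b => M) M) : MultilinearMap k (fun _ : Fin (a + b) => M) T :=
  (MultilinearMap.uncurrySum
    (({ toFun := fun L => L.compMultilinearMap g
        map_add' := fun _ _ => rfl
        map_smul' := fun _ _ => rfl } :
      (M →ₗ[k] T) →ₗ[k] MultilinearMap k (fun _ : Fin b => M) T).compMultilinearMap
        (MultilinearMap.curryRight f))).domDomCongr finSumFinEquiv

theorem MultilinearMap.graftLast_apply {k M T : Type*} [Field k] [AddCommGroup M] [Module k M]
    [AddCommGroup T] [Module k T] {a b : ℕ} (f : MultilinearMap k (fun _ : Fin (a + 1) => M) T)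
    (g : MultilinearMap k (fun _ : Fin b => M) M) (x : Fin (a + b) → M) :
    MultilinearMap.graftLast f g x =
      f (Fin.snoc (α := fun _ => M) (fun i : Fin a => x (Fin.castAdd b i))
        (g fun j : Fin b => x (Fin.natAdd a j))) := rfl

theorem OrderedFinpartition.index_emb {n : ℕ} (c : OrderedFinpartition n) (m : Fin c.length)
    (j : Fin (c.partSize m)) : c.index (c.emb m j) = m :=
  congrArg Sigma.fst (c.equivSigma.symm_apply_apply ⟨m, j⟩)

namespace DGSpace

variable {k : Type u} [Field k] {V : DGSpace.{u, v} k} {U : DGSpace.{u, w} k}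
  {T : Type*} [AddCommGroup T] [Module k T] {A : Type*} [Ring A] [Algebra k A] [Grassmann k A]

/-! ## Even points -/

variable (V A) in
/-- The pure even square-zero points of `V ⊗ A`. -/
def purePoints : Set (V ⊗[k] A) :=
  {z | ∃ p, ∃ x ∈ V.par p, ∃ a ∈ Grassmann.par k (A := A) p, a * a = 0 ∧ z = x ⊗ₜ a}

variable (V A) in
/-- The space of even nilpotent points of `V ⊗ A`. -/
def points : Submodule k (V ⊗[k] A) := Submodule.span k (purePoints V A)

theorem eq_of_mem_points {ι N : Type*} [Fintype ι] [AddCommGroup N] [Module k N]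
    (f g : MultilinearMap k (fun _ : ι => V ⊗[k] A) N)
    (h : ∀ (p : ι → ZMod 2) (x : ι → V) (a : ι → A), (∀ i, x i ∈ V.par (p i)) →
      (∀ i, a i ∈ Grassmann.par k (p i)) → (∀ i, a i * a i = 0) →
      f (fun i => x i ⊗ₜ a i) = g fun i => x i ⊗ₜ a i) (z : ι → V ⊗[k] A)
    (hz : ∀ i, z i ∈ points V A) : f z = g z := by
  refine MultilinearMap.eq_of_mem_span f g (fun _ => purePoints V A) (fun y hy => ?_) z hz
  choose p x hx a ha haa hxa using hy
  rw [show y = fun i => x i ⊗ₜ[k] a i from funext hxa]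
  exact h p x a hx ha haa

/-- In an even point x ⊗ a both factors have the same parity, so the sign of permuting the vectors
and that of permuting the coefficients cancel. -/
theorem gext_relabel {n m : ℕ} (e : Fin n ≃ Fin m) (F : Multi V T m) (z : Fin n → V ⊗[k] A)
    (hz : ∀ i, z i ∈ points V A) : gext A (relabel e F) z = gext A F fun j => z (e.symm j) := by
  refine eq_of_mem_points (gext A (relabel e F)) ((gext A F).domDomCongr e.symm)
    (fun p x a hx ha _ => ?_) z hz
  rw [gext_tmul, relabel_apply_of_mem_par e F p x hx, MultilinearMap.domDomCongr_apply,
    gext_tmul F (fun j => x (e.symm j)) (fun j => a (e.symm j))]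
  have h := prod_ofFn_eq_koszulSign_smul e e.injective p a ha (List.ofFn e.symm)
    (List.nodup_ofFn.2 e.symm.injective) (fun i => List.mem_ofFn.2 ⟨e i, by simp⟩)
    (List.pairwise_ofFn.2 fun i j h => by simpa using h)
  rw [List.map_ofFn] at h
  change _ = _ ⊗ₜ[k] (List.ofFn (a ∘ e.symm)).prod
  rw [h, TensorProduct.tmul_smul, TensorProduct.smul_tmul']

/-- Comparison with products needs an injective sorting key. Breaking ties by position leaves the
sign unchanged because the sorting is stable. -/
theorem koszulSign_index {n : ℕ} (c : OrderedFinpartition n) (p : Fin n → ZMod 2) :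
    koszulSign c.index p = koszulSign (fun i => toLex (c.index i, i)) p := by
  unfold koszulSign
  refine Finset.prod_congr rfl fun i _ => Finset.prod_congr rfl fun j _ => ?_
  by_cases h : i < j
  · simp only [Prod.Lex.toLex_lt_toLex, h, h.not_gt, and_false, or_false]
  · simp only [h, false_and]

/-- Again the two signs cancel: the concatenation of the blocks is the list of labels sorted by
block and then by position, so the block-by-block product of coefficients carries the sign in
`graft`. -/
theorem gext_graft {n : ℕ} (c : OrderedFinpartition n) (F : Multi V T c.length)
    (G : ∀ m, Multi V V (c.partSize m)) (z : Fin n → V ⊗[k] A) (hz : ∀ i, z i ∈ points V A) :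
    gext A (graft c F G) z = gext A F fun m => gext A (G m) fun j => z (c.emb m j) := by
  refine eq_of_mem_points (gext A (graft c F G))
    (((gext A F).compMultilinearMap fun m => gext A (G m)).domDomCongr c.equivSigma)
    (fun p x a hx ha _ => ?_) z hz
  rw [gext_tmul, graft_apply_of_mem_par c F G p x hx, MultilinearMap.domDomCongr_apply]
  change _ = gext A F fun m => gext A (G m) fun j => x (c.emb m j) ⊗ₜ[k] a (c.emb m j)
  simp only [gext_tmul]
  have hinj : Function.Injective fun i => toLex (c.index i, i) := fun i j h => by
    simpa using congrArg (fun z => (ofLex z).2) h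
  have hs : (List.ofFn fun m => List.ofFn (c.emb m)).flatten.Pairwise
      fun x y => toLex (c.index x, x) < toLex (c.index y, y) := by
    rw [List.pairwise_flatten]
    constructor
    · intro l hl
      obtain ⟨m, rfl⟩ := List.mem_ofFn.1 hl
      refine List.pairwise_ofFn.2 fun i j h => ?_
      rw [Prod.Lex.toLex_lt_toLex]
      right
      exact ⟨by simp [OrderedFinpartition.index_emb], c.emb_strictMono m h⟩
    · refine List.pairwise_ofFn.2 fun m m' h x hx y hy => ?_
      obtain ⟨i, rfl⟩ := List.mem_ofFn.1 hx
      obtain ⟨j, rfl⟩ := List.mem_ofFn.1 hy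
      rw [Prod.Lex.toLex_lt_toLex]
      left
      simpa [OrderedFinpartition.index_emb] using h
  have h := prod_ofFn_eq_koszulSign_smul (fun i => toLex (c.index i, i)) hinj p a ha
    (List.ofFn fun m => List.ofFn (c.emb m)).flatten
    (hs.imp fun h e => h.ne (by rw [e]))
    (fun i => List.mem_flatten.2 ⟨List.ofFn (c.emb (c.index i)), List.mem_ofFn.2 ⟨_, rfl⟩,
      List.mem_ofFn.2 ⟨c.invEmbedding i, c.emb_invEmbedding i⟩⟩) hs
  rw [koszulSign_index, TensorProduct.smul_tmul, ← h, List.map_flatten, List.prod_flatten,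
    List.map_ofFn, List.map_ofFn]
  congr 3
  ext m
  simp only [Function.comp, List.map_ofFn]
  rfl

theorem gext_smul_univ {n : ℕ} (F : Multi V T n) (c : Fin n → ℤ) (x : Fin n → V) :
    F (fun i => c i • x i) = (∏ i, c i) • F x := by
  have := F.map_smul_univ (fun i => (c i : k)) x
  rw [← Int.cast_prod, Int.cast_smul_eq_zsmul] at this
  simpa only [Int.cast_smul_eq_zsmul] using this

/-- A coefficient θ of parity q makes the inner map even. Moving θ past the coefficients of the
first a arguments cancels the twists by which `compLast` moves the inner map past these arguments.
-/
theorem gext_compLast {a b : ℕ} (q : ℤ) {θ : A} (hθ : θ ∈ Grassmann.par k (q : ZMod 2))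
    (f : Multi V T (a + 1)) (g : Multi V V b) (z : Fin (a + b) → V ⊗[k] A)
    (hz : ∀ i, z i ∈ points V A) :
    lact T θ (gext A (compLast q f g) z) = gext A f (Fin.snoc (α := fun _ => V ⊗[k] A)
      (fun i => z (Fin.castAdd b i)) (lact V θ (gext A g fun j => z (Fin.natAdd a j)))) := by
  refine eq_of_mem_points ((lact T θ).compMultilinearMap (gext A (compLast q f g)))
    (MultilinearMap.graftLast (gext A f) ((lact V θ).compMultilinearMap (gext A g)))
    (fun p x c hx hc _ => ?_) z hz
  rw [LinearMap.compMultilinearMap_apply, MultilinearMap.graftLast_apply, gext_tmul,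
    LinearMap.compMultilinearMap_apply, gext_tmul, lact_tmul, lact_tmul, compLast_apply]
  have h : (Fin.snoc (α := fun _ => V ⊗[k] A) (fun i : Fin a => x (Fin.castAdd b i) ⊗ₜ[k]
      c (Fin.castAdd b i)) ((g fun i => x (Fin.natAdd a i)) ⊗ₜ[k]
        (θ * (List.ofFn fun i => c (Fin.natAdd a i)).prod))) =
      fun i => (Fin.snoc (α := fun _ => V) (fun i : Fin a => x (Fin.castAdd b i))
        (g fun i => x (Fin.natAdd a i)) i : V) ⊗ₜ[k] (Fin.snoc (α := fun _ => A)
          (fun i : Fin a => c (Fin.castAdd b i))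
          (θ * (List.ofFn fun i => c (Fin.natAdd a i)).prod) i : A) := by
    ext i
    refine Fin.lastCases ?_ (fun i => ?_) i <;> simp
  rw [h, gext_tmul, List.ofFn_succ', List.prod_concat]
  have h2 : (Fin.snoc (α := fun _ => V) (fun i : Fin a => V.twist q (x (Fin.castAdd b i)))
        (g fun i => x (Fin.natAdd a i))) = fun i => (Fin.snoc (α := fun _ => ℤ)
          (fun i : Fin a => paritySign q (p (Fin.castAdd b i))) 1 i : ℤ) •
        (Fin.snoc (α := fun _ => V) (fun i : Fin a => x (Fin.castAdd b i))
        (g fun i => x (Fin.natAdd a i)) i : V) := by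
    ext i
    refine Fin.lastCases ?_ (fun i => ?_) i
    · simp
    · simp [twist_of_mem_par (hx _)]
  rw [h2, gext_smul_univ, Fin.prod_univ_castSucc]
  simp only [Fin.snoc_castSucc, Fin.snoc_last, mul_one]
  have h3 : (List.ofFn c).prod = (List.ofFn fun i : Fin a => c (Fin.castAdd b i)).prod *
      (List.ofFn fun i => c (Fin.natAdd a i)).prod := by
    rw [List.ofFn_add, List.prod_append]; rfl
  rw [h3, ← mul_assoc,
    Grassmann.mul_prod_ofFn hθ (fun i => p (Fin.castAdd b i)) _ fun i => hc _,
    TensorProduct.smul_tmul, smul_mul_assoc, smul_smul, ← Finset.prod_mul_distrib]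
  simp only [paritySign_mul_self, Finset.prod_const_one, one_smul, mul_assoc]

/-- With an odd coefficient the differential becomes the even operator ηd, and the signed Leibniz
sum becomes an unsigned one. -/
theorem gext_compTensorD {n : ℕ} {η : A} (hη : η ∈ Grassmann.par k (1 : ZMod 2)) (F : Multi V T n)
    (z : Fin n → V ⊗[k] A) (hz : ∀ i, z i ∈ points V A) :
    lact T η (gext A (compTensorD F) z) =
      ∑ i, gext A F (Function.update z i (lact V η (V.d.rTensor A (z i)))) := by
  have h0 : ∀ (z : Fin n → V ⊗[k] A) (i : Fin n),
      (gext A F).compLinearMap (fun j => if j = i then (lact V η) ∘ₗ (V.d.rTensor A)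
        else LinearMap.id) z =
      gext A F (Function.update z i (lact V η (V.d.rTensor A (z i)))) := by
    intro z i
    rw [MultilinearMap.compLinearMap_apply]
    congr 1
    ext j
    by_cases h : j = i
    · subst h; simp
    · simp [h]
  have key := eq_of_mem_points ((lact T η).compMultilinearMap (gext A (compTensorD F)))
    (∑ i, (gext A F).compLinearMap fun j => if j = i then (lact V η) ∘ₗ (V.d.rTensor A)
        else LinearMap.id)
    (fun p x a hx ha _ => ?_) z hz
  · rw [LinearMap.compMultilinearMap_apply, _root_.sum_apply] at key
    rw [key]
    exact Finset.sum_congr rfl fun i _ => h0 z i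
  · rw [LinearMap.compMultilinearMap_apply, _root_.sum_apply, compTensorD, gext_sum,
      _root_.sum_apply, map_sum]
    refine Finset.sum_congr rfl fun i _ => ?_
    rw [h0, gext_tmul, lact_tmul, MultilinearMap.compLinearMap_apply]
    have h1 : (fun j => (if j < i then V.twist 1 else if j = i then V.d else LinearMap.id) (x j)) =
        fun j => (if j < i then paritySign (1 : ℤ) (p j) else 1) •
          (Function.update x i (V.d (x i))) j := by
      ext j
      rcases lt_trichotomy j i with h | h | h
      · rw [if_pos h, if_pos h, twist_of_mem_par (hx j), Function.update_of_ne h.ne]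
      · subst h; simp
      · rw [if_neg h.not_gt, if_neg h.ne', if_neg h.not_gt, Function.update_of_ne h.ne', one_smul]
        rfl
    have h2 : Function.update (fun j => x j ⊗ₜ[k] a j) i
        (lact V η (V.d.rTensor A (x i ⊗ₜ[k] a i))) =
        fun j => (Function.update x i (V.d (x i))) j ⊗ₜ[k] (Function.update a i (η * a i)) j := by
      ext j
      by_cases h : j = i
      · subst h; simp
      · simp [h]
    rw [h1, h2, gext_smul_univ, gext_tmul, Grassmann.mul_prod_ofFn_update hη p a ha i,
      TensorProduct.smul_tmul, smul_smul, ← Finset.prod_mul_distrib]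
    rw [Finset.prod_eq_one, one_smul]
    intro j _
    split_ifs
    · simp [paritySign_mul_self]
    · simp

end DGSpace

/-! ## Square-zero ideals and nilpotence -/

section Nil

variable {k : Type u} [Field k] {A : Type*} [Ring A] [Algebra k A] [Grassmann k A]
  {M T T' : Type*} [AddCommGroup M] [Module k M] [AddCommGroup T] [Module k T]
  [AddCommGroup T'] [Module k T']

/-- Homogeneous elements of square zero. -/
def IsNull (k : Type u) [Field k] {A : Type*} [Ring A] [Algebra k A] [Grassmann k A] (e : A) :
    Prop := Grassmann.Hom k e ∧ e * e = 0

variable (M) in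
/-- The subspace of the elements of `M ⊗ A` divisible by `e`. -/
def divBy (e : A) : Submodule k (M ⊗[k] A) := LinearMap.range (lact M e)

theorem tmul_mem_divBy (x : M) (e b : A) : x ⊗ₜ[k] (e * b) ∈ divBy (k := k) M e :=
  ⟨x ⊗ₜ b, rfl⟩

theorem tmul_mem_divBy_self (x : M) (e : A) : x ⊗ₜ[k] e ∈ divBy (k := k) M e :=
  ⟨x ⊗ₜ 1, by simp⟩

theorem divBy_le_span (e : A) :
    divBy (k := k) M e ≤ Submodule.span k {z | ∃ x b, z = x ⊗ₜ[k] (e * b)} := by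
  rintro _ ⟨z, rfl⟩
  induction z using TensorProduct.induction_on with
  | zero => simp
  | tmul x b => exact Submodule.subset_span ⟨x, b, rfl⟩
  | add z z' h h' => rw [map_add]; exact add_mem h h'

theorem gext_mem_divBy {n : ℕ} {e : A} (he : Grassmann.Hom k e)
    (F : MultilinearMap k (fun _ : Fin n => M) T) (z : Fin n → M ⊗[k] A) (i : Fin n)
    (hi : z i ∈ divBy (k := k) M e) : gext A F z ∈ divBy (k := k) T e := by
  refine MultilinearMap.mem_of_mem_span (gext A F)
    (fun l => {z | ∃ x b, z = x ⊗ₜ[k] b ∧ (l = i → ∃ c, b = e * c)}) _ (fun y hy => ?_) z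
    fun l => ?_
  · choose x b hxb hb using hy
    rw [show y = fun i => x i ⊗ₜ[k] b i from funext hxb, gext_tmul]
    obtain ⟨c, hc⟩ := Grassmann.prod_ofFn_mem_ideal he b i (hb i rfl)
    rw [hc]
    exact tmul_mem_divBy _ _ _
  · by_cases h : l = i
    · subst h
      refine Submodule.span_mono ?_ (divBy_le_span e hi)
      rintro _ ⟨x, b, rfl⟩
      exact ⟨x, e * b, rfl, fun _ => ⟨b, rfl⟩⟩
    · refine Submodule.span_mono ?_ (mem_span_range_tmul (z l))
      rintro _ ⟨⟨x, b⟩, rfl⟩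
      exact ⟨x, b, rfl, fun h' => absurd h' h⟩

theorem gext_eq_zero_of_divBy {n : ℕ} {e : A} (he : IsNull k e)
    (F : MultilinearMap k (fun _ : Fin n => M) T) (z : Fin n → M ⊗[k] A) {i j : Fin n}
    (hij : i ≠ j) (hi : z i ∈ divBy (k := k) M e) (hj : z j ∈ divBy (k := k) M e) :
    gext A F z = 0 := by
  refine MultilinearMap.eq_of_mem_span (gext A F) 0
    (fun l => {z | ∃ x b, z = x ⊗ₜ[k] b ∧ (l = i ∨ l = j → ∃ c, b = e * c)}) (fun y hy => ?_) z
    fun l => ?_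
  · choose x b hxb hb using hy
    rw [show y = fun i => x i ⊗ₜ[k] b i from funext hxb, gext_tmul,
      Grassmann.prod_ofFn_eq_zero he.1 he.2 b hij (hb i (.inl rfl)) (hb j (.inr rfl))]
    simp
  · by_cases h : l = i ∨ l = j
    · have hl : z l ∈ divBy (k := k) M e := by
        rcases h with rfl | rfl <;> assumption
      refine Submodule.span_mono ?_ (divBy_le_span e hl)
      rintro _ ⟨x, b, rfl⟩
      exact ⟨x, e * b, rfl, fun _ => ⟨b, rfl⟩⟩
    · refine Submodule.span_mono ?_ (mem_span_range_tmul (z l))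
      rintro _ ⟨⟨x, b⟩, rfl⟩
      exact ⟨x, b, rfl, fun h' => absurd h' h⟩

theorem rTensor_mem_divBy {e : A} (φ : M →ₗ[k] T) {z : M ⊗[k] A} (hz : z ∈ divBy (k := k) M e) :
    φ.rTensor A z ∈ divBy (k := k) T e := by
  obtain ⟨y, rfl⟩ := hz
  refine ⟨φ.rTensor A y, ?_⟩
  simp only [lact, ← LinearMap.comp_apply, LinearMap.lTensor_comp_rTensor,
    LinearMap.rTensor_comp_lTensor]

theorem rTensor_lact (φ : M →ₗ[k] T) (a : A) (z : M ⊗[k] A) :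
    φ.rTensor A (lact M a z) = lact T a (φ.rTensor A z) := by
  simp only [lact, ← LinearMap.comp_apply, LinearMap.lTensor_comp_rTensor,
    LinearMap.rTensor_comp_lTensor]

theorem lact_lact (a b : A) (z : M ⊗[k] A) : lact M a (lact M b z) = lact M (a * b) z := by
  induction z using TensorProduct.induction_on with
  | zero => simp
  | tmul x c => simp [mul_assoc]
  | add z z' h h' => simp only [map_add, h, h']

theorem lact_one (z : M ⊗[k] A) : lact M (1 : A) z = z := by
  induction z using TensorProduct.induction_on with
  | zero => simp
  | tmul x c => simp
  | add z z' h h' => simp only [map_add, h, h']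

theorem lact_mem_divBy {e : A} (he : Grassmann.Hom k e) (a : A) {z : M ⊗[k] A}
    (hz : z ∈ divBy (k := k) M e) : lact M a z ∈ divBy (k := k) M e := by
  obtain ⟨y, rfl⟩ := hz
  obtain ⟨c, hc⟩ := Grassmann.exists_mul_comm he a
  exact ⟨lact M c y, by rw [lact_lact, lact_lact, hc]⟩

theorem act_mem_divBy {e : A} (he : Grassmann.Hom k e) (P : (M →ₗ[k] T) ⊗[k] A) {z : M ⊗[k] A}
    (hz : z ∈ divBy (k := k) M e) : act P z ∈ divBy (k := k) T e := by
  obtain ⟨y, rfl⟩ := hz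
  induction P using TensorProduct.induction_on with
  | zero => simp
  | add P P' h h' => rw [map_add, LinearMap.add_apply]; exact add_mem h h'
  | tmul φ a =>
    have : act (φ ⊗ₜ[k] a) (lact M e y) = lact T a (φ.rTensor A (lact M e y)) := by
      induction y using TensorProduct.induction_on with
      | zero => simp
      | tmul x c => simp
      | add z z' h h' => simp only [map_add, h, h']
    rw [this]
    exact lact_mem_divBy he a (rTensor_mem_divBy φ ⟨y, rfl⟩)

theorem act_lact_left (e : A) (P : (M →ₗ[k] T) ⊗[k] A) (z : M ⊗[k] A) :
    act (lact _ e P) z = lact T e (act P z) := by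
  induction P using TensorProduct.induction_on with
  | zero => simp
  | add P P' h h' => simp only [map_add, LinearMap.add_apply, h, h']
  | tmul φ a =>
    induction z using TensorProduct.induction_on with
    | zero => simp
    | tmul x c => simp [mul_assoc]
    | add z z' h h' => simp only [map_add, h, h']

/-- `x` is a sum of `N` elements divisible by homogeneous elements of square zero. -/
def IsNilSum (x : M ⊗[k] A) (N : ℕ) : Prop :=
  ∃ (y : Fin N → M ⊗[k] A) (e : Fin N → A),
    (∀ i, IsNull k (e i)) ∧ (∀ i, y i ∈ divBy (k := k) M (e i)) ∧ x = ∑ i, y i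

theorem IsNilSum.add {x y : M ⊗[k] A} {N N' : ℕ} (hx : IsNilSum x N) (hy : IsNilSum y N') :
    IsNilSum (x + y) (N + N') := by
  obtain ⟨z, e, he, hz, rfl⟩ := hx
  obtain ⟨z', e', he', hz', rfl⟩ := hy
  refine ⟨Fin.append z z', Fin.append e e', fun i => ?_, fun i => ?_, ?_⟩
  · refine Fin.addCases (fun i => ?_) (fun i => ?_) i
    · simpa using he i
    · simpa using he' i
  · refine Fin.addCases (fun i => ?_) (fun i => ?_) i
    · simpa using hz i
    · simpa using hz' i
  · rw [Fin.sum_univ_add]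
    simp

theorem exists_isNilSum_of_mem_span {s : Set (M ⊗[k] A)}
    (hs : ∀ z ∈ s, ∃ e : A, IsNull k e ∧ z ∈ divBy (k := k) M e) {x : M ⊗[k] A}
    (hx : x ∈ Submodule.span k s) : ∃ N, IsNilSum x N := by
  induction hx using Submodule.span_induction with
  | mem x hx =>
    obtain ⟨e, he, hxe⟩ := hs x hx
    exact ⟨1, fun _ => x, fun _ => e, fun _ => he, fun _ => hxe, by simp⟩
  | zero => exact ⟨0, fun _ => 0, fun i => i.elim0, fun i => i.elim0, fun i => i.elim0, by simp⟩
  | add x y _ _ hx hy =>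
    obtain ⟨N, hN⟩ := hx
    obtain ⟨N', hN'⟩ := hy
    exact ⟨_, hN.add hN'⟩
  | smul c x _ hx =>
    obtain ⟨N, y, e, he, hy, rfl⟩ := hx
    exact ⟨N, fun i => c • y i, e, he, fun i => Submodule.smul_mem _ _ (hy i), Finset.smul_sum⟩

/-- After expansion, more than N arguments are chosen from N summands, so two of them lie in the
same square-zero ideal. -/
theorem IsNilSum.gext_eq_zero {x : M ⊗[k] A} {N n : ℕ} (hx : IsNilSum x N) (hn : N < n)
    (F : MultilinearMap k (fun _ : Fin n => M) T) : gext A F (fun _ => x) = 0 := by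
  obtain ⟨y, e, he, hy, rfl⟩ := hx
  rw [MultilinearMap.map_sum]
  refine Finset.sum_eq_zero fun g _ => ?_
  obtain ⟨i, j, hij, h⟩ := Fintype.exists_ne_map_eq_of_card_lt g (by simpa using hn)
  exact gext_eq_zero_of_divBy (he (g i)) F _ hij (hy _) (by rw [h]; exact hy _)

theorem gext_mkPiAlgebraFin {R : Type*} [Ring R] [Algebra k R] {n : ℕ} (z : Fin n → R ⊗[k] A) :
    gext A (MultilinearMap.mkPiAlgebraFin k n R) z = (List.ofFn z).prod := by
  have : gext A (MultilinearMap.mkPiAlgebraFin k n R) =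
      MultilinearMap.mkPiAlgebraFin k n (R ⊗[k] A) := by
    refine multilinear_eq_of_tmul _ _ fun x a => ?_
    rw [gext_tmul, MultilinearMap.mkPiAlgebraFin_apply, MultilinearMap.mkPiAlgebraFin_apply]
    induction n with
    | zero => simp [Algebra.TensorProduct.one_def]
    | succ n ih =>
      rw [List.ofFn_succ, List.ofFn_succ, List.ofFn_succ, List.prod_cons, List.prod_cons,
        List.prod_cons, ← ih (fun i => z i.succ), Algebra.TensorProduct.tmul_mul_tmul]
  rw [this, MultilinearMap.mkPiAlgebraFin_apply]

/-- The power is the extension of the n-fold multiplication map, to which the pigeonhole argument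
applies. -/
theorem IsNilSum.pow_eq_zero {R : Type*} [Ring R] [Algebra k R] {x : R ⊗[k] A} {N n : ℕ}
    (hx : IsNilSum x N) (hn : N < n) : x ^ n = 0 := by
  have := hx.gext_eq_zero hn (MultilinearMap.mkPiAlgebraFin k n R)
  rw [gext_mkPiAlgebraFin] at this
  simpa using this

end Nil

/-! ### Testing multilinear maps on even points -/

namespace DGSpace

variable {k : Type u} [Field k] {V : DGSpace.{u, v} k} {U : DGSpace.{u, w} k}
  {T : Type*} [AddCommGroup T] [Module k T] {A : Type*} [Ring A] [Algebra k A] [Grassmann k A]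

theorem purePoints_divBy {z : V ⊗[k] A} (hz : z ∈ purePoints V A) :
    ∃ e : A, IsNull k e ∧ z ∈ divBy (k := k) V e := by
  obtain ⟨p, x, hx, a, ha, haa, rfl⟩ := hz
  exact ⟨a, ⟨⟨p, ha⟩, haa⟩, tmul_mem_divBy_self _ _⟩

/-- A family of even square-zero points. -/
def IsValid {n : ℕ} (z : Fin n → V ⊗[k] A) : Prop :=
  ∀ i, z i ∈ points V A ∧ ∃ e : A, IsNull k e ∧ z i ∈ divBy (k := k) V e

/-- Arbitrary square-zero coefficients on homogeneous arguments suffice, since fresh ones can be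
cancelled. The factor η is allowed for because the structure equations are odd and are manipulated
only after multiplication by an odd coefficient. -/
theorem multi_ext_of_valid [Nontrivial A] {n : ℕ} {F G : Multi V T n}
    (h : ∀ η ∈ Grassmann.par k (A := A) (1 : ZMod 2), ∀ z : Fin n → V ⊗[k] A, IsValid z →
      lact T η (gext A F z) = lact T η (gext A G z)) : F = G := by
  refine multi_ext_par fun p x hx => ?_
  rw [← sub_eq_zero]
  refine Grassmann.eq_zero_of_tmul_prod (k := k) (A := A) p _ fun η hη a ha => ?_
  have h1 := h η hη (fun i => x i ⊗ₜ a i) fun i =>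
    have : x i ⊗ₜ[k] a i ∈ purePoints V A := ⟨p i, x i, hx i, a i, (ha i).1, (ha i).2, rfl⟩
    ⟨Submodule.subset_span this, purePoints_divBy this⟩
  rw [gext_tmul, gext_tmul, lact_tmul, lact_tmul] at h1
  rw [TensorProduct.sub_tmul, h1, sub_self]

/-- Positive arity matters: the coefficient of the value has square zero because it contains the
square-zero coefficient of some argument. -/
theorem lact_gext_mem_points {n : ℕ} {q : ℤ} {F : Multi V V n} (hF : HasDegree q F) (hn : 0 < n)
    {θ : A} (hθ : θ ∈ Grassmann.par k (q : ZMod 2)) {z : Fin n → V ⊗[k] A}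
    (hz : ∀ i, z i ∈ points V A) : lact V θ (gext A F z) ∈ points V A := by
  refine MultilinearMap.mem_of_mem_span ((lact V θ).compMultilinearMap (gext A F))
    (fun _ => purePoints V A) _ (fun y hy => ?_) z hz
  choose p x hx a ha haa hxa using hy
  rw [show y = fun i => x i ⊗ₜ[k] a i from funext hxa, LinearMap.compMultilinearMap_apply,
    gext_tmul, lact_tmul]
  refine Submodule.subset_span ⟨_, _, hF.mem_par hx, _, ?_, ?_, rfl⟩
  · rw [add_comm]
    exact Grassmann.mul_mem hθ (Grassmann.prod_ofFn_mem a p ha)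
  · exact Grassmann.mul_self_mul ⟨_, hθ⟩ (Grassmann.hom_prod_ofFn a fun i => ⟨_, ha i⟩)
      (.inr (Grassmann.prod_ofFn_mul_self a (fun i => ⟨_, ha i⟩) ⟨0, hn⟩ (haa _)))

theorem gext_mem_points {n : ℕ} {F : Multi V V n} (hF : HasDegree 0 F) (hn : 0 < n)
    {z : Fin n → V ⊗[k] A} (hz : ∀ i, z i ∈ points V A) : gext A F z ∈ points V A := by
  rw [← lact_one (gext A F z)]
  exact lact_gext_mem_points hF hn (by simpa using Grassmann.one_mem) hz

theorem lact_rTensor_mem_points {q : ℤ} {φ : V →ₗ[k] U} (hφ : IsHomogeneous V U q φ)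
    {θ : A} (hθ : θ ∈ Grassmann.par k (q : ZMod 2)) {z : V ⊗[k] A} (hz : z ∈ points V A) :
    lact U θ (φ.rTensor A z) ∈ points U A := by
  have : points V A ≤ (points U A).comap (lact U θ ∘ₗ φ.rTensor A) := by
    refine Submodule.span_le.2 ?_
    rintro _ ⟨p, x, hx, a, ha, haa, rfl⟩
    refine Submodule.subset_span ⟨_, _, hφ.mem_par hx, θ * a, ?_, ?_, rfl⟩
    · rw [add_comm]
      exact Grassmann.mul_mem hθ ha
    · exact Grassmann.mul_self_mul ⟨_, hθ⟩ ⟨_, ha⟩ (.inr haa)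
  exact this hz

theorem rTensor_mem_points {φ : V →ₗ[k] U} (hφ : IsHomogeneous V U 0 φ) {z : V ⊗[k] A}
    (hz : z ∈ points V A) : φ.rTensor A z ∈ points U A := by
  rw [← lact_one (φ.rTensor A z)]
  exact lact_rTensor_mem_points hφ (by simpa using Grassmann.one_mem) hz

/-- Graded symmetric maps. -/
def IsSymm {n : ℕ} (F : Multi V T n) : Prop := ∀ σ : Fin n ≃ Fin n, relabel σ F = F

/-- Graded symmetry becomes ordinary symmetry on even points. -/
theorem IsSymm.gext_perm {n : ℕ} {F : Multi V T n} (hF : IsSymm F) {z : Fin n → V ⊗[k] A}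
    (hz : ∀ i, z i ∈ points V A) (σ : Fin n ≃ Fin n) :
    gext A F (fun i => z (σ i)) = gext A F z := by
  conv_rhs => rw [← hF σ.symm, gext_relabel σ.symm F z hz]
  simp

theorem IsSymm.gext_removeNth {n : ℕ} {F : Multi V T (n + 1)} (hF : IsSymm F)
    {z : Fin (n + 1) → V ⊗[k] A} (hz : ∀ i, z i ∈ points V A) (i : Fin (n + 1)) :
    gext A F (Fin.snoc (α := fun _ => V ⊗[k] A) (i.removeNth z) (z i)) = gext A F z := by
  rw [← hF.gext_perm hz (finSuccEquivLast.trans (finSuccEquiv' i).symm)]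
  congr 1
  ext j
  refine Fin.lastCases ?_ (fun j => ?_) j
  · simp
  · simp [Fin.removeNth]

/-! ### Even operators -/

/-- Linear maps of parity `p`. -/
def HasParity (p : ZMod 2) (φ : V →ₗ[k] V) : Prop := ∀ q, ∀ x ∈ V.par q, φ x ∈ V.par (q + p)

variable (V A) in
/-- Even operators with coefficients in `A`. -/
def evenOps : Submodule k (Module.End k V ⊗[k] A) :=
  Submodule.span k {P | ∃ p φ, HasParity p φ ∧ ∃ a ∈ Grassmann.par k (A := A) p, P = φ ⊗ₜ a}

variable (V A) in
/-- Even nilpotent operators with coefficients in `A`. -/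
def nilOps : Submodule k (Module.End k V ⊗[k] A) :=
  Submodule.span k
    {P | ∃ p φ, HasParity p φ ∧ ∃ a ∈ Grassmann.par k (A := A) p, a * a = 0 ∧ P = φ ⊗ₜ a}

theorem nilOps_le_evenOps : nilOps V A ≤ evenOps V A := by
  refine Submodule.span_mono ?_
  rintro _ ⟨p, φ, hφ, a, ha, _, rfl⟩
  exact ⟨p, φ, hφ, a, ha, rfl⟩

theorem exists_isNilSum_of_mem_nilOps {P : Module.End k V ⊗[k] A} (hP : P ∈ nilOps V A) :
    ∃ N, IsNilSum P N := by
  refine exists_isNilSum_of_mem_span ?_ hP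
  rintro _ ⟨p, φ, hφ, a, ha, haa, rfl⟩
  exact ⟨a, ⟨⟨p, ha⟩, haa⟩, tmul_mem_divBy_self _ _⟩

theorem HasParity.mul {p q : ZMod 2} {φ ψ : Module.End k V} (hφ : HasParity p φ)
    (hψ : HasParity q ψ) : HasParity (p + q) (φ * ψ) := fun r x hx => by
  have := hφ _ _ (hψ r x hx)
  rwa [add_assoc, add_comm q p] at this

theorem one_mem_evenOps : (1 : Module.End k V ⊗[k] A) ∈ evenOps V A :=
  Submodule.subset_span ⟨0, 1, fun q x hx => by simpa using hx, 1, Grassmann.one_mem, rfl⟩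

theorem mul_mem_evenOps {P Q : Module.End k V ⊗[k] A} (hP : P ∈ evenOps V A)
    (hQ : Q ∈ evenOps V A) : P * Q ∈ evenOps V A := by
  have h := Submodule.mul_mem_mul hP hQ
  rw [evenOps, Submodule.span_mul_span] at h
  refine Submodule.span_mono ?_ h
  rintro _ ⟨_, ⟨p, φ, hφ, a, ha, rfl⟩, _, ⟨q, ψ, hψ, b, hb, rfl⟩, rfl⟩
  exact ⟨p + q, φ * ψ, hφ.mul hψ, a * b, Grassmann.mul_mem ha hb,
    Algebra.TensorProduct.tmul_mul_tmul _ _ _ _⟩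

theorem pow_mem_evenOps {P : Module.End k V ⊗[k] A} (hP : P ∈ evenOps V A) (n : ℕ) :
    P ^ n ∈ evenOps V A := by
  induction n with
  | zero => rw [pow_zero]; exact one_mem_evenOps
  | succ n ih => rw [pow_succ]; exact mul_mem_evenOps ih hP

theorem HasParity.twist_comp {p : ZMod 2} {φ : Module.End k V} (hφ : HasParity p φ) :
    (V.twist 1 : Module.End k V) * φ = paritySign 1 p • (φ * V.twist 1) := by
  ext x
  rw [← sum_parityProj x]
  simp only [map_sum]
  refine Finset.sum_congr rfl fun q _ => ?_
  have hx := parityProj_mem q x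
  generalize V.parityProj q x = y at hx
  rw [Module.End.mul_apply, twist_of_mem_par (hφ q y hx), LinearMap.smul_apply,
    Module.End.mul_apply, twist_of_mem_par hx, map_zsmul, smul_smul]
  congr 1
  rcases zmod_two_cases p with rfl | rfl <;> rcases zmod_two_cases q with rfl | rfl <;> decide

theorem strace_apply (φ : Module.End k V) :
    V.strace φ = LinearMap.trace k V ((V.twist 1 : Module.End k V) * φ) := rfl

/-- An odd operator anticommutes with the grading sign, so cyclicity makes its supertrace equal to
its own negative. -/
theorem HasParity.strace_eq_zero [CharZero k] {φ : Module.End k V} (hφ : HasParity 1 φ) :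
    V.strace φ = 0 := by
  have h : LinearMap.trace k V ((V.twist 1 : Module.End k V) * φ) =
      -LinearMap.trace k V ((V.twist 1 : Module.End k V) * φ) := by
    conv_lhs => rw [hφ.twist_comp]
    rw [show paritySign 1 1 = -1 from rfl, neg_one_zsmul, map_neg, LinearMap.trace_mul_comm]
  rw [strace_apply]
  exact self_eq_neg.1 h

variable (V A) in
/-- The supertrace of operators with coefficients in `A`. -/
def straceA : Module.End k V ⊗[k] A →ₗ[k] k ⊗[k] A := V.strace.rTensor A

theorem straceA_tmul (φ : Module.End k V) (a : A) :
    straceA V A (φ ⊗ₜ a) = V.strace φ ⊗ₜ a := rfl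

/-- For factors of equal parity, the sign in the graded cyclicity of the supertrace cancels the sign
from exchanging the coefficients. For factors of different parity both supertraces are those of odd
operators and vanish. -/
theorem straceA_mul_comm [CharZero k] {P Q : Module.End k V ⊗[k] A} (hP : P ∈ evenOps V A)
    (hQ : Q ∈ evenOps V A) : straceA V A (P * Q) = straceA V A (Q * P) := by
  induction hP using Submodule.span_induction with
  | zero => simp
  | add x y _ _ hx hy => rw [add_mul, mul_add, map_add, map_add, hx, hy]
  | smul c x _ hx => rw [smul_mul_assoc, mul_smul_comm, map_smul, map_smul, hx]
  | mem P hP =>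
    obtain ⟨p, φ, hφ, a, ha, rfl⟩ := hP
    induction hQ using Submodule.span_induction with
    | zero => simp
    | add x y _ _ hx hy => rw [add_mul, mul_add, map_add, map_add, hx, hy]
    | smul c x _ hx => rw [smul_mul_assoc, mul_smul_comm, map_smul, map_smul, hx]
    | mem Q hQ =>
      obtain ⟨q, ψ, hψ, b, hb, rfl⟩ := hQ
      rw [Algebra.TensorProduct.tmul_mul_tmul, Algebra.TensorProduct.tmul_mul_tmul, straceA_tmul,
        straceA_tmul]
      by_cases h : p = q
      · subst h
        have h1 : V.strace (φ * ψ) = paritySign 1 p • V.strace (ψ * φ) := by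
          rw [strace_apply, strace_apply, ← mul_assoc, hφ.twist_comp, smul_mul_assoc, map_zsmul,
            mul_assoc, LinearMap.trace_mul_comm, mul_assoc]
        rw [h1, Grassmann.comm ha hb, TensorProduct.tmul_smul, TensorProduct.smul_tmul', smul_smul]
        rcases zmod_two_cases p with rfl | rfl <;> simp [paritySign]
      · have hpq : p + q = 1 := (by decide : ∀ p q : ZMod 2, p ≠ q → p + q = 1) p q h
        rw [(hpq ▸ hφ.mul hψ : HasParity 1 (φ * ψ)).strace_eq_zero,
          (show HasParity 1 (ψ * φ) from by
            have := hψ.mul hφ; rwa [add_comm, hpq] at this).strace_eq_zero]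
        simp

/-- The operator parity equals the parity of the coefficients because F has degree 0. Nilpotence
needs at least one frozen argument, whose square-zero coefficient divides the result. -/
theorem gext_curryRight_mem {n : ℕ} {F : Multi V V (n + 1)} (hF : HasDegree 0 F)
    {z : Fin n → V ⊗[k] A} (hz : ∀ i, z i ∈ points V A) :
    gext A F.curryRight z ∈ evenOps V A ∧ (0 < n → gext A F.curryRight z ∈ nilOps V A) := by
  have key : ∀ (p : Fin n → ZMod 2) (x : Fin n → V), (∀ i, x i ∈ V.par (p i)) →
      HasParity (∑ i, p i) (F.curryRight x) := by
    intro p x hx q y hy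
    rw [MultilinearMap.curryRight_apply]
    have := hF.mem_par (p := Fin.snoc (α := fun _ => ZMod 2) p q)
      (x := Fin.snoc (α := fun _ => V) x y) fun i => by
        refine Fin.lastCases ?_ (fun i => ?_) i
        · simpa using hy
        · simpa using hx i
    rw [Fin.sum_univ_castSucc] at this
    simpa [add_comm] using this
  constructor
  · refine MultilinearMap.mem_of_mem_span (gext A F.curryRight) (fun _ => purePoints V A) _
      (fun y hy => ?_) z hz
    choose p x hx a ha haa hxa using hy
    rw [show y = fun i => x i ⊗ₜ[k] a i from funext hxa, gext_tmul]
    exact Submodule.subset_span ⟨_, _, key p x hx, _, Grassmann.prod_ofFn_mem a p ha, rfl⟩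
  · intro hn
    refine MultilinearMap.mem_of_mem_span (gext A F.curryRight) (fun _ => purePoints V A) _
      (fun y hy => ?_) z hz
    choose p x hx a ha haa hxa using hy
    rw [show y = fun i => x i ⊗ₜ[k] a i from funext hxa, gext_tmul]
    exact Submodule.subset_span ⟨_, _, key p x hx, _, Grassmann.prod_ofFn_mem a p ha,
      Grassmann.prod_ofFn_mul_self a (fun i => ⟨_, ha i⟩) ⟨0, hn⟩ (haa _), rfl⟩

/-- An operator is determined by its values at homogeneous x ⊗ 1. Multiplying by a fresh coefficient
of the parity of x turns this into a pure even point. -/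
theorem op_ext {P Q : (V →ₗ[k] T) ⊗[k] A}
    (h : ∀ y : V ⊗[k] A, y ∈ purePoints V A → act P y = act Q y) : P = Q := by
  rw [← sub_eq_zero]
  refine act_apply_one_tmul_injective _ fun x => ?_
  rw [← sum_parityProj x, TensorProduct.sum_tmul, map_sum]
  refine Finset.sum_eq_zero fun p _ => ?_
  refine Grassmann.eq_zero_of_ract p _ fun ζ hζ hζζ => ?_
  rw [← act_ract, ract_tmul, one_mul, map_sub, LinearMap.sub_apply,
    h _ ⟨p, _, parityProj_mem p x, ζ, hζ, hζζ, rfl⟩, sub_self]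

end DGSpace

/-- Used to truncate the expansion of a multilinear map at x + y when two arguments y give zero:
only the constant and the linear terms in y remain. -/
theorem Finset.sum_univ_eq_of_card_le_one {ι N : Type*} [Fintype ι] [DecidableEq ι] [AddCommMonoid N]
    (g : Finset ι → N) (hg : ∀ s, 1 < #s → g s = 0) : ∑ s, g s = g ∅ + ∑ i, g {i} := by
  rw [← Finset.sum_filter_add_sum_filter_not Finset.univ (fun s : Finset ι => s = ∅)]
  congr 1
  · rw [Finset.sum_filter, Finset.sum_ite_eq' Finset.univ ∅, if_pos (Finset.mem_univ _)]
  · rw [← Finset.sum_image (s := Finset.univ) (g := fun i : ι => ({i} : Finset ι)) (f := g)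
      (fun i _ j _ h => Finset.singleton_injective h)]
    symm
    refine Finset.sum_subset (fun s hs => ?_) (fun s hs hs' => ?_)
    · obtain ⟨i, -, rfl⟩ := Finset.mem_image.1 hs
      simp
    · refine hg s ?_
      by_contra h
      have h1 : s ≠ ∅ := (Finset.mem_filter.1 hs).2
      have h2 : #s = 1 := by
        have := Finset.card_pos.2 (Finset.nonempty_iff_ne_empty.2 h1)
        omega
      obtain ⟨i, rfl⟩ := Finset.card_eq_one.1 h2
      exact hs' (Finset.mem_image.2 ⟨i, Finset.mem_univ _, rfl⟩)

/-! ### Composing operators with coefficients -/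

section

variable {k : Type u} [Field k] {A : Type*} [Ring A] [Algebra k A] {M T T' : Type*}
  [AddCommGroup M] [Module k M] [AddCommGroup T] [Module k T] [AddCommGroup T'] [Module k T']

/-- Composition of operators with coefficients in `A` with a linear map. -/
def opL (φ : T →ₗ[k] T') : (M →ₗ[k] T) ⊗[k] A →ₗ[k] (M →ₗ[k] T') ⊗[k] A :=
  (LinearMap.compRight k φ).rTensor A

theorem opL_tmul (φ : T →ₗ[k] T') (ψ : M →ₗ[k] T) (a : A) :
    opL φ (ψ ⊗ₜ[k] a) = (φ ∘ₗ ψ) ⊗ₜ a := rfl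

theorem act_opL (φ : T →ₗ[k] T') (P : (M →ₗ[k] T) ⊗[k] A) (y : M ⊗[k] A) :
    act (opL φ P) y = φ.rTensor A (act P y) := act_comp_left φ P y

theorem gext_curryRight_zero {n : ℕ} (z : Fin n → M ⊗[k] A) :
    gext A (MultilinearMap.curryRight (0 : MultilinearMap k (fun _ : Fin (n + 1) => M) T)) z = 0 := by
  have h : MultilinearMap.curryRight (0 : MultilinearMap k (fun _ : Fin (n + 1) => M) T) = 0 := rfl
  rw [h, gext_zero]
  rfl

theorem opL_gext {n : ℕ} (φ : T →ₗ[k] T') (F : MultilinearMap k (fun _ : Fin (n + 1) => M) T)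
    (z : Fin n → M ⊗[k] A) : opL φ (gext A F.curryRight z) =
      gext A (φ.compMultilinearMap F).curryRight z := by
  rw [opL, ← gext_postcomp]
  rfl

theorem opL_eq_mul (φ : M →ₗ[k] M) (P : Module.End k M ⊗[k] A) :
    opL φ P = ((φ : Module.End k M) ⊗ₜ[k] (1 : A)) * P := by
  induction P using TensorProduct.induction_on with
  | zero => simp
  | tmul x c => rw [opL_tmul, Algebra.TensorProduct.tmul_mul_tmul, one_mul]; rfl
  | add z z' h h' => rw [map_add, h, h', mul_add]

end

namespace DGSpace

variable {k : Type u} [Field k] {V : DGSpace.{u, v} k} {U : DGSpace.{u, w} k}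
  {T T' : Type*} [AddCommGroup T] [Module k T] [AddCommGroup T'] [Module k T']
  {A : Type*} [Ring A] [Algebra k A] [Grassmann k A]

/-! ## Point functions -/

/-- The truncated generating function `∑ₙ Fₙ(x, …, x) / n!`, over `1 ≤ n ≤ B`. -/
def ptEval (B : ℕ) (F : ∀ n, Multi V T n) (x : V ⊗[k] A) : T ⊗[k] A :=
  ∑ m ∈ range B, ((m + 1).factorial : k)⁻¹ • gext A (F (m + 1)) fun _ => x

/-- The truncated derivative of the generating function, `∑ₙ Fₙ₊₁(x, …, x, -) / n!`. -/
def ptOp (B : ℕ) (F : ∀ n, Multi V T n) (x : V ⊗[k] A) : (V →ₗ[k] T) ⊗[k] A :=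
  ∑ m ∈ range B, (m.factorial : k)⁻¹ • gext A (F (m + 1)).curryRight fun _ => x

theorem IsSymm.gext_const_add {m : ℕ} {F : Multi V T (m + 1)} (hF : IsSymm F) {x y : V ⊗[k] A}
    (hx : x ∈ points V A) (hy : y ∈ points V A) {e : A} (he : IsNull k e)
    (hye : y ∈ divBy (k := k) V e) :
    gext A F (fun _ => x + y) = gext A F (fun _ => x) +
      ((m + 1 : ℕ) : k) • act (gext A F.curryRight fun _ => x) y := by
  have h := (gext A F).map_add_univ (fun _ => y) (fun _ => x)
  have h1 : ((fun _ => y) + fun _ => x : Fin (m + 1) → V ⊗[k] A) = fun _ => x + y := by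
    ext; simp [add_comm]
  rw [h1] at h
  rw [h, Finset.sum_univ_eq_of_card_le_one]
  · congr 1
    have h2 : ∀ i : Fin (m + 1), gext A F (({i} : Finset (Fin (m + 1))).piecewise (fun _ => y)
        fun _ => x) = act (gext A F.curryRight fun _ => x) y := by
      intro i
      rw [← gext_snoc, ← hF.gext_removeNth (i := i)]
      · congr 1
        ext l
        refine Fin.lastCases ?_ (fun l => ?_) l
        · simp
        · simp [Fin.removeNth, Finset.piecewise, Fin.succAbove_ne]
      · intro l
        by_cases h : l = i
        · simp [h, hy]
        · simp [Finset.piecewise, h, hx]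
    simp only [h2, Finset.sum_const, Finset.card_univ, Fintype.card_fin, Nat.cast_smul_eq_nsmul]
  · intro s hs
    obtain ⟨a, ha, b, hb, hab⟩ := Finset.one_lt_card.1 hs
    refine gext_eq_zero_of_divBy he F _ hab ?_ ?_
    · rwa [Finset.piecewise_eq_of_mem _ _ _ ha]
    · rwa [Finset.piecewise_eq_of_mem _ _ _ hb]

theorem ptEval_add [CharZero k] (B : ℕ) {F : ∀ n, Multi V T n} (hF : ∀ n, IsSymm (F n))
    {x y : V ⊗[k] A} (hx : x ∈ points V A) (hy : y ∈ points V A) {e : A} (he : IsNull k e)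
    (hye : y ∈ divBy (k := k) V e) :
    ptEval B F (x + y) = ptEval B F x + act (ptOp B F x) y := by
  simp only [ptEval, ptOp, map_sum, LinearMap.sum_apply, ← Finset.sum_add_distrib]
  refine Finset.sum_congr rfl fun m _ => ?_
  rw [(hF (m + 1)).gext_const_add hx hy he hye, smul_add, map_smul, LinearMap.smul_apply, smul_smul]
  congr 2
  rw [Nat.factorial_succ, Nat.cast_mul, mul_inv, mul_comm, ← mul_assoc,
    mul_inv_cancel₀ (Nat.cast_ne_zero.2 (Nat.succ_ne_zero m)), one_mul]

/-- The difference quotient of `ptEval`. -/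
def ptDiffOp (B : ℕ) (F : ∀ n, Multi V T n) (x y : V ⊗[k] A) : (V →ₗ[k] T) ⊗[k] A :=
  ∑ m ∈ range B, ((m + 1).factorial : k)⁻¹ • ∑ i : Fin (m + 1),
    gext A (F (m + 1)).curryRight (i.removeNth fun l => if l < i then x else y)

/-- Telescoping: replace y by x one argument at a time. Unlike the Taylor formula this holds for an
arbitrary difference of points, as uniqueness of the fixed point requires. -/
theorem IsSymm.gext_const_sub {m : ℕ} {F : Multi V T (m + 1)} (hF : IsSymm F) {x y : V ⊗[k] A}
    (hx : x ∈ points V A) (hy : y ∈ points V A) :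
    gext A F (fun _ => x) - gext A F (fun _ => y) = ∑ i : Fin (m + 1),
      act (gext A F.curryRight (i.removeNth fun l => if l < i then x else y)) (x - y) := by
  let t : ℕ → T ⊗[k] A := fun j => gext A F fun l : Fin (m + 1) => if l.val < j then x else y
  have h1 : gext A F (fun _ => x) = t (m + 1) := by
    simp only [t]; congr 1; ext l; rw [if_pos l.2]
  have h2 : gext A F (fun _ => y) = t 0 := by
    simp only [t]; congr 1
  rw [h1, h2, ← Finset.sum_range_sub, Finset.sum_range]
  refine Finset.sum_congr rfl fun i _ => ?_
  have h3 : t (i + 1) = gext A F (Function.update (fun l => if l < i then x else y) i x) := by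
    simp only [t]; congr 1; ext l
    by_cases h : l = i
    · subst h; simp
    · rw [Function.update_of_ne h]
      have : (l.val < i.val + 1) ↔ l < i := by
        rw [Fin.lt_def]
        have : l.val ≠ i.val := fun e => h (Fin.ext e)
        omega
      simp only [this]
  have h4 : t i = gext A F (Function.update (fun l => if l < i then x else y) i y) := by
    simp only [t]; congr 1; ext l
    by_cases h : l = i
    · subst h; simp
    · rw [Function.update_of_ne h]; rfl
  rw [h3, h4, ← (gext A F).map_update_sub, ← gext_snoc, ← hF.gext_removeNth (i := i)]
  · congr 1
    ext l
    refine Fin.lastCases ?_ (fun l => ?_) l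
    · simp
    · simp [Fin.removeNth]
  · intro l
    by_cases h : l = i
    · rw [h, Function.update_self]; exact sub_mem hx hy
    · rw [Function.update_of_ne h]; split_ifs <;> assumption

theorem ptEval_sub (B : ℕ) {F : ∀ n, Multi V T n} (hF : ∀ n, IsSymm (F n))
    {x y : V ⊗[k] A} (hx : x ∈ points V A) (hy : y ∈ points V A) :
    ptEval B F x - ptEval B F y = act (ptDiffOp B F x y) (x - y) := by
  simp only [ptEval, ptDiffOp, map_sum, LinearMap.sum_apply, ← Finset.sum_sub_distrib]
  refine Finset.sum_congr rfl fun m _ => ?_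
  rw [← smul_sub, (hF (m + 1)).gext_const_sub hx hy, map_smul, LinearMap.smul_apply, map_sum,
    LinearMap.sum_apply]

theorem HasDegree.comp {n : ℕ} {p q : ℤ} {F : Multi V V n} (hF : HasDegree p F) {φ : V →ₗ[k] V}
    (hφ : IsHomogeneous V V q φ) : HasDegree (p + q) (φ.compMultilinearMap F) := fun i x hx => by
  have := hφ _ _ (hF i x hx)
  rwa [add_assoc] at this

/-- The degrees of h and L add up to 0, so hE'(x) is even. Since L 1 = 0, it has no constant term,
and each remaining term contains a nilpotent argument. -/
theorem opL_ptOp_mem (B : ℕ) {L : ∀ n, Multi V V n} (hL : ∀ n, HasDegree 1 (L n))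
    (hL1 : L 1 = 0) {h : V →ₗ[k] V} (hh : IsHomogeneous V V (-1) h) {x : V ⊗[k] A}
    (hx : x ∈ points V A) : opL h (ptOp B L x) ∈ nilOps V A := by
  rw [ptOp, map_sum]
  refine Submodule.sum_mem _ fun m _ => ?_
  rw [map_smul]
  refine Submodule.smul_mem _ _ ?_
  rcases Nat.eq_zero_or_pos m with rfl | hm
  · have : gext A (L (0 + 1)).curryRight (fun _ => x) = 0 := by
      simp only [hL1]
      exact gext_curryRight_zero _
    rw [this, map_zero]
    exact zero_mem _
  · rw [opL_gext]
    exact (gext_curryRight_mem (by simpa using (hL (m + 1)).comp hh) fun _ => hx).2 hm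

theorem opL_ptDiffOp_mem (B : ℕ) {L : ∀ n, Multi V V n} (hL : ∀ n, HasDegree 1 (L n))
    (hL1 : L 1 = 0) {h : V →ₗ[k] V} (hh : IsHomogeneous V V (-1) h) {x y : V ⊗[k] A}
    (hx : x ∈ points V A) (hy : y ∈ points V A) : opL h (ptDiffOp B L x y) ∈ nilOps V A := by
  rw [ptDiffOp, map_sum]
  refine Submodule.sum_mem _ fun m _ => ?_
  rw [map_smul]
  refine Submodule.smul_mem _ _ ?_
  rw [map_sum]
  refine Submodule.sum_mem _ fun i _ => ?_
  rcases Nat.eq_zero_or_pos m with rfl | hm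
  · have : ∀ z, gext A (L (0 + 1)).curryRight z = 0 := by
      intro z
      simp only [hL1]
      exact gext_curryRight_zero _
    rw [this, map_zero]
    exact zero_mem _
  · rw [opL_gext]
    refine (gext_curryRight_mem (by simpa using (hL (m + 1)).comp hh) fun l => ?_).2 hm
    simp only [Fin.removeNth]
    split_ifs <;> assumption

theorem eq_zero_of_act_eq {P : Module.End k V ⊗[k] A} (hP : P ∈ nilOps V A) {z : V ⊗[k] A}
    (h : z = act P z) : z = 0 := by
  obtain ⟨N, hN⟩ := exists_isNilSum_of_mem_nilOps hP
  have h1 : ∀ n, z = act (P ^ n) z := by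
    intro n
    induction n with
    | zero => rw [pow_zero, act_one]
    | succ n ih => rw [pow_succ, act_mul, ← h, ← ih]
  rw [h1 (N + 1), hN.pow_eq_zero (Nat.lt_succ_self N)]
  simp

/-- The difference z of two solutions satisfies z = Pz, where P is h composed with the difference
quotient of the generating function; P is nilpotent, hence z = 0. -/
theorem fixedPoint_unique (B : ℕ) {L : ∀ n, Multi V V n} (hLs : ∀ n, IsSymm (L n))
    (hL : ∀ n, HasDegree 1 (L n)) (hL1 : L 1 = 0) {h : V →ₗ[k] V} (hh : IsHomogeneous V V (-1) h)
    {c x y : V ⊗[k] A} (hx : x ∈ points V A) (hy : y ∈ points V A)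
    (hcx : x = c + h.rTensor A (ptEval B L x)) (hcy : y = c + h.rTensor A (ptEval B L y)) :
    x = y := by
  rw [← sub_eq_zero]
  refine eq_zero_of_act_eq (opL_ptDiffOp_mem B hL hL1 hh hx hy) ?_
  rw [act_opL, ← ptEval_sub B hLs hx hy, map_sub]
  nth_rewrite 1 [hcx, hcy]
  abel

end DGSpace

/-! ## Sums over subfamilies -/

section Subsum

variable {α N N' : Type*} [AddCommGroup N] [AddCommGroup N']

/-- Partial evaluation of a family of functions at the first argument. -/
def consFam (a : α) (F : ∀ m, (Fin m → α) → N) : ∀ m, (Fin m → α) → N :=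
  fun m z => F (m + 1) (Fin.cons (α := fun _ => α) a z)

/-- Partial evaluation of a family of functions at the last argument. -/
def snocFam (a : α) (F : ∀ m, (Fin m → α) → N) : ∀ m, (Fin m → α) → N :=
  fun m z => F (m + 1) (Fin.snoc (α := fun _ => α) z a)

/-- The sum of the values of `F` at all (ordered) subfamilies of the family `u`. -/
def subsum : ∀ {n : ℕ}, (∀ m, (Fin m → α) → N) → (Fin n → α) → N
  | 0, F, u => F 0 u
  | _ + 1, F, u => subsum F (Fin.tail u) + subsum (consFam (u 0) F) (Fin.tail u)

theorem subsum_zero (F : ∀ m, (Fin m → α) → N) (u : Fin 0 → α) : subsum F u = F 0 u := rfl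

theorem subsum_cons {n : ℕ} (F : ∀ m, (Fin m → α) → N) (a : α) (u : Fin n → α) :
    subsum F (Fin.cons (α := fun _ => α) a u) = subsum F u + subsum (consFam a F) u := rfl

theorem subsum_congr {D : Set α} {n : ℕ} {F G : ∀ m, (Fin m → α) → N}
    (h : ∀ m z, (∀ i, z i ∈ D) → F m z = G m z) {u : Fin n → α} (hu : ∀ i, u i ∈ D) :
    subsum F u = subsum G u := by
  induction n generalizing F G with
  | zero => exact h 0 u hu
  | succ n ih =>
    refine congrArg₂ (· + ·) (ih h fun i => hu i.succ)
      (ih (fun m z hz => h _ _ (Fin.cases (hu 0) hz)) fun i => hu i.succ)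

theorem subsum_map (φ : N →+ N') {n : ℕ} (F : ∀ m, (Fin m → α) → N) (u : Fin n → α) :
    subsum (fun m z => φ (F m z)) u = φ (subsum F u) := by
  induction n generalizing F with
  | zero => rfl
  | succ n ih =>
    rw [subsum, subsum, map_add, ← ih, ← ih]
    rfl

theorem subsum_add {n : ℕ} (F G : ∀ m, (Fin m → α) → N) (u : Fin n → α) :
    subsum (fun m z => F m z + G m z) u = subsum F u + subsum G u := by
  induction n generalizing F G with
  | zero => rfl
  | succ n ih =>
    simp only [subsum, ih]
    rw [add_add_add_comm, ← ih (consFam (u 0) F)]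
    rfl

theorem subsum_fun_zero {n : ℕ} (u : Fin n → α) :
    subsum (fun m (_ : Fin m → α) => (0 : N)) u = 0 := by
  induction n with
  | zero => rfl
  | succ n ih =>
    rw [subsum, ih, zero_add]
    exact ih _

theorem subsum_eq_zero {D : Set α} {n : ℕ} {F : ∀ m, (Fin m → α) → N}
    (h : ∀ m z, (∀ i, z i ∈ D) → F m z = 0) {u : Fin n → α} (hu : ∀ i, u i ∈ D) :
    subsum F u = 0 :=
  (subsum_congr h hu).trans (subsum_fun_zero u)

theorem subsum_sub {n : ℕ} (F G : ∀ m, (Fin m → α) → N) (u : Fin n → α) :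
    subsum (fun m z => F m z - G m z) u = subsum F u - subsum G u := by
  rw [eq_sub_iff_add_eq, ← subsum_add]
  simp

theorem subsum_mem {R : Type*} [Ring R] [Module R N] (p : Submodule R N) {D : Set α} {n : ℕ}
    {F : ∀ m, (Fin m → α) → N} (h : ∀ m z, (∀ i, z i ∈ D) → F m z ∈ p) {u : Fin n → α}
    (hu : ∀ i, u i ∈ D) : subsum F u ∈ p := by
  induction n generalizing F with
  | zero => exact h 0 u hu
  | succ n ih =>
    exact add_mem (ih h fun i => hu i.succ)
      (ih (fun m z hz => h _ _ (Fin.cases (hu 0) hz)) fun i => hu i.succ)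

theorem subsum_snoc {n : ℕ} (F : ∀ m, (Fin m → α) → N) (u : Fin n → α) (a : α) :
    subsum F (Fin.snoc (α := fun _ => α) u a) = subsum F u + subsum (snocFam a F) u := by
  induction n generalizing F with
  | zero =>
    simp only [subsum, snocFam, consFam]
    congr 1
    · congr 1; ext i; exact i.elim0
    · congr 1; ext i
      obtain rfl : i = 0 := Fin.eq_zero i
      simp [Fin.snoc]
  | succ n ih =>
    obtain ⟨b, u, rfl⟩ : ∃ b u', u = Fin.cons (α := fun _ => α) b u' :=
      ⟨u 0, Fin.tail u, (Fin.cons_self_tail u).symm⟩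
    rw [← Fin.cons_snoc_eq_snoc_cons, subsum_cons, subsum_cons, subsum_cons, ih, ih,
      add_add_add_comm]
    congr 3
    funext m z
    simp only [consFam, snocFam, Fin.cons_snoc_eq_snoc_cons]

theorem subsum_comp {β : Type*} (φ : β → α) {n : ℕ} (F : ∀ m, (Fin m → α) → N) (u : Fin n → β) :
    subsum (fun m z => F m (φ ∘ z)) u = subsum F (φ ∘ u) := by
  induction n generalizing F with
  | zero => rfl
  | succ n ih =>
    obtain ⟨b, u, rfl⟩ : ∃ b u', u = Fin.cons (α := fun _ => β) b u' :=
      ⟨u 0, Fin.tail u, (Fin.cons_self_tail u).symm⟩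
    have h : consFam b (fun m z => F m (φ ∘ z)) = fun m z => consFam (φ b) F m (φ ∘ z) := by
      funext m z
      simp only [consFam, Fin.comp_cons]
    rw [Fin.comp_cons, subsum_cons, subsum_cons, ih, h, ih]

/-- A family of functions is determined by its sums over subfamilies. -/
theorem eq_zero_of_subsum_eq_zero {D : Set α} {F : ∀ m, (Fin m → α) → N}
    (h : ∀ n (u : Fin n → α), (∀ i, u i ∈ D) → subsum F u = 0) {n : ℕ} {z : Fin n → α}
    (hz : ∀ i, z i ∈ D) : F n z = 0 := by
  induction n generalizing F with
  | zero => exact h 0 z hz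
  | succ n ih =>
    obtain ⟨a, z, rfl⟩ : ∃ b u', z = Fin.cons (α := fun _ => α) b u' :=
      ⟨z 0, Fin.tail z, (Fin.cons_self_tail z).symm⟩
    refine ih (F := consFam a F) (fun m u hu => ?_) fun i => hz i.succ
    have := h _ (Fin.cons (α := fun _ => α) a u) (Fin.cases (hz 0) hu)
    rwa [subsum_cons, h _ _ hu, zero_add] at this

/-- Adjoining a member a to a family changes the sum over subfamilies by the contributions of those
containing a. Hence F n z is the iterated finite difference of S at 0 in the directions z_i. -/
theorem eq_foldl_of_subsum {D : Set α} [AddCommMonoid α] {F : ∀ m, (Fin m → α) → N} {S : α → N}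
    (h : ∀ n (u : Fin n → α), (∀ i, u i ∈ D) → subsum F u = S (∑ i, u i)) {n : ℕ} {z : Fin n → α}
    (hz : ∀ i, z i ∈ D) :
    F n z = (List.ofFn z).foldl (fun S a x => S (x + a) - S x) S 0 := by
  induction n generalizing F S with
  | zero =>
    have := h 0 z hz
    simpa [subsum] using this
  | succ n ih =>
    obtain ⟨a, z, rfl⟩ : ∃ b u', z = Fin.cons (α := fun _ => α) b u' :=
      ⟨z 0, Fin.tail z, (Fin.cons_self_tail z).symm⟩
    rw [List.ofFn_cons, List.foldl_cons]
    refine ih (F := consFam a F) (fun m u hu => ?_) fun i => hz i.succ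
    have := h _ (Fin.cons (α := fun _ => α) a u) (Fin.cases (hz 0) hu)
    rw [subsum_cons, h _ _ hu, Fin.sum_cons, add_comm a] at this
    rw [← this]
    abel

/-- If the sums over subfamilies only depend on the sum of the family, the functions are
symmetric. -/
theorem perm_of_subsum {D : Set α} [AddCommMonoid α] {F : ∀ m, (Fin m → α) → N} {S : α → N}
    (h : ∀ n (u : Fin n → α), (∀ i, u i ∈ D) → subsum F u = S (∑ i, u i)) {n : ℕ} {z : Fin n → α}
    (hz : ∀ i, z i ∈ D) (σ : Equiv.Perm (Fin n)) : F n (z ∘ σ) = F n z := by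
  rw [eq_foldl_of_subsum h hz, eq_foldl_of_subsum (z := z ∘ σ) h fun i => hz (σ i)]
  -- Finite differences in different directions commute.
  have : RightCommutative fun (S : α → N) a x => S (x + a) - S x := ⟨fun S a b => by
    funext x
    simp only [add_right_comm x a b]
    abel⟩
  rw [(Equiv.Perm.ofFn_comp_perm σ z).foldl_eq]

/-- Restriction of a family to a subset. -/
def restrict {n : ℕ} (z : Fin n → α) (I : Finset (Fin n)) : Fin #I → α :=
  fun i => z (I.orderEmbOfFin rfl i)

/-- Any increasing enumeration of I may be used. The equation is between values of F because the
arities #I and m agree only propositionally. -/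
theorem apply_restrict_of_strictMono {n m : ℕ} (F : ∀ m, (Fin m → α) → N) (z : Fin n → α)
    (I : Finset (Fin n)) (e : Fin m → Fin n) (he : StrictMono e) (hI : ∀ i, i ∈ I ↔ ∃ j, e j = i) :
    F #I (restrict z I) = F m fun i => z (e i) := by
  obtain rfl : I = Finset.univ.image e := by ext; simp [hI]
  have hc : #(Finset.univ.image e) = m := by
    rw [Finset.card_image_of_injective _ he.injective, Finset.card_univ, Fintype.card_fin]
  have h : ∀ c (hc : #(Finset.univ.image e) = c),
      F c (fun i => z ((Finset.univ.image e).orderEmbOfFin hc i)) =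
      F #(Finset.univ.image e) (restrict z (Finset.univ.image e)) := by
    rintro _ rfl; rfl
  rw [← h m hc]
  congr 1
  funext i
  rw [← Finset.orderEmbOfFin_unique hc (fun x => by simp) he]

theorem sum_finset_fin_succ {n : ℕ} (f : Finset (Fin (n + 1)) → N) :
    ∑ I, f I = ∑ I : Finset (Fin n), f (I.map (Fin.succEmb n)) +
      ∑ I : Finset (Fin n), f (insert 0 (I.map (Fin.succEmb n))) := by
  rw [← Finset.powerset_univ, Fin.univ_succ, Finset.cons_eq_insert, Finset.sum_powerset_insert]
  · have h : ∀ g : Finset (Fin (n + 1)) → N,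
        ∑ I ∈ (Finset.univ.map (Fin.succEmb n)).powerset, g I =
          ∑ I : Finset (Fin n), g (I.map (Fin.succEmb n)) := by
      intro g
      rw [← Finset.powerset_univ]
      refine Eq.trans ?_ (Finset.sum_map _ (Finset.mapEmbedding (Fin.succEmb n)).toEmbedding g)
      congr 1
      ext s
      simp only [Finset.mem_powerset, Finset.mem_map, Finset.subset_map_iff]
      constructor
      · rintro ⟨t, ht, rfl⟩; exact ⟨t, ht, rfl⟩
      · rintro ⟨t, ht, rfl⟩; exact ⟨t, ht, rfl⟩
    exact congrArg₂ (· + ·) (h _) (h _)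
  · simp

theorem apply_restrict_map_succ {n : ℕ} (F : ∀ m, (Fin m → α) → N) (a : α) (z : Fin n → α)
    (I : Finset (Fin n)) : F _ (restrict (Fin.cons (α := fun _ => α) a z) (I.map (Fin.succEmb n))) =
      F _ (restrict z I) := by
  rw [apply_restrict_of_strictMono F _ _ (fun i => (I.orderEmbOfFin rfl i).succ)]
  · simp only [Fin.cons_succ]; rfl
  · exact fun i j h => by simpa using h
  · intro i
    simp only [Finset.mem_map, Fin.coe_succEmb]
    constructor
    · rintro ⟨j, hj, rfl⟩
      have : j ∈ Set.range (I.orderEmbOfFin rfl) := by simpa using hj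
      obtain ⟨l, rfl⟩ := this
      exact ⟨l, rfl⟩
    · rintro ⟨j, rfl⟩
      exact ⟨_, I.orderEmbOfFin_mem rfl j, rfl⟩

theorem apply_restrict_insert_zero {n : ℕ} (F : ∀ m, (Fin m → α) → N) (a : α) (z : Fin n → α)
    (I : Finset (Fin n)) :
    F _ (restrict (Fin.cons (α := fun _ => α) a z) (insert 0 (I.map (Fin.succEmb n)))) =
      consFam a F _ (restrict z I) := by
  rw [apply_restrict_of_strictMono F _ _
    (Fin.cons (α := fun _ => Fin (n + 1)) 0 fun i => (I.orderEmbOfFin rfl i).succ)]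
  · rw [consFam]
    congr 1
    funext i
    refine Fin.cases rfl (fun i => rfl) i
  · intro i j h
    induction i using Fin.cases with
    | zero =>
      induction j using Fin.cases with
      | zero => exact (lt_irrefl _ h).elim
      | succ j => simp
    | succ i =>
      induction j using Fin.cases with
      | zero => exact (Fin.not_lt_zero _ h).elim
      | succ j => simpa using h
  · intro i
    simp only [Finset.mem_insert, Finset.mem_map, Fin.coe_succEmb, Fin.exists_fin_succ, Fin.cons_zero,
      Fin.cons_succ]
    refine or_congr eq_comm ?_
    constructor
    · rintro ⟨j, hj, rfl⟩
      have : j ∈ Set.range (I.orderEmbOfFin rfl) := by simpa using hj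
      obtain ⟨l, rfl⟩ := this
      exact ⟨l, rfl⟩
    · rintro ⟨j, rfl⟩
      exact ⟨_, I.orderEmbOfFin_mem rfl j, rfl⟩

theorem compl_map_succ {n : ℕ} (I : Finset (Fin n)) :
    (I.map (Fin.succEmb n))ᶜ = insert 0 (Iᶜ.map (Fin.succEmb n)) := by
  ext i
  refine Fin.cases ?_ (fun i => ?_) i <;> simp [Fin.succ_ne_zero]

theorem compl_insert_zero {n : ℕ} (I : Finset (Fin n)) :
    (insert 0 (I.map (Fin.succEmb n)))ᶜ = Iᶜ.map (Fin.succEmb n) := by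
  rw [← compl_compl (Iᶜ.map _), compl_map_succ, compl_compl]

/-- Splitting a family into two subfamilies: when the summands vanish on families with a common
member, one can sum over all pairs of subfamilies. -/
theorem subsum_split {D : Set α} {n : ℕ} (H : ∀ a, (Fin a → α) → ∀ b, (Fin b → α) → N)
    (hH : ∀ a z b z', (∀ i, z i ∈ D) → (∀ i, z' i ∈ D) → ∀ i j, z i = z' j → H a z b z' = 0)
    {u : Fin n → α} (hu : ∀ i, u i ∈ D) :
    subsum (fun _ z => ∑ I : Finset _, H _ (restrict z I) _ (restrict z Iᶜ)) u =
      subsum (fun a z => subsum (fun b z' => H a z b z') u) u := by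
  induction n generalizing H with
  | zero =>
    simp only [subsum]
    rw [Fintype.sum_eq_single ∅ (fun I hI => (hI (Subsingleton.elim _ _)).elim)]
    have h1 : ∀ (I : Finset (Fin 0)) (F : ∀ m, (Fin m → α) → N), F _ (restrict u I) = F 0 u := by
      intro I F
      rw [apply_restrict_of_strictMono F u I id strictMono_id fun i => i.elim0]
      rfl
    rw [h1 _ fun b z' => H _ (restrict u ∅) b z', h1 _ fun a z => H a z 0 u]
  | succ n ih =>
    obtain ⟨x, u, rfl⟩ : ∃ b u', u = Fin.cons (α := fun _ => α) b u' :=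
      ⟨u 0, Fin.tail u, (Fin.cons_self_tail u).symm⟩
    have hx : x ∈ D := hu 0
    have hu' : ∀ i, u i ∈ D := fun i => hu i.succ
    have h1 : consFam x (fun m z => ∑ I : Finset (Fin m), H _ (restrict z I) _ (restrict z Iᶜ)) =
        fun m z => (∑ I : Finset (Fin m), H _ (restrict z I) _
          (Fin.cons (α := fun _ => α) x (restrict z Iᶜ))) +
          ∑ I : Finset (Fin m), H _ (Fin.cons (α := fun _ => α) x (restrict z I)) _
            (restrict z Iᶜ) := by
      funext m z
      rw [consFam, sum_finset_fin_succ]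
      congr 1
      · refine Finset.sum_congr rfl fun I _ => ?_
        rw [apply_restrict_map_succ (fun a y => H a y _ _), compl_map_succ,
          apply_restrict_insert_zero (fun a y => H _ _ a y)]
        rfl
      · refine Finset.sum_congr rfl fun I _ => ?_
        rw [apply_restrict_insert_zero (fun a y => H a y _ _), compl_insert_zero,
          consFam, apply_restrict_map_succ (fun a y => H _ _ a y)]
    rw [subsum_cons, h1, subsum_add, ih H hH hu',
      ih (fun a z b z' => H a z (b + 1) (Fin.cons (α := fun _ => α) x z'))
        (fun a z b z' hz hz' i j h => hH _ _ _ _ hz (Fin.cases hx hz') i j.succ h) hu',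
      ih (fun a z b z' => H (a + 1) (Fin.cons (α := fun _ => α) x z) b z')
        (fun a z b z' hz hz' i j h => hH _ _ _ _ (Fin.cases hx hz) hz' i.succ j h) hu']
    -- Pairs of subfamilies that both contain x contribute nothing. These are the only pairs that
    -- are not accounted for by placing x in I or in its complement.
    have h2 : subsum (fun a z => subsum (fun b z' => H (a + 1) (Fin.cons (α := fun _ => α) x z)
        (b + 1) (Fin.cons (α := fun _ => α) x z')) u) u = 0 :=
      subsum_eq_zero (fun a z hz => subsum_eq_zero (fun b z' hz' =>
        hH (a + 1) (Fin.cons (α := fun _ => α) x z) (b + 1) (Fin.cons (α := fun _ => α) x z')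
          (Fin.cases hx hz) (Fin.cases hx hz') 0 0 rfl) hu') hu'
    have h3 : subsum (fun a z => subsum (fun b z' => H a z b z')
          (Fin.cons (α := fun _ => α) x u)) u =
        subsum (fun a z => subsum (fun b z' => H a z b z') u) u +
          subsum (fun a z => subsum (fun b z' => H a z (b + 1)
            (Fin.cons (α := fun _ => α) x z')) u) u := by
      rw [← subsum_add]; rfl
    have h4 : subsum (consFam x fun a z => subsum (fun b z' => H a z b z')
          (Fin.cons (α := fun _ => α) x u)) u =
        subsum (fun a z => subsum (fun b z' => H (a + 1) (Fin.cons (α := fun _ => α) x z) b z')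
          u) u + 0 := by
      rw [← h2, ← subsum_add]; rfl
    rw [subsum_cons, h3, h4]
    abel

/-- The left side sums over subfamilies with a modified member, the right side over subfamilies to
which some δ (u i) is appended. By h1 the modified member can be moved to the end; by h2 the extra
terms, in which u i occurs besides δ (u i), vanish. -/
theorem subsum_update {D : Set α} {n : ℕ} (δ : α → α) (F : ∀ m, (Fin m → α) → N)
    (h1 : ∀ m (i : Fin (m + 1)) z, (∀ i, z i ∈ D) → ∀ a ∈ D,
      F (m + 1) (i.insertNth (α := fun _ => α) (δ a) z) = F (m + 1) (Fin.snoc (α := fun _ => α) z (δ a)))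
    (h2 : ∀ m z, (∀ i, z i ∈ D) → ∀ i, F (m + 1) (Fin.snoc (α := fun _ => α) z (δ (z i))) = 0)
    {u : Fin n → α} (hu : ∀ i, u i ∈ D) :
    subsum (fun m z => ∑ i, F m (Function.update z i (δ (z i)))) u =
      ∑ i, subsum (snocFam (δ (u i)) F) u := by
  induction n generalizing F with
  | zero => simp [subsum]
  | succ n ih =>
    obtain ⟨x, u, rfl⟩ : ∃ b u', u = Fin.cons (α := fun _ => α) b u' :=
      ⟨u 0, Fin.tail u, (Fin.cons_self_tail u).symm⟩
    have hx : x ∈ D := hu 0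
    have hu' : ∀ i, u i ∈ D := fun i => hu i.succ
    have h3 : consFam x (fun m z => ∑ i, F m (Function.update z i (δ (z i)))) =
        fun m z => consFam (δ x) F m z + ∑ i, consFam x F m (Function.update z i (δ (z i))) := by
      funext m z
      rw [consFam, Fin.sum_univ_succ]
      simp only [consFam, Fin.cons_zero, Fin.cons_succ, Fin.update_cons_zero, Fin.cons_update]
    have h4 : ∀ y, consFam x (snocFam y F) = snocFam y (consFam x F) := by
      intro y
      funext m z
      simp only [consFam, snocFam, Fin.cons_snoc_eq_snoc_cons]
    rw [subsum_cons, h3, subsum_add, ih F h1 h2 hu', ih (consFam x F) _ _ hu', Fin.sum_univ_succ]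
    · simp only [Fin.cons_zero, Fin.cons_succ, subsum_cons, Finset.sum_add_distrib, h4]
      have h5 : subsum (snocFam (δ x) (consFam x F)) u = 0 :=
        subsum_eq_zero (fun m z hz => by
          have := h2 _ (Fin.cons (α := fun _ => α) x z) (Fin.cases hx hz) 0
          rwa [← Fin.cons_snoc_eq_snoc_cons] at this) hu'
      have h6 : subsum (consFam (δ x) F) u = subsum (snocFam (δ x) F) u :=
        subsum_congr (fun m z hz => by
          rw [consFam, ← Fin.insertNth_zero', h1 _ _ _ hz _ hx]; rfl) hu'
      rw [h5, h6]
      abel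
    · intro m i z hz a ha
      have := h1 _ i.succ (Fin.cons (α := fun _ => α) x z) (Fin.cases hx hz) a ha
      rwa [Fin.insertNth_succ_cons, ← Fin.cons_snoc_eq_snoc_cons] at this
    · intro m z hz i
      have := h2 _ (Fin.cons (α := fun _ => α) x z) (Fin.cases hx hz) i.succ
      rwa [← Fin.cons_snoc_eq_snoc_cons] at this

end Subsum

/-! ## Composition of families and exponential sums -/

section Compose

variable {α N M T : Type*} [AddCommGroup N]

/-- The composition of two families of functions along all partitions. -/
def compFam (Φ : ∀ n, (Fin n → M) → N) (X : ∀ n, (Fin n → α) → M) : ∀ n, (Fin n → α) → N :=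
  fun n z => ∑ c : OrderedFinpartition n, Φ c.length fun m => X (c.partSize m) fun j => z (c.emb m j)

/-- Here the new label 0 joins the block l: this block acquires the argument a in first place, and
all other blocks keep their values. -/
theorem apply_extendMiddle (X : ∀ n, (Fin n → α) → M) {n : ℕ} (c : OrderedFinpartition n)
    (l : Fin c.length) (a : α) (z : Fin n → α) (m : Fin c.length) :
    X ((c.extendMiddle l).partSize m)
      (fun j => Fin.cons (α := fun _ => α) a z ((c.extendMiddle l).emb m j)) =
    Function.update (fun m => X (c.partSize m) fun j => z (c.emb m j)) l
      (consFam a X (c.partSize l) fun j => z (c.emb l j)) m := by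
  have key : ∀ {s t : ℕ} (h : s = t) (e : Fin t → Fin (n + 1)),
      X s (fun j => Fin.cons (α := fun _ => α) a z (e (Fin.cast h j))) =
        X t fun j => Fin.cons (α := fun _ => α) a z (e j) := by
    rintro s _ rfl e; rfl
  by_cases h : m = l
  · subst h
    rw [Function.update_self, consFam]
    have hs : (c.extendMiddle m).partSize m = c.partSize m + 1 := by simp
    have he : (c.extendMiddle m).emb m =
        fun j => Fin.cases (motive := fun _ => Fin (n + 1)) 0 (Fin.succ ∘ c.emb m) (Fin.cast hs j) := by
      simp [OrderedFinpartition.extendMiddle]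
      rfl
    rw [he, key hs]
    congr 1
    funext j
    refine Fin.cases rfl (fun j => rfl) j
  · rw [Function.update_of_ne h]
    have hs : (c.extendMiddle l).partSize m = c.partSize m := by simp [h]
    have he : (c.extendMiddle l).emb m = fun j => (c.emb m (Fin.cast hs j)).succ := by
      simp [OrderedFinpartition.extendMiddle, h]
      rfl
    rw [he, key hs fun j => (c.emb m j).succ]
    rfl

theorem apply_extendLeft (X : ∀ n, (Fin n → α) → M) {n : ℕ} (c : OrderedFinpartition n)
    (a : α) (z : Fin n → α) :
    (fun m => X (c.extendLeft.partSize m)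
      (fun j => Fin.cons (α := fun _ => α) a z (c.extendLeft.emb m j))) =
    Fin.cons (α := fun _ => M) (X 1 fun _ => a) fun m => X (c.partSize m) fun j => z (c.emb m j) := by
  funext m
  refine Fin.cases ?_ (fun m => ?_) m <;> rfl

theorem sum_orderedFinpartition_succ {n : ℕ} (f : OrderedFinpartition (n + 1) → N) :
    ∑ c, f c = ∑ c : OrderedFinpartition n, (f c.extendLeft + ∑ l, f (c.extendMiddle l)) := by
  rw [← (OrderedFinpartition.extendEquiv n).sum_comp, Fintype.sum_sigma]
  refine Finset.sum_congr rfl fun c _ => ?_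
  rw [Fintype.sum_option]
  rfl

/-- In a partition of the enlarged label set, the new label is either a block by itself or belongs
to one of the old blocks. This is the chain rule in combinatorial form. -/
theorem consFam_compFam (Φ : ∀ n, (Fin n → M) → N) (X : ∀ n, (Fin n → α) → M) (a : α) :
    consFam a (compFam Φ X) = fun n z => compFam (consFam (X 1 fun _ => a) Φ) X n z +
      ∑ c : OrderedFinpartition n, ∑ l, Φ c.length
        (Function.update (fun m => X (c.partSize m) fun j => z (c.emb m j)) l
          (consFam a X (c.partSize l) fun j => z (c.emb l j))) := by
  funext n z
  rw [consFam, compFam, sum_orderedFinpartition_succ, Finset.sum_add_distrib]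
  refine congrArg₂ (· + ·) (Finset.sum_congr rfl fun c _ => ?_)
    (Finset.sum_congr rfl fun c _ => Finset.sum_congr rfl fun l _ => ?_)
  · exact congrArg (Φ (c.length + 1)) (apply_extendLeft X c a z)
  · exact congrArg (Φ c.length) (funext fun m => apply_extendMiddle X c l a z m)

end Compose

/-! ### Exponential sums and the exponential formula -/

section ExpSum

variable {k α M T : Type*} [Field k] [AddCommGroup M] [Module k M] [AddCommGroup T] [Module k T]

/-- `φ` vanishes if two arguments lie in `Z`. -/
def VanishesOn (Φ : ∀ n, MultilinearMap k (fun _ : Fin n => M) T) (Z : Submodule k M) : Prop :=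
  ∀ n (z : Fin n → M) i j, i ≠ j → z i ∈ Z → z j ∈ Z → Φ n z = 0

/-- An argument in `P` can be moved to the first place if the other arguments lie in `P`. -/
def IsSymmOn (Φ : ∀ n, MultilinearMap k (fun _ : Fin n => M) T) (P : Submodule k M) : Prop :=
  ∀ n (i : Fin (n + 1)) (z : Fin n → M) y, (∀ j, z j ∈ P) → y ∈ P →
    Φ (n + 1) (i.insertNth (α := fun _ => M) y z) = Φ (n + 1) (Fin.cons (α := fun _ => M) y z)

/-- The truncated exponential sum `∑ₙ Φₙ(x, …, x) / n!`, over `n < B`. -/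
def expSum (B : ℕ) (Φ : ∀ n, MultilinearMap k (fun _ : Fin n => M) T) (x : M) : T :=
  ∑ m ∈ range B, (m.factorial : k)⁻¹ • Φ m fun _ => x

/-- Partial evaluation of a family of multilinear maps at the first argument. -/
def curryFam (y : M) (Φ : ∀ n, MultilinearMap k (fun _ : Fin n => M) T) :
    ∀ n, MultilinearMap k (fun _ : Fin n => M) T :=
  fun n => (Φ (n + 1)).curryLeft y

variable {Φ : ∀ n, MultilinearMap k (fun _ : Fin n => M) T} {P Z : Submodule k M}

theorem VanishesOn.curryFam (h : VanishesOn Φ Z) (y : M) : VanishesOn (curryFam y Φ) Z :=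
  fun n z i j hij hi hj => h (n + 1) (Fin.cons (α := fun _ => M) y z) i.succ j.succ
    (fun h => hij (Fin.succ_injective _ h)) hi hj

theorem VanishesOn.curryFam_apply (h : VanishesOn Φ Z) {y : M} (hy : y ∈ Z) (n : ℕ) (z : Fin n → M)
    (i : Fin n) (hi : z i ∈ Z) : _root_.curryFam y Φ n z = 0 :=
  h (n + 1) (Fin.cons (α := fun _ => M) y z) 0 i.succ (Fin.succ_ne_zero i).symm hy hi

theorem IsSymmOn.curryFam (h : IsSymmOn Φ P) {y : M} (hy : y ∈ P) : IsSymmOn (curryFam y Φ) P := by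
  intro n i z x hz hx
  have h1 := h (n + 1) i.succ (Fin.cons (α := fun _ => M) y z) x (Fin.cases hy hz) hx
  have h2 := h (n + 1) (Fin.succ 0) (Fin.cons (α := fun _ => M) y z) x (Fin.cases hy hz) hx
  rw [Fin.insertNth_succ_cons] at h1 h2
  rw [Fin.insertNth_zero'] at h2
  exact h1.trans h2.symm

/-- First-order Taylor expansion in the direction y, exact because two arguments from Z give zero.
One argument is used up by y, so the truncation drops from B + 1 to B. -/
theorem VanishesOn.expSum_add [CharZero k] (hZ : VanishesOn Φ Z) (hP : IsSymmOn Φ P) {x y : M}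
    (hx : x ∈ P) (hy : y ∈ P) (hyZ : y ∈ Z) (B : ℕ) :
    expSum (B + 1) Φ (x + y) = expSum (B + 1) Φ x + expSum B (_root_.curryFam y Φ) x := by
  rw [expSum, expSum, expSum, Finset.sum_range_succ', Finset.sum_range_succ', add_right_comm,
    ← Finset.sum_add_distrib]
  congr 1
  · refine Finset.sum_congr rfl fun m _ => ?_
    have h := (Φ (m + 1)).map_add_univ (fun _ => y) (fun _ => x)
    have h1 : ((fun _ => y) + fun _ => x : Fin (m + 1) → M) = fun _ => x + y := by
      ext; simp [add_comm]
    rw [h1] at h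
    rw [h, Finset.sum_univ_eq_of_card_le_one]
    · have h2 : ∀ i : Fin (m + 1), Φ (m + 1) (({i} : Finset (Fin (m + 1))).piecewise (fun _ => y)
          fun _ => x) = _root_.curryFam y Φ m fun _ => x := by
        intro i
        rw [_root_.curryFam, MultilinearMap.curryLeft_apply, ← hP m i _ y (fun _ => hx) hy]
        congr 1
        ext l
        refine Fin.succAboveCases i ?_ (fun l => ?_) l
        · simp
        · simp [Finset.piecewise]
      simp only [h2, Finset.sum_const, Finset.card_univ, Fintype.card_fin]
      rw [← Nat.cast_smul_eq_nsmul k, smul_add, smul_smul]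
      congr 2
      rw [Nat.factorial_succ, Nat.cast_mul, mul_inv, mul_comm, ← mul_assoc,
        mul_inv_cancel₀ (Nat.cast_ne_zero.2 (Nat.succ_ne_zero m)), one_mul]
    · intro s hs
      obtain ⟨a, ha, b, hb, hab⟩ := Finset.one_lt_card.1 hs
      refine hZ _ _ a b hab ?_ ?_
      · rwa [Finset.piecewise_eq_of_mem _ _ _ ha]
      · rwa [Finset.piecewise_eq_of_mem _ _ _ hb]
  · congr 2
    exact Subsingleton.elim _ _

/-- One slot is already occupied by an element of Z, so any further argument from Z gives zero. -/
theorem VanishesOn.expSum_curryFam_add (hZ : VanishesOn Φ Z) {x y z : M} (hy : y ∈ Z) (hz : z ∈ Z)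
    (B : ℕ) : expSum B (_root_.curryFam y Φ) (x + z) = expSum B (_root_.curryFam y Φ) x := by
  rw [expSum, expSum]
  refine Finset.sum_congr rfl fun m _ => ?_
  congr 1
  have h := (_root_.curryFam y Φ m).map_add_univ (fun _ => z) (fun _ => x)
  have h1 : ((fun _ => z) + fun _ => x : Fin m → M) = fun _ => x + z := by
    ext; simp [add_comm]
  rw [h1] at h
  rw [h, Fintype.sum_eq_single ∅, Finset.piecewise_empty]
  intro s hs
  obtain ⟨i, hi⟩ := Finset.nonempty_iff_ne_empty.2 hs
  refine hZ.curryFam_apply hy m _ i ?_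
  rwa [Finset.piecewise_eq_of_mem _ _ _ hi]

/-- The part of a family in positive arities. -/
def posFam {N : Type*} [AddCommGroup N] (X : ∀ n, (Fin n → α) → N) : ∀ n, (Fin n → α) → N
  | 0, _ => 0
  | n + 1, z => X (n + 1) z

theorem consFam_posFam {N : Type*} [AddCommGroup N] (X : ∀ n, (Fin n → α) → N) (a : α) :
    consFam a (posFam X) = consFam a X := rfl

theorem subsum_eq_add_posFam {N : Type*} [AddCommGroup N] (X : ∀ n, (Fin n → α) → N) {n : ℕ}
    (u : Fin n → α) : subsum X u = X 0 Fin.elim0 + subsum (posFam X) u := by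
  induction n with
  | zero =>
    rw [subsum_zero, subsum_zero, posFam, add_zero]
    congr 1
    exact Subsingleton.elim _ _
  | succ n ih => rw [subsum, subsum, ih, consFam_posFam, add_assoc]

/-- The exponential formula: summing over subfamilies and partitions amounts to applying the
exponential sum of Φ to the sum of X over nonempty subfamilies. In the induction a point a is
adjoined. Partitions having {a} as a block give the derivative of Φ along X 1 a; those where a joins
a block give the first-order effect of replacing X by X + `consFam a X`. No symmetry of X is needed.
-/
theorem subsum_compFam [CharZero k] {D : Set α} {ζ : α → Submodule k M}
    {X : ∀ n, (Fin n → α) → M} (hΦP : IsSymmOn Φ P) (hΦZ : ∀ a ∈ D, VanishesOn Φ (ζ a))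
    (hXP : ∀ n z, (∀ i, z i ∈ D) → X (n + 1) z ∈ P)
    (hXζ : ∀ n z, (∀ i, z i ∈ D) → ∀ i, X n z ∈ ζ (z i)) {n : ℕ} {u : Fin n → α}
    (hu : ∀ i, u i ∈ D) (B : ℕ) (hB : n < B) :
    subsum (compFam (fun n => Φ n) X) u = expSum B Φ (subsum (posFam X) u) := by
  induction n generalizing Φ X B with
  | zero =>
    obtain ⟨B, rfl⟩ : ∃ b, B = b + 1 := ⟨B - 1, by omega⟩
    rw [subsum_zero, subsum_zero, posFam, expSum, Finset.sum_range_succ', Finset.sum_eq_zero, zero_add]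
    · rw [compFam, Fintype.sum_unique]
      simp only [Nat.factorial_zero, Nat.cast_one, inv_one, one_smul]
      refine congrArg (Φ 0) (Subsingleton.elim _ _)
    · intro m _
      rw [(Φ (m + 1)).map_coord_zero 0 rfl, smul_zero]
  | succ n ih =>
    obtain ⟨B, rfl⟩ : ∃ b, B = b + 1 := ⟨B - 1, by omega⟩
    obtain ⟨a, u, rfl⟩ : ∃ b u', u = Fin.cons (α := fun _ => α) b u' :=
      ⟨u 0, Fin.tail u, (Fin.cons_self_tail u).symm⟩
    have ha : a ∈ D := hu 0
    have hu' : ∀ i, u i ∈ D := fun i => hu i.succ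
    have hyP : X 1 (fun _ => a) ∈ P := hXP 0 _ fun _ => ha
    have hyζ : X 1 (fun _ => a) ∈ ζ a := hXζ 1 _ (fun _ => ha) 0
    -- All values of `consFam a X` lie in ζ a, on which Φ vanishes to second order. So the Leibniz
    -- sum over one modified block is exactly the difference between the compositions with X +
    -- `consFam a X` and with X.
    have h1 : ∀ m z, (∀ i, z i ∈ D) → (∑ c : OrderedFinpartition m, ∑ l, Φ c.length
        (Function.update (fun m => X (c.partSize m) fun j => z (c.emb m j)) l
          (consFam a X (c.partSize l) fun j => z (c.emb l j)))) =
        compFam (fun n => Φ n) (fun n z => X n z + consFam a X n z) m z -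
          compFam (fun n => Φ n) X m z := by
      intro m z hz
      rw [compFam, compFam, ← Finset.sum_sub_distrib]
      refine Finset.sum_congr rfl fun c _ => ?_
      have h := (Φ c.length).map_add_univ
        (fun m => consFam a X (c.partSize m) fun j => z (c.emb m j))
        (fun m => X (c.partSize m) fun j => z (c.emb m j))
      have h1 : ∀ l, consFam a X (c.partSize l) (fun j => z (c.emb l j)) ∈ ζ a := fun l =>
        hXζ (c.partSize l + 1) (Fin.cons (α := fun _ => α) a fun j => z (c.emb l j))
          (Fin.cases ha fun j => hz _) 0
      rw [Finset.sum_univ_eq_of_card_le_one] at h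
      · rw [eq_sub_iff_add_eq, add_comm]
        refine Eq.trans ?_ (h.symm.trans (congrArg (Φ c.length) (funext fun i => add_comm _ _)))
        rw [Finset.piecewise_empty]
        congr 1
        refine Finset.sum_congr rfl fun l _ => congrArg (Φ c.length) (funext fun i => ?_)
        by_cases hi : i = l
        · subst hi; simp
        · simp [hi]
      · intro s hs
        obtain ⟨i, hi, j, hj, hij⟩ := Finset.one_lt_card.1 hs
        refine hΦZ a ha _ _ i j hij ?_ ?_
        · rw [Finset.piecewise_eq_of_mem _ _ _ hi]; exact h1 i
        · rw [Finset.piecewise_eq_of_mem _ _ _ hj]; exact h1 j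
    have hcons : ∀ n z, (∀ i, z i ∈ D) → consFam a X n z ∈ P := fun n z hz =>
      hXP n _ (Fin.cases ha hz)
    have hx : subsum (posFam X) u ∈ P :=
      subsum_mem P (fun m z hz => by
        cases m with
        | zero => exact zero_mem P
        | succ m => exact hXP m z hz) hu'
    have hxa : subsum (posFam (consFam a X)) u ∈ P :=
      subsum_mem P (fun m z hz => by
        cases m with
        | zero => exact zero_mem P
        | succ m => exact hcons _ z hz) hu'
    have hxζ : subsum (posFam (consFam a X)) u ∈ ζ a :=
      subsum_mem (ζ a) (fun m z hz => by
        cases m with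
        | zero => exact zero_mem _
        | succ m => exact hXζ _ (Fin.cons (α := fun _ => α) a z) (Fin.cases ha hz) 0) hu'
    have h2 : subsum (posFam fun n z => X n z + consFam a X n z) u =
        subsum (posFam X) u + subsum (posFam (consFam a X)) u := by
      rw [← subsum_add]
      congr 1
      funext n z
      cases n with
      | zero => exact (add_zero (0 : M)).symm
      | succ n => rfl
    have h3 : consFam a X 0 Fin.elim0 = X 1 fun _ => a := by
      rw [consFam]
      congr 1
      funext i
      obtain rfl : i = 0 := Fin.eq_zero i
      rfl
    -- The argument splits as S(X) + S(consFam a X) + X 1 a, where S sums over nonempty subfamilies.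
    -- The Taylor formula removes X 1 a, and in the resulting derivative term S(consFam a X) can be
    -- dropped since it too lies in ζ a.
    rw [subsum_cons, subsum_cons, consFam_posFam, subsum_eq_add_posFam (consFam a X), h3,
      add_left_comm, add_comm (X 1 _), (hΦZ a ha).expSum_add hΦP (add_mem hx hxa) hyP hyζ,
      (hΦZ a ha).expSum_curryFam_add hyζ hxζ, ← h2,
      ← ih (Φ := Φ) (X := fun n z => X n z + consFam a X n z) hΦP hΦZ
        (fun n z hz => add_mem (hXP n z hz) (hcons _ z hz))
        (fun n z hz i => add_mem (hXζ n z hz i) (hXζ _ (Fin.cons (α := fun _ => α) a z)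
          (Fin.cases ha hz) i.succ)) hu'
        (B + 1) (by omega),
      ← ih (hΦP.curryFam hyP) (fun b hb => (hΦZ b hb).curryFam _) hXP hXζ hu' B (by omega),
      consFam_compFam, subsum_add, subsum_congr h1 hu', subsum_sub, add_left_comm,
      ← add_sub_assoc, add_sub_cancel_left, add_comm]
    rfl

end ExpSum

/-! ### Null points, and symmetry of families of operators -/

namespace DGSpace

variable {k : Type u} [Field k] {V : DGSpace.{u, v} k} {U : DGSpace.{u, w} k}
  {T : Type*} [AddCommGroup T] [Module k T]
  {A : Type*} [Ring A] [Algebra k A] [Grassmann k A]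

variable (V A) in
/-- The even square-zero points. -/
def nullPoints : Set (V ⊗[k] A) :=
  {x | x ∈ points V A ∧ ∃ e : A, IsNull k e ∧ x ∈ divBy (k := k) V e}

/-- The subspace of points divisible by a null element chosen for `x`. -/
def multiples (x : V ⊗[k] A) : Submodule k (V ⊗[k] A) :=
  divBy V (Classical.epsilon fun e : A => IsNull k e ∧ x ∈ divBy (k := k) V e)

theorem exists_multiples_eq {x : V ⊗[k] A} (hx : x ∈ nullPoints V A) :
    ∃ e : A, IsNull k e ∧ x ∈ divBy (k := k) V e ∧ multiples x = divBy V e :=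
  ⟨_, (Classical.epsilon_spec hx.2).1, (Classical.epsilon_spec hx.2).2, rfl⟩

/-- The extension of scalars of a family of multilinear maps. -/
abbrev gextFam (A : Type*) [Ring A] [Algebra k A] (F : ∀ n, Multi V T n) (n : ℕ) :
    MultilinearMap k (fun _ : Fin n => V ⊗[k] A) (T ⊗[k] A) := gext A (F n)

/-- The family of operators obtained by leaving the last argument free. -/
abbrev opFam (F : ∀ n, Multi V T n) (n : ℕ) : Multi V (V →ₗ[k] T) n := (F (n + 1)).curryRight

theorem vanishesOn_gextFam {e : A} (he : IsNull k e) (F : ∀ n, Multi V T n) :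
    VanishesOn (gextFam A F) (divBy V e) :=
  fun n z _ _ hij hi hj => gext_eq_zero_of_divBy he (F n) z hij hi hj

theorem vanishesOn_multiples {x : V ⊗[k] A} (hx : x ∈ nullPoints V A) (F : ∀ n, Multi V T n) :
    VanishesOn (gextFam A F) (multiples x) := by
  obtain ⟨e, he, -, h⟩ := exists_multiples_eq hx
  rw [h]
  exact vanishesOn_gextFam he F

theorem IsSymm.gext_insertNth {n : ℕ} {F : Multi V T (n + 1)} (hF : IsSymm F) (i : Fin (n + 1))
    {z : Fin n → V ⊗[k] A} {y : V ⊗[k] A} (hz : ∀ j, z j ∈ points V A) (hy : y ∈ points V A) :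
    gext A F (i.insertNth (α := fun _ => V ⊗[k] A) y z) =
        gext A F (Fin.snoc (α := fun _ => V ⊗[k] A) z y) := by
  rw [← hF.gext_removeNth (z := i.insertNth (α := fun _ => V ⊗[k] A) y z) (i := i)]
  · simp
  · intro l
    refine Fin.succAboveCases i ?_ (fun l => ?_) l
    · simpa using hy
    · simpa using hz l

theorem isSymmOn_gextFam {F : ∀ n, Multi V T n} (hF : ∀ n, IsSymm (F n)) :
    IsSymmOn (gextFam A F) (points V A) := by
  intro n i z y hz hy
  rw [gextFam, (hF (n + 1)).gext_insertNth i hz hy, ← Fin.insertNth_zero',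
    (hF (n + 1)).gext_insertNth 0 hz hy]

/-- Operators are compared on a pure point w in the free slot. There, inserting y anywhere before w
is an instance of the symmetry of F in all its arguments. -/
theorem isSymmOn_opFam {F : ∀ n, Multi V T n} (hF : ∀ n, IsSymm (F n)) :
    IsSymmOn (gextFam A (opFam F)) (points V A) := by
  intro n i z y hz hy
  refine op_ext fun w hw => ?_
  have h : ∀ i : Fin (n + 1),
      act (gextFam A (opFam F) (n + 1) (i.insertNth (α := fun _ => V ⊗[k] A) y z)) w =
      gext A (F (n + 2)) (Fin.snoc (α := fun _ => V ⊗[k] A)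
        (Fin.snoc (α := fun _ => V ⊗[k] A) z w) y) := by
    intro i
    rw [gextFam, ← gext_snoc]
    refine Eq.trans ?_ ((hF (n + 2)).gext_insertNth i.castSucc
      (z := Fin.snoc (α := fun _ => V ⊗[k] A) z w) (y := y) (fun j => ?_) hy)
    · congr 1
      ext l
      refine Fin.lastCases ?_ (fun l => ?_) l
      · have : Fin.last (n + 1) = i.castSucc.succAbove (Fin.last n) := by
          rw [Fin.succAbove_of_le_castSucc _ _ (by simpa using Fin.le_last i), Fin.succ_last]
        rw [Fin.snoc_last, this, Fin.insertNth_apply_succAbove, Fin.snoc_last]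
      · rw [Fin.snoc_castSucc]
        refine Fin.succAboveCases i ?_ (fun l => ?_) l
        · simp
        · rw [Fin.insertNth_apply_succAbove, ← Fin.castSucc_succAbove_castSucc,
            Fin.insertNth_apply_succAbove, Fin.snoc_castSucc]
    · refine Fin.lastCases ?_ (fun l => ?_) j
      · rw [Fin.snoc_last]; exact Submodule.subset_span hw
      · simpa using hz l
  rw [h, ← Fin.insertNth_zero', h]

/-! ## Sums over subfamilies and point functions -/

/-- In the expansion of Φ at the m-th power of ∑ u_i, terms with a repeated member vanish, and each
set of m distinct members occurs m! times, which the factorial removes. -/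
theorem subsum_eq_expSum {M : Type*} [AddCommGroup M] [Module k M] [CharZero k]
    {Φ : ∀ n, MultilinearMap k (fun _ : Fin n => M) T} {P : Submodule k M} {D : Set M}
    (hP : IsSymmOn Φ P) (hD : ∀ a ∈ D, a ∈ P ∧ ∃ Z : Submodule k M, a ∈ Z ∧ VanishesOn Φ Z)
    {n : ℕ} {u : Fin n → M} (hu : ∀ i, u i ∈ D) {B : ℕ} (hB : n < B) :
    subsum (fun n => Φ n) u = expSum B Φ (∑ i, u i) := by
  induction n generalizing Φ B with
  | zero =>
    obtain ⟨B, rfl⟩ : ∃ b, B = b + 1 := ⟨B - 1, by omega⟩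
    rw [subsum_zero, expSum, Finset.sum_range_succ', Finset.sum_eq_zero, zero_add]
    · simp only [Nat.factorial_zero, Nat.cast_one, inv_one, one_smul]
      exact congrArg (Φ 0) (Subsingleton.elim _ _)
    · intro m _
      rw [(Φ (m + 1)).map_coord_zero 0 (by simp), smul_zero]
  | succ n ih =>
    obtain ⟨B, rfl⟩ : ∃ b, B = b + 1 := ⟨B - 1, by omega⟩
    obtain ⟨a, u, rfl⟩ : ∃ b u', u = Fin.cons (α := fun _ => M) b u' :=
      ⟨u 0, Fin.tail u, (Fin.cons_self_tail u).symm⟩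
    have ha : a ∈ D := hu 0
    have hu' : ∀ i, u i ∈ D := fun i => hu i.succ
    obtain ⟨haP, Z, haZ, hZ⟩ := hD a ha
    have hx : ∑ i, u i ∈ P := sum_mem fun i _ => (hD _ (hu' i)).1
    rw [subsum_cons, Fin.sum_cons, add_comm a, hZ.expSum_add hP hx haP haZ,
      ih hP hD hu' (by omega : n < B + 1)]
    congr 1
    refine ih (hP.curryFam haP) (fun b hb => ?_) hu' (by omega)
    obtain ⟨hbP, Z, hbZ, hZ⟩ := hD b hb
    exact ⟨hbP, Z, hbZ, hZ.curryFam a⟩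

theorem ptOp_eq_expSum (B : ℕ) (F : ∀ n, Multi V T n) (x : V ⊗[k] A) :
    ptOp B F x = expSum B (gextFam A (opFam F)) x := rfl

theorem expSum_succ_eq_ptEval (B : ℕ) {F : ∀ n, Multi V T n} (hF : F 0 = 0) (x : V ⊗[k] A) :
    expSum (B + 1) (gextFam A F) x = ptEval B F x := by
  rw [expSum, Finset.sum_range_succ', ptEval]
  have : gext A (F 0) (fun _ => x) = 0 := by
    rw [hF, gext_zero]; rfl
  rw [this, smul_zero, add_zero]

theorem subsum_gextFam [CharZero k] {F : ∀ n, Multi V T n} (hF : ∀ n, IsSymm (F n)) (hF0 : F 0 = 0)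
    {n : ℕ} {u : Fin n → V ⊗[k] A} (hu : ∀ i, u i ∈ nullPoints V A) {B : ℕ} (hB : n ≤ B) :
    subsum (fun n z => gext A (F n) z) u = ptEval B F (∑ i, u i) := by
  rw [← expSum_succ_eq_ptEval B hF0]
  refine subsum_eq_expSum (D := nullPoints V A) (isSymmOn_gextFam hF) (fun a ha => ⟨ha.1, ?_⟩) hu
    (Nat.lt_succ_of_le hB)
  obtain ⟨e, he, hae⟩ := ha.2
  exact ⟨_, hae, vanishesOn_gextFam he F⟩

theorem subsum_opFam [CharZero k] {F : ∀ n, Multi V T n} (hF : ∀ n, IsSymm (F n))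
    {n : ℕ} {u : Fin n → V ⊗[k] A} (hu : ∀ i, u i ∈ nullPoints V A) {B : ℕ} (hB : n < B) :
    subsum (fun n z => gext A (opFam F n) z) u = ptOp B F (∑ i, u i) := by
  rw [ptOp_eq_expSum]
  refine subsum_eq_expSum (D := nullPoints V A) (isSymmOn_opFam hF) (fun a ha => ⟨ha.1, ?_⟩) hu hB
  obtain ⟨e, he, hae⟩ := ha.2
  exact ⟨_, hae, vanishesOn_gextFam he _⟩

theorem subsum_snocFam {F : ∀ n, Multi V T n} {n : ℕ} (u : Fin n → V ⊗[k] A) (y : V ⊗[k] A) :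
    subsum (snocFam y fun n z => gext A (F n) z) u =
      act (subsum (fun n z => gext A (opFam F n) z) u) y := by
  have := subsum_map ((act (k := k) (A := A) (M := V) (T := T)).flip y).toAddMonoidHom
    (fun n z => gext A (opFam F n) z) u
  refine Eq.trans ?_ this
  congr 1
  funext m z
  exact gext_snoc _ _ _

theorem lact_d_mem {η : A} (hη : η ∈ Grassmann.par k (1 : ZMod 2)) {x : V ⊗[k] A}
    (hx : x ∈ points V A) : lact V η (V.d.rTensor A x) ∈ points V A :=
  lact_rTensor_mem_points (V.isHomogeneous_d) (by simpa using hη) hx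

/-- Precomposition with the tensor differential becomes the derivative in the direction ηdx. A term
containing both u_i and ηd u_i vanishes, as both are divisible by the same null element. -/
theorem subsum_compTensorD {F : ∀ n, Multi V T n} (hF : ∀ n, IsSymm (F n)) {η : A}
    (hη : η ∈ Grassmann.par k (1 : ZMod 2)) {n : ℕ} {u : Fin n → V ⊗[k] A}
    (hu : ∀ i, u i ∈ nullPoints V A) :
    subsum (fun n z => lact T η (gext A (compTensorD (F n)) z)) u =
      act (subsum (fun n z => gext A (opFam F n) z) u) (lact V η (V.d.rTensor A (∑ i, u i))) := by
  rw [subsum_congr (fun m z hz => gext_compTensorD hη (F m) z fun i => (hz i).1) hu,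
    subsum_update (D := nullPoints V A) (fun x => lact V η (V.d.rTensor A x))
      (fun n z => gext A (F n) z) _ _ hu]
  · simp only [subsum_snocFam, map_sum]
  · intro m i z hz a ha
    exact (hF (m + 1)).gext_insertNth i (fun j => (hz j).1) (lact_d_mem hη ha.1)
  · intro m z hz i
    obtain ⟨e, he, hie⟩ := (hz i).2
    refine gext_eq_zero_of_divBy he _ _ (Fin.castSucc_lt_last i).ne ?_ ?_
    · simpa using hie
    · simpa using lact_mem_divBy he.1 _ (rTensor_mem_divBy _ hie)

theorem shuffle_symm_castAdd {n : ℕ} (I : Finset (Fin n)) (i : Fin #I) :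
    (shuffle I).symm (Fin.castAdd _ i) = I.orderEmbOfFin rfl i := by
  simp [shuffle]

theorem shuffle_symm_natAdd {n : ℕ} (I : Finset (Fin n)) (i : Fin #Iᶜ) :
    (shuffle I).symm (Fin.natAdd _ i) = Iᶜ.orderEmbOfFin rfl i := by
  simp [shuffle]

/-- The sum of all graftings of the members of `L` into those of `F`. -/
def composeAll (F : ∀ n, Multi V T n) (L : ∀ n, Multi V V n) (n : ℕ) : Multi V T n :=
  ∑ I : Finset (Fin n), relabel (shuffle I) (compLast 1 (F (#I + 1)) (L #Iᶜ))

/-- Overlapping subfamilies contribute zero, so the complementary index sets I and Iᶜ may be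
replaced by two independent subfamilies, and the sum factors as a derivative of F applied to η times
the value of L. -/
theorem subsum_composeAll (F : ∀ n, Multi V T n) (L : ∀ n, Multi V V n) {η : A}
    (hη : η ∈ Grassmann.par k (1 : ZMod 2)) {n : ℕ} {u : Fin n → V ⊗[k] A}
    (hu : ∀ i, u i ∈ nullPoints V A) :
    subsum (fun n z => lact T η (gext A (composeAll F L n) z)) u =
      act (subsum (fun n z => gext A (opFam F n) z) u)
        (lact V η (subsum (fun n z => gext A (L n) z) u)) := by
  have h1 : ∀ m (z : Fin m → V ⊗[k] A), (∀ i, z i ∈ nullPoints V A) →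
      lact T η (gext A (composeAll F L m) z) = ∑ I : Finset (Fin m),
        (fun a (z : Fin a → V ⊗[k] A) b z' => gext A (F (a + 1)) (Fin.snoc (α := fun _ => V ⊗[k] A) z
          (lact V η (gext A (L b) z')))) _ (restrict z I) _ (restrict z Iᶜ) := by
    intro m z hz
    have hz' : ∀ i, z i ∈ points V A := fun i => (hz i).1
    rw [composeAll, gext_sum, _root_.sum_apply, map_sum]
    refine Finset.sum_congr rfl fun I _ => ?_
    rw [gext_relabel _ _ _ hz', gext_compLast 1 (by simpa using hη) _ _ _ fun _ => hz' _]
    simp only [shuffle_symm_castAdd, shuffle_symm_natAdd]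
    rfl
  rw [subsum_congr h1 hu, subsum_split (D := nullPoints V A)
    (fun a (z : Fin a → V ⊗[k] A) b z' => gext A (F (a + 1)) (Fin.snoc (α := fun _ => V ⊗[k] A) z
          (lact V η (gext A (L b) z')))) _ hu]
  · simp only [gext_snoc]
    have h2 : ∀ a (z : Fin a → V ⊗[k] A), subsum (fun b z' => act (gext A (opFam F a) z)
        (lact V η (gext A (L b) z'))) u = act (gext A (opFam F a) z)
        (lact V η (subsum (fun n z => gext A (L n) z) u)) := fun a z =>
      subsum_map ((act (gext A (opFam F a) z)) ∘ₗ lact V η).toAddMonoidHom _ u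
    simp only [h2]
    exact subsum_map ((act (k := k) (A := A) (M := V) (T := T)).flip _).toAddMonoidHom
      (fun n z => gext A (opFam F n) z) u
  · intro a z b z' hz hz' i j hij
    obtain ⟨e, he, hie⟩ := (hz i).2
    refine gext_eq_zero_of_divBy he _ _ (Fin.castSucc_lt_last i).ne ?_ ?_
    · simpa using hie
    · rw [hij] at hie
      simpa using lact_mem_divBy he.1 _ (gext_mem_divBy he.1 (L b) z' j hie)

end DGSpace

theorem subsum_eq_sum {α N : Type*} [AddCommGroup N] {D : Set α} {F : ∀ m, (Fin m → α) → N}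
    (h0 : ∀ z, F 0 z = 0) (h : ∀ m z, (∀ i, z i ∈ D) → F (m + 2) z = 0) {n : ℕ} {u : Fin n → α}
    (hu : ∀ i, u i ∈ D) : subsum F u = ∑ i, F 1 fun _ => u i := by
  induction n with
  | zero => simp [subsum, h0]
  | succ n ih =>
    have h1 : F 1 (Fin.cons (α := fun _ => α) (u 0) Fin.elim0) = F 1 fun _ => u 0 := by
      congr 1
      funext i
      obtain rfl : i = 0 := Fin.eq_zero i
      rfl
    have h2 : subsum (posFam (consFam (u 0) F)) (Fin.tail u) = 0 := by
      refine subsum_eq_zero (D := D) (fun m z hz => ?_) fun i => hu i.succ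
      cases m with
      | zero => rfl
      | succ m => exact h _ (Fin.cons (α := fun _ => α) (u 0) z) (Fin.cases (hu 0) hz)
    rw [subsum, ih (u := Fin.tail u) fun i => hu i.succ, subsum_eq_add_posFam (consFam (u 0) F), h2, add_zero, consFam,
      Fin.sum_univ_succ, add_comm, h1]
    rfl

/-! ### The structure equations as equations between point functions -/

namespace DGSpace

variable {k : Type u} [Field k] {V : DGSpace.{u, v} k} {U : DGSpace.{u, w} k}
  {T : Type*} [AddCommGroup T] [Module k T]
  {A : Type*} [Ring A] [Algebra k A] [Grassmann k A]

/-- The structure of a unimodular L∞-algebra in terms of symmetric maps of degrees `1` and `0`. -/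
structure IsSymmetricULInfty (V : DGSpace.{u, v} k) (L : ∀ n, Multi V V n)
    (Q : ∀ n, Multi V k n) : Prop where
  ell_zero : L 0 = 0
  ell_one : L 1 = 0
  q_zero : Q 0 = 0
  ell_degree : ∀ n, HasDegree 1 (L n)
  q_degree : ∀ n, HasScalarDegree 0 (Q n)
  ell_symm : ∀ n, IsSymm (L n)
  q_symm : ∀ n, IsSymm (Q n)
  ell_eq : ∀ n, V.d.compMultilinearMap (L n) + compTensorD (L n) + composeAll L L n = 0
  q_eq : ∀ n, compTensorD (Q n) + composeAll Q L n + traceLast (L (n + 1)) = 0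

/-- At x = ∑ u_i the right side reads η dE(x) + E'(x)(ηD(x)) with D(x) = dx + E(x): the terms with
`compTensorD` and `composeAll` are the two parts of the derivative of E along ηD. -/
theorem subsum_ell_eq {L : ∀ n, Multi V V n} (hL : ∀ n, IsSymm (L n)) {η : A}
    (hη : η ∈ Grassmann.par k (1 : ZMod 2)) {n : ℕ} {u : Fin n → V ⊗[k] A}
    (hu : ∀ i, u i ∈ nullPoints V A) :
    subsum (fun n z => lact V η (gext A (V.d.compMultilinearMap (L n) + compTensorD (L n) +
      composeAll L L n) z)) u = lact V η (V.d.rTensor A (subsum (fun n z => gext A (L n) z) u)) +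
      act (subsum (fun n z => gext A (opFam L n) z) u) (lact V η (V.d.rTensor A (∑ i, u i) +
        subsum (fun n z => gext A (L n) z) u)) := by
  have h : subsum (fun n z => lact V η (V.d.rTensor A (gext A (L n) z))) u =
      lact V η (V.d.rTensor A (subsum (fun n z => gext A (L n) z) u)) :=
    subsum_map ((lact V η) ∘ₗ V.d.rTensor A).toAddMonoidHom _ u
  simp only [gext_add, add_apply, map_add, subsum_add, subsum_compTensorD hL hη hu,
    subsum_composeAll L L hη hu, ← h, gext_postcomp]
  rw [add_assoc]

/-- The derivative of q along ηD plus η times the divergence str E'(x). -/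
theorem subsum_q_eq {L : ∀ n, Multi V V n} {Q : ∀ n, Multi V k n} (hQ : ∀ n, IsSymm (Q n)) {η : A}
    (hη : η ∈ Grassmann.par k (1 : ZMod 2)) {n : ℕ} {u : Fin n → V ⊗[k] A}
    (hu : ∀ i, u i ∈ nullPoints V A) :
    subsum (fun n z => lact k η (gext A (compTensorD (Q n) + composeAll Q L n +
      traceLast (L (n + 1))) z)) u =
      act (subsum (fun n z => gext A (opFam Q n) z) u) (lact V η (V.d.rTensor A (∑ i, u i) +
        subsum (fun n z => gext A (L n) z) u)) +
      lact k η (straceA V A (subsum (fun n z => gext A (opFam L n) z) u)) := by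
  have h : subsum (fun n z => lact k η (straceA V A (gext A (opFam L n) z))) u =
      lact k η (straceA V A (subsum (fun n z => gext A (opFam L n) z) u)) :=
    subsum_map ((lact k η) ∘ₗ straceA V A).toAddMonoidHom _ u
  simp only [gext_add, add_apply, map_add, subsum_add, subsum_compTensorD hQ hη hu,
    subsum_composeAll Q L hη hu, ← h, traceLast, gext_postcomp]
  rfl

theorem exists_sum_of_mem_points {x : V ⊗[k] A} (hx : x ∈ points V A) :
    ∃ (n : ℕ) (u : Fin n → V ⊗[k] A), (∀ i, u i ∈ nullPoints V A) ∧ ∑ i, u i = x := by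
  induction hx using Submodule.span_induction with
  | mem x hx => exact ⟨1, fun _ => x, fun _ => ⟨Submodule.subset_span hx, purePoints_divBy hx⟩,
      by simp⟩
  | zero => exact ⟨0, Fin.elim0, fun i => i.elim0, by simp⟩
  | add x y _ _ hx hy =>
    obtain ⟨n, u, hu, rfl⟩ := hx
    obtain ⟨m, v, hv, rfl⟩ := hy
    refine ⟨n + m, Fin.append u v, fun i => ?_, by simp [Fin.sum_univ_add]⟩
    refine Fin.addCases (fun i => ?_) (fun i => ?_) i
    · simpa using hu i
    · simpa using hv i
  | smul c x _ hx =>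
    obtain ⟨n, u, hu, rfl⟩ := hx
    exact ⟨n, fun i => c • u i, fun i => ⟨Submodule.smul_mem _ _ (hu i).1, (hu i).2.imp
      fun e he => ⟨he.1, Submodule.smul_mem _ _ he.2⟩⟩, by rw [Finset.smul_sum]⟩

theorem nullPoints_of_mem_purePoints {x : V ⊗[k] A} (hx : x ∈ purePoints V A) :
    x ∈ nullPoints V A :=
  ⟨Submodule.subset_span hx, purePoints_divBy hx⟩

section

variable [CharZero k] {L : ∀ n, Multi V V n} {Q : ∀ n, Multi V k n}

/-- A point is a sum of finitely many null points, and the exponential sums are independent of the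
truncation B once B exceeds their number; hence the formulation for all large B. -/
theorem IsSymmetricULInfty.ell_point (H : IsSymmetricULInfty V L Q) {η : A}
    (hη : η ∈ Grassmann.par k (1 : ZMod 2)) {x : V ⊗[k] A} (hx : x ∈ points V A) :
    ∀ᶠ B in Filter.atTop, lact V η (V.d.rTensor A (ptEval B L x)) +
      act (ptOp B L x) (lact V η (V.d.rTensor A x + ptEval B L x)) = 0 := by
  obtain ⟨n, u, hu, rfl⟩ := exists_sum_of_mem_points hx
  refine Filter.eventually_atTop.2 ⟨n + 1, fun B hB => ?_⟩
  have h := subsum_ell_eq H.ell_symm hη hu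
  rw [subsum_gextFam H.ell_symm H.ell_zero hu (by omega : n ≤ B), subsum_opFam H.ell_symm hu
    (by omega : n < B)] at h
  rw [← h]
  refine subsum_eq_zero (D := nullPoints V A) (fun m z _ => ?_) hu
  rw [H.ell_eq, gext_zero]
  exact map_zero _

theorem IsSymmetricULInfty.q_point (H : IsSymmetricULInfty V L Q) {η : A}
    (hη : η ∈ Grassmann.par k (1 : ZMod 2)) {x : V ⊗[k] A} (hx : x ∈ points V A) :
    ∀ᶠ B in Filter.atTop, act (ptOp B Q x) (lact V η (V.d.rTensor A x + ptEval B L x)) +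
      lact k η (straceA V A (ptOp B L x)) = 0 := by
  obtain ⟨n, u, hu, rfl⟩ := exists_sum_of_mem_points hx
  refine Filter.eventually_atTop.2 ⟨n + 1, fun B hB => ?_⟩
  have h := subsum_q_eq (L := L) H.q_symm hη hu
  rw [subsum_gextFam H.ell_symm H.ell_zero hu (by omega : n ≤ B), subsum_opFam H.ell_symm hu
    (by omega : n < B), subsum_opFam H.q_symm hu (by omega : n < B)] at h
  rw [← h]
  refine subsum_eq_zero (D := nullPoints V A) (fun m z _ => ?_) hu
  rw [H.q_eq, gext_zero]
  exact map_zero _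

end

/-! ## Sums over trees -/

theorem HasDegree.sum {ι : Type*} {s : Finset ι} {n : ℕ} {p : ℤ} {F : ι → Multi V V n}
    (h : ∀ i ∈ s, HasDegree p (F i)) : HasDegree p (∑ i ∈ s, F i) := fun i x hx => by
  rw [_root_.sum_apply]
  exact Submodule.sum_mem _ fun j hj => h j hj i x hx

theorem HasScalarDegree.sum {ι : Type*} {s : Finset ι} {n : ℕ} {p : ℤ} {F : ι → Multi V k n}
    (h : ∀ i ∈ s, HasScalarDegree p (F i)) : HasScalarDegree p (∑ i ∈ s, F i) :=
  fun i x hx hp => by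
    rw [_root_.sum_apply]
    exact Finset.sum_eq_zero fun j hj => h j hj i x hx hp

theorem parityProj_mem_gr {i : ℤ} {x : V} (hx : x ∈ V.gr i) (p : ZMod 2) :
    V.parityProj p x ∈ V.gr i := by
  rw [parityProj, weight_apply_of_mem V _ hx]
  exact Submodule.smul_mem _ _ hx

theorem hasDegree_graft {n : ℕ} (c : OrderedFinpartition n) {p : ℤ} {F : Multi V V c.length}
    (hF : HasDegree p F) {G : ∀ m, Multi V V (c.partSize m)} (hG : ∀ m, HasDegree 0 (G m)) :
    HasDegree p (graft c F G) := fun i x hx => by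
  rw [graft_apply]
  refine Submodule.sum_mem _ fun q _ => zsmul_mem ?_ _
  rw [← c.sum_sigma_eq_sum]
  refine hF _ _ fun m => ?_
  simpa using hG m _ _ fun j => parityProj_mem_gr (hx (c.emb m j)) _

theorem hasScalarDegree_graft {n : ℕ} (c : OrderedFinpartition n) {p : ℤ} {F : Multi V k c.length}
    (hF : HasScalarDegree p F) {G : ∀ m, Multi V V (c.partSize m)} (hG : ∀ m, HasDegree 0 (G m)) :
    HasScalarDegree p (graft c F G) := fun i x hx hp => by
  rw [graft_apply]
  refine Finset.sum_eq_zero fun q _ => ?_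
  rw [← c.sum_sigma_eq_sum] at hp
  rw [hF _ _ (fun m => by simpa using hG m _ _ fun j => parityProj_mem_gr (hx (c.emb m j)) _) hp,
    smul_zero]

theorem graft_sum {n : ℕ} (c : OrderedFinpartition n) (F : Multi V T c.length)
    {ι : Fin c.length → Type*} [∀ m, Fintype (ι m)] (G : ∀ m, ι m → Multi V V (c.partSize m)) :
    graft c F (fun m => ∑ t, G m t) = ∑ t : ∀ m, ι m, graft c F fun m => G m (t m) := by
  ext x
  simp only [graft_apply, _root_.sum_apply]
  rw [Finset.sum_comm]
  refine Finset.sum_congr rfl fun p _ => ?_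
  rw [F.map_sum, Finset.smul_sum]

theorem hasDegree_ofSubsingleton :
    HasDegree 0 (MultilinearMap.ofSubsingleton k V V (0 : Fin 1) LinearMap.id) := fun i x hx => by
  simpa using hx 0

theorem hasDegree_thetaInner {L : ∀ n, Multi V V n} (hL : ∀ n, HasDegree 1 (L n)) {h : V →ₗ[k] V}
    (hh : IsHomogeneous V V (-1) h) : ∀ {n : ℕ} (t : LTree n), HasDegree 0 (thetaInner L h t)
  | _, .leaf => hasDegree_ofSubsingleton
  | _, .node c _ b => by
    have := (hasDegree_graft c (hL c.length) fun m => hasDegree_thetaInner hL hh (b m)).comp hh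
    rwa [add_neg_cancel] at this

/-- The sum over all trees, all vertices being decorated by `h L`. -/
def innerTrees (L : ∀ n, Multi V V n) (h : V →ₗ[k] V) (n : ℕ) : Multi V V n :=
  ∑ t : LTree n, thetaInner L h t

/-- The sum of all graftings of sums of trees into the members of `F`. -/
def graftTrees (F : ∀ n, Multi V T n) (L : ∀ n, Multi V V n) (h : V →ₗ[k] V) (n : ℕ) : Multi V T n :=
  ∑ c : OrderedFinpartition n, graft c (F c.length) fun m => innerTrees L h (c.partSize m)

theorem hasDegree_innerTrees {L : ∀ n, Multi V V n} (hL : ∀ n, HasDegree 1 (L n)) {h : V →ₗ[k] V}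
    (hh : IsHomogeneous V V (-1) h) (n : ℕ) : HasDegree 0 (innerTrees L h n) :=
  HasDegree.sum fun t _ => hasDegree_thetaInner hL hh t

theorem graft_zero {n : ℕ} (c : OrderedFinpartition n) (G : ∀ m, Multi V V (c.partSize m)) :
    graft c (0 : Multi V T c.length) G = 0 := by
  ext x
  simp [graft_apply]

/-- Partitions with fewer than two blocks contribute nothing because F vanishes in arities 0 and 1,
so the condition on the number of inputs of the root may be dropped. -/
theorem graftTrees_eq_sum {F : ∀ n, Multi V T n} (hF0 : F 0 = 0) (hF1 : F 1 = 0)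
    (L : ∀ n, Multi V V n) (h : V →ₗ[k] V) (n : ℕ) :
    graftTrees F L h n =
      ∑ t : TreeWithLeg n, graft t.1.1 (F t.1.1.length) fun m => thetaInner L h (t.2 m) := by
  rw [Fintype.sum_sigma, graftTrees]
  simp only [innerTrees, graft_sum]
  have hF : ∀ m, ¬ 2 ≤ m → F m = 0 := fun m hm => by
    interval_cases m
    · exact hF0
    · exact hF1
  rw [← Fintype.sum_subtype_add_sum_subtype fun c : OrderedFinpartition n => 2 ≤ c.length]
  refine (congrArg _ (Finset.sum_eq_zero fun c _ => Finset.sum_eq_zero fun t _ => ?_)).trans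
    (add_zero _)
  rw [hF _ c.2, graft_zero]

theorem graftTrees_eq_sum_treeWithoutLeg (F : ∀ n, Multi V T n)
    (L : ∀ n, Multi V V n) (h : V →ₗ[k] V) (n : ℕ) :
    graftTrees F L h n =
      ∑ t : TreeWithoutLeg n, graft t.1 (F t.1.length) fun m => thetaInner L h (t.2 m) := by
  rw [Fintype.sum_sigma, graftTrees]
  simp only [innerTrees, graft_sum]

/-- The identity, as a family of maps concentrated in arity one. -/
def idFam (V : DGSpace.{u, v} k) : ∀ n, Multi V V n
  | 1 => MultilinearMap.ofSubsingleton k V V 0 LinearMap.id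
  | _ => 0

theorem sum_lTree {N : Type*} [AddCommMonoid N] {n : ℕ} (hn : n ≠ 1) (f : LTree n → N) :
    ∑ t, f t = ∑ t : TreeWithLeg n, f (.node t.1.1 t.1.2 t.2) := by
  symm
  refine Fintype.sum_bijective (fun t : TreeWithLeg n => LTree.node t.1.1 t.1.2 t.2)
    ⟨fun s t hst => ?_, fun t => ?_⟩ _ _ fun t => rfl
  · have := congrArg LTree.unfold hst
    exact Option.some_injective _ this
  · cases t with
    | leaf => exact (hn rfl).elim
    | node c hc b => exact ⟨⟨⟨c, hc⟩, b⟩, rfl⟩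

theorem sum_lTree_one {N : Type*} [AddCommMonoid N] (f : LTree 1 → N) :
    ∑ t, f t = f .leaf := by
  refine Fintype.sum_eq_single _ fun t ht => ?_
  -- The arity is made a variable so that case analysis on the tree is possible; a root vertex would
  -- need at least two blocks.
  have key : ∀ {n : ℕ} (t : LTree n) (hn : n = 1), hn ▸ t = LTree.leaf := by
    intro n t hn
    cases t with
    | leaf => rfl
    | node c hc b =>
      have := c.length_le
      omega
  exact (ht (key t rfl)).elim

/-- A tree is trivial or consists of a root vertex with trees grafted on it. This recursion is the
source of the fixed point equation. -/
theorem innerTrees_eq {L : ∀ n, Multi V V n} (hL0 : L 0 = 0) (hL1 : L 1 = 0) (h : V →ₗ[k] V)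
    (n : ℕ) : innerTrees L h n = idFam V n + h.compMultilinearMap (graftTrees L L h n) := by
  by_cases hn : n = 1
  · subst hn
    have : graftTrees L L h 1 = 0 := by
      rw [graftTrees_eq_sum hL0 hL1]
      refine Finset.sum_eq_zero fun t _ => ?_
      have := t.1.1.length_le
      have := t.1.2
      omega
    rw [this, innerTrees, sum_lTree_one]
    simp [idFam, thetaInner]
  · have hid : idFam V n = 0 := by
      match n, hn with
      | 0, _ => rfl
      | 1, hn => exact (hn rfl).elim
      | _ + 2, _ => rfl
    rw [hid, zero_add, graftTrees_eq_sum hL0 hL1, innerTrees, sum_lTree hn]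
    ext x
    simp [thetaInner]

theorem graftTrees_zero {F : ∀ n, Multi V T n} (hF : F 0 = 0) (L : ∀ n, Multi V V n)
    (h : V →ₗ[k] V) : graftTrees F L h 0 = 0 := by
  rw [graftTrees]
  refine Finset.sum_eq_zero fun c _ => ?_
  obtain rfl : c = default := Subsingleton.elim _ _
  exact (congrArg (fun G : Multi V T 0 => graft (default : OrderedFinpartition 0) G _) hF).trans
    (graft_zero _ _)

theorem innerTrees_zero {L : ∀ n, Multi V V n} (hL0 : L 0 = 0) (hL1 : L 1 = 0) (h : V →ₗ[k] V) :
    innerTrees L h 0 = 0 := by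
  rw [innerTrees_eq hL0 hL1, graftTrees_zero hL0]
  ext x
  simp [idFam]

end DGSpace

/-! ### The tree sum as the solution of a fixed point equation -/

namespace DGSpace

variable {k : Type u} [Field k] {V : DGSpace.{u, v} k} {U : DGSpace.{u, w} k}
  {T : Type*} [AddCommGroup T] [Module k T]
  {A : Type*} [Ring A] [Algebra k A] [Grassmann k A]

/-- The value of the generating function of the sums of trees. -/
def treePoint (L : ∀ n, Multi V V n) (h : V →ₗ[k] V) {n : ℕ} (u : Fin n → V ⊗[k] A) : V ⊗[k] A :=
  subsum (fun n z => gext A (innerTrees L h n) z) u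

/-- The value of the derivative of the generating function of the sums of trees. -/
def treeOp (L : ∀ n, Multi V V n) (h : V →ₗ[k] V) {n : ℕ} (u : Fin n → V ⊗[k] A) :
    Module.End k V ⊗[k] A :=
  subsum (fun n z => gext A (opFam (innerTrees L h) n) z) u

theorem gext_mem_multiples {n : ℕ} (F : Multi V V n) {z : Fin n → V ⊗[k] A} {i : Fin n}
    (hz : z i ∈ nullPoints V A) : gext A F z ∈ multiples (z i) := by
  obtain ⟨e, he, h, h'⟩ := exists_multiples_eq hz
  rw [h']
  exact gext_mem_divBy he.1 F z i h

theorem gext_graftTrees (F : ∀ n, Multi V T n) (L : ∀ n, Multi V V n) (h : V →ₗ[k] V) {n : ℕ}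
    {z : Fin n → V ⊗[k] A} (hz : ∀ i, z i ∈ points V A) :
    gext A (graftTrees F L h n) z =
      compFam (fun n => gextFam A F n) (fun n z => gext A (innerTrees L h n) z) n z := by
  rw [graftTrees, gext_sum, _root_.sum_apply, compFam]
  refine Finset.sum_congr rfl fun c _ => gext_graft c _ _ z hz

theorem act_snocFam {F : ∀ n, Multi V T n} {n : ℕ} (u : Fin n → V ⊗[k] A) (y : V ⊗[k] A) :
    subsum (fun n z => gext A (F n) z) (Fin.snoc (α := fun _ => V ⊗[k] A) u y) =
      subsum (fun n z => gext A (F n) z) u +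
        act (subsum (fun n z => gext A (opFam F n) z) u) y := by
  rw [subsum_snoc, subsum_snocFam]

theorem treePoint_snoc (L : ∀ n, Multi V V n) (h : V →ₗ[k] V) {n : ℕ} (u : Fin n → V ⊗[k] A)
    (y : V ⊗[k] A) : treePoint L h (Fin.snoc (α := fun _ => V ⊗[k] A) u y) =
      treePoint L h u + act (treeOp L h u) y := act_snocFam u y

section

variable [CharZero k] {L : ∀ n, Multi V V n} {Q : ∀ n, Multi V k n} {h : V →ₗ[k] V}
  {n : ℕ} {u : Fin n → V ⊗[k] A}

theorem IsSymmetricULInfty.posFam_innerTrees (H : IsSymmetricULInfty V L Q) (h : V →ₗ[k] V) :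
    posFam (fun n (z : Fin n → V ⊗[k] A) => gext A (innerTrees L h n) z) =
      fun n z => gext A (innerTrees L h n) z := by
  funext n z
  cases n with
  | zero =>
    rw [innerTrees_zero H.ell_zero H.ell_one, gext_zero]
    rfl
  | succ n => rfl

theorem IsSymmetricULInfty.gext_innerTrees_mem (H : IsSymmetricULInfty V L Q)
    (hh : IsHomogeneous V V (-1) h) {z : Fin n → V ⊗[k] A} (hz : ∀ i, z i ∈ points V A) :
    gext A (innerTrees L h n) z ∈ points V A := by
  cases n with
  | zero =>
    rw [innerTrees_zero H.ell_zero H.ell_one, gext_zero]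
    exact zero_mem _
  | succ n => exact gext_mem_points (hasDegree_innerTrees H.ell_degree hh _) (Nat.succ_pos n) hz

/-- The exponential formula applied to F and the family of tree sums: grafting trees into F means
evaluating the generating function of F at the tree point. -/
theorem IsSymmetricULInfty.subsum_graftTrees (H : IsSymmetricULInfty V L Q)
    (hh : IsHomogeneous V V (-1) h) {F : ∀ n, Multi V T n} (hF : ∀ n, IsSymm (F n)) (hF0 : F 0 = 0)
    (hu : ∀ i, u i ∈ nullPoints V A) {B : ℕ} (hB : n ≤ B) :
    subsum (fun n z => gext A (graftTrees F L h n) z) u = ptEval B F (treePoint L h u) := by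
  have h1 := subsum_compFam (Φ := gextFam A F) (P := points V A) (D := nullPoints V A)
    (ζ := multiples) (X := fun n z => gext A (innerTrees L h n) z) (isSymmOn_gextFam hF)
    (fun a ha => vanishesOn_multiples ha F)
    (fun m z hz => H.gext_innerTrees_mem hh fun i => (hz i).1)
    (fun m z hz i => gext_mem_multiples _ (hz i)) hu (B + 1) (Nat.lt_succ_of_le hB)
  rw [H.posFam_innerTrees, expSum_succ_eq_ptEval B hF0] at h1
  exact (subsum_congr (fun m z hz => gext_graftTrees F L h fun i => (hz i).1) hu).trans h1

theorem IsSymmetricULInfty.treePoint_mem (H : IsSymmetricULInfty V L Q)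
    (hh : IsHomogeneous V V (-1) h) (hu : ∀ i, u i ∈ nullPoints V A) :
    treePoint L h u ∈ points V A :=
  subsum_mem _ (fun _ _ hz => H.gext_innerTrees_mem hh fun i => (hz i).1) hu

theorem subsum_idFam (hu : ∀ i, u i ∈ nullPoints V A) :
    subsum (fun n z => gext A (idFam V n) z) u = ∑ i, u i := by
  rw [subsum_eq_sum (D := nullPoints V A) _ _ hu]
  · refine Finset.sum_congr rfl fun i _ => ?_
    have : gext A (idFam V 1) = MultilinearMap.ofSubsingleton k _ _ 0 LinearMap.id :=
      multilinear_eq_of_tmul _ _ fun x a => by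
        rw [gext_tmul]
        simp [idFam]
    rw [this]
    rfl
  · intro z
    rw [idFam, gext_zero]
    · rfl
    · simp
  · intro m z _
    rw [idFam, gext_zero]
    · rfl
    · omega

/-- The generating function of the recursion `innerTrees_eq`. -/
theorem IsSymmetricULInfty.treePoint_eq (H : IsSymmetricULInfty V L Q)
    (hh : IsHomogeneous V V (-1) h) (hu : ∀ i, u i ∈ nullPoints V A) {B : ℕ} (hB : n ≤ B) :
    treePoint L h u = ∑ i, u i + h.rTensor A (ptEval B L (treePoint L h u)) := by
  rw [← H.subsum_graftTrees hh H.ell_symm H.ell_zero hu hB, ← subsum_idFam hu]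
  have h1 := subsum_map (h.rTensor A).toAddMonoidHom
    (fun n z => gext A (graftTrees L L h n) z) u
  refine Eq.trans ?_ (congrArg _ h1)
  rw [← subsum_add, treePoint]
  congr 1
  funext m z
  rw [innerTrees_eq H.ell_zero H.ell_one, gext_add, add_apply, gext_postcomp]
  rfl

/-- Both tree points solve the same fixed point equation, which has only one solution. This yields
symmetry of the tree sums without permuting any trees. -/
theorem IsSymmetricULInfty.treePoint_congr (H : IsSymmetricULInfty V L Q)
    (hh : IsHomogeneous V V (-1) h) {m : ℕ} {u' : Fin m → V ⊗[k] A}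
    (hu : ∀ i, u i ∈ nullPoints V A) (hu' : ∀ i, u' i ∈ nullPoints V A)
    (he : ∑ i, u i = ∑ i, u' i) : treePoint L h u = treePoint L h u' := by
  have h1 := H.treePoint_eq hh hu (le_max_left n m)
  have h2 := H.treePoint_eq hh hu' (le_max_right n m)
  rw [← he] at h2
  exact fixedPoint_unique (max n m) H.ell_symm H.ell_degree H.ell_one hh (H.treePoint_mem hh hu)
    (H.treePoint_mem hh hu') h1 h2

theorem forall_snoc_mem {α : Type*} {D : Set α} {n : ℕ} {u : Fin n → α} (hu : ∀ i, u i ∈ D)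
    {y : α} (hy : y ∈ D) (i : Fin (n + 1)) : Fin.snoc (α := fun _ => α) u y i ∈ D := by
  refine Fin.lastCases ?_ (fun i => ?_) i
  · simpa using hy
  · simpa using hu i

theorem IsSymmetricULInfty.act_treeOp_mem (H : IsSymmetricULInfty V L Q)
    (hh : IsHomogeneous V V (-1) h) (hu : ∀ i, u i ∈ nullPoints V A) {y : V ⊗[k] A}
    (hy : y ∈ nullPoints V A) : act (treeOp L h u) y ∈ points V A := by
  have h1 := H.treePoint_mem hh (forall_snoc_mem hu hy)
  rw [treePoint_snoc] at h1
  exact (Submodule.add_mem_iff_right _ (H.treePoint_mem hh hu)).1 h1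

theorem IsSymmetricULInfty.act_treeOp_mem_nullPoints (H : IsSymmetricULInfty V L Q)
    (hh : IsHomogeneous V V (-1) h) (hu : ∀ i, u i ∈ nullPoints V A) {y : V ⊗[k] A}
    (hy : y ∈ nullPoints V A) : act (treeOp L h u) y ∈ nullPoints V A :=
  ⟨H.act_treeOp_mem hh hu hy, hy.2.imp fun _ he => ⟨he.1, act_mem_divBy he.1.1 _ he.2⟩⟩

/-- The chain rule for generating functions of sums of trees. -/
theorem IsSymmetricULInfty.ptEval_treePoint_snoc (H : IsSymmetricULInfty V L Q)
    (hh : IsHomogeneous V V (-1) h) {F : ∀ n, Multi V T n} (hF : ∀ n, IsSymm (F n))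
    (hu : ∀ i, u i ∈ nullPoints V A) {y : V ⊗[k] A} (hy : y ∈ nullPoints V A) (B : ℕ) :
    ptEval B F (treePoint L h (Fin.snoc (α := fun _ => V ⊗[k] A) u y)) =
      ptEval B F (treePoint L h u) + act (ptOp B F (treePoint L h u)) (act (treeOp L h u) y) := by
  obtain ⟨e, he, hye⟩ := (H.act_treeOp_mem_nullPoints hh hu hy).2
  rw [treePoint_snoc, ptEval_add B hF (H.treePoint_mem hh hu) (H.act_treeOp_mem hh hu hy) he hye]

/-- Differentiation of x = v + hE(x) in the direction of a new null point y: the derivative R of the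
tree point satisfies R = 1 + hE'(x)R. -/
theorem IsSymmetricULInfty.treeOp_eq (H : IsSymmetricULInfty V L Q)
    (hh : IsHomogeneous V V (-1) h) (hu : ∀ i, u i ∈ nullPoints V A) {B : ℕ} (hB : n < B) :
    treeOp L h u = 1 + opL h (ptOp B L (treePoint L h u)) * treeOp L h u := by
  refine op_ext fun y hy => ?_
  have hy' := nullPoints_of_mem_purePoints hy
  have h1 := H.treePoint_eq hh (forall_snoc_mem hu hy') (Nat.succ_le_of_lt hB)
  rw [H.ptEval_treePoint_snoc hh H.ell_symm hu hy', treePoint_snoc, map_add, ← add_assoc,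
    Fin.sum_univ_castSucc, Fin.snoc_last] at h1
  simp only [Fin.snoc_castSucc] at h1
  have h2 := H.treePoint_eq hh hu hB.le
  rw [add_right_comm _ y, ← h2, add_assoc, add_right_inj] at h1
  rw [h1, map_add, LinearMap.add_apply, act_one, act_mul, act_opL, ← h1]

theorem IsSymmetricULInfty.treeOp_mem (H : IsSymmetricULInfty V L Q)
    (hh : IsHomogeneous V V (-1) h) (hu : ∀ i, u i ∈ nullPoints V A) :
    treeOp L h u ∈ evenOps V A :=
  subsum_mem _ (fun _ _ hz => (gext_curryRight_mem (hasDegree_innerTrees H.ell_degree hh _)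
    fun i => (hz i).1).1) hu

theorem eq_sum_pow_of_eq {R : Type*} [Ring R] {P X : R} (h : X = 1 + P * X) {N : ℕ}
    (hP : P ^ N = 0) : X = ∑ j ∈ range N, P ^ j := by
  have : ∀ m, X = ∑ j ∈ range m, P ^ j + P ^ m * X := by
    intro m
    induction m with
    | zero => simp
    | succ m ih =>
      rw [Finset.sum_range_succ, add_assoc, pow_succ, mul_assoc]
      nth_rewrite 1 [ih]
      nth_rewrite 1 [h]
      rw [mul_add, mul_one]
  rw [this N, hP, zero_mul, add_zero]

theorem exists_pow_eq_zero_of_mem_nilOps {P : Module.End k V ⊗[k] A} (hP : P ∈ nilOps V A) :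
    ∃ N, ∀ m, N ≤ m → P ^ m = 0 := by
  obtain ⟨N, hN⟩ := exists_isNilSum_of_mem_nilOps hP
  exact ⟨N + 1, fun m hm => hN.pow_eq_zero hm⟩

end

end DGSpace

theorem exists_eq_of_subsum_congr {α N : Type*} [AddCommMonoid α] [AddCommGroup N] {D : Set α}
    {F : ∀ m, (Fin m → α) → N}
    (h : ∀ {n m} (u : Fin n → α) (u' : Fin m → α), (∀ i, u i ∈ D) → (∀ i, u' i ∈ D) →
      ∑ i, u i = ∑ i, u' i → subsum F u = subsum F u') :
    ∃ S : α → N, ∀ n (u : Fin n → α), (∀ i, u i ∈ D) → subsum F u = S (∑ i, u i) := by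
  classical
  refine ⟨fun x => if h : ∃ p : Σ n, Fin n → α, (∀ i, p.2 i ∈ D) ∧ ∑ i, p.2 i = x then
    subsum F h.choose.2 else 0, fun n u hu => ?_⟩
  have hex : ∃ p : Σ n, Fin n → α, (∀ i, p.2 i ∈ D) ∧ ∑ i, p.2 i = ∑ i, u i := ⟨⟨n, u⟩, hu, rfl⟩
  simp only [dif_pos hex]
  exact h _ _ hu hex.choose_spec.1 hex.choose_spec.2.symm

/-! ### The transferred bracket -/

namespace DGSpace

variable {k : Type u} [Field k] {V : DGSpace.{u, v} k} {U : DGSpace.{u, w} k}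
  {T : Type*} [AddCommGroup T] [Module k T]
  {A : Type*} [Ring A] [Algebra k A] [Grassmann k A]

/-- Precomposition of a family of multilinear maps with a linear map. -/
def pullFam (f : U →ₗ[k] V) (F : ∀ n, Multi V T n) (n : ℕ) : Multi U T n :=
  (F n).compLinearMap fun _ => f

theorem subsum_pullFam (f : U →ₗ[k] V) (F : ∀ n, Multi V T n) {n : ℕ} (u : Fin n → U ⊗[k] A) :
    subsum (fun n z => gext A (pullFam f F n) z) u =
      subsum (fun n z => gext A (F n) z) (f.rTensor A ∘ u) := by
  rw [← subsum_comp]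
  congr 1
  funext m z
  exact gext_precomp _ _ _

theorem rTensor_mem_nullPoints {f : U →ₗ[k] V} (hf : IsHomogeneous U V 0 f) {x : U ⊗[k] A}
    (hx : x ∈ nullPoints U A) : f.rTensor A x ∈ nullPoints V A :=
  ⟨rTensor_mem_points hf hx.1, hx.2.imp fun _ he => ⟨he.1, rTensor_mem_divBy f he.2⟩⟩

theorem isNull_of_odd [CharZero k] {η : A} (hη : η ∈ Grassmann.par k (1 : ZMod 2)) : IsNull k η :=
  ⟨⟨1, hη⟩, Grassmann.sq_zero_of_odd hη⟩

/-- The transferred bracket `∑ g θ f^{⊗ n}`. -/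
def transferredEll (L : ∀ n, Multi V V n) (f : U →ₗ[k] V) (g : V →ₗ[k] U) (h : V →ₗ[k] V) (n : ℕ) :
    Multi U U n :=
  g.compMultilinearMap (pullFam f (graftTrees L L h) n)

/-- If the sums over subfamilies depend only on the total, the values of F on null points are
iterated differences and so do not change under permutations; even points detect graded symmetry. -/
theorem isSymm_of_subsum_congr [Nontrivial A] {F : ∀ n, Multi V T n}
    (h : ∀ {n m} (u : Fin n → V ⊗[k] A) (u' : Fin m → V ⊗[k] A), (∀ i, u i ∈ nullPoints V A) →
      (∀ i, u' i ∈ nullPoints V A) → ∑ i, u i = ∑ i, u' i →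
      subsum (fun n z => gext A (F n) z) u = subsum (fun n z => gext A (F n) z) u') (n : ℕ) :
    IsSymm (F n) := fun σ => by
  obtain ⟨S, hS⟩ := exists_eq_of_subsum_congr (D := nullPoints V A)
    (F := fun n z => gext A (F n) z) h
  refine multi_ext_of_valid (A := A) fun η _ z hz => ?_
  rw [gext_relabel σ _ z fun i => (hz i).1]
  exact congrArg _ (perm_of_subsum hS hz σ.symm)

theorem eq_zero_of_subsum_lact [Nontrivial A] {F : ∀ n, Multi V T n}
    (h : ∀ η ∈ Grassmann.par k (A := A) (1 : ZMod 2), ∀ n (u : Fin n → V ⊗[k] A),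
      (∀ i, u i ∈ nullPoints V A) → subsum (fun n z => lact T η (gext A (F n) z)) u = 0) (n : ℕ) :
    F n = 0 := by
  refine multi_ext_of_valid (A := A) fun η hη z hz => ?_
  rw [gext_zero]
  refine Eq.trans ?_ (map_zero _).symm
  exact eq_zero_of_subsum_eq_zero (D := nullPoints V A)
    (F := fun n z => lact T η (gext A (F n) z)) (h η hη) hz

section

variable [CharZero k] {L : ∀ n, Multi V V n} {Q : ∀ n, Multi V k n} {f : U →ₗ[k] V}
  {g : V →ₗ[k] U} {h : V →ₗ[k] V} {n : ℕ} {u : Fin n → U ⊗[k] A}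

theorem IsSymmetricULInfty.subsum_transferredEll (H : IsSymmetricULInfty V L Q)
    (hh : IsHomogeneous V V (-1) h) (hf : IsHomogeneous U V 0 f)
    (hu : ∀ i, u i ∈ nullPoints U A) {B : ℕ} (hB : n ≤ B) :
    subsum (fun n z => gext A (transferredEll L f g h n) z) u =
      g.rTensor A (ptEval B L (treePoint L h (f.rTensor A ∘ u))) := by
  have hu' : ∀ i, (f.rTensor A ∘ u) i ∈ nullPoints V A := fun i => rTensor_mem_nullPoints hf (hu i)
  rw [← H.subsum_graftTrees hh H.ell_symm H.ell_zero hu' hB, ← subsum_pullFam]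
  exact (subsum_map (g.rTensor A).toAddMonoidHom _ u).symm ▸
    congrArg (fun F => subsum F u) (funext fun m => funext fun z => gext_postcomp _ _ _)

/-- The derivative of u ↦ gE(x(fu)) is gE'(x)Rf, by the chain rule. -/
theorem IsSymmetricULInfty.act_opFam_transferredEll (H : IsSymmetricULInfty V L Q)
    (hh : IsHomogeneous V V (-1) h) (hf : IsHomogeneous U V 0 f)
    (hu : ∀ i, u i ∈ nullPoints U A) {y : U ⊗[k] A} (hy : y ∈ nullPoints U A) {B : ℕ} (hB : n < B) :
    act (subsum (fun n z => gext A (opFam (transferredEll L f g h) n) z) u) y =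
      g.rTensor A (act (ptOp B L (treePoint L h (f.rTensor A ∘ u)))
        (act (treeOp L h (f.rTensor A ∘ u)) (f.rTensor A y))) := by
  have hu' : ∀ i, (f.rTensor A ∘ u) i ∈ nullPoints V A := fun i => rTensor_mem_nullPoints hf (hu i)
  have h1 := act_snocFam (F := transferredEll L f g h) u y
  rw [H.subsum_transferredEll hh hf (forall_snoc_mem hu hy) (Nat.succ_le_of_lt hB),
    H.subsum_transferredEll hh hf hu hB.le, Fin.comp_snoc, H.ptEval_treePoint_snoc hh H.ell_symm hu'
      (rTensor_mem_nullPoints hf hy), map_add, add_right_inj] at h1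
  exact h1.symm

theorem IsSymmetricULInfty.isSymm_transferredEll (H : IsSymmetricULInfty V L Q) [Nontrivial A]
    (hh : IsHomogeneous V V (-1) h) (hf : IsHomogeneous U V 0 f) (n : ℕ) :
    IsSymm (transferredEll L f g h n) := by
  refine isSymm_of_subsum_congr (A := A) (fun {n m} u u' hu hu' he => ?_) n
  have h1 : ∀ i, (f.rTensor A ∘ u) i ∈ nullPoints V A := fun i => rTensor_mem_nullPoints hf (hu i)
  have h2 : ∀ i, (f.rTensor A ∘ u') i ∈ nullPoints V A := fun i => rTensor_mem_nullPoints hf (hu' i)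
  rw [H.subsum_transferredEll hh hf hu (le_max_left n m),
    H.subsum_transferredEll hh hf hu' (le_max_right n m), H.treePoint_congr hh h1 h2]
  simp only [Function.comp_apply, ← map_sum, he]

theorem IsSymmetricULInfty.hasDegree_graftTrees (H : IsSymmetricULInfty V L Q)
    (hh : IsHomogeneous V V (-1) h) (n : ℕ) : HasDegree 1 (graftTrees L L h n) :=
  HasDegree.sum fun _ _ => hasDegree_graft _ (H.ell_degree _)
    fun _ => hasDegree_innerTrees H.ell_degree hh _

theorem IsSymmetricULInfty.hasDegree_transferredEll (H : IsSymmetricULInfty V L Q)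
    (hh : IsHomogeneous V V (-1) h) (hf : IsHomogeneous U V 0 f) (hg : IsHomogeneous V U 0 g)
    (n : ℕ) : HasDegree 1 (transferredEll L f g h n) := fun i x hx => by
  have := hg _ _ (H.hasDegree_graftTrees hh n i (fun j => f (x j)) fun j => by
    simpa using hf _ _ (hx j))
  rwa [add_zero] at this

theorem IsSymmetricULInfty.transferredEll_zero (H : IsSymmetricULInfty V L Q) :
    transferredEll L f g h 0 = 0 := by
  ext x
  simp [transferredEll, pullFam, graftTrees_zero H.ell_zero]

theorem IsSymmetricULInfty.transferredEll_one (H : IsSymmetricULInfty V L Q) :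
    transferredEll L f g h 1 = 0 := by
  have : graftTrees L L h 1 = 0 := by
    rw [graftTrees_eq_sum H.ell_zero H.ell_one]
    refine Finset.sum_eq_zero fun t _ => ?_
    have := t.1.1.length_le
    have := t.1.2
    omega
  ext x
  simp [transferredEll, pullFam, this]

/-- `treeOp_eq` gives R as a right inverse of 1 - hE'(x). It equals the finite Neumann series, which
is a left inverse as well. -/
theorem IsSymmetricULInfty.treeOp_mul (H : IsSymmetricULInfty V L Q)
    (hh : IsHomogeneous V V (-1) h) {u : Fin n → V ⊗[k] A} (hu : ∀ i, u i ∈ nullPoints V A) {B : ℕ}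
    (hB : n < B) : treeOp L h u * (1 - opL h (ptOp B L (treePoint L h u))) = 1 := by
  obtain ⟨N, hN⟩ := exists_pow_eq_zero_of_mem_nilOps (opL_ptOp_mem (A := A) B H.ell_degree H.ell_one
    hh (H.treePoint_mem hh hu))
  rw [eq_sum_pow_of_eq (H.treeOp_eq hh hu hB) (hN N le_rfl), geom_sum_mul_neg, hN N le_rfl, sub_zero]

/-- The infinitesimal action of the differential on the points of the transferred structure. -/
theorem IsSymmetricULInfty.act_treeOp_differential (H : IsSymmetricULInfty V L Q)
    (hh : IsHomogeneous V V (-1) h) (hf : IsChainMap U V f)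
    (hfg : ∀ x : V, f (g x) - x = V.d (h x) + h (V.d x))
    (hu : ∀ i, u i ∈ nullPoints U A) (η : A) {B : ℕ} (hB : n < B)
    (hE : lact V η (V.d.rTensor A (ptEval B L (treePoint L h (f.rTensor A ∘ u)))) +
      act (ptOp B L (treePoint L h (f.rTensor A ∘ u)))
        (lact V η (V.d.rTensor A (treePoint L h (f.rTensor A ∘ u)) +
          ptEval B L (treePoint L h (f.rTensor A ∘ u)))) = 0) :
    act (treeOp L h (f.rTensor A ∘ u)) (f.rTensor A (lact U η (U.d.rTensor A (∑ i, u i) +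
      g.rTensor A (ptEval B L (treePoint L h (f.rTensor A ∘ u)))))) =
    lact V η (V.d.rTensor A (treePoint L h (f.rTensor A ∘ u)) +
          ptEval B L (treePoint L h (f.rTensor A ∘ u))) := by
  have hu' : ∀ i, (f.rTensor A ∘ u) i ∈ nullPoints V A :=
    fun i => rTensor_mem_nullPoints hf.1 (hu i)
  have h1 := H.treeOp_mul hh hu' hB
  have h2 := H.treePoint_eq hh hu' hB.le
  set x := treePoint L h (f.rTensor A ∘ u)
  set E := ptEval B L x
  set M := ptOp B L x
  have hfd : ∀ y : U ⊗[k] A, f.rTensor A (U.d.rTensor A y) = V.d.rTensor A (f.rTensor A y) := by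
    intro y
    rw [← LinearMap.comp_apply, ← LinearMap.rTensor_comp, ← LinearMap.comp_apply,
      ← LinearMap.rTensor_comp]
    congr 2
    ext y; exact hf.2 y
  have hfg' : ∀ y : V ⊗[k] A, f.rTensor A (g.rTensor A y) =
      y + (V.d.rTensor A (h.rTensor A y) + h.rTensor A (V.d.rTensor A y)) := by
    intro y
    induction y using TensorProduct.induction_on with
    | zero => simp
    | tmul y a =>
      simp only [LinearMap.rTensor_tmul, ← TensorProduct.add_tmul, ← hfg]
      congr 1; abel
    | add y z hy hz => simp only [map_add, hy, hz]; abel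
  -- On the right, M(ηD) is -η dE by `hE`, giving η(dx + E + h dE). On the left, fgE = E + dhE + hdE
  -- and dfu + dhE = dx give the same expression.
  have h3 : f.rTensor A (lact U η (U.d.rTensor A (∑ i, u i) + g.rTensor A E)) =
      act (1 - opL h M) (lact V η (V.d.rTensor A x + E)) := by
    rw [map_sub, LinearMap.sub_apply, act_one, act_opL, eq_neg_of_add_eq_zero_right hE, map_neg,
      sub_neg_eq_add, rTensor_lact, rTensor_lact, ← map_add, map_add, hfd, hfg']
    congr 1
    rw [show V.d.rTensor A x = _ from congrArg _ h2]
    simp only [map_add, map_sum, Function.comp_apply]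
    abel
  rw [h3, ← act_mul, h1, act_one]

/-- The tangent vector `η (d u + λ(u))` of the transferred structure. -/
theorem IsSymmetricULInfty.lact_differential_mem (H : IsSymmetricULInfty V L Q)
    (hh : IsHomogeneous V V (-1) h) (hf : IsHomogeneous U V 0 f) (hg : IsHomogeneous V U 0 g)
    (hu : ∀ i, u i ∈ nullPoints U A) {η : A} (hη : η ∈ Grassmann.par k (1 : ZMod 2)) :
    lact U η (U.d.rTensor A (∑ i, u i) +
      subsum (fun n z => gext A (transferredEll L f g h n) z) u) ∈ nullPoints U A := by
  refine ⟨?_, η, isNull_of_odd hη, ⟨_, rfl⟩⟩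
  rw [map_add]
  refine add_mem (lact_d_mem hη (sum_mem fun i _ => (hu i).1)) ?_
  rw [show lact U η (subsum (fun n z => gext A (transferredEll L f g h n) z) u) =
    subsum (fun n z => lact U η (gext A (transferredEll L f g h n) z)) u from
    (subsum_map (lact U η).toAddMonoidHom _ u).symm]
  refine subsum_mem (D := nullPoints U A) _ (fun m z hz => ?_) hu
  cases m with
  | zero =>
    have : gext A (transferredEll L f g h 0) z = 0 := by
      rw [H.transferredEll_zero, gext_zero]
      rfl
    rw [this, map_zero]
    exact zero_mem _
  | succ m =>
    exact lact_gext_mem_points (H.hasDegree_transferredEll hh hf hg _) (Nat.succ_pos m)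
      (by simpa using hη) fun i => (hz i).1

/-- The tree map carries the transferred vector field to D, so the derivative of gE(x(fu)) along the
former is gE'(x)(ηD(x)). With dg = gd the equation is g applied to the structure equation of V at
the tree point. -/
theorem IsSymmetricULInfty.transferredEll_eq (H : IsSymmetricULInfty V L Q) [Nontrivial A]
    (hh : IsHomogeneous V V (-1) h) (hf : IsChainMap U V f) (hg : IsChainMap V U g)
    (hfg : ∀ x : V, f (g x) - x = V.d (h x) + h (V.d x)) (n : ℕ) :
    U.d.compMultilinearMap (transferredEll L f g h n) + compTensorD (transferredEll L f g h n) +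
      composeAll (transferredEll L f g h) (transferredEll L f g h) n = 0 := by
  refine eq_zero_of_subsum_lact (A := A) (F := fun n =>
    U.d.compMultilinearMap (transferredEll L f g h n) + compTensorD (transferredEll L f g h n) +
      composeAll (transferredEll L f g h) (transferredEll L f g h) n) (fun η hη n u hu => ?_) n
  have hu' : ∀ i, (f.rTensor A ∘ u) i ∈ nullPoints V A :=
    fun i => rTensor_mem_nullPoints hf.1 (hu i)
  obtain ⟨B, hE, hB⟩ := ((H.ell_point hη (H.treePoint_mem hh hu')).and
    (Filter.eventually_gt_atTop n)).exists
  rw [subsum_ell_eq (fun n => H.isSymm_transferredEll (A := A) hh hf.1 n) hη hu,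
    H.act_opFam_transferredEll hh hf.1 hu (H.lact_differential_mem hh hf.1 hg.1 hu hη) hB,
    H.subsum_transferredEll hh hf.1 hu hB.le, H.act_treeOp_differential hh hf hfg hu η hB hE]
  have hgd : ∀ y : V ⊗[k] A, U.d.rTensor A (g.rTensor A y) = g.rTensor A (V.d.rTensor A y) := by
    intro y
    rw [← LinearMap.comp_apply, ← LinearMap.rTensor_comp, ← LinearMap.comp_apply,
      ← LinearMap.rTensor_comp]
    congr 2
    ext y; exact (hg.2 y).symm
  rw [hgd, ← rTensor_lact, ← map_add, hE, map_zero]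

end

end DGSpace

/-! ### Generating functions of wheels -/

namespace DGSpace

variable {k : Type u} [Field k] {V : DGSpace.{u, v} k} {U : DGSpace.{u, w} k}
  {T : Type*} [AddCommGroup T] [Module k T]
  {A : Type*} [Ring A] [Algebra k A] [Grassmann k A]

/-- The sum of all trees for which the first and the last leg lie on different branches at the
root. -/
def splitTrees (L : ∀ n, Multi V V n) (h : V →ₗ[k] V) (n : ℕ) : Multi V V (n + 1) :=
  ∑ c : {c : OrderedFinpartition (n + 1) // c.index 0 ≠ c.index (Fin.last n)},
    graft c.1 (L c.1.length) fun m => innerTrees L h (c.1.partSize m)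

/-- The sum over all wheels. -/
def wheelTrees (L : ∀ n, Multi V V n) (h : V →ₗ[k] V) (n : ℕ) : Multi V k n :=
  traceLast (h.compMultilinearMap (splitTrees L h n))

theorem wheelTrees_zero (L : ∀ n, Multi V V n) (h : V →ₗ[k] V) : wheelTrees L h 0 = 0 := by
  have : splitTrees L h 0 = 0 := Finset.sum_eq_zero fun c _ => (c.2 rfl).elim
  rw [wheelTrees, this]
  ext x
  have h0 : (h.compMultilinearMap (0 : Multi V V (0 + 1))).curryRight = 0 := by
    ext; simp
  rw [traceLast, h0]
  simp

theorem gext_wheelTrees (L : ∀ n, Multi V V n) (h : V →ₗ[k] V) {n : ℕ} (z : Fin n → V ⊗[k] A) :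
    gext A (wheelTrees L h n) z =
      straceA V A (opL h (gext A (splitTrees L h n).curryRight z)) := by
  rw [opL_gext, wheelTrees, traceLast, gext_postcomp]
  rfl

/-- The family of functions `X` on flagged arguments, set to zero if both flags occur. -/
def flagged {α N : Type*} [AddCommGroup N] (X : ∀ n, (Fin n → α) → N) (n : ℕ)
    (z : Fin n → α × Bool × Bool) : N :=
  open Classical in
  if (∃ i, (z i).2.1 = true) ∧ ∃ i, (z i).2.2 = true then 0 else X n fun i => (z i).1

theorem subsum_flagged {α N : Type*} [AddCommGroup N] (X : ∀ n, (Fin n → α) → N) {n : ℕ}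
    {u : Fin n → α × Bool × Bool} (hu : (∀ i, (u i).2.1 = false) ∨ ∀ i, (u i).2.2 = false) :
    subsum (flagged X) u = subsum X fun i => (u i).1 := by
  refine Eq.trans ?_ (subsum_comp Prod.fst X u)
  rcases hu with hu | hu
  · refine subsum_congr (D := {p : α × Bool × Bool | p.2.1 = false}) (fun m z hz => if_neg ?_) hu
    rintro ⟨⟨i, hi⟩, -⟩
    exact absurd hi (by simpa using hz i)
  · refine subsum_congr (D := {p : α × Bool × Bool | p.2.2 = false}) (fun m z hz => if_neg ?_) hu
    rintro ⟨-, i, hi⟩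
    exact absurd hi (by simpa using hz i)

/-- The flags mark the first and the last leg. Since a block carrying both flags contributes zero,
the sum over all partitions reduces to those separating the two legs, and the exponential formula
becomes available for `splitTrees`. -/
theorem compFam_flagged {L : ∀ n, Multi V V n} {h : V →ₗ[k] V} {n : ℕ} {a y : V ⊗[k] A}
    {z : Fin n → V ⊗[k] A} (ha : a ∈ points V A) (hz : ∀ i, z i ∈ points V A)
    (hy : y ∈ points V A) :
    compFam (fun n => gextFam A L n) (flagged fun n z => gext A (innerTrees L h n) z) (n + 2)
      (Fin.cons (α := fun _ => (V ⊗[k] A) × Bool × Bool) (a, true, false)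
        (Fin.snoc (α := fun _ => (V ⊗[k] A) × Bool × Bool) (fun i => (z i, false, false))
          (y, false, true))) =
      gext A (splitTrees L h (n + 1)) (Fin.cons (α := fun _ => V ⊗[k] A) a
        (Fin.snoc (α := fun _ => V ⊗[k] A) z y)) := by
  set W := Fin.cons (α := fun _ => (V ⊗[k] A) × Bool × Bool) (a, true, false)
        (Fin.snoc (α := fun _ => (V ⊗[k] A) × Bool × Bool) (fun i => (z i, false, false))
          (y, false, true)) with hW
  have hW1 : (fun i => (W i).1) = Fin.cons (α := fun _ => V ⊗[k] A) a
        (Fin.snoc (α := fun _ => V ⊗[k] A) z y) := by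
    funext i
    refine Fin.cases rfl (fun i => ?_) i
    refine Fin.lastCases ?_ (fun i => ?_) i
    · simp [hW]
    · simp [hW]
  have hWp : ∀ i, (W i).1 ∈ points V A := by
    intro i
    refine Fin.cases ha (fun i => ?_) i
    refine Fin.lastCases ?_ (fun i => ?_) i
    · simpa [hW] using hy
    · simpa [hW] using hz i
  have hfirst : ∀ i, (W i).2.1 = true ↔ i = 0 := by
    intro i
    refine Fin.cases (by simp [hW]) (fun i => ?_) i
    refine Fin.lastCases ?_ (fun i => ?_) i
    · simp [hW, Fin.ext_iff]
    · simp [hW, Fin.succ_ne_zero]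
  have hlast : ∀ i, (W i).2.2 = true ↔ i = Fin.last (n + 1) := by
    intro i
    refine Fin.cases (by simp [hW, Fin.ext_iff]) (fun i => ?_) i
    refine Fin.lastCases ?_ (fun i => ?_) i
    · simp [hW]
    · simp [hW, Fin.ext_iff, i.2.ne]
  have hblock : ∀ (c : OrderedFinpartition (n + 2)) m,
      ((∃ i, (W (c.emb m i)).2.1 = true) ∧ ∃ i, (W (c.emb m i)).2.2 = true) ↔
        c.index 0 = m ∧ c.index (Fin.last (n + 1)) = m := by
    intro c m
    simp only [hfirst, hlast]
    have key : ∀ j : Fin (n + 2), (∃ i, c.emb m i = j) ↔ c.index j = m := by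
      intro j
      constructor
      · rintro ⟨i, rfl⟩
        exact c.index_emb m i
      · rintro rfl
        exact ⟨_, c.emb_invEmbedding j⟩
    rw [key, key]
  rw [splitTrees, gext_sum, _root_.sum_apply, compFam,
    ← Fintype.sum_subtype_add_sum_subtype fun c : OrderedFinpartition (n + 2) =>
      c.index 0 ≠ c.index (Fin.last (n + 1))]
  refine (congrArg₂ (· + ·) (Finset.sum_congr rfl fun c _ => ?_)
    (Finset.sum_eq_zero fun c _ => ?_)).trans (add_zero _)
  · rw [gext_graft _ _ _ _ (by rw [← hW1]; exact hWp), ← hW1]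
    refine congrArg (gext A (L c.1.length)) (funext fun m => if_neg ?_)
    rw [hblock]
    rintro ⟨h1, h2⟩
    exact c.2 (h1.trans h2.symm)
  · have hc := not_not.1 c.2
    refine MultilinearMap.map_coord_zero _ (c.1.index 0) (if_pos ?_)
    rw [hblock]
    exact ⟨rfl, hc.symm⟩

theorem snocFam_consFam_flagged {α N : Type*} [AddCommGroup N] (X : ∀ n, (Fin n → α) → N) (a y : α) :
    snocFam (y, false, true) (consFam (a, true, false) (flagged X)) = fun _ _ => 0 := by
  funext m z
  refine if_pos ⟨⟨0, rfl⟩, Fin.last _, ?_⟩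
  rw [Fin.cons_snoc_eq_snoc_cons]
  simp

/-- Inclusion and exclusion: a mixed second difference isolates the subfamilies containing both a
and y. -/
theorem subsum_cons_snoc {α N : Type*} [AddCommGroup N] (F : ∀ m, (Fin m → α) → N) {n : ℕ} (a y : α)
    (u : Fin n → α) : subsum (snocFam y (consFam a F)) u =
      subsum F (Fin.cons (α := fun _ => α) a (Fin.snoc (α := fun _ => α) u y)) -
        subsum F (Fin.snoc (α := fun _ => α) u y) - subsum F (Fin.cons (α := fun _ => α) a u) +
          subsum F u := by
  rw [subsum_cons, subsum_snoc, subsum_cons, subsum_snoc]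
  abel

section

variable [CharZero k] {L : ∀ n, Multi V V n} {Q : ∀ n, Multi V k n} {h : V →ₗ[k] V}
  {n : ℕ} {u : Fin n → V ⊗[k] A}

theorem IsSymmetricULInfty.posFam_flagged (H : IsSymmetricULInfty V L Q) (h : V →ₗ[k] V) :
    posFam (flagged fun n (z : Fin n → V ⊗[k] A) => gext A (innerTrees L h n) z) =
      flagged fun n z => gext A (innerTrees L h n) z := by
  funext n z
  cases n with
  | zero =>
    refine (?_ : (0 : V ⊗[k] A) = _)
    rw [flagged, innerTrees_zero H.ell_zero H.ell_one, gext_zero]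
    simp
  | succ n => rfl

theorem IsSymmetricULInfty.subsum_compFam_flagged (H : IsSymmetricULInfty V L Q)
    (hh : IsHomogeneous V V (-1) h) {w : Fin n → (V ⊗[k] A) × Bool × Bool}
    (hw : ∀ i, (w i).1 ∈ nullPoints V A) {B : ℕ} (hB : n ≤ B) :
    subsum (compFam (fun n => gextFam A L n) (flagged fun n z => gext A (innerTrees L h n) z)) w =
      ptEval B L (subsum (flagged fun n z => gext A (innerTrees L h n) z) w) := by
  have hP : ∀ n (z : Fin (n + 1) → (V ⊗[k] A) × Bool × Bool), (∀ i, (z i).1 ∈ nullPoints V A) →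
      flagged (fun n z => gext A (innerTrees L h n) z) (n + 1) z ∈ points V A := by
    intro m z hz
    rw [flagged]
    split_ifs
    · exact zero_mem _
    · exact H.gext_innerTrees_mem hh fun i => (hz i).1
  have hζ : ∀ n (z : Fin n → (V ⊗[k] A) × Bool × Bool), (∀ i, (z i).1 ∈ nullPoints V A) → ∀ i,
      flagged (fun n z => gext A (innerTrees L h n) z) n z ∈ multiples (z i).1 := by
    intro m z hz i
    rw [flagged]
    split_ifs
    · exact zero_mem _
    · exact gext_mem_multiples (innerTrees L h m) (z := fun i => (z i).1) (hz i)
  have h1 := subsum_compFam (Φ := gextFam A L) (P := points V A)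
    (D := {p : (V ⊗[k] A) × Bool × Bool | p.1 ∈ nullPoints V A})
    (ζ := fun p : (V ⊗[k] A) × Bool × Bool => multiples p.1)
    (X := flagged fun n (z : Fin n → V ⊗[k] A) => gext A (innerTrees L h n) z)
    (isSymmOn_gextFam H.ell_symm) (fun a ha => vanishesOn_multiples ha L) hP hζ (u := w) hw (B + 1)
    (Nat.lt_succ_of_le hB)
  rwa [H.posFam_flagged, expSum_succ_eq_ptEval B H.ell_zero] at h1

theorem forall_cons_mem {α : Type*} {D : Set α} {n : ℕ} {u : Fin n → α} (hu : ∀ i, u i ∈ D)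
    {y : α} (hy : y ∈ D) (i : Fin (n + 1)) : Fin.cons (α := fun _ => α) y u i ∈ D :=
  Fin.cases hy hu i

/-- Let x_a be the tree point with a adjoined. Without branches containing both a and y, adjoining y
adds Ry to x and to x_a alike. The mixed difference E(x_a + Ry) - E(x + Ry) - E(x_a) + E(x) is then
(E'(x_a) - E'(x))Ry. -/
theorem IsSymmetricULInfty.subsum_splitTrees (H : IsSymmetricULInfty V L Q)
    (hh : IsHomogeneous V V (-1) h) {a : V ⊗[k] A} (ha : a ∈ nullPoints V A)
    (hu : ∀ i, u i ∈ nullPoints V A) {B : ℕ} (hB : n + 2 ≤ B) :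
    subsum (consFam a fun n z => gext A (splitTrees L h n).curryRight z) u =
      (ptOp B L (treePoint L h (Fin.cons (α := fun _ => V ⊗[k] A) a u)) -
        ptOp B L (treePoint L h u)) * treeOp L h u := by
  refine op_ext fun y hy => ?_
  have hy' := nullPoints_of_mem_purePoints hy
  set a' : (V ⊗[k] A) × Bool × Bool := (a, true, false)
  set y' : (V ⊗[k] A) × Bool × Bool := (y, false, true)
  set u' : Fin n → (V ⊗[k] A) × Bool × Bool := fun i => (u i, false, false)
  set X : ∀ n, (Fin n → V ⊗[k] A) → V ⊗[k] A := fun n z => gext A (innerTrees L h n) z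
  set C := compFam (fun n => gextFam A L n) (flagged X)
  have hu' : ∀ i, (u' i).1 ∈ nullPoints V A := hu
  have hsnoc : ∀ i, (Fin.snoc (α := fun _ => (V ⊗[k] A) × Bool × Bool) u' y' i).1 ∈
      nullPoints V A := forall_snoc_mem (D := {p : (V ⊗[k] A) × Bool × Bool | p.1 ∈ nullPoints V A}) hu' hy'
  have hcons : ∀ i, (Fin.cons (α := fun _ => (V ⊗[k] A) × Bool × Bool) a' u' i).1 ∈
      nullPoints V A := forall_cons_mem (D := {p : (V ⊗[k] A) × Bool × Bool | p.1 ∈ nullPoints V A}) hu' ha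
  have hboth : ∀ i, (Fin.cons (α := fun _ => (V ⊗[k] A) × Bool × Bool) a'
      (Fin.snoc (α := fun _ => (V ⊗[k] A) × Bool × Bool) u' y') i).1 ∈
      nullPoints V A := forall_cons_mem (D := {p : (V ⊗[k] A) × Bool × Bool | p.1 ∈ nullPoints V A}) hsnoc ha
  have h1 : act (subsum (consFam a fun n z => gext A (splitTrees L h n).curryRight z) u) y =
      subsum (snocFam y' (consFam a' C)) u' := by
    refine (subsum_map ((act (k := k) (A := A) (M := V) (T := V)).flip y).toAddMonoidHom _ u).symm.trans ?_
    refine Eq.trans ?_ (subsum_comp (fun x : V ⊗[k] A => (x, false, false)) _ u)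
    refine subsum_congr (D := nullPoints V A) (fun m z hz => ?_) hu
    refine Eq.trans ?_ (compFam_flagged (L := L) (h := h) ha.1 (fun i => (hz i).1) hy'.1).symm
    rw [Fin.cons_snoc_eq_snoc_cons, gext_snoc]
    rfl
  have h2 : subsum (flagged X) u' = treePoint L h u := subsum_flagged X (.inl fun i => rfl)
  have h3 : subsum (flagged X) (Fin.cons (α := fun _ => (V ⊗[k] A) × Bool × Bool) a' u') =
      treePoint L h (Fin.cons (α := fun _ => V ⊗[k] A) a u) := by
    rw [subsum_flagged X (.inr fun i => ?_)]
    · rw [treePoint]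
      congr 1
      funext i
      refine Fin.cases rfl (fun i => rfl) i
    · refine Fin.cases rfl (fun i => rfl) i
  have h4 : subsum (flagged X) (Fin.snoc (α := fun _ => (V ⊗[k] A) × Bool × Bool) u' y') =
      treePoint L h u + act (treeOp L h u) y := by
    rw [subsum_flagged X (.inl fun i => ?_), ← treePoint_snoc]
    · rw [treePoint]
      congr 1
      funext i
      refine Fin.lastCases ?_ (fun i => ?_) i
      · simp [y']
      · simp [u']
    · refine Fin.lastCases ?_ (fun i => ?_) i
      · simp [y']
      · simp [u']
  -- The flagged family has no terms involving both a and y, so its mixed difference is zero and the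
  -- increments simply add.
  have h5 : subsum (flagged X) (Fin.cons (α := fun _ => (V ⊗[k] A) × Bool × Bool) a'
      (Fin.snoc (α := fun _ => (V ⊗[k] A) × Bool × Bool) u' y')) =
      treePoint L h (Fin.cons (α := fun _ => V ⊗[k] A) a u) + act (treeOp L h u) y := by
    have := subsum_cons_snoc (flagged X) a' y' u'
    rw [snocFam_consFam_flagged, subsum_fun_zero, h2, h3, h4] at this
    rw [← sub_eq_zero, this]
    abel
  obtain ⟨e, he, hye⟩ := (H.act_treeOp_mem_nullPoints hh hu hy').2
  rw [h1, subsum_cons_snoc, H.subsum_compFam_flagged hh hboth (by omega : n + 1 + 1 ≤ B),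
    H.subsum_compFam_flagged hh hsnoc (by omega : n + 1 ≤ B),
    H.subsum_compFam_flagged hh hcons (by omega : n + 1 ≤ B),
    H.subsum_compFam_flagged hh hu' (by omega : n ≤ B), h2, h3, h4, h5,
    ptEval_add B H.ell_symm (H.treePoint_mem hh hu) (H.act_treeOp_mem hh hu hy') he hye,
    ptEval_add B H.ell_symm (H.treePoint_mem hh (forall_cons_mem hu ha))
      (H.act_treeOp_mem hh hu hy') he hye, act_mul, map_sub, LinearMap.sub_apply]
  abel

end

/-! ## The logarithm -/

theorem mul_mul_eq_zero_of_divBy {R : Type*} [Ring R] [Algebra k R] {e : A} (he : IsNull k e)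
    {P P' : R ⊗[k] A} (hP : P ∈ divBy (k := k) R e) (hP' : P' ∈ divBy (k := k) R e)
    (Z : R ⊗[k] A) : P * Z * P' = 0 := by
  obtain ⟨P, rfl⟩ := hP
  obtain ⟨P', rfl⟩ := hP'
  induction P using TensorProduct.induction_on with
  | zero => simp
  | add x y hx hy => rw [map_add, add_mul, add_mul, hx, hy, add_zero]
  | tmul x a =>
    induction P' using TensorProduct.induction_on with
    | zero => simp
    | add x y hx hy => rw [map_add, mul_add, hx, hy, add_zero]
    | tmul y b =>
      induction Z using TensorProduct.induction_on with
      | zero => simp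
      | add x y hx hy => rw [mul_add, add_mul, hx, hy, add_zero]
      | tmul z c =>
        have : e * a * c * (e * b) = 0 := by
          rw [mul_assoc e a c, ← mul_assoc, Grassmann.mul_mul_self_eq_zero he.1 he.2, zero_mul]
        rw [lact_tmul, lact_tmul, Algebra.TensorProduct.tmul_mul_tmul,
          Algebra.TensorProduct.tmul_mul_tmul, this, TensorProduct.tmul_zero]

/-- Products with two factors Z vanish, and the m + 1 terms with one factor Z have equal supertraces
by cyclicity. -/
theorem straceA_pow_add [CharZero k] {P Z : Module.End k V ⊗[k] A} (hP : P ∈ evenOps V A)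
    (hZ : Z ∈ evenOps V A) (hZZ : ∀ X, Z * X * Z = 0) (m : ℕ) :
    straceA V A ((P + Z) ^ (m + 1)) =
      straceA V A (P ^ (m + 1)) + ((m + 1 : ℕ) : k) • straceA V A (Z * P ^ m) := by
  -- S is the part of first order in Z. The extra factor P ^ r makes the statement inductive; at m =
  -- 0 the truncated subtraction is harmless because the coefficient is 0.
  have key : ∀ m : ℕ, ∃ S, (P + Z) ^ m = P ^ m + S ∧ (∀ X, S * X * Z = 0) ∧
      ∀ r : ℕ, straceA V A (S * P ^ r) = (m : k) • straceA V A (Z * P ^ (m - 1 + r)) := by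
    intro m
    induction m with
    | zero => exact ⟨0, by simp⟩
    | succ m ih =>
      obtain ⟨S, h1, h2, h3⟩ := ih
      refine ⟨S * P + P ^ m * Z, ?_, fun X => ?_, fun r => ?_⟩
      · have h4 := h2 1
        rw [mul_one] at h4
        rw [pow_succ, h1, add_mul, mul_add, mul_add, h4, pow_succ]
        abel
      · rw [add_mul, add_mul, mul_assoc S, h2, mul_assoc (P ^ m), mul_assoc (P ^ m), hZZ, mul_zero,
          add_zero]
      · rw [add_mul, map_add, mul_assoc, ← pow_succ', h3, mul_assoc (P ^ m),
          straceA_mul_comm (pow_mem_evenOps hP m) (mul_mem_evenOps hZ (pow_mem_evenOps hP r)),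
          mul_assoc, ← pow_add]
        rcases Nat.eq_zero_or_pos m with rfl | hm
        · simp
        · rw [show m - 1 + (r + 1) = m + r by omega, show m + 1 - 1 + r = m + r by omega,
            add_comm r m, Nat.cast_succ, add_smul, one_smul]
  obtain ⟨S, h1, -, h3⟩ := key (m + 1)
  have := h3 0
  rw [pow_zero, mul_one] at this
  rw [h1, map_add, this]
  simp

/-- The truncated series `-log det (1 - h M_x)`. -/
def logDet (B N : ℕ) (L : ∀ n, Multi V V n) (h : V →ₗ[k] V) (x : V ⊗[k] A) : k ⊗[k] A :=
  ∑ j ∈ range N, ((j + 1 : ℕ) : k)⁻¹ • straceA V A (opL h (ptOp B L x) ^ (j + 1))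

theorem ptOp_sub_mem_divBy [CharZero k] (B : ℕ) {L : ∀ n, Multi V V n} (hL : ∀ n, IsSymm (L n))
    {x y : V ⊗[k] A} (hx : x ∈ points V A) (hy : y ∈ points V A) {e : A} (he : IsNull k e)
    (hye : y ∈ divBy (k := k) V e) : ptOp B L (x + y) - ptOp B L x ∈ divBy (k := k) (V →ₗ[k] V) e := by
  cases B with
  | zero => simp [ptOp]
  | succ B =>
    have h1 := VanishesOn.expSum_add (k := k) (Φ := gextFam A (opFam L)) (P := points V A)
      (Z := divBy V e) (vanishesOn_gextFam he (opFam L)) (isSymmOn_opFam hL) hx hy hye B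
    rw [ptOp_eq_expSum, ptOp_eq_expSum, h1, add_sub_cancel_left]
    refine Submodule.sum_mem _ fun m _ => Submodule.smul_mem _ _ ?_
    rw [curryFam, MultilinearMap.curryLeft_apply]
    exact gext_mem_divBy he.1 (opFam L (m + 1)) _ 0 hye

section

variable [CharZero k] {L : ∀ n, Multi V V n} {Q : ∀ n, Multi V k n} {h : V →ₗ[k] V}
  {n : ℕ} {u : Fin n → V ⊗[k] A}

theorem IsSymmetricULInfty.treePoint_cons (H : IsSymmetricULInfty V L Q)
    (hh : IsHomogeneous V V (-1) h) {a : V ⊗[k] A} (ha : a ∈ nullPoints V A)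
    (hu : ∀ i, u i ∈ nullPoints V A) : treePoint L h (Fin.cons (α := fun _ => V ⊗[k] A) a u) =
      treePoint L h u + act (treeOp L h u) a := by
  rw [← treePoint_snoc]
  refine H.treePoint_congr hh (forall_cons_mem hu ha) (forall_snoc_mem hu ha) ?_
  rw [Fin.sum_univ_succ, Fin.sum_univ_castSucc, add_comm]
  simp

/-- The formula δ(-log det(1 - P)) = tr(δP (1 - P)⁻¹), exact here since δP lies in the square-zero
ideal of the null element belonging to a. The inverse is R, written as a Neumann series; in each
summand 1/(j + 1) cancels the factor from `straceA_pow_add`. -/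
theorem IsSymmetricULInfty.logDet_cons (H : IsSymmetricULInfty V L Q)
    (hh : IsHomogeneous V V (-1) h) {a : V ⊗[k] A} (ha : a ∈ nullPoints V A)
    (hu : ∀ i, u i ∈ nullPoints V A) {B : ℕ} (hB : n < B) :
    ∀ᶠ N in Filter.atTop, logDet B N L h (treePoint L h (Fin.cons (α := fun _ => V ⊗[k] A) a u)) =
      logDet B N L h (treePoint L h u) + straceA V A (opL h
        (ptOp B L (treePoint L h (Fin.cons (α := fun _ => V ⊗[k] A) a u)) -
          ptOp B L (treePoint L h u)) * treeOp L h u) := by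
  set x := treePoint L h u with hx
  set x' := treePoint L h (Fin.cons (α := fun _ => V ⊗[k] A) a u) with hx'
  have hxp : x ∈ points V A := H.treePoint_mem hh hu
  have hxp' : x' ∈ points V A := H.treePoint_mem hh (forall_cons_mem hu ha)
  have hP := opL_ptOp_mem B H.ell_degree H.ell_one hh hxp
  have hP' := opL_ptOp_mem B H.ell_degree H.ell_one hh hxp'
  obtain ⟨N, hN⟩ := exists_pow_eq_zero_of_mem_nilOps hP
  refine Filter.eventually_atTop.2 ⟨N, fun N' hN' => ?_⟩
  have hZ := sub_mem hP' hP
  rw [← map_sub] at hZ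
  obtain ⟨hy, e, he, hye⟩ := H.act_treeOp_mem_nullPoints hh hu ha
  have hZe : opL h (ptOp B L x' - ptOp B L x) ∈ divBy (k := k) (Module.End k V) e := by
    refine rTensor_mem_divBy _ ?_
    rw [hx', H.treePoint_cons hh ha hu]
    exact ptOp_sub_mem_divBy B H.ell_symm hxp hy he hye
  have hsum : opL h (ptOp B L x') = opL h (ptOp B L x) + opL h (ptOp B L x' - ptOp B L x) := by
    rw [← map_add, add_sub_cancel]
  rw [logDet, logDet, hsum, eq_sum_pow_of_eq (H.treeOp_eq hh hu hB) (hN N' hN'), Finset.mul_sum,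
    map_sum, ← Finset.sum_add_distrib]
  refine Finset.sum_congr rfl fun j _ => ?_
  rw [straceA_pow_add (nilOps_le_evenOps hP) (nilOps_le_evenOps hZ)
    fun X => mul_mul_eq_zero_of_divBy he hZe hZe X, smul_add, smul_smul,
    inv_mul_cancel₀ (Nat.cast_ne_zero.2 (Nat.succ_ne_zero j)), one_smul]

/-- The wheels that contain a are those given by trees separating a from the cut leg, so the
increment is the supertrace of h applied to `subsum_splitTrees`. -/
theorem IsSymmetricULInfty.subsum_wheelTrees_cons (H : IsSymmetricULInfty V L Q)
    (hh : IsHomogeneous V V (-1) h) {a : V ⊗[k] A} (ha : a ∈ nullPoints V A)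
    (hu : ∀ i, u i ∈ nullPoints V A) {B : ℕ} (hB : n + 2 ≤ B) :
    subsum (fun n z => gext A (wheelTrees L h n) z) (Fin.cons (α := fun _ => V ⊗[k] A) a u) =
      subsum (fun n z => gext A (wheelTrees L h n) z) u + straceA V A (opL h
        (ptOp B L (treePoint L h (Fin.cons (α := fun _ => V ⊗[k] A) a u)) -
          ptOp B L (treePoint L h u)) * treeOp L h u) := by
  rw [subsum_cons]
  congr 1
  have h1 := H.subsum_splitTrees hh ha hu hB
  have h2 := subsum_map ((straceA V A) ∘ₗ opL h).toAddMonoidHom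
    (consFam a fun n z => gext A (splitTrees L h n).curryRight z) u
  rw [h1] at h2
  rw [opL_eq_mul, mul_assoc, ← opL_eq_mul]
  refine Eq.trans ?_ h2
  congr 1
  funext m z
  exact gext_wheelTrees L h _

theorem ptOp_zero (B : ℕ) (hL1 : L 1 = 0) : ptOp B L (0 : V ⊗[k] A) = 0 := by
  refine Finset.sum_eq_zero fun m _ => ?_
  cases m with
  | zero =>
    have : gext A (L (0 + 1)).curryRight (fun _ => (0 : V ⊗[k] A)) = 0 := by
      simp only [hL1]
      exact gext_curryRight_zero _
    rw [this, smul_zero]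
  | succ m => rw [MultilinearMap.map_coord_zero _ 0 rfl, smul_zero]

/-- Both sides vanish on the empty family and grow by the same supertrace when a point is adjoined.
Cutting each wheel at one place, determined by the leg 0, thus accounts for the symmetry factors in
the logarithm. -/
theorem IsSymmetricULInfty.subsum_wheelTrees (H : IsSymmetricULInfty V L Q)
    (hh : IsHomogeneous V V (-1) h) (hu : ∀ i, u i ∈ nullPoints V A) {B : ℕ} (hB : n < B) :
    ∀ᶠ N in Filter.atTop, subsum (fun n z => gext A (wheelTrees L h n) z) u =
      logDet B N L h (treePoint L h u) := by
  induction n with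
  | zero =>
    refine Filter.Eventually.of_forall fun N => ?_
    have : treePoint L h u = 0 := by
      rw [treePoint, subsum_zero, innerTrees_zero H.ell_zero H.ell_one, gext_zero]
      rfl
    rw [this, logDet, ptOp_zero B H.ell_one, map_zero, subsum_zero, wheelTrees_zero, gext_zero]
    simp
  | succ n ih =>
    obtain ⟨a, u, rfl⟩ : ∃ b u', u = Fin.cons (α := fun _ => V ⊗[k] A) b u' :=
      ⟨u 0, Fin.tail u, (Fin.cons_self_tail u).symm⟩
    have ha : a ∈ nullPoints V A := hu 0
    have hu' : ∀ i, u i ∈ nullPoints V A := fun i => hu i.succ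
    filter_upwards [ih hu' (by omega), H.logDet_cons hh ha hu' (by omega : n < B)] with N h1 h2
    rw [H.subsum_wheelTrees_cons hh ha hu' (by omega : n + 2 ≤ B), h1]
    exact h2.symm

end

end DGSpace

/-! ### Supertraces and the derivative of the structure equation -/

namespace DGSpace

variable {k : Type u} [Field k] {V : DGSpace.{u, v} k} {U : DGSpace.{u, w} k}
  {T : Type*} [AddCommGroup T] [Module k T]
  {A : Type*} [Ring A] [Algebra k A] [Grassmann k A]

/-- An endomorphism of nonzero degree has supertrace zero. -/
theorem IsHomogeneous.strace_eq_zero [CharZero k] {φ : V →ₗ[k] V} {p : ℤ}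
    (hφ : IsHomogeneous V V p φ) (hp : p ≠ 0) : V.strace φ = 0 := by
  let E : Module.End k V := V.weight fun i => (i : k)
  let τ : Module.End k V := V.twist 1
  have h1 : E * φ - φ * E = (p : k) • (φ : Module.End k V) := by
    refine linearMap_ext_gr fun i x hx => ?_
    rw [LinearMap.sub_apply, Module.End.mul_apply, Module.End.mul_apply, LinearMap.smul_apply,
      weight_apply_of_mem V _ hx, weight_apply_of_mem V _ (hφ i x hx), map_smul, ← sub_smul]
    congr 1
    push_cast
    ring
  have h2 : E * τ = τ * E := by
    refine linearMap_ext_gr fun i x hx => ?_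
    rw [Module.End.mul_apply, Module.End.mul_apply, twist_of_mem_gr hx, weight_apply_of_mem V _ hx,
      map_smul, map_smul, weight_apply_of_mem V _ hx, twist_of_mem_gr hx, smul_comm]
  have h3 : (p : k) • V.strace φ = 0 := by
    rw [← map_smul, ← h1, strace_apply, mul_sub, map_sub, sub_eq_zero, ← mul_assoc, ← h2, mul_assoc,
      LinearMap.trace_mul_comm, mul_assoc]
  exact (smul_eq_zero.1 h3).resolve_left (Int.cast_ne_zero.2 hp)

theorem HasDegree.traceLast [CharZero k] {n : ℕ} {p : ℤ} {F : Multi V V (n + 1)}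
    (hF : HasDegree p F) : HasScalarDegree p (traceLast F) := fun i x hx hp => by
  refine IsHomogeneous.strace_eq_zero (p := ∑ j, i j + p) (fun q y hy => ?_) hp
  have := hF (Fin.snoc (α := fun _ => ℤ) i q) (Fin.snoc (α := fun _ => V) x y) fun j => by
    refine Fin.lastCases ?_ (fun j => ?_) j
    · simpa using hy
    · simpa using hx j
  rw [Fin.sum_univ_castSucc] at this
  simp only [Fin.snoc_castSucc, Fin.snoc_last] at this
  rw [MultilinearMap.curryRight_apply, show q + (∑ j, i j + p) = ∑ j, i j + q + p by ring]
  exact this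

theorem lact_gext_curryRight_mem {n : ℕ} {q : ℤ} {F : Multi V V (n + 1)} (hF : HasDegree q F)
    {θ : A} (hθ : θ ∈ Grassmann.par k (q : ZMod 2)) {z : Fin n → V ⊗[k] A}
    (hz : ∀ i, z i ∈ points V A) : lact (Module.End k V) θ (gext A F.curryRight z) ∈ evenOps V A := by
  refine MultilinearMap.mem_of_mem_span
    ((lact (Module.End k V) θ).compMultilinearMap (gext A F.curryRight)) (fun _ => purePoints V A) _
      (fun y hy => ?_) z hz
  choose p x hx a ha haa hxa using hy
  rw [show y = fun i => x i ⊗ₜ[k] a i from funext hxa, LinearMap.compMultilinearMap_apply,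
    gext_tmul, lact_tmul]
  refine Submodule.subset_span ⟨q + ∑ i, p i, _, fun r y hy => ?_, _,
    Grassmann.mul_mem hθ (Grassmann.prod_ofFn_mem a p ha), rfl⟩
  rw [MultilinearMap.curryRight_apply]
  have := hF.mem_par (p := Fin.snoc (α := fun _ => ZMod 2) p r)
    (x := Fin.snoc (α := fun _ => V) x y) fun i => by
      refine Fin.lastCases ?_ (fun i => ?_) i
      · simpa using hy
      · simpa using hx i
  rw [Fin.sum_univ_castSucc] at this
  simp only [Fin.snoc_castSucc, Fin.snoc_last] at this
  rwa [show r + ((q : ZMod 2) + ∑ i, p i) = ∑ i, p i + r + q by ring]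

theorem lact_ptOp_mem (B : ℕ) {L : ∀ n, Multi V V n} (hL : ∀ n, HasDegree 1 (L n)) {η : A}
    (hη : η ∈ Grassmann.par k (1 : ZMod 2)) {x : V ⊗[k] A} (hx : x ∈ points V A) :
    lact (Module.End k V) η (ptOp B L x) ∈ evenOps V A := by
  rw [ptOp, map_sum]
  refine Submodule.sum_mem _ fun m _ => ?_
  rw [map_smul]
  exact Submodule.smul_mem _ _ (lact_gext_curryRight_mem (hL _) (by simpa using hη) fun _ => hx)

/-- Precomposition of operators with coefficients in `A` with a linear map. -/
def opR (f : U →ₗ[k] V) : (V →ₗ[k] T) ⊗[k] A →ₗ[k] (U →ₗ[k] T) ⊗[k] A :=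
  (LinearMap.lcomp k T f).rTensor A

theorem act_opR (f : U →ₗ[k] V) (P : (V →ₗ[k] T) ⊗[k] A) (y : U ⊗[k] A) :
    act (opR f P) y = act P (f.rTensor A y) := by
  induction P using TensorProduct.induction_on with
  | zero => simp
  | add P P' h h' => simp only [map_add, LinearMap.add_apply, h, h']
  | tmul φ a =>
    induction y using TensorProduct.induction_on with
    | zero => simp
    | add y y' h h' => simp only [map_add, h, h']
    | tmul y b => rfl

/-- Cyclicity of the trace between two spaces; there is no sign because f has degree 0 and commutes
with the grading twist. -/
theorem straceA_opL_opR {f : U →ₗ[k] V} (hf : IsHomogeneous U V 0 f) (g : V →ₗ[k] U)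
    (Z : (V →ₗ[k] V) ⊗[k] A) : straceA U A (opL g (opR f Z)) = straceA V A (opL (f ∘ₗ g) Z) := by
  induction Z using TensorProduct.induction_on with
  | zero => simp
  | add P P' h h' => simp only [map_add, h, h']
  | tmul φ a =>
    have h1 : V.twist 1 ∘ₗ f = f ∘ₗ U.twist 1 := by
      ext x
      simp [twist_comm_of_isHomogeneous hf, sgn_zero]
    have h2 : V.twist 1 ∘ₗ (f ∘ₗ g) ∘ₗ φ = f ∘ₗ U.twist 1 ∘ₗ g ∘ₗ φ :=
      congrArg (fun F => F ∘ₗ g ∘ₗ φ) h1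
    change U.strace (g ∘ₗ φ ∘ₗ f) ⊗ₜ[k] a = V.strace ((f ∘ₗ g) ∘ₗ φ) ⊗ₜ a
    congr 1
    exact (LinearMap.trace_comp_comm' f (U.twist 1 ∘ₗ g ∘ₗ φ)).trans
      (congrArg (LinearMap.trace k V) h2.symm)

theorem act_eq_zero_of_divBy {e : A} (he : IsNull k e) {P : (V →ₗ[k] T) ⊗[k] A}
    (hP : P ∈ divBy (k := k) (V →ₗ[k] T) e) {z : V ⊗[k] A} (hz : z ∈ divBy (k := k) V e) :
    act P z = 0 := by
  obtain ⟨P, rfl⟩ := hP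
  obtain ⟨z, rfl⟩ := hz
  induction P using TensorProduct.induction_on with
  | zero => simp
  | add P P' h h' => simp only [map_add, LinearMap.add_apply, h, h', add_zero]
  | tmul φ a =>
    induction z using TensorProduct.induction_on with
    | zero => simp
    | add y y' h h' => simp only [map_add, h, h', add_zero]
    | tmul y b =>
      rw [lact_tmul, lact_tmul, act_tmul, ← mul_assoc, Grassmann.mul_mul_self_eq_zero he.1 he.2,
        zero_mul, TensorProduct.tmul_zero]

/-- Left multiplication by a coefficient, as an operator. -/
theorem lact_eq_mul {R : Type*} [Ring R] [Algebra k R] (η : A) (P : R ⊗[k] A) :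
    lact R η P = ((1 : R) ⊗ₜ[k] η) * P := by
  induction P using TensorProduct.induction_on with
  | zero => simp
  | tmul x c => rw [lact_tmul, Algebra.TensorProduct.tmul_mul_tmul, one_mul]
  | add z z' h h' => rw [map_add, h, h', mul_add]

theorem act_tmul_left (φ : V →ₗ[k] V) (η : A) (y : V ⊗[k] A) :
    act (φ ⊗ₜ[k] η) y = lact V η (φ.rTensor A y) := by
  induction y using TensorProduct.induction_on with
  | zero => simp
  | tmul x c => rfl
  | add z z' h h' => simp only [map_add, h, h']

theorem HasParity.tmul_mem {p : ZMod 2} {φ : V →ₗ[k] V} (hφ : HasParity p φ) {a : A}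
    (ha : a ∈ Grassmann.par k p) : φ ⊗ₜ[k] a ∈ evenOps V A :=
  Submodule.subset_span ⟨p, φ, hφ, a, ha, rfl⟩

theorem IsHomogeneous.hasParity {p : ℤ} {φ : V →ₗ[k] V} (hφ : IsHomogeneous V V p φ) :
    HasParity (p : ZMod 2) φ := fun _ _ hx => hφ.mem_par hx

theorem straceA_lact (η : A) (P : Module.End k V ⊗[k] A) :
    straceA V A (lact _ η P) = lact k η (straceA V A P) := rTensor_lact _ _ _

section

variable [CharZero k] {L : ∀ n, Multi V V n} {Q : ∀ n, Multi V k n} {h : V →ₗ[k] V}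
  {f : U →ₗ[k] V} {g : V →ₗ[k] U} {n : ℕ}

/-- The structure equation as an equation between operators. -/
theorem IsSymmetricULInfty.op_eq (H : IsSymmetricULInfty V L Q) {η : A}
    (hη : η ∈ Grassmann.par k (1 : ZMod 2)) {x : V ⊗[k] A} (hx : x ∈ points V A) :
    ∀ᶠ B in Filter.atTop,
      -- Membership of ηD(x) in the even points is assumed because the Taylor formula is applied in
      -- this direction.
      lact V η (V.d.rTensor A x + ptEval B L x) ∈ points V A →
      V.d ⊗ₜ[k] η * ptOp B L x + ptOp B L x * V.d ⊗ₜ[k] η +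
        ptOp B L x * lact (Module.End k V) η (ptOp B L x) +
        (ptOp B L (x + lact V η (V.d.rTensor A x + ptEval B L x)) - ptOp B L x) =
      (0 : Module.End k V ⊗[k] A) := by
  obtain ⟨n, u, hu, rfl⟩ := exists_sum_of_mem_points hx
  have key : ∀ {m} (u : Fin m → V ⊗[k] A), (∀ i, u i ∈ nullPoints V A) → ∀ B, m < B →
      lact V η (V.d.rTensor A (ptEval B L (∑ i, u i))) +
        act (ptOp B L (∑ i, u i)) (lact V η (V.d.rTensor A (∑ i, u i) + ptEval B L (∑ i, u i))) =
          0 := by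
    intro m u hu B hB
    have h := subsum_ell_eq H.ell_symm hη hu
    rw [subsum_gextFam H.ell_symm H.ell_zero hu hB.le, subsum_opFam H.ell_symm hu hB] at h
    rw [← h]
    refine subsum_eq_zero (D := nullPoints V A) (fun m z _ => ?_) hu
    rw [H.ell_eq, gext_zero]
    exact map_zero _
  refine Filter.eventually_atTop.2 ⟨n + 2, fun B hB hD => ?_⟩
  refine op_ext fun y hy => ?_
  have hy' := nullPoints_of_mem_purePoints hy
  have h1 := key u hu B (by omega)
  have h2 := key (Fin.snoc (α := fun _ => V ⊗[k] A) u y) (forall_snoc_mem hu hy') B (by omega)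
  rw [Fin.sum_univ_castSucc] at h2
  simp only [Fin.snoc_castSucc, Fin.snoc_last] at h2
  set x := ∑ i, u i
  set M := ptOp B L x
  set D := lact V η (V.d.rTensor A x + ptEval B L x) with hDdef
  obtain ⟨e, he, hye⟩ := hy'.2
  have hDη : D ∈ divBy (k := k) V η := ⟨_, rfl⟩
  have hE := ptEval_add B H.ell_symm hx hy'.1 he hye
  -- Symmetry of the second derivative: both sides are the mixed second difference of E in the
  -- directions y and ηD.
  have h3 : act (ptOp B L (x + y)) D - act M D = act (ptOp B L (x + D)) y - act M y := by
    have e1 := ptEval_add B H.ell_symm (add_mem hx hy'.1) hD (isNull_of_odd hη) hDη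
    have e2 := ptEval_add B H.ell_symm (add_mem hx hD) hy'.1 he hye
    have e3 := ptEval_add B H.ell_symm hx hD (isNull_of_odd hη) hDη
    rw [hE] at e1
    rw [e3, add_right_comm, e1] at e2
    have := sub_eq_zero.2 e2
    rw [← sub_eq_zero, ← this]
    abel
  -- Operator and argument are both divisible by the null element of y, so this term is of second
  -- order in y.
  have h4 : act (ptOp B L (x + y) - M) (lact V η (V.d.rTensor A y + act M y)) = 0 := by
    have hP : ptOp B L (x + y) - M ∈ divBy (k := k) (V →ₗ[k] V) e :=
      ptOp_sub_mem_divBy B H.ell_symm hx hy'.1 he hye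
    have hz : lact V η (V.d.rTensor A y + act M y) ∈ divBy (k := k) V e :=
      lact_mem_divBy he.1 _ (add_mem (rTensor_mem_divBy _ hye) (act_mem_divBy he.1 _ hye))
    exact act_eq_zero_of_divBy he hP hz
  rw [hE, show V.d.rTensor A (x + y) + (ptEval B L x + act M y) =
      (V.d.rTensor A x + ptEval B L x) + (V.d.rTensor A y + act M y) by rw [map_add]; abel,
    map_add (lact V η), map_add (act (ptOp B L (x + y)))] at h2
  rw [map_sub, LinearMap.sub_apply, sub_eq_zero] at h4
  rw [h4, ← hDdef] at h2
  rw [map_add, LinearMap.add_apply, map_sub, LinearMap.sub_apply, ← h3]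
  simp only [map_add, LinearMap.add_apply, act_mul, act_tmul_left,
    act_lact_left, map_zero, LinearMap.zero_apply]
  have h5 := sub_eq_zero.2 (h2.trans h1.symm)
  rw [← h5]
  simp only [map_add]
  abel

end

end DGSpace

/-! ### The transferred scalar operations -/

namespace DGSpace

variable {k : Type u} [Field k] {V : DGSpace.{u, v} k} {U : DGSpace.{u, w} k}
  {T : Type*} [AddCommGroup T] [Module k T]
  {A : Type*} [Ring A] [Algebra k A] [Grassmann k A]

/-- The transferred scalar operation `∑ θ f^{⊗ n}`. -/
def transferredQ (L : ∀ n, Multi V V n) (Q : ∀ n, Multi V k n) (f : U →ₗ[k] V) (h : V →ₗ[k] V) :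
    ∀ n, Multi U k n :=
  pullFam f fun n => graftTrees Q L h n + wheelTrees L h n

section

variable [CharZero k] {L : ∀ n, Multi V V n} {Q : ∀ n, Multi V k n} {h : V →ₗ[k] V}
  {f : U →ₗ[k] V} {g : V →ₗ[k] U} {n : ℕ}

theorem IsSymmetricULInfty.transferredQ_zero (H : IsSymmetricULInfty V L Q) :
    transferredQ L Q f h 0 = 0 := by
  ext x
  simp [transferredQ, pullFam, graftTrees_zero H.q_zero, wheelTrees_zero]

theorem IsSymmetricULInfty.hasScalarDegree_transferredQ (H : IsSymmetricULInfty V L Q)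
    (hh : IsHomogeneous V V (-1) h) (hf : IsHomogeneous U V 0 f) (n : ℕ) :
    HasScalarDegree 0 (transferredQ L Q f h n) := fun i x hx hi => by
  have hx' : ∀ j, f (x j) ∈ V.gr (i j) := fun j => by simpa using hf _ _ (hx j)
  have h1 : HasScalarDegree 0 (graftTrees Q L h n) := HasScalarDegree.sum fun c _ =>
    hasScalarDegree_graft c (H.q_degree _) fun m => hasDegree_innerTrees H.ell_degree hh _
  have h2 : HasDegree 1 (splitTrees L h n) := HasDegree.sum fun c _ =>
    hasDegree_graft c.1 (H.ell_degree _) fun m => hasDegree_innerTrees H.ell_degree hh _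
  have h3 : HasScalarDegree 0 (wheelTrees L h n) := by
    have := (h2.comp hh).traceLast
    rwa [add_neg_cancel] at this
  change graftTrees Q L h n (fun j => f (x j)) + wheelTrees L h n (fun j => f (x j)) = 0
  rw [h1 i _ hx' hi, h3 i _ hx' hi, add_zero]

theorem IsSymmetricULInfty.subsum_transferredQ (H : IsSymmetricULInfty V L Q)
    (hh : IsHomogeneous V V (-1) h) (hf : IsHomogeneous U V 0 f) {u : Fin n → U ⊗[k] A}
    (hu : ∀ i, u i ∈ nullPoints U A) {B : ℕ} (hB : n ≤ B) :
    subsum (fun n z => gext A (transferredQ L Q f h n) z) u =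
      ptEval B Q (treePoint L h (f.rTensor A ∘ u)) +
        subsum (fun n z => gext A (wheelTrees L h n) z) (f.rTensor A ∘ u) := by
  have hu' : ∀ i, (f.rTensor A ∘ u) i ∈ nullPoints V A := fun i => rTensor_mem_nullPoints hf (hu i)
  rw [transferredQ, subsum_pullFam]
  simp only [gext_add, add_apply, subsum_add]
  rw [H.subsum_graftTrees hh H.q_symm H.q_zero hu' hB]

/-- The choice of cut singles out the leg 0, so symmetry of the wheel sum is not visible; it follows
because the logarithm of the determinant depends on the tree point alone. -/
theorem IsSymmetricULInfty.subsum_wheelTrees_congr (H : IsSymmetricULInfty V L Q)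
    (hh : IsHomogeneous V V (-1) h) {n m : ℕ} {u : Fin n → V ⊗[k] A} {u' : Fin m → V ⊗[k] A}
    (hu : ∀ i, u i ∈ nullPoints V A) (hu' : ∀ i, u' i ∈ nullPoints V A)
    (he : ∑ i, u i = ∑ i, u' i) :
    subsum (fun n z => gext A (wheelTrees L h n) z) u =
      subsum (fun n z => gext A (wheelTrees L h n) z) u' := by
  obtain ⟨N, h1, h2⟩ := ((H.subsum_wheelTrees hh hu (Nat.lt_succ_of_le (le_max_left n m))).and
    (H.subsum_wheelTrees hh hu' (Nat.lt_succ_of_le (le_max_right n m)))).exists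
  rw [h1, h2, H.treePoint_congr hh hu hu' he]

theorem IsSymmetricULInfty.isSymm_transferredQ (H : IsSymmetricULInfty V L Q) [Nontrivial A]
    (hh : IsHomogeneous V V (-1) h) (hf : IsHomogeneous U V 0 f) (n : ℕ) :
    IsSymm (transferredQ L Q f h n) := by
  refine isSymm_of_subsum_congr (A := A) (fun {n m} u u' hu hu' he => ?_) n
  have h1 : ∀ i, (f.rTensor A ∘ u) i ∈ nullPoints V A := fun i => rTensor_mem_nullPoints hf (hu i)
  have h2 : ∀ i, (f.rTensor A ∘ u') i ∈ nullPoints V A := fun i => rTensor_mem_nullPoints hf (hu' i)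
  have he' : ∑ i, (f.rTensor A ∘ u) i = ∑ i, (f.rTensor A ∘ u') i := by
    simp only [Function.comp_apply, ← map_sum, he]
  rw [H.subsum_transferredQ hh hf hu (le_max_left n m),
    H.subsum_transferredQ hh hf hu' (le_max_right n m), H.treePoint_congr hh h1 h2 he',
    H.subsum_wheelTrees_congr hh h1 h2 he']

theorem IsSymmetricULInfty.subsum_wheelTrees_snoc (H : IsSymmetricULInfty V L Q)
    (hh : IsHomogeneous V V (-1) h) {u : Fin n → V ⊗[k] A} {a : V ⊗[k] A}
    (ha : a ∈ nullPoints V A) (hu : ∀ i, u i ∈ nullPoints V A) {B : ℕ} (hB : n + 2 ≤ B) :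
    subsum (fun n z => gext A (wheelTrees L h n) z) (Fin.snoc (α := fun _ => V ⊗[k] A) u a) =
      subsum (fun n z => gext A (wheelTrees L h n) z) u + straceA V A (opL h
        (ptOp B L (treePoint L h u + act (treeOp L h u) a) -
          ptOp B L (treePoint L h u)) * treeOp L h u) := by
  rw [← H.treePoint_cons hh ha hu, ← H.subsum_wheelTrees_cons hh ha hu hB]
  refine (H.subsum_wheelTrees_congr hh (forall_cons_mem hu ha) (forall_snoc_mem hu ha) ?_).symm
  rw [Fin.sum_univ_succ, Fin.sum_univ_castSucc, add_comm]
  simp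

theorem IsSymmetricULInfty.opFam_transferredEll (H : IsSymmetricULInfty V L Q)
    (hh : IsHomogeneous V V (-1) h) (hf : IsHomogeneous U V 0 f) {u : Fin n → U ⊗[k] A}
    (hu : ∀ i, u i ∈ nullPoints U A) {B : ℕ} (hB : n < B) :
    subsum (fun n z => gext A (opFam (transferredEll L f g h) n) z) u =
      opL g (opR f (ptOp B L (treePoint L h (f.rTensor A ∘ u)) * treeOp L h (f.rTensor A ∘ u))) :=
  op_ext fun y hy => by
    rw [H.act_opFam_transferredEll hh hf hu (nullPoints_of_mem_purePoints hy) hB, act_opL, act_opR,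
      act_mul]

/-- The ring computation behind `straceA_variation`, kept apart from operators. There P = hM, δ = d
⊗ η, E = ηM, H = hδM, G = fgE, and N stands for h applied to the variation of M. -/
theorem mul_eq_of_eq_neg_add {S : Type*} [Ring S] {N G H E P δ : S} (hN : N = -(H + P * δ + P * E))
    (hG : G = E + δ * P + H) (R : S) :
    N * R = (1 - P) * E * R - G * R + δ * (P * R) - P * δ * R := by
  rw [hN, hG]
  noncomm_ring

/-- The first variation of the logarithm of the determinant along the differential. -/
theorem straceA_variation {M N R : Module.End k V ⊗[k] A}
    (hfg : ∀ x : V, f (g x) - x = V.d (h x) + h (V.d x)) {η : A}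
    (hη : η ∈ Grassmann.par k (1 : ZMod 2)) (hM : lact (Module.End k V) η M ∈ evenOps V A)
    (hP : opL h M ∈ evenOps V A) (hR : R ∈ evenOps V A)
    (h1 : R = 1 + opL h M * R) (h2 : R * (1 - opL h M) = 1)
    (h3 : V.d ⊗ₜ[k] η * M + M * V.d ⊗ₜ[k] η + M * lact (Module.End k V) η M + N = 0) :
    straceA V A (opL h N * R) = lact k η (straceA V A M) -
      lact k η (straceA V A (opL (f ∘ₗ g) (M * R))) := by
  set P : Module.End k V ⊗[k] A := opL h M with hPdef
  set δ : Module.End k V ⊗[k] A := (V.d : Module.End k V) ⊗ₜ[k] η with hδ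
  set E := lact (Module.End k V) η M with hE
  have hδe : δ ∈ evenOps V A := HasParity.tmul_mem (by simpa using V.isHomogeneous_d.hasParity) hη
  -- The homotopy relation fg = 1 + dh + hd, multiplied by η and by M.
  have hG : opL (f ∘ₗ g) (E : Module.End k V ⊗[k] A) =
      E + δ * P + opL h (δ * M) := by
    have e1 : ((f ∘ₗ g : Module.End k V)) ⊗ₜ[k] (1 : A) * (1 ⊗ₜ[k] η) =
        (1 : Module.End k V) ⊗ₜ[k] η + δ * ((h : Module.End k V) ⊗ₜ[k] (1 : A)) +
          (h : Module.End k V) ⊗ₜ[k] (1 : A) * δ := by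
      simp only [hδ, Algebra.TensorProduct.tmul_mul_tmul, mul_one, one_mul,
        ← TensorProduct.add_tmul]
      congr 1
      ext x
      have := hfg x
      rw [sub_eq_iff_eq_add] at this
      simp only [LinearMap.comp_apply, LinearMap.add_apply, Module.End.mul_apply,
        Module.End.one_apply, this]
      abel
    rw [hE, hPdef, opL_eq_mul, opL_eq_mul, opL_eq_mul, lact_eq_mul, ← mul_assoc, e1, add_mul,
      add_mul, mul_assoc, mul_assoc]
  -- R is a two-sided inverse of 1 - P, hence commutes with P; this lets the two terms containing δ
  -- cancel under the supertrace.
  have hRP : R * P = P * R := by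
    have : R - R * P = R - P * R := by
      rw [mul_sub, mul_one] at h2
      rw [h2, eq_sub_iff_add_eq, ← h1]
    simpa using this
  have hN : opL h N * R = (1 - P) * E * R - opL (f ∘ₗ g) E * R + δ * (P * R) - P * δ * R := by
    have e2 : opL h N = -(opL h (δ * M) + P * δ + P * E) := by
      rw [eq_neg_of_add_eq_zero_right h3, map_neg, map_add, map_add, opL_eq_mul h (M * δ),
        opL_eq_mul h (M * E), hPdef, opL_eq_mul h M, mul_assoc, mul_assoc]
    exact mul_eq_of_eq_neg_add e2 hG R
  have t1 : straceA V A ((1 - P) * E * R) = lact k η (straceA V A M) := by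
    rw [straceA_mul_comm (mul_mem_evenOps (sub_mem one_mem_evenOps hP) hM) hR, ← mul_assoc, h2,
      one_mul, hE, straceA_lact]
  have t2 : straceA V A (opL (f ∘ₗ g) E * R) =
      lact k η (straceA V A (opL (f ∘ₗ g) (M * R))) := by
    rw [← straceA_lact]
    congr 1
    rw [opL_eq_mul, opL_eq_mul, hE, lact_eq_mul, lact_eq_mul]
    simp only [← mul_assoc, Algebra.TensorProduct.tmul_mul_tmul, mul_one, one_mul]
  have t3 : straceA V A (δ * (P * R)) = straceA V A (P * δ * R) := by
    rw [straceA_mul_comm hδe (mul_mem_evenOps hP hR), straceA_mul_comm (mul_mem_evenOps hP hδe) hR,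
      ← mul_assoc, hRP]
  rw [hN, map_sub, map_add, map_sub, t1, t2, t3]
  abel

/-- Along the transferred vector field the tree point moves by ηD(x). The variation of q is -η str
E'(x) by the structure equation, that of the wheels is η str E'(x) - η str(fgE'(x)R). What remains
is the negative of η str(gE'(x)Rf), taken over U. -/
theorem IsSymmetricULInfty.transferredQ_eq (H : IsSymmetricULInfty V L Q) [Nontrivial A]
    (hh : IsHomogeneous V V (-1) h) (hf : IsChainMap U V f) (hg : IsChainMap V U g)
    (hfg : ∀ x : V, f (g x) - x = V.d (h x) + h (V.d x)) (n : ℕ) :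
    compTensorD (transferredQ L Q f h n) +
      composeAll (transferredQ L Q f h) (transferredEll L f g h) n +
      traceLast (transferredEll L f g h (n + 1)) = 0 := by
  refine eq_zero_of_subsum_lact (A := A) (F := fun n => compTensorD (transferredQ L Q f h n) +
      composeAll (transferredQ L Q f h) (transferredEll L f g h) n +
      traceLast (transferredEll L f g h (n + 1))) (fun η hη n u hu => ?_) n
  have hu' : ∀ i, (f.rTensor A ∘ u) i ∈ nullPoints V A :=
    fun i => rTensor_mem_nullPoints hf.1 (hu i)
  have hx := H.treePoint_mem hh hu'
  obtain ⟨B, ⟨⟨hE, hop⟩, hq⟩, hB⟩ := ((((H.ell_point hη hx).and (H.op_eq hη hx)).and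
    (H.q_point hη hx)).and (Filter.eventually_ge_atTop (n + 2))).exists
  have hv := H.lact_differential_mem (g := g) hh hf.1 hg.1 hu hη
  have hv' := rTensor_mem_nullPoints hf.1 hv
  have hRv := H.act_treeOp_differential hh hf hfg hu η (by omega : n < B) hE
  rw [← H.subsum_transferredEll hh hf.1 hu (by omega : n ≤ B)] at hRv
  rw [subsum_q_eq (fun n => H.isSymm_transferredQ (A := A) hh hf.1 n) hη hu]
  set v := lact U η (U.d.rTensor A (∑ i, u i) +
    subsum (fun n z => gext A (transferredEll L f g h n) z) u) with hvdef
  -- The vector v is divisible by η, hence a null point. It can be adjoined to the family, so that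
  -- the derivative along v is an actual increment of the generating function.
  have h1 := act_snocFam (F := transferredQ L Q f h) u v
  rw [H.subsum_transferredQ hh hf.1 (forall_snoc_mem hu hv) (by omega : n + 1 ≤ B),
    H.subsum_transferredQ hh hf.1 hu (by omega : n ≤ B), Fin.comp_snoc,
    H.ptEval_treePoint_snoc hh H.q_symm hu' hv', H.subsum_wheelTrees_snoc hh hv' hu' hB, hRv] at h1
  have hD := (H.act_treeOp_mem hh hu' hv')
  rw [hRv] at hD
  have h2 := straceA_variation hfg hη (lact_ptOp_mem B H.ell_degree hη hx)
    (nilOps_le_evenOps (opL_ptOp_mem B H.ell_degree H.ell_one hh hx)) (H.treeOp_mem hh hu')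
    (H.treeOp_eq hh hu' (by omega : n < B)) (H.treeOp_mul hh hu' (by omega : n < B)) (hop hD)
  rw [H.opFam_transferredEll hh hf.1 hu (by omega : n < B), straceA_opL_opR hf.1]
  rw [h2] at h1
  have h3 := sub_eq_zero.2 h1
  rw [← neg_eq_zero, ← h3]
  rw [eq_neg_of_add_eq_zero_left hq]
  abel

/-- The transferred structure. -/
theorem IsSymmetricULInfty.transferred (H : IsSymmetricULInfty V L Q)
    (hh : IsHomogeneous V V (-1) h) (hf : IsChainMap U V f) (hg : IsChainMap V U g)
    (hfg : ∀ x : V, f (g x) - x = V.d (h x) + h (V.d x)) :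
    IsSymmetricULInfty U (transferredEll L f g h) (transferredQ L Q f h) where
  ell_zero := H.transferredEll_zero
  ell_one := H.transferredEll_one
  q_zero := H.transferredQ_zero
  ell_degree := H.hasDegree_transferredEll hh hf.1 hg.1
  q_degree := H.hasScalarDegree_transferredQ hh hf.1
  ell_symm := H.isSymm_transferredEll (A := ExteriorAlgebra k (ℕ →₀ k)) hh hf.1
  q_symm := H.isSymm_transferredQ (A := ExteriorAlgebra k (ℕ →₀ k)) hh hf.1
  ell_eq := H.transferredEll_eq (A := ExteriorAlgebra k (ℕ →₀ k)) hh hf hg hfg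
  q_eq := H.transferredQ_eq (A := ExteriorAlgebra k (ℕ →₀ k)) hh hf hg hfg

end

end DGSpace

/-! ## Parity change -/

/-- The number of inversions involving i is congruent to i + e i modulo 2, since it counts the
symmetric difference of {j | j < i} and {j | e j < e i}. -/
theorem prod_ite_lt_mul_prod_ite_lt {n : ℕ} (e : Fin n ≃ Fin n) (i : Fin n) {s : ℤ} (hs : s * s = 1) :
    (∏ j, if i < j ∧ e j < e i then s else 1) * (∏ j, if j < i ∧ e i < e j then s else 1) =
      s ^ (i : ℕ) * s ^ (e i : ℕ) := by
  have h1 : s ^ (i : ℕ) = ∏ j, if j < i then s else 1 := by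
    rw [Finset.prod_ite, Finset.prod_const_one, mul_one, Finset.prod_const]
    congr 1
    rw [show (univ.filter fun j => j < i) = Finset.Iio i by ext; simp, Fin.card_Iio]
  have h2 : s ^ (e i : ℕ) = ∏ j, if e j < e i then s else 1 := by
    rw [Equiv.prod_comp e fun j => if j < e i then s else 1, Finset.prod_ite,
      Finset.prod_const_one, mul_one, Finset.prod_const]
    congr 1
    rw [show (univ.filter fun j => j < e i) = Finset.Iio (e i) by ext; simp, Fin.card_Iio]
  rw [h1, h2, ← Finset.prod_mul_distrib, ← Finset.prod_mul_distrib]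
  refine Finset.prod_congr rfl fun j _ => ?_
  rcases lt_trichotomy i j with h | rfl | h
  · have : e i ≠ e j := fun h' => h.ne (e.injective h')
    simp [h, h.not_gt]
  · simp
  · have : e i ≠ e j := fun h' => h.ne' (e.injective h')
    rcases this.lt_or_gt with h' | h'
    · simp [h, h.not_gt, h', h'.not_gt]
    · simp [h, h.not_gt, h', h'.not_gt, hs]

namespace DGSpace

/-- The sign comparison that turns graded skew symmetry on V into graded symmetry on V[1]: the outer
products are the signs of s ⊗ ⋯ ⊗ s before and after the permutation. -/
theorem koszulSign_add_one {n : ℕ} (e : Fin n ≃ Fin n) (p : Fin n → ZMod 2) :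
    (∏ i, paritySign 1 (p i) ^ (i.rev : ℕ)) * koszulSign e (fun i => p i + 1) =
      inversionSign e * koszulSign e p * ∏ i, paritySign 1 (p i) ^ ((e i).rev : ℕ) := by
  have hs : ∀ i, paritySign 1 (p i) * paritySign 1 (p i) = 1 := fun i => paritySign_mul_self _ _
  -- For every inversion, (p_i + 1)(p_j + 1) + 1 + p_i p_j = p_i + p_j modulo 2. Hence each i
  -- contributes its parity sign once for every inversion it takes part in.
  have h1 : koszulSign e (fun i => p i + 1) * (inversionSign e * koszulSign e p) =
      ∏ i, paritySign 1 (p i) ^ (i : ℕ) * paritySign 1 (p i) ^ (e i : ℕ) := by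
    rw [Finset.prod_congr rfl fun i _ => (prod_ite_lt_mul_prod_ite_lt e i (hs i)).symm,
      Finset.prod_mul_distrib, Finset.prod_comm (f := fun i j =>
        if j < i ∧ e i < e j then paritySign 1 (p i) else 1)]
    simp only [inversionSign, koszulSign, ← Finset.prod_mul_distrib]
    refine Finset.prod_congr rfl fun i _ => Finset.prod_congr rfl fun j _ => ?_
    by_cases h : i < j ∧ e j < e i
    · simp only [h, true_and]
      rcases zmod_two_cases (p i) with hi | hi <;> rcases zmod_two_cases (p j) with hj | hj <;>
        simp [hi, hj, paritySign]
    · have h' : ∀ P Q : Prop, (i < j ∧ e j < e i ∧ P ∧ Q) ↔ False := fun P Q =>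
        iff_false_intro fun h'' => h ⟨h''.1, h''.2.1⟩
      simp only [h, h', if_false, mul_one]
  have h2 : (inversionSign e * koszulSign e p) * (inversionSign e * koszulSign e p) = 1 := by
    rw [mul_mul_mul_comm, koszulSign_mul_self, inversionSign, koszulSign_mul_self, one_mul]
  have h3 : (∏ i, paritySign 1 (p i) ^ (i.rev : ℕ)) *
      ∏ i, paritySign 1 (p i) ^ (i : ℕ) * paritySign 1 (p i) ^ (e i : ℕ) =
        ∏ i, paritySign 1 (p i) ^ ((e i).rev : ℕ) := by
    rw [← Finset.prod_mul_distrib]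
    refine Finset.prod_congr rfl fun i _ => ?_
    have e1 : (i.rev : ℕ) + i = n - 1 := by rw [Fin.val_rev]; omega
    have e2 : ((e i).rev : ℕ) + e i = n - 1 := by rw [Fin.val_rev]; omega
    rw [← mul_assoc, ← pow_add, e1, ← e2, pow_add, mul_assoc, ← mul_pow, hs, one_pow, mul_one]
  rw [← h3, ← h1]
  linear_combination (-((∏ i, paritySign 1 (p i) ^ (i.rev : ℕ)) * koszulSign e fun i => p i + 1)) * h2

variable {k : Type u} [Field k] {V : DGSpace.{u, v} k}
  {T : Type*} [AddCommGroup T] [Module k T]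

theorem sgn_natCast_mul (n : ℕ) (d : ℤ) : sgn k (n * d) = ((paritySign 1 (d : ZMod 2)) ^ n : ℤ) := by
  have h : sgn k d = ((paritySign 1 (d : ZMod 2) : ℤ) : k) := by
    have := sgn_eq (k := k) 1 d
    rwa [one_mul, Int.cast_one] at this
  induction n with
  | zero => simp [sgn_zero]
  | succ n ih => rw [Nat.cast_succ, add_mul, one_mul, sgn_add, ih, pow_succ, h]; push_cast; rfl

variable (V T) in
/-- The parity change `f ↦ f (s ⊗ ⋯ ⊗ s)`. -/
def parityChange (n : ℕ) : Multi V T n ≃ₗ[k] Multi V.shift T n where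
  toFun f := f.compLinearMap fun i => V.susp.toLinearMap ∘ₗ V.shift.twist (i.rev : ℕ)
  map_add' _ _ := rfl
  map_smul' _ _ := rfl
  invFun F := F.compLinearMap fun i => V.shift.twist (i.rev : ℕ) ∘ₗ V.susp.symm.toLinearMap
  left_inv f := by
    ext x
    simp only [MultilinearMap.compLinearMap_apply, LinearMap.comp_apply, LinearEquiv.coe_coe,
      twist_twist, twist_of_even ⟨_, rfl⟩, LinearMap.id_apply, LinearEquiv.apply_symm_apply]
  right_inv f := by
    ext x
    simp only [MultilinearMap.compLinearMap_apply, LinearMap.comp_apply, LinearEquiv.coe_coe,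
      twist_twist, twist_of_even ⟨_, rfl⟩, LinearMap.id_apply, LinearEquiv.symm_apply_apply]

theorem parityChange_apply {n : ℕ} (f : Multi V T n) (d : Fin n → ℤ) (x : Fin n → V.shift)
    (hx : ∀ i, x i ∈ V.shift.gr (d i)) :
    parityChange V T n f x = (∏ i, sgn k ((i.rev : ℕ) * d i)) • f fun i => V.susp (x i) := by
  rw [← MultilinearMap.map_smul_univ]
  refine congrArg f (funext fun i => ?_)
  rw [LinearMap.comp_apply, twist_of_mem_gr (hx i), map_smul]
  rfl

theorem parityChange_relabel {n m : ℕ} (e : Fin n ≃ Fin m) (f : Multi V T m) :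
    parityChange V T n (relabel e f) = inversionSign e • relabel e (parityChange V T m f) := by
  obtain rfl : n = m := by simpa using Fintype.card_congr e
  refine multi_ext_gr fun d x hx => ?_
  have hx' : ∀ i, V.susp (x i) ∈ V.par ((d i : ZMod 2) + 1) := fun i => by
    have := mem_par_of_mem_gr (V := V) (i := d i + 1) (hx i)
    rwa [Int.cast_add, Int.cast_one] at this
  rw [parityChange_apply _ d x hx, relabel_apply_of_mem_par e f _ _ hx', _root_.smul_apply,
    relabel_apply_of_mem_par e _ _ x fun i => mem_par_of_mem_gr (hx i),
    parityChange_apply _ (fun j => d (e.symm j)) _ fun j => hx (e.symm j)]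
  have h := congrArg (Int.cast (R := k)) (koszulSign_add_one e fun i => (d i : ZMod 2))
  rw [← Equiv.prod_comp e fun j => sgn k ((j.rev : ℕ) * d (e.symm j))]
  simp only [Equiv.symm_apply_apply, sgn_natCast_mul]
  push_cast at h ⊢
  simp only [← Int.cast_smul_eq_zsmul k, smul_smul, h, mul_assoc]

/-- The sign (-1)^(|I||J|) of the axioms arises here, from exchanging the b suspensions of the inner
map with the a first inputs. -/
theorem parityChange_compLast {a b : ℕ} (f : Multi V T (a + 1)) (g : Multi V V b) :
    parityChange V T (a + b) (compLast (2 - b) f g) =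
      ((-1) ^ (a * b) : ℤ) • compLast 1 (parityChange V T (a + 1) f) (tilde g) := by
  refine multi_ext_gr fun d x hx => ?_
  rw [_root_.smul_apply, compLast_apply, parityChange_apply _ d x hx, compLast_apply]
  have h1 : tilde g (fun j => x (Fin.natAdd a j)) =
      V.susp.symm (parityChange V V b g fun j => x (Fin.natAdd a j)) := rfl
  rw [h1, parityChange_apply g _ _ fun j => hx (Fin.natAdd a j)]
  have h2 : ∀ y : Fin (a + 1) → V.shift, parityChange V T (a + 1) f y =
      f fun i => V.susp (V.shift.twist (i.rev : ℕ) (y i)) := fun y => rfl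
  rw [h2]
  have h3 : (fun i : Fin (a + 1) => V.susp (V.shift.twist (i.rev : ℕ)
      (Fin.snoc (α := fun _ => V.shift) (fun i => V.shift.twist 1 (x (Fin.castAdd b i)))
        (V.susp.symm ((∏ j : Fin b, sgn k ((j.rev : ℕ) * d (Fin.natAdd a j))) •
          g fun j => V.susp (x (Fin.natAdd a j)))) i))) =
    fun i : Fin (a + 1) => (Fin.snoc (α := fun _ => k)
      (fun i => sgn k (((i.castSucc.rev : ℕ) + 1) * d (Fin.castAdd b i)))
        (∏ j : Fin b, sgn k ((j.rev : ℕ) * d (Fin.natAdd a j))) i) •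
      (Fin.snoc (α := fun _ => V) (fun i : Fin a => V.susp (x (Fin.castAdd b i)))
        (g fun j : Fin b => V.susp (x (Fin.natAdd a j))) i) := by
    funext i
    refine Fin.lastCases ?_ (fun i => ?_) i
    · simp only [Fin.snoc_last, Fin.rev_last, Fin.val_zero, Nat.cast_zero, twist_zero,
        LinearMap.id_apply, LinearEquiv.apply_symm_apply]
    · simp only [Fin.snoc_castSucc, twist_twist]
      rw [twist_of_mem_gr (hx _), map_smul]
  rw [h3, MultilinearMap.map_smul_univ]
  have h4 : (fun i : Fin (a + 1) => Fin.snoc (α := fun _ => V)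
      (fun i : Fin a => V.twist (2 - b) (V.susp (x (Fin.castAdd b i))))
        (g fun j : Fin b => V.susp (x (Fin.natAdd a j))) i) =
    fun i : Fin (a + 1) => (Fin.snoc (α := fun _ => k)
      (fun i => sgn k ((2 - b) * (d (Fin.castAdd b i) + 1))) 1 i) •
      (Fin.snoc (α := fun _ => V) (fun i : Fin a => V.susp (x (Fin.castAdd b i)))
        (g fun j : Fin b => V.susp (x (Fin.natAdd a j))) i) := by
    funext i
    refine Fin.lastCases ?_ (fun i => ?_) i
    · simp only [Fin.snoc_last, one_smul]
    · simp only [Fin.snoc_castSucc]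
      exact twist_of_mem_gr (V := V) (hx (Fin.castAdd b i)) _
  refine (congrArg (_ • f ·) h4).trans ?_
  rw [MultilinearMap.map_smul_univ, ← Int.cast_smul_eq_zsmul k, smul_smul, smul_smul]
  congr 1
  simp only [Fin.prod_univ_castSucc, Fin.snoc_castSucc, Fin.snoc_last, mul_one, Fin.prod_univ_add]
  rw [mul_right_comm, ← mul_assoc]
  have h5 : ∀ j : Fin b, ((Fin.natAdd a j).rev : ℕ) = (j.rev : ℕ) := fun j => by
    simp only [Fin.val_rev, Fin.val_natAdd]; omega
  simp only [h5]
  congr 1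
  have h6 : (((-1) ^ (a * b) : ℤ) : k) = ∏ _i : Fin a, sgn k b := by
    rw [Finset.prod_const, Finset.card_univ, Fintype.card_fin, pow_mul']
    simp [sgn, Int.negOnePow]
  rw [h6, ← Finset.prod_mul_distrib, ← Finset.prod_mul_distrib]
  refine Finset.prod_congr rfl fun i _ => ?_
  rw [← sgn_add, ← sgn_add]
  have e1 : ((Fin.castAdd b i).rev : ℤ) = a + b - 1 - i := by
    rw [Fin.val_rev, Fin.val_castAdd]; omega
  have e2 : ((Fin.castSucc i).rev : ℤ) = a - i := by
    rw [Fin.val_rev, Fin.val_castSucc]; omega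
  rw [e1, e2]
  -- For each of the a first inputs the exponents differ by b plus the even number 2(1 - b).
  have e3 : (a + b - 1 - i : ℤ) * d (Fin.castAdd b i) + (2 - b) * (d (Fin.castAdd b i) + 1) =
      (b + (a - i + 1) * d (Fin.castAdd b i)) + ((1 - b) + (1 - b)) := by ring
  rw [e3, sgn_add _ (_ + _), sgn_add (1 - b : ℤ), sgn_mul_self, mul_one]

/-- The differential passes n suspensions. In the i-th summand there is one sign for each earlier
input, one for each later input, and one because the differential of V[1] is -d. -/
theorem parityChange_compTensorD {n : ℕ} (f : Multi V T n) :
    parityChange V T n (compTensorD f) = sgn k n • compTensorD (parityChange V T n f) := by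
  refine multi_ext_gr fun d x hx => ?_
  rw [parityChange_apply _ d x hx, _root_.smul_apply, compTensorD, compTensorD,
    _root_.sum_apply, _root_.sum_apply, Finset.smul_sum, Finset.smul_sum]
  refine Finset.sum_congr rfl fun i _ => ?_
  rw [MultilinearMap.compLinearMap_apply, MultilinearMap.compLinearMap_apply]
  have hy : ∀ j, (if j < i then V.shift.twist 1 else if j = i then V.shift.d else LinearMap.id) (x j)
      ∈ V.shift.gr (d j + if j = i then 1 else 0) := fun j => by
    rcases lt_trichotomy j i with h | rfl | h
    · rw [if_pos h, if_neg h.ne, twist_of_mem_gr (hx j), add_zero]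
      exact Submodule.smul_mem _ _ (hx j)
    · rw [if_neg (lt_irrefl j), if_pos rfl, if_pos rfl]
      exact V.shift.d_mem _ _ (hx j)
    · rw [if_neg h.not_gt, if_neg h.ne', if_neg h.ne']
      simpa using hx j
  rw [parityChange_apply _ _ _ hy]
  have h1 : (fun j => (if j < i then V.twist 1 else if j = i then V.d else LinearMap.id)
      (V.susp (x j))) = fun j => (if j < i then sgn k (d j + 1) else 1) •
        (if j = i then V.d else LinearMap.id) (V.susp (x j)) := by
    funext j
    split_ifs with h1 h2 h2
    · exact (h1.ne h2).elim
    · exact (twist_of_mem_gr (V := V) (hx j) 1).trans (by rw [one_mul]; rfl)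
    · rw [one_smul]
    · rw [one_smul]
  have h2 : (fun j => V.susp ((if j < i then V.shift.twist 1 else if j = i then V.shift.d else
      LinearMap.id) (x j))) = fun j => (if j < i then sgn k (d j) else if j = i then -1 else 1) •
        (if j = i then V.d else LinearMap.id) (V.susp (x j)) := by
    funext j
    split_ifs with h1 h2 h2
    · exact (h1.ne h2).elim
    · rw [twist_of_mem_gr (hx j), one_mul, map_smul]; rfl
    · rw [neg_one_smul]; rfl
    · rw [one_smul]; rfl
  rw [h1, h2, MultilinearMap.map_smul_univ, MultilinearMap.map_smul_univ, smul_smul, smul_smul,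
    smul_smul]
  congr 1
  rw [← Finset.prod_mul_distrib, mul_assoc, ← Finset.prod_mul_distrib]
  have h3 : ∀ j, (sgn k ((j.rev : ℕ) * d j) * if j < i then sgn k (d j + 1) else 1) =
      (sgn k ((j.rev : ℕ) * (d j + if j = i then 1 else 0)) *
        if j < i then sgn k (d j) else if j = i then -1 else 1) *
          ((if j < i then -1 else 1) * if j = i then - sgn k (i.rev : ℕ) else 1) := fun j => by
    split_ifs with h1 h2 h2
    · exact (h1.ne h2).elim
    · rw [sgn_add, sgn_one, add_zero]; ring
    · subst h2
      rw [mul_one, mul_add, mul_one, sgn_add,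
        show ∀ a s : k, a * s * (-1) * (1 * (-s)) = a * (s * s) from fun a s => by ring, sgn_mul_self,
        mul_one]
    · simp
  rw [Finset.prod_congr rfl fun j _ => h3 j, Finset.prod_mul_distrib, mul_comm (sgn k n)]
  congr 1
  rw [Finset.prod_mul_distrib, Finset.prod_ite_eq' Finset.univ, if_pos (Finset.mem_univ _),
    Finset.prod_ite, Finset.prod_const_one, mul_one, Finset.prod_const,
    show (univ.filter fun j => j < i) = Finset.Iio i by ext; simp, Fin.card_Iio]
  have h4 : ((-1 : k)) ^ (i : ℕ) = sgn k i := by simp [sgn, Int.negOnePow]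
  have h5 : (n : ℤ) = i + ((i.rev : ℕ) + 1) := by rw [Fin.val_rev]; omega
  rw [h4, h5, sgn_add, sgn_add, sgn_one]
  ring

/-- The shift exchanges even and odd parts, which reverses the supertrace. -/
theorem strace_shift (φ : V.shift →ₗ[k] V.shift) :
    V.shift.strace φ = -V.strace (V.susp.toLinearMap ∘ₗ φ ∘ₗ V.susp.symm.toLinearMap) := by
  have : V.susp.toLinearMap ∘ₗ V.shift.twist 1 ∘ₗ V.susp.symm.toLinearMap = -V.twist 1 := by
    refine linearMap_ext_gr fun i x hx => ?_
    rw [LinearMap.neg_apply, twist_of_mem_gr hx, LinearMap.comp_apply, LinearMap.comp_apply]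
    refine (twist_of_mem_gr (V := V.shift) (i := i - 1) (x := V.susp.symm x)
      (show x ∈ V.gr (i - 1 + 1) by rwa [sub_add_cancel]) 1).trans ?_
    have : sgn k (1 * (i - 1)) = -sgn k (1 * i) := by
      rw [one_mul, one_mul, sub_eq_add_neg, sgn_add, sgn_neg, sgn_one, mul_neg_one]
    rw [this, neg_smul]
    rfl
  rw [strace_apply, strace_apply, ← map_neg, ← neg_mul, ← this]
  rfl

/-- The suspension of the traced input gives the sign with exponent the total degree of the others,
and the shifted supertrace gives a minus sign. If the resulting endomorphism has degree 0, then this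
total is -1 and the signs cancel; otherwise both supertraces are zero. -/
theorem parityChange_traceLast [CharZero k] {n : ℕ} {f : Multi V V (n + 1)}
    (hf : HasDegree (2 - (n + 1 : ℕ)) f) :
    parityChange V k n (traceLast f) = traceLast (tilde f) := by
  refine multi_ext_gr fun d x hx => ?_
  rw [parityChange_apply _ d x hx]
  have hhom : IsHomogeneous V V (∑ i, d i + 1) (f.curryRight fun i => V.susp (x i)) :=
    fun q y hy => by
      have := hf (Fin.snoc (α := fun _ => ℤ) (fun i => d i + 1) q)
        (Fin.snoc (α := fun _ => V) (fun i => V.susp (x i)) y) fun j => by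
          refine Fin.lastCases ?_ (fun j => ?_) j
          · simpa using hy
          · simp only [Fin.snoc_castSucc]
            exact hx j
      rw [Fin.sum_univ_castSucc] at this
      simp only [Fin.snoc_castSucc, Fin.snoc_last, Finset.sum_add_distrib, Finset.sum_const,
        Finset.card_univ, Fintype.card_fin, nsmul_eq_mul, mul_one, Nat.cast_add, Nat.cast_one] at this
      rw [MultilinearMap.curryRight_apply, show q + (∑ j, d j + 1) =
        ∑ j, d j + n + q + (2 - (n + 1)) by ring]
      exact this
  have h1 : V.susp.toLinearMap ∘ₗ (tilde f).curryRight x ∘ₗ V.susp.symm.toLinearMap =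
      (∏ i, sgn k (((i.rev : ℕ) + 1) * d i)) • f.curryRight fun i => V.susp (x i) := by
    refine linearMap_ext_gr fun i y hy => ?_
    have hy' : V.susp.symm y ∈ V.shift.gr (i - 1) :=
      show y ∈ V.gr (i - 1 + 1) by rwa [sub_add_cancel]
    refine (parityChange_apply f (Fin.snoc (α := fun _ => ℤ) d (i - 1))
      (Fin.snoc (α := fun _ => V.shift) x (V.susp.symm y)) fun j => ?_).trans ?_
    · refine Fin.lastCases ?_ (fun j => ?_) j
      · simpa using hy'
      · simpa using hx j
    · rw [Fin.prod_univ_castSucc]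
      simp only [Fin.snoc_castSucc, Fin.snoc_last, Fin.rev_last, Fin.val_zero, Nat.cast_zero,
        zero_mul, sgn_zero, mul_one, LinearMap.smul_apply]
      congr 1
      refine Finset.prod_congr rfl fun i _ => ?_
      rw [Fin.rev_castSucc, Fin.val_succ]
      push_cast
      rfl
  have h2 : traceLast (tilde f) x = -((∏ i, sgn k (((i.rev : ℕ) + 1) * d i)) *
      V.strace (f.curryRight fun i => V.susp (x i))) :=
    (strace_shift _).trans (by rw [h1, map_smul, smul_eq_mul])
  rw [h2]
  by_cases hd : ∑ i, d i + 1 = 0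
  · have h3 : ∏ i, sgn k (((i.rev : ℕ) + 1) * d i) = -∏ i, sgn k ((i.rev : ℕ) * d i) := by
      simp only [add_mul, one_mul, sgn_add]
      rw [Finset.prod_mul_distrib]
      have h4 : ∀ s : Finset (Fin n), ∏ i ∈ s, sgn k (d i) = sgn k (∑ i ∈ s, d i) := by
        intro s
        classical
        induction s using Finset.induction_on with
        | empty => simp [sgn_zero]
        | insert i s hi ih => rw [Finset.prod_insert hi, Finset.sum_insert hi, sgn_add, ih]
      rw [h4, eq_neg_of_add_eq_zero_left hd, sgn_neg, sgn_one, mul_neg_one]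
    rw [h3, neg_mul, neg_neg]
    rfl
  · have h5 := hhom.strace_eq_zero hd
    rw [h5, mul_zero, neg_zero]
    exact (congrArg (_ • ·) h5).trans (smul_zero _)

end DGSpace

/-! ### Translation between the skew and the symmetric axioms -/

namespace DGSpace

variable {k : Type u} [Field k] {V : DGSpace.{u, v} k}
  {T : Type*} [AddCommGroup T] [Module k T]

theorem compLast_zero_right {a b : ℕ} (q : ℤ) (f : Multi V T (a + 1)) :
    compLast q f (0 : Multi V V b) = 0 := by
  ext x
  rw [compLast_apply]
  exact f.map_coord_zero (Fin.last a) (by simp)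

theorem compLast_zero_left {a b : ℕ} (q : ℤ) (g : Multi V V b) :
    compLast q (0 : Multi V T (a + 1)) g = 0 := rfl

theorem relabel_zero {n m : ℕ} (e : Fin n ≃ Fin m) : relabel e (0 : Multi V T m) = 0 := by
  refine multi_ext_par fun p x hx => ?_
  rw [relabel_apply_of_mem_par e _ p x hx]
  exact smul_zero _

theorem composeAll_eq_sum {F : ∀ n, Multi V T n} {L : ∀ n, Multi V V n} (h0 : L 0 = 0)
    (h1 : L 1 = 0) (n : ℕ) : composeAll F L n = ∑ I : {I : Finset (Fin n) // 2 ≤ #Iᶜ},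
      relabel (shuffle I.1) (compLast 1 (F (#I.1 + 1)) (L #I.1ᶜ)) := by
  rw [composeAll, ← Fintype.sum_subtype_add_sum_subtype fun I : Finset (Fin n) => 2 ≤ #Iᶜ]
  refine (congrArg _ (Finset.sum_eq_zero fun I _ => ?_)).trans (add_zero _)
  have hL : ∀ m, ¬ 2 ≤ m → L m = 0 := fun m hm => by
    interval_cases m
    · exact h0
    · exact h1
  rw [hL _ I.2, compLast_zero_right, relabel_zero]

theorem composeAll_eq_sum' {F : ∀ n, Multi V T n} {L : ∀ n, Multi V V n} (h0 : L 0 = 0)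
    (h1 : L 1 = 0) (hF : F 1 = 0) (n : ℕ) :
    composeAll F L n = ∑ I : {I : Finset (Fin n) // 1 ≤ #I ∧ 2 ≤ #Iᶜ},
      relabel (shuffle I.1) (compLast 1 (F (#I.1 + 1)) (L #I.1ᶜ)) := by
  rw [composeAll, ← Fintype.sum_subtype_add_sum_subtype fun I : Finset (Fin n) =>
    1 ≤ #I ∧ 2 ≤ #Iᶜ]
  refine (congrArg _ (Finset.sum_eq_zero fun I _ => ?_)).trans (add_zero _)
  have hL : ∀ m, ¬ 2 ≤ m → L m = 0 := fun m hm => by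
    interval_cases m
    · exact h0
    · exact h1
  by_cases hI : 1 ≤ #I.1
  · rw [hL _ fun h => I.2 ⟨hI, h⟩, compLast_zero_right, relabel_zero]
  · have h2 : F (#I.1 + 1) = 0 := by
      obtain h3 : #I.1 = 0 := by omega
      rw [h3]; exact hF
    rw [h2, compLast_zero_left, relabel_zero]

/-- The symmetric brackets obtained from skew-symmetric ones by the parity change. -/
def shiftedEll (ℓ : ∀ n, Multi V V n) (n : ℕ) : Multi V.shift V.shift n :=
  if 2 ≤ n then tilde (ℓ n) else 0

/-- The symmetric scalar operations obtained from skew-symmetric ones by the parity change. -/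
def shiftedQ (q : ∀ n, Multi V k n) (n : ℕ) : Multi V.shift k n :=
  if 1 ≤ n then tildeScalar (q n) else 0

theorem hasDegree_tilde {n : ℕ} {f : Multi V V n} :
    HasDegree 1 (tilde f) ↔ HasDegree (2 - n) f := by
  have key : ∀ (d : Fin n → ℤ) (x : Fin n → V), (∀ i, x i ∈ V.gr (d i + 1)) →
      (tilde f (fun i => V.susp.symm (x i)) ∈ V.shift.gr (∑ i, d i + 1) ↔
        f x ∈ V.gr (∑ i, (d i + 1) + (2 - n))) := by
    intro d x hx
    have h1 : tilde f (fun i => V.susp.symm (x i)) = V.susp.symm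
      ((∏ i : Fin n, sgn k ((i.rev : ℕ) * d i)) • f x) := parityChange_apply f d _ hx
    have h2 : IsUnit (∏ i : Fin n, sgn k ((i.rev : ℕ) * d i)) := by
      refine isUnit_iff_ne_zero.2 (Finset.prod_ne_zero_iff.2 fun i _ h => ?_)
      have := sgn_mul_self (k := k) ((i.rev : ℕ) * d i)
      rw [h, mul_zero] at this
      exact zero_ne_one this
    rw [h1, Finset.sum_add_distrib, Finset.sum_const, Finset.card_univ, Fintype.card_fin,
      nsmul_eq_mul, mul_one, show (∑ i, d i + n + (2 - n) : ℤ) = ∑ i, d i + 1 + 1 by ring]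
    exact Submodule.smul_mem_iff_of_isUnit _ h2
  constructor
  · intro h d x hx
    have := (key (fun i => d i - 1) x fun i => by simpa using hx i).1
      (h _ _ fun i => show x i ∈ V.gr (d i - 1 + 1) by simpa using hx i)
    simpa using this
  · intro h d x hx
    exact (key d x hx).2 (h _ _ hx)

theorem hasScalarDegree_tildeScalar {n : ℕ} {f : Multi V k n} :
    HasScalarDegree 0 (tildeScalar f) ↔ HasScalarDegree (-n) f := by
  have key : ∀ (d : Fin n → ℤ) (x : Fin n → V), (∀ i, x i ∈ V.gr (d i + 1)) →
      (tildeScalar f (fun i => V.susp.symm (x i)) = 0 ↔ f x = 0) := by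
    intro d x hx
    have h1 : tildeScalar f (fun i => V.susp.symm (x i)) =
      ((∏ i : Fin n, sgn k ((i.rev : ℕ) * d i)) • f x) := parityChange_apply f d _ hx
    rw [h1, smul_eq_zero_iff_right]
    refine Finset.prod_ne_zero_iff.2 fun i _ h => ?_
    have := sgn_mul_self (k := k) ((i.rev : ℕ) * d i)
    rw [h, mul_zero] at this
    exact zero_ne_one this
  constructor
  · intro h d x hx hd
    refine (key (fun i => d i - 1) x fun i => by simpa using hx i).1
      (h _ _ (fun i => show x i ∈ V.gr (d i - 1 + 1) by simpa using hx i) ?_)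
    rw [Finset.sum_sub_distrib]
    simpa [sub_eq_add_neg] using hd
  · intro h d x hx hd
    refine (key d x hx).2 (h _ _ hx ?_)
    rw [Finset.sum_add_distrib]
    simpa using hd

theorem isSymm_parityChange {n : ℕ} {f : Multi V T n} : IsSymm (parityChange V T n f) ↔
    ∀ σ : Fin n ≃ Fin n, relabel σ f = inversionSign σ • f := by
  refine forall_congr' fun σ => ?_
  have hs : inversionSign σ * inversionSign σ = 1 := koszulSign_mul_self _ _
  have h := parityChange_relabel σ f
  constructor
  · intro h1
    refine (parityChange V T n).injective ?_
    rw [h, h1, map_zsmul]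
  · intro h1
    rw [h1, map_zsmul] at h
    rw [← one_smul ℤ (relabel σ _), ← hs, mul_smul, ← h, ← mul_smul, hs, one_smul]

/-- The sign (-1)^(2-n) in the differential cancels the sign from the n suspensions; the overall
minus comes from the differential -d of V[1]. -/
theorem tilde_del {n : ℕ} (f : Multi V V n) : parityChange V V n (del (2 - n) f) =
    -(V.susp.toLinearMap.compMultilinearMap (V.shift.d.compMultilinearMap (tilde f) +
      compTensorD (tilde f))) := by
  have h1 : parityChange V V n (V.d.compMultilinearMap f) =
    -(V.susp.toLinearMap.compMultilinearMap (V.shift.d.compMultilinearMap (tilde f))) := by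
    ext x
    exact (neg_neg (V.d (parityChange V V n f x))).symm
  have h2 : sgn k (2 - n) * sgn k n = 1 := by
    rw [← sgn_add, sub_add_cancel, sgn, Int.negOnePow_even _ even_two]
    simp
  rw [del, map_sub, map_smul, parityChange_compTensorD, smul_smul, h2, one_smul, h1]
  ext x
  exact (neg_add' _ _).symm

theorem parityChange_delScalar {n : ℕ} (f : Multi V k n) :
    parityChange V k n (delScalar (-n) f) = -compTensorD (tildeScalar f) := by
  have h2 : sgn k (-n) * sgn k n = 1 := by rw [sgn_neg, sgn_mul_self]
  rw [delScalar, map_neg, map_smul, parityChange_compTensorD, smul_smul, h2, one_smul]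
  rfl

/-- The signs in the unimodular L∞ axioms are exactly those created by the parity change, from the
relabelling and from the grafting, so the symmetric form has none. -/
theorem parityChange_summand {F : ∀ n, Multi V T n} {ℓ : ∀ n, Multi V V n} {n : ℕ}
    (I : Finset (Fin n)) :
    parityChange V T n ((inversionSign (shuffle I) * (-1) ^ (#I * #Iᶜ)) •
        relabel (shuffle I) (compLast (2 - #Iᶜ) (F (#I + 1)) (ℓ #Iᶜ))) =
      relabel (shuffle I) (compLast 1 (parityChange V T _ (F (#I + 1))) (tilde (ℓ #Iᶜ))) := by
  have hs : inversionSign (shuffle I) * inversionSign (shuffle I) = 1 := koszulSign_mul_self _ _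
  have hz : ∀ (c : ℤ) (f : Multi V.shift T (#I + #Iᶜ)),
      relabel (shuffle I) (c • f) = c • relabel (shuffle I) f := fun c f => by
    refine multi_ext_par fun p x hx => ?_
    rw [relabel_apply_of_mem_par _ _ p x hx, _root_.smul_apply, _root_.smul_apply,
      relabel_apply_of_mem_par _ _ p x hx, smul_comm]
  rw [map_zsmul, parityChange_relabel, parityChange_compLast, hz, smul_smul, smul_smul]
  have : inversionSign (shuffle I) * (-1) ^ (#I * #Iᶜ) * (inversionSign (shuffle I) *
      (-1) ^ (#I * #Iᶜ)) = 1 := by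
    rw [mul_mul_mul_comm, hs, one_mul, ← mul_pow]
    simp
  rw [mul_assoc _ (inversionSign _), this, one_smul]

end DGSpace

namespace DGSpace

variable {k : Type u} [Field k] {V : DGSpace.{u, v} k}
  {T : Type*} [AddCommGroup T] [Module k T] {ℓ : ∀ n, Multi V V n} {q : ∀ n, Multi V k n}

theorem shiftedEll_of_le {n : ℕ} (hn : 2 ≤ n) : shiftedEll ℓ n = tilde (ℓ n) := if_pos hn

theorem shiftedQ_of_le {n : ℕ} (hn : 1 ≤ n) : shiftedQ q n = tildeScalar (q n) := if_pos hn

theorem shiftedEll_zero : shiftedEll ℓ 0 = 0 := if_neg (by omega)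
theorem shiftedEll_one : shiftedEll ℓ 1 = 0 := if_neg (by omega)
theorem shiftedQ_zero : shiftedQ q 0 = 0 := if_neg (by omega)

theorem ell_eq_iff {n : ℕ} (hn : 2 ≤ n) :
    del (2 - (n : ℤ)) (ℓ n) = ∑ I : {I : Finset (Fin n) // 1 ≤ #I ∧ 2 ≤ #Iᶜ},
      (inversionSign (shuffle I.1) * (-1) ^ (#I.1 * #I.1ᶜ)) •
        relabel (shuffle I.1) (compLast (2 - #I.1ᶜ) (ℓ (#I.1 + 1)) (ℓ #I.1ᶜ)) ↔
    V.shift.d.compMultilinearMap (shiftedEll ℓ n) + compTensorD (shiftedEll ℓ n) +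
      composeAll (shiftedEll ℓ) (shiftedEll ℓ) n = 0 := by
  rw [composeAll_eq_sum' shiftedEll_zero shiftedEll_one shiftedEll_one, shiftedEll_of_le hn,
    ← (parityChange V V n).injective.eq_iff, tilde_del, map_sum]
  simp only [parityChange_summand]
  rw [neg_eq_iff_add_eq_zero]
  have h : ∑ I : {I : Finset (Fin n) // 1 ≤ #I ∧ 2 ≤ #Iᶜ}, relabel (shuffle I.1)
      (compLast 1 (shiftedEll ℓ (#I.1 + 1)) (shiftedEll ℓ #I.1ᶜ)) =
    ∑ I : {I : Finset (Fin n) // 1 ≤ #I ∧ 2 ≤ #Iᶜ}, relabel (shuffle I.1)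
      (compLast 1 (tilde (ℓ (#I.1 + 1))) (tilde (ℓ #I.1ᶜ))) :=
    Finset.sum_congr rfl fun I _ => by
      rw [shiftedEll_of_le I.2.2, shiftedEll_of_le (Nat.succ_le_succ I.2.1)]
  rw [h]
  exact Iff.rfl

theorem q_eq_iff [CharZero k] {n : ℕ} (hn : 1 ≤ n) (hℓ : HasDegree (2 - (n + 1 : ℕ)) (ℓ (n + 1))) :
    delScalar (-(n : ℤ)) (q n) = (∑ I : {I : Finset (Fin n) // 2 ≤ #Iᶜ},
      (inversionSign (shuffle I.1) * (-1) ^ (#I.1 * #I.1ᶜ)) •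
        relabel (shuffle I.1) (compLast (2 - #I.1ᶜ) (q (#I.1 + 1)) (ℓ #I.1ᶜ))) +
          traceLast (ℓ (n + 1)) ↔
    compTensorD (shiftedQ q n) + composeAll (shiftedQ q) (shiftedEll ℓ) n +
      traceLast (shiftedEll ℓ (n + 1)) = 0 := by
  rw [composeAll_eq_sum shiftedEll_zero shiftedEll_one, shiftedQ_of_le hn,
    shiftedEll_of_le (Nat.succ_le_succ hn), ← (parityChange V k n).injective.eq_iff,
    parityChange_delScalar, map_add, map_sum, parityChange_traceLast hℓ]
  simp only [parityChange_summand]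
  rw [neg_eq_iff_add_eq_zero, add_assoc]
  have h : ∑ I : {I : Finset (Fin n) // 2 ≤ #Iᶜ}, relabel (shuffle I.1)
      (compLast 1 (shiftedQ q (#I.1 + 1)) (shiftedEll ℓ #I.1ᶜ)) =
    ∑ I : {I : Finset (Fin n) // 2 ≤ #Iᶜ}, relabel (shuffle I.1)
      (compLast 1 (parityChange V k _ (q (#I.1 + 1))) (tilde (ℓ #I.1ᶜ))) :=
    Finset.sum_congr rfl fun I _ => by
      rw [shiftedEll_of_le I.2, shiftedQ_of_le (Nat.succ_le_succ (Nat.zero_le _))]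
      rfl
  rw [h]

theorem hasDegree_zero {n : ℕ} (p : ℤ) : HasDegree p (0 : Multi V V n) :=
  fun _ _ _ => zero_mem _

theorem IsUnimodularLInfty.isSymmetricULInfty [CharZero k] (H : IsUnimodularLInfty V ℓ q) :
    IsSymmetricULInfty V.shift (shiftedEll ℓ) (shiftedQ q) where
  ell_zero := shiftedEll_zero
  ell_one := shiftedEll_one
  q_zero := shiftedQ_zero
  ell_degree n := by
    by_cases hn : 2 ≤ n
    · rw [shiftedEll_of_le hn]
      exact hasDegree_tilde.2 (H.ell_degree n hn)
    · rw [shiftedEll, if_neg hn]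
      exact hasDegree_zero 1
  q_degree n := by
    by_cases hn : 1 ≤ n
    · rw [shiftedQ_of_le hn]
      exact hasScalarDegree_tildeScalar.2 (H.q_degree n hn)
    · rw [shiftedQ, if_neg hn]
      exact fun _ _ _ _ => rfl
  ell_symm n := by
    by_cases hn : 2 ≤ n
    · rw [shiftedEll_of_le hn]
      exact isSymm_parityChange.2 (H.ell_skew n hn)
    · rw [shiftedEll, if_neg hn]
      exact fun σ => relabel_zero σ
  q_symm n := by
    by_cases hn : 1 ≤ n
    · rw [shiftedQ_of_le hn]
      exact isSymm_parityChange.2 (H.q_skew n hn)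
    · rw [shiftedQ, if_neg hn]
      exact fun σ => relabel_zero σ
  ell_eq n := by
    by_cases hn : 2 ≤ n
    · exact (ell_eq_iff hn).1 (H.ell_eq n hn)
    · rw [composeAll_eq_sum shiftedEll_zero shiftedEll_one, shiftedEll, if_neg hn]
      have : IsEmpty {I : Finset (Fin n) // 2 ≤ #Iᶜ} := ⟨fun I => hn (I.2.trans (card_finset_fin_le _))⟩
      rw [Finset.univ_eq_empty, Finset.sum_empty]
      ext x
      simp [compTensorD]
  q_eq n := by
    by_cases hn : 1 ≤ n
    · exact (q_eq_iff hn (H.ell_degree _ (Nat.succ_le_succ hn))).1 (H.q_eq n hn)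
    · rw [composeAll_eq_sum shiftedEll_zero shiftedEll_one, shiftedQ, if_neg hn]
      have : IsEmpty {I : Finset (Fin n) // 2 ≤ #Iᶜ} :=
        ⟨fun I => hn ((Nat.le_succ 1).trans (I.2.trans (card_finset_fin_le _)))⟩
      obtain rfl : n = 0 := by omega
      rw [Finset.univ_eq_empty, Finset.sum_empty, shiftedEll_one]
      ext x
      have h0 : (0 : Multi V.shift V.shift (0 + 1)).curryRight = 0 := rfl
      simp [compTensorD, traceLast, h0]

theorem IsSymmetricULInfty.isUnimodularLInfty [CharZero k]
    (H : IsSymmetricULInfty V.shift (shiftedEll ℓ) (shiftedQ q)) : IsUnimodularLInfty V ℓ q where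
  ell_degree n hn := hasDegree_tilde.1 (shiftedEll_of_le (ℓ := ℓ) hn ▸ H.ell_degree n)
  q_degree n hn := hasScalarDegree_tildeScalar.1 (shiftedQ_of_le (q := q) hn ▸ H.q_degree n)
  ell_skew n hn := isSymm_parityChange.1 (by
    have := H.ell_symm n
    rwa [shiftedEll_of_le hn] at this)
  q_skew n hn := isSymm_parityChange.1 (by
    have := H.q_symm n
    rwa [shiftedQ_of_le hn] at this)
  ell_eq n hn := (ell_eq_iff hn).2 (H.ell_eq n)
  q_eq n hn := (q_eq_iff hn (hasDegree_tilde.1 (shiftedEll_of_le (ℓ := ℓ) (Nat.succ_le_succ hn) ▸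
    H.ell_degree (n + 1)))).2 (H.q_eq n)

theorem exists_shifted_eq {L : ∀ n, Multi V.shift V.shift n} {Q : ∀ n, Multi V.shift k n}
    (hL0 : L 0 = 0) (hL1 : L 1 = 0) (hQ0 : Q 0 = 0) :
    ∃ (ℓ : ∀ n, Multi V V n) (q : ∀ n, Multi V k n), (∀ n, tilde (ℓ n) = L n) ∧
      (∀ n, tildeScalar (q n) = Q n) ∧ shiftedEll ℓ = L ∧ shiftedQ q = Q := by
  have h1 : ∀ n, tilde ((parityChange V V n).symm (L n)) = L n := fun n =>
    (parityChange V V n).apply_symm_apply (L n)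
  have h2 : ∀ n, tildeScalar ((parityChange V k n).symm (Q n)) = Q n := fun n =>
    (parityChange V k n).apply_symm_apply (Q n)
  refine ⟨fun n => (parityChange V V n).symm (L n), fun n => (parityChange V k n).symm (Q n),
    h1, h2, funext fun n => ?_, funext fun n => ?_⟩
  · match n with
    | 0 => rw [shiftedEll_zero, hL0]
    | 1 => rw [shiftedEll_one, hL1]
    | n + 2 => rw [shiftedEll_of_le (by omega), h1]
  · match n with
    | 0 => rw [shiftedQ_zero, hQ0]
    | n + 1 => rw [shiftedQ_of_le (by omega), h2]

end DGSpace

/-! ## The morphism of dg wheeled operads -/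

namespace DGSpace

variable {k : Type u} [Field k] {V : DGSpace.{u, v} k}
  {T T' : Type*} [AddCommGroup T] [Module k T] [AddCommGroup T'] [Module k T']

theorem relabel_postcomp {n m : ℕ} (e : Fin n ≃ Fin m) (φ : T →ₗ[k] T') (F : Multi V T m) :
    relabel e (φ.compMultilinearMap F) = φ.compMultilinearMap (relabel e F) :=
  multi_ext_par fun p x hx => by
    rw [relabel_apply_of_mem_par e _ p x hx, LinearMap.compMultilinearMap_apply,
      LinearMap.compMultilinearMap_apply, relabel_apply_of_mem_par e F p x hx, map_zsmul]

theorem relabel_add {n m : ℕ} (e : Fin n ≃ Fin m) (F G : Multi V T m) :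
    relabel e (F + G) = relabel e F + relabel e G :=
  multi_ext_par fun p x hx => by
    rw [_root_.add_apply]
    simp only [relabel_apply_of_mem_par e _ p x hx, _root_.add_apply, smul_add]

theorem relabel_smul {n m : ℕ} (e : Fin n ≃ Fin m) (c : k) (F : Multi V T m) :
    relabel e (c • F) = c • relabel e F :=
  multi_ext_par fun p x hx => by
    rw [_root_.smul_apply, relabel_apply_of_mem_par e _ p x hx, _root_.smul_apply,
      relabel_apply_of_mem_par e F p x hx, smul_comm]

theorem compTensorD_add {n : ℕ} (F G : Multi V T n) :
    compTensorD (F + G) = compTensorD F + compTensorD G := by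
  rw [compTensorD, compTensorD, compTensorD, ← Finset.sum_add_distrib]
  rfl

theorem compTensorD_smul {n : ℕ} (c : k) (F : Multi V T n) :
    compTensorD (c • F) = c • compTensorD F := by
  rw [compTensorD, compTensorD, Finset.smul_sum]
  rfl

variable (V T) in
/-- `compTensorD` as a linear map. -/
def compTensorDHom (n : ℕ) : Multi V T n →ₗ[k] Multi V T n where
  toFun := compTensorD
  map_add' := compTensorD_add
  map_smul' := compTensorD_smul

variable (V) in
/-- `traceLast` as a linear map. -/
def traceLastHom (n : ℕ) : Multi V V (n + 1) →ₗ[k] Multi V k n where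
  toFun := traceLast
  map_add' f g := by
    ext x
    exact map_add V.strace (f.curryRight x) (g.curryRight x)
  map_smul' c f := by
    ext x
    exact map_smul V.strace c (f.curryRight x)

/-- On even points both sides are unsigned sums over the position of ηd, which a relabelling merely
permutes. -/
theorem compTensorD_relabel {n m : ℕ} (e : Fin n ≃ Fin m) (F : Multi V T m) :
    compTensorD (relabel e F) = relabel e (compTensorD F) := by
  refine multi_ext_of_valid (A := ExteriorAlgebra k (ℕ →₀ k)) fun η hη z hz => ?_
  have hz' := fun i => (hz i).1
  rw [gext_compTensorD hη _ _ hz', gext_relabel e _ z hz',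
    gext_compTensorD hη _ _ fun i => hz' (e.symm i), ← Equiv.sum_comp e]
  refine Finset.sum_congr rfl fun i _ => ?_
  rw [gext_relabel]
  · congr 1
    funext j
    rw [Equiv.symm_apply_apply]
    by_cases h : j = e i
    · subst h; simp
    · rw [Function.update_of_ne h, Function.update_of_ne]
      rintro rfl
      simp at h
  · intro j
    by_cases h : j = i
    · subst h
      rw [Function.update_self]
      exact lact_d_mem hη (hz' j)
    · rw [Function.update_of_ne h]
      exact hz' j

theorem compTensorD_apply {n : ℕ} (F : Multi V T n) (x : Fin n → V) :
    compTensorD F x = ∑ i : Fin n, F fun j =>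
      (if j < i then V.twist 1 else if j = i then V.d else LinearMap.id) (x j) := by
  rw [compTensorD, _root_.sum_apply]
  rfl

/-- The differential acts on one of the first a inputs or on an input of G. The sum for F also
contains the term in which it acts on the output of G; this does not occur on the left and is
subtracted. -/
theorem compTensorD_compLast {a b : ℕ} (q : ℤ) (F : Multi V T (a + 1)) (G : Multi V V b) :
    compTensorD (compLast q F G) = sgn k q • (compLast q (compTensorD F) G -
      compLast (q + 1) F (V.d.compMultilinearMap G)) + compLast (q + 1) F (compTensorD G) := by
  ext x
  rw [_root_.add_apply, _root_.smul_apply, _root_.sub_apply, compLast_apply, compLast_apply,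
    compLast_apply, compTensorD_apply, compTensorD_apply, Fin.sum_univ_add,
    Fin.sum_univ_castSucc]
  have h1 : (F fun j => (if j < Fin.last a then V.twist 1 else if j = Fin.last a then V.d else
      LinearMap.id) (Fin.snoc (α := fun _ => V) (fun i => V.twist q (x (Fin.castAdd b i)))
        (G fun j => x (Fin.natAdd a j)) j)) =
      F (Fin.snoc (α := fun _ => V) (fun i => V.twist (q + 1) (x (Fin.castAdd b i)))
        (V.d.compMultilinearMap G fun j => x (Fin.natAdd a j))) := by
    congr 1
    funext j
    refine Fin.lastCases ?_ (fun j => ?_) j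
    · simp
    · rw [if_pos (Fin.castSucc_lt_last j), Fin.snoc_castSucc, Fin.snoc_castSucc, twist_twist,
        add_comm]
  rw [h1, add_sub_cancel_right, Finset.smul_sum]
  congr 1
  · refine Finset.sum_congr rfl fun i _ => ?_
    rw [compLast_apply]
    have h2 : (Fin.snoc (α := fun _ => V) (fun l : Fin a => V.twist q
        ((if Fin.castAdd b l < Fin.castAdd b i then V.twist 1 else
          if Fin.castAdd b l = Fin.castAdd b i then V.d else LinearMap.id) (x (Fin.castAdd b l))))
        (G fun j => (if Fin.natAdd a j < Fin.castAdd b i then V.twist 1 else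
          if Fin.natAdd a j = Fin.castAdd b i then V.d else LinearMap.id) (x (Fin.natAdd a j)))) =
      fun j => (if j = i.castSucc then sgn k q else 1) •
        (if j < i.castSucc then V.twist 1 else if j = i.castSucc then V.d else LinearMap.id)
          (Fin.snoc (α := fun _ => V) (fun i => V.twist q (x (Fin.castAdd b i)))
            (G fun j => x (Fin.natAdd a j)) j) := by
      funext j
      refine Fin.lastCases ?_ (fun l => ?_) j
      · have e1 : ∀ l : Fin b, ¬ Fin.natAdd a l < Fin.castAdd b i := fun l => by
          rw [Fin.lt_def, Fin.val_natAdd, Fin.val_castAdd]; omega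
        have e2 : ∀ l : Fin b, ¬ Fin.natAdd a l = Fin.castAdd b i := fun l => by
          rw [Fin.ext_iff, Fin.val_natAdd, Fin.val_castAdd]; omega
        simp only [e1, e2, if_false, Fin.snoc_last, LinearMap.id_apply,
          (Fin.castSucc_lt_last i).not_gt, (Fin.castSucc_lt_last i).ne', one_smul]
      · simp only [Fin.snoc_castSucc, Fin.castSucc_lt_castSucc_iff, Fin.castSucc_inj]
        rcases lt_trichotomy l i with h | rfl | h
        · have : Fin.castAdd b l < Fin.castAdd b i := h
          rw [if_pos h, if_pos this, if_neg h.ne, one_smul, twist_twist, twist_twist, add_comm]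
        · rw [if_neg (lt_irrefl _), if_neg (lt_irrefl _), if_pos rfl, if_pos rfl, if_pos rfl,
            d_twist, smul_smul, sgn_mul_self, one_smul]
        · have h' : Fin.castAdd b i < Fin.castAdd b l := h
          rw [if_neg h.not_gt, if_neg h'.not_gt, if_neg h.ne', if_neg h'.ne', if_neg h.ne',
            one_smul, LinearMap.id_apply, LinearMap.id_apply]
    rw [h2, MultilinearMap.map_smul_univ, Finset.prod_ite_eq' Finset.univ,
      if_pos (Finset.mem_univ _)]
  · rw [compTensorD_apply]
    have h3 := map_sum (MultilinearMap.curryRight F fun i : Fin a =>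
      V.twist (q + 1) (x (Fin.castAdd b i))) (fun i : Fin b => G fun j =>
        (if j < i then V.twist 1 else if j = i then V.d else LinearMap.id) (x (Fin.natAdd a j)))
        Finset.univ
    simp only [MultilinearMap.curryRight_apply] at h3
    rw [h3]
    refine Finset.sum_congr rfl fun i _ => ?_
    rw [compLast_apply]
    congr 1
    funext j
    refine Fin.lastCases ?_ (fun l => ?_) j
    · simp only [Fin.snoc_last]
      congr 1
      funext l
      simp only [Fin.natAdd_lt_natAdd_iff, Fin.natAdd_inj]
    · have : Fin.castAdd b l < Fin.natAdd a i := by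
        rw [Fin.lt_def, Fin.val_natAdd, Fin.val_castAdd]; omega
      rw [Fin.snoc_castSucc, Fin.snoc_castSucc, if_pos this, twist_twist]

theorem strace_d_comp (φ : V →ₗ[k] V) : V.strace (V.d ∘ₗ φ) = -V.strace (φ ∘ₗ V.d) := by
  have h : (V.twist 1 : Module.End k V) * V.d = -(V.d * V.twist 1) := by
    ext x
    rw [LinearMap.neg_apply, Module.End.mul_apply, Module.End.mul_apply, d_twist, sgn_one,
      neg_one_smul, neg_neg]
  have h2 := LinearMap.trace_mul_comm k (V.d : Module.End k V) ((V.twist 1 : Module.End k V) * φ)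
  rw [strace_apply, strace_apply]
  change LinearMap.trace k V ((V.twist 1 : Module.End k V) * (V.d * φ)) =
    -LinearMap.trace k V ((V.twist 1 : Module.End k V) * (φ * V.d))
  rw [← mul_assoc, h, neg_mul, map_neg, mul_assoc, h2, mul_assoc]

/-- The differential of the output and that of the traced input form a supercommutator, whose
supertrace is zero. The signs agree when the partial evaluation has degree -1; in all other degrees
both supertraces vanish. -/
theorem traceLast_del [CharZero k] {n : ℕ} {p : ℤ} {F : Multi V V (n + 1)} (hF : HasDegree p F) :
    traceLast (del p F) = delScalar p (traceLast F) := by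
  refine multi_ext_gr fun i x hx => ?_
  set y : Fin n → V := fun j => V.twist 1 (x j) with hy
  have hhom : IsHomogeneous V V (∑ j, i j + p) (F.curryRight x) := fun r z hz => by
    have := hF (Fin.snoc (α := fun _ => ℤ) i r) (Fin.snoc (α := fun _ => V) x z) fun j => by
      refine Fin.lastCases ?_ (fun j => ?_) j
      · simpa using hz
      · simpa using hx j
    rw [Fin.sum_univ_castSucc] at this
    simp only [Fin.snoc_castSucc, Fin.snoc_last] at this
    rw [MultilinearMap.curryRight_apply, show r + (∑ j, i j + p) = ∑ j, i j + r + p by ring]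
    exact this
  have h1 : (compTensorD F).curryRight x = F.curryRight y ∘ₗ V.d + ∑ l : Fin n,
      F.curryRight fun j => (if j < l then V.twist 1 else if j = l then V.d else LinearMap.id)
        (x j) := by
    ext z
    rw [MultilinearMap.curryRight_apply, compTensorD_apply, Fin.sum_univ_castSucc,
      LinearMap.add_apply, LinearMap.sum_apply, add_comm]
    congr 1
    · rw [LinearMap.comp_apply, MultilinearMap.curryRight_apply]
      congr 1
      funext j
      refine Fin.lastCases ?_ (fun j => ?_) j
      · simp
      · rw [if_pos (Fin.castSucc_lt_last j), Fin.snoc_castSucc, Fin.snoc_castSucc]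
    · refine Finset.sum_congr rfl fun l _ => ?_
      rw [MultilinearMap.curryRight_apply]
      congr 1
      funext j
      refine Fin.lastCases ?_ (fun j => ?_) j
      · simp [(Fin.castSucc_lt_last l).not_gt, (Fin.castSucc_lt_last l).ne']
      · simp [Fin.castSucc_lt_castSucc_iff, Fin.castSucc_inj]
  have h2 : F.curryRight y = sgn k (∑ j, i j) • F.curryRight x := by
    have e : y = fun j => sgn k (i j) • x j := funext fun j => by
      rw [hy]
      simp only [twist_of_mem_gr (hx j), one_mul]
    have h4 : ∀ s : Finset (Fin n), ∏ j ∈ s, sgn k (i j) = sgn k (∑ j ∈ s, i j) := by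
      intro s
      classical
      induction s using Finset.induction_on with
      | empty => simp [sgn_zero]
      | insert j s hj ih => rw [Finset.prod_insert hj, Finset.sum_insert hj, sgn_add, ih]
    rw [e, MultilinearMap.map_smul_univ, h4]
  have h3 : V.strace (V.d ∘ₗ F.curryRight x) =
      sgn k (∑ j, i j + p) • V.strace (F.curryRight x ∘ₗ V.d) := by
    rw [strace_d_comp]
    by_cases h : ∑ j, i j + p + 1 = 0
    · rw [eq_neg_of_add_eq_zero_left h, sgn_neg, sgn_one, neg_one_smul]
    · have : IsHomogeneous V V (∑ j, i j + p + 1) (F.curryRight x ∘ₗ V.d) := fun r z hz => by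
        have := hhom _ _ (V.d_mem r z hz)
        rwa [show r + 1 + (∑ j, i j + p) = r + (∑ j, i j + p + 1) by ring] at this
      rw [this.strace_eq_zero h, neg_zero, smul_zero]
  have h4 : (del p F).curryRight x = V.d ∘ₗ F.curryRight x -
      sgn k p • (compTensorD F).curryRight x := rfl
  have h5 : compTensorD (traceLast F) x = V.strace (∑ l : Fin n,
      F.curryRight fun j => (if j < l then V.twist 1 else if j = l then V.d else LinearMap.id)
        (x j)) := by
    rw [compTensorD_apply, map_sum]
    rfl
  change V.strace ((del p F).curryRight x) = -(sgn k p • compTensorD (traceLast F) x)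
  rw [h4, map_sub, h3, map_smul, h1, map_add, h5, h2, LinearMap.smul_comp, map_smul, sgn_add]
  simp only [smul_eq_mul]
  ring

theorem HasDegree.compLast {a b : ℕ} {p q : ℤ} {F : Multi V V (a + 1)} {G : Multi V V b}
    (hF : HasDegree p F) (hG : HasDegree q G) : HasDegree (p + q) (compLast q F G) :=
  fun i x hx => by
    have := hF (Fin.snoc (α := fun _ => ℤ) (fun j => i (Fin.castAdd b j))
        (∑ j, i (Fin.natAdd a j) + q)) (Fin.snoc (α := fun _ => V)
      (fun j : Fin a => V.twist q (x (Fin.castAdd b j))) (G fun j => x (Fin.natAdd a j)))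
      fun j => by
        refine Fin.lastCases ?_ (fun j => ?_) j
        · simpa using hG _ _ fun j => hx (Fin.natAdd a j)
        · simpa using by
            rw [twist_of_mem_gr (hx _)]
            exact Submodule.smul_mem _ _ (hx _)
    rw [Fin.sum_univ_castSucc] at this
    simp only [Fin.snoc_castSucc, Fin.snoc_last] at this
    rw [compLast_apply, Fin.sum_univ_add, show ∑ j, i (Fin.castAdd b j) + ∑ j, i (Fin.natAdd a j) +
      (p + q) = ∑ j, i (Fin.castAdd b j) + (∑ j, i (Fin.natAdd a j) + q) + p by ring]
    exact this

theorem HasDegree.relabel {n m : ℕ} (e : Fin n ≃ Fin m) {p : ℤ} {F : Multi V V m}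
    (hF : HasDegree p F) : HasDegree p (relabel e F) := fun i x hx => by
  rw [relabel_apply_of_mem_par e F _ x fun j => mem_par_of_mem_gr (hx j)]
  refine zsmul_mem ?_ _
  rw [← Equiv.sum_comp e.symm]
  exact hF _ _ fun j => hx (e.symm j)

theorem HasDegree.smul {n : ℕ} {p : ℤ} {F : Multi V V n} (hF : HasDegree p F) (c : k) :
    HasDegree p (c • F) := fun i x hx => Submodule.smul_mem _ _ (hF i x hx)

theorem compLast_sub_smul_right {a b : ℕ} (q : ℤ) (F : Multi V T (a + 1)) (G G' : Multi V V b)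
    (c : k) : compLast q F (G - c • G') = compLast q F G - c • compLast q F G' := by
  ext x
  rw [_root_.sub_apply, _root_.smul_apply, compLast_apply, compLast_apply, compLast_apply,
    ← MultilinearMap.curryRight_apply, ← MultilinearMap.curryRight_apply,
    ← MultilinearMap.curryRight_apply, ← map_smul, ← map_sub]
  rfl

theorem del_compLast {a b : ℕ} {p q r : ℤ} (hr : p + q = r) (F : Multi V V (a + 1))
    (G : Multi V V b) : del r (compLast q F G) =
      compLast q (del p F) G + sgn k p • compLast (q + 1) F (del q G) := by
  have h1 : compLast q (del p F) G = V.d.compMultilinearMap (compLast q F G) -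
    sgn k p • compLast q (compTensorD F) G := rfl
  rw [h1, del, del, compTensorD_compLast, compLast_sub_smul_right, ← hr, sgn_add, smul_add,
    smul_smul, mul_assoc, sgn_mul_self, mul_one, smul_sub, smul_sub, smul_smul]
  abel

theorem delScalar_compLast {a b : ℕ} {p q r : ℤ} (hr : p + q = r) (F : Multi V k (a + 1))
    (G : Multi V V b) : delScalar r (compLast q F G) =
      compLast q (delScalar p F) G + sgn k p • compLast (q + 1) F (del q G) := by
  have h1 : compLast q (delScalar p F) G = -(sgn k p • compLast q (compTensorD F) G) := rfl
  rw [h1, del, delScalar, compTensorD_compLast, compLast_sub_smul_right, ← hr, sgn_add, smul_add,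
    smul_smul, mul_assoc, sgn_mul_self, mul_one, smul_sub, smul_sub, smul_smul]
  abel

theorem del_relabel {n m : ℕ} (e : Fin n ≃ Fin m) (p : ℤ) (F : Multi V V m) :
    del p (relabel e F) = relabel e (del p F) := by
  rw [del, del, sub_eq_add_neg, sub_eq_add_neg, relabel_add, relabel_postcomp, ← neg_smul,
    ← neg_smul, relabel_smul, compTensorD_relabel]

theorem delScalar_relabel {n m : ℕ} (e : Fin n ≃ Fin m) (p : ℤ) (F : Multi V k m) :
    delScalar p (relabel e F) = relabel e (delScalar p F) := by
  have h : ∀ {n} (G : Multi V k n), delScalar p G = (-sgn k p) • compTensorD G :=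
    fun G => (neg_smul _ _).symm
  rw [h, h, relabel_smul, compTensorD_relabel]

variable (V) in
/-- `del` as a linear map. -/
def delHom (n : ℕ) (p : ℤ) : Multi V V n →ₗ[k] Multi V V n where
  toFun := del p
  map_add' f g := by
    ext x
    simp only [del, compTensorD_add, _root_.add_apply, _root_.sub_apply, _root_.smul_apply,
      LinearMap.compMultilinearMap_apply, map_add, smul_add]
    abel
  map_smul' c f := by
    ext x
    simp only [del, compTensorD_smul, _root_.sub_apply, _root_.smul_apply,
      LinearMap.compMultilinearMap_apply, map_smul, smul_sub, RingHom.id_apply,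
      smul_comm (sgn k p) c]

variable (V) in
/-- `delScalar` as a linear map. -/
def delScalarHom (n : ℕ) (p : ℤ) : Multi V k n →ₗ[k] Multi V k n :=
  -(sgn k p • compTensorDHom V k n)

theorem del_sum_smul {n : ℕ} (p : ℤ) {ι : Type*} (s : Finset ι) (c : ι → k)
    (F : ι → Multi V V n) : del p (∑ i ∈ s, c i • F i) = ∑ i ∈ s, c i • del p (F i) := by
  have := map_sum (delHom V n p) (fun i => c i • F i) s
  simp only [map_smul] at this
  exact this

theorem delScalar_sum_smul {n : ℕ} (p : ℤ) {ι : Type*} (s : Finset ι) (c : ι → k)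
    (F : ι → Multi V k n) :
    delScalar p (∑ i ∈ s, c i • F i) = ∑ i ∈ s, c i • delScalar p (F i) := by
  have := map_sum (delScalarHom V n p) (fun i => c i • F i) s
  simp only [map_smul] at this
  exact this

theorem del_id : del 0 (MultilinearMap.ofSubsingleton k V V (0 : Fin 1) LinearMap.id) = 0 := by
  ext x
  rw [del, sgn_zero, one_smul, _root_.sub_apply, compTensorD_apply, Fin.sum_univ_one]
  simp

variable {W : DGSpace.{u, v} k} {L L' : ∀ n, Multi W W n} {Q Q' : ∀ n, Multi W k n}

theorem _root_.OperadicExpr.hasDegree_eval (hL : ∀ n, HasDegree 1 (L n)) :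
    ∀ {n : ℕ} {p : ℤ} (t : OperadicExpr k n p), HasDegree p (t.eval L)
  | _, _, .ell n _ => hL n
  | _, _, .one => hasDegree_ofSubsingleton
  | _, _, .comp s t h => h ▸ (s.hasDegree_eval hL).compLast (t.hasDegree_eval hL)
  | _, _, .relabel e t => (t.hasDegree_eval hL).relabel e
  | _, _, .lin _ c t => HasDegree.sum fun i _ => ((t i).hasDegree_eval hL).smul (c i)

theorem _root_.OperadicExpr.eval_congr (hL : ∀ n, 2 ≤ n → L n = L' n) :
    ∀ {n : ℕ} {p : ℤ} (t : OperadicExpr k n p), t.eval L = t.eval L'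
  | _, _, .ell n hn => hL n hn
  | _, _, .one => rfl
  | _, _, .comp s t _ => by
    rw [OperadicExpr.eval, OperadicExpr.eval, s.eval_congr hL, t.eval_congr hL]
  | _, _, .relabel e t => by rw [OperadicExpr.eval, OperadicExpr.eval, t.eval_congr hL]
  | _, _, .lin _ c t => Finset.sum_congr rfl fun i _ => by rw [(t i).eval_congr hL]

theorem _root_.WheeledExpr.eval_congr (hL : ∀ n, 2 ≤ n → L n = L' n)
    (hQ : ∀ n, 1 ≤ n → Q n = Q' n) :
    ∀ {n : ℕ} {p : ℤ} (t : WheeledExpr k n p), t.eval L Q = t.eval L' Q'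
  | _, _, .gen n hn => hQ n hn
  | _, _, .comp s t _ => by
    rw [WheeledExpr.eval, WheeledExpr.eval, s.eval_congr hL hQ, t.eval_congr hL]
  | _, _, .trace t => by rw [WheeledExpr.eval, WheeledExpr.eval, t.eval_congr hL]
  | _, _, .relabel e t => by rw [WheeledExpr.eval, WheeledExpr.eval, t.eval_congr hL hQ]
  | _, _, .lin _ c t => Finset.sum_congr rfl fun i _ => by rw [(t i).eval_congr hL hQ]

/-- Both differentials are compatible with linear combinations and relabelling and are derivations
for composition, so it is enough to compare them on generators, where the claim is the structure
equation. -/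
theorem IsSymmetricULInfty.eval_diff [CharZero k] (H : IsSymmetricULInfty W L Q) :
    ∀ {n : ℕ} {p : ℤ} (t : OperadicExpr k n p), t.diff.eval L = del p (t.eval L)
  | _, _, .ell n hn => by
    have h := H.ell_eq n
    rw [composeAll_eq_sum' H.ell_zero H.ell_one H.ell_one] at h
    have h1 : del 1 (L n) = W.d.compMultilinearMap (L n) + compTensorD (L n) := by
      rw [del, sgn_one, neg_one_smul, sub_neg_eq_add]
    refine Eq.trans ?_ (h1.trans (eq_neg_of_add_eq_zero_left h)).symm
    rw [← Finset.sum_neg_distrib]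
    exact Finset.sum_congr rfl fun I _ => neg_one_smul k _
  | _, _, .one => (Finset.sum_of_isEmpty _).trans del_id.symm
  | _, _, .comp (p := p) (q := q) s t h => by
    refine (Fin.sum_univ_two _).trans ?_
    refine Eq.trans ?_ (del_compLast h (s.eval L) (t.eval L)).symm
    rw [← H.eval_diff s, ← H.eval_diff t]
    exact congrArg₂ (· + ·) (one_smul k _) rfl
  | _, _, .relabel e t => by
    refine Eq.trans ?_ (del_relabel e _ _).symm
    rw [← H.eval_diff t]
    rfl
  | _, _, .lin _ c t => by
    refine Eq.trans ?_ (del_sum_smul _ _ c _).symm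
    exact Finset.sum_congr rfl fun i _ => by rw [← H.eval_diff (t i)]

theorem IsSymmetricULInfty.eval_diff_wheeled [CharZero k] (H : IsSymmetricULInfty W L Q) :
    ∀ {n : ℕ} {p : ℤ} (t : WheeledExpr k n p), t.diff.eval L Q = delScalar p (t.eval L Q)
  | _, _, .gen n hn => by
    have h := H.q_eq n
    rw [composeAll_eq_sum H.ell_zero H.ell_one, add_assoc] at h
    have h1 : delScalar 0 (Q n) = -compTensorD (Q n) := by
      rw [delScalar, sgn_zero, one_smul]
    refine Eq.trans ?_ (h1.trans (neg_eq_of_add_eq_zero_right h)).symm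
    refine (Fintype.sum_option _).trans ((add_comm _ _).trans ?_)
    exact congrArg₂ (· + ·) (Finset.sum_congr rfl fun I _ => one_smul k _) (one_smul k _)
  | _, _, .comp (p := p) (q := q) s t h => by
    refine (Fin.sum_univ_two _).trans ?_
    refine Eq.trans ?_ (delScalar_compLast h (s.eval L Q) (t.eval L)).symm
    rw [← H.eval_diff_wheeled s, ← H.eval_diff t]
    exact congrArg₂ (· + ·) (one_smul k _) rfl
  | _, _, .trace t => by
    refine Eq.trans ?_ (traceLast_del (t.hasDegree_eval H.ell_degree))
    rw [← H.eval_diff t]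
    rfl
  | _, _, .relabel e t => by
    refine Eq.trans ?_ (delScalar_relabel e _ _).symm
    rw [← H.eval_diff_wheeled t]
    rfl
  | _, _, .lin _ c t => by
    refine Eq.trans ?_ (delScalar_sum_smul _ _ c _).symm
    exact Finset.sum_congr rfl fun i _ => by rw [← H.eval_diff_wheeled (t i)]

theorem IsSymmetricULInfty.isDGMorphism [CharZero k] (H : IsSymmetricULInfty W L Q)
    (hL : ∀ n, 2 ≤ n → L' n = L n) (hQ : ∀ n, 1 ≤ n → Q' n = Q n) : IsDGMorphism W L' Q' where
  ell_degree n hn := hL n hn ▸ H.ell_degree n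
  q_degree n hn := hQ n hn ▸ H.q_degree n
  ell_symm n hn := hL n hn ▸ H.ell_symm n
  q_symm n hn := hQ n hn ▸ H.q_symm n
  map_diff n p t := by rw [OperadicExpr.eval_congr hL, OperadicExpr.eval_congr hL, H.eval_diff]
  map_diff_wheeled n p t := by
    rw [WheeledExpr.eval_congr hL hQ, WheeledExpr.eval_congr hL hQ, H.eval_diff_wheeled]

end DGSpace

/-! ### Agreement with the sums over graphs, and the shift of `f`, `g`, `h` -/

namespace DGSpace

variable {k : Type u} [Field k] {V : DGSpace.{u, v} k} {U : DGSpace.{u, w} k}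
  {W : DGSpace.{u, v} k} {T : Type*} [AddCommGroup T] [Module k T]
  {L L' : ∀ n, Multi W W n} {Q Q' : ∀ n, Multi W k n} {h : W →ₗ[k] W}

theorem thetaInner_congr (hL : ∀ n, 2 ≤ n → L n = L' n) :
    ∀ {n : ℕ} (t : LTree n), thetaInner L h t = thetaInner L' h t
  | _, .leaf => rfl
  | _, .node c hc b => by
    rw [thetaInner, thetaInner, hL _ hc]
    simp only [thetaInner_congr hL]

theorem thetaRooted_congr (hL : ∀ n, 2 ≤ n → L n = L' n) {n : ℕ} (t : TreeWithLeg n) :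
    thetaRooted L h t = thetaRooted L' h t := by
  rw [thetaRooted, thetaRooted, hL _ t.1.2]
  simp only [thetaInner_congr hL]

theorem thetaUnrooted_congr (hL : ∀ n, 2 ≤ n → L n = L' n) (hQ : ∀ n, 1 ≤ n → Q n = Q' n) {n : ℕ}
    (hn : 1 ≤ n) (t : TreeWithoutLeg n) : thetaUnrooted L Q h t = thetaUnrooted L' Q' h t := by
  rw [thetaUnrooted, thetaUnrooted, hQ _ (t.1.length_pos hn)]
  simp only [thetaInner_congr hL]

theorem _root_.OrderedFinpartition.two_le_length_of_index_ne {n : ℕ} (c : OrderedFinpartition n)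
    {i j : Fin n} (h : c.index i ≠ c.index j) : 2 ≤ c.length :=
  Fin.nontrivial_iff_two_le.1 ⟨_, _, h⟩

/-- A wheel is a tree for which the first and the last leg lie on different branches. -/
def wheelGraphEquiv (n : ℕ) : WheelGraph n ≃
    Σ c : {c : OrderedFinpartition (n + 1) // c.index 0 ≠ c.index (Fin.last n)},
      ∀ m, LTree (c.1.partSize m) where
  toFun G := ⟨⟨G.1.1.1, G.2⟩, G.1.2⟩
  invFun t := ⟨⟨⟨t.1.1, t.1.1.two_le_length_of_index_ne t.1.2⟩, t.2⟩, t.1.2⟩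
  left_inv _ := rfl
  right_inv _ := rfl

theorem splitTrees_eq_sum (L : ∀ n, Multi W W n) (h : W →ₗ[k] W) (n : ℕ) :
    splitTrees L h n = ∑ G : WheelGraph n, thetaRooted L h G.1 := by
  rw [splitTrees]
  simp only [innerTrees, graft_sum]
  rw [← Fintype.sum_sigma' fun (c : {c : OrderedFinpartition (n + 1) //
    c.index 0 ≠ c.index (Fin.last n)}) (t : ∀ m, LTree (c.1.partSize m)) =>
      graft c.1 (L c.1.length) fun m => thetaInner L h (t m)]
  refine (Equiv.sum_comp (wheelGraphEquiv n) fun t => graft t.1.1 (L t.1.1.length)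
    fun m => thetaInner L h (t.2 m)).symm.trans ?_
  exact Finset.sum_congr rfl fun G _ => by rw [thetaRooted]; rfl

theorem wheelTrees_eq_sum (L : ∀ n, Multi W W n) (h : W →ₗ[k] W) (n : ℕ) :
    wheelTrees L h n = ∑ G : WheelGraph n, thetaWheel L h G := by
  have h1 : h.compMultilinearMap (splitTrees L h n) =
      ∑ G : WheelGraph n, h.compMultilinearMap (thetaRooted L h G.1) := by
    ext x
    simp only [splitTrees_eq_sum, LinearMap.compMultilinearMap_apply, _root_.sum_apply, map_sum]
  rw [wheelTrees, h1]
  exact map_sum (traceLastHom W n) _ _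

theorem compLinearMap_sum {ι : Type*} [Fintype ι] {n : ℕ} (F : ι → Multi V T n) (f : U →ₗ[k] V) :
    (∑ i, F i).compLinearMap (fun _ => f) = ∑ i, (F i).compLinearMap fun _ => f := by
  ext x
  simp only [MultilinearMap.compLinearMap_apply, _root_.sum_apply]

theorem transferEll_eq (ℓ : ∀ n, Multi V V n) (f : U →ₗ[k] V) (g : V →ₗ[k] U) (h : V →ₗ[k] V)
    (n : ℕ) : transferEll ℓ f g h n =
      transferredEll (shiftedEll ℓ) (shiftMap 0 f) (shiftMap 0 g) (shiftMap (-1) h) n := by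
  have hL : ∀ m, 2 ≤ m → tilde (ℓ m) = shiftedEll ℓ m := fun m hm => (shiftedEll_of_le hm).symm
  have h1 : ∀ G : TreeWithLeg n, thetaRooted (fun m => tilde (ℓ m)) (shiftMap (-1) h) G =
      thetaRooted (shiftedEll ℓ) (shiftMap (-1) h) G := fun G => thetaRooted_congr hL G
  rw [transferEll, transferredEll, pullFam, graftTrees_eq_sum shiftedEll_zero shiftedEll_one,
    compLinearMap_sum]
  simp only [h1]
  ext x
  simp only [_root_.sum_apply, LinearMap.compMultilinearMap_apply, map_sum]
  rfl

theorem transferQ_eq (ℓ : ∀ n, Multi V V n) (q : ∀ n, Multi V k n) (f : U →ₗ[k] V)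
    (h : V →ₗ[k] V) {n : ℕ} (hn : 1 ≤ n) : transferQ ℓ q f h n =
      transferredQ (shiftedEll ℓ) (shiftedQ q) (shiftMap 0 f) (shiftMap (-1) h) n := by
  have hL : ∀ m, 2 ≤ m → tilde (ℓ m) = shiftedEll ℓ m := fun m hm => (shiftedEll_of_le hm).symm
  have h1 : ∀ G : TreeWithoutLeg n, thetaUnrooted (fun m => tilde (ℓ m))
      (fun m => tildeScalar (q m)) (shiftMap (-1) h) G =
      thetaUnrooted (shiftedEll ℓ) (shiftedQ q) (shiftMap (-1) h) G := fun G =>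
    thetaUnrooted_congr hL (fun m hm => (shiftedQ_of_le hm).symm) hn G
  have h2 : ∀ G : WheelGraph n, thetaWheel (fun m => tilde (ℓ m)) (shiftMap (-1) h) G =
      thetaWheel (shiftedEll ℓ) (shiftMap (-1) h) G := fun G => by
    rw [thetaWheel, thetaWheel, thetaRooted_congr hL]
  have h3 : transferredQ (shiftedEll ℓ) (shiftedQ q) (shiftMap 0 f) (shiftMap (-1) h) n =
      (graftTrees (shiftedQ q) (shiftedEll ℓ) (shiftMap (-1) h) n).compLinearMap
        (fun _ => shiftMap 0 f) +
      (wheelTrees (shiftedEll ℓ) (shiftMap (-1) h) n).compLinearMap fun _ => shiftMap 0 f := rfl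
  rw [h3, transferQ, graftTrees_eq_sum_treeWithoutLeg, wheelTrees_eq_sum, compLinearMap_sum,
    compLinearMap_sum]
  simp only [h1, h2]
  rfl

theorem shiftMap_zero_apply (f : U →ₗ[k] V) (x : U.shift) :
    shiftMap 0 f x = V.susp.symm (f (U.susp x)) := by
  rw [shiftMap, sgn_zero, one_smul]
  rfl

theorem shiftMap_neg_one_apply (h : V →ₗ[k] V) (x : V.shift) :
    shiftMap (-1) h x = -V.susp.symm (h (V.susp x)) := by
  rw [shiftMap, sgn_neg, sgn_one, neg_one_smul]
  rfl

theorem isHomogeneous_shiftMap {p : ℤ} {f : U →ₗ[k] V} (hf : IsHomogeneous U V p f) :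
    IsHomogeneous U.shift V.shift p (shiftMap p f) := fun i x hx => by
  have := hf (i + 1) _ hx
  rw [add_right_comm] at this
  exact Submodule.smul_mem (V.shift.gr (i + p)) _ this

theorem IsChainMap.shiftMap {f : U →ₗ[k] V} (hf : IsChainMap U V f) :
    IsChainMap U.shift V.shift (shiftMap 0 f) := by
  refine ⟨isHomogeneous_shiftMap hf.1, fun x => ?_⟩
  rw [shiftMap_zero_apply, shiftMap_zero_apply]
  exact (map_neg f _).trans (congrArg Neg.neg (hf.2 x))

/-- Both d and h have odd degree and change sign under the shift, so dh + hd is unaffected. -/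
theorem shiftMap_homotopy {f : U →ₗ[k] V} {g : V →ₗ[k] U} {h : V →ₗ[k] V}
    (hfg : ∀ x : V, f (g x) - x = V.d (h x) + h (V.d x)) (x : V.shift) :
    shiftMap 0 f (shiftMap 0 g x) - x =
      V.shift.d (shiftMap (-1) h x) + shiftMap (-1) h (V.shift.d x) := by
  rw [shiftMap_zero_apply, shiftMap_zero_apply, shiftMap_neg_one_apply, shiftMap_neg_one_apply,
    map_neg]
  refine (hfg x).trans (congrArg₂ (· + ·) (neg_neg _).symm ?_)
  exact ((congrArg Neg.neg (map_neg h (V.d x))).trans (neg_neg _)).symm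

end DGSpace

theorem mainTheorem3 {k : Type u} [Field k] [CharZero k]
    (V : DGSpace.{u, v} k) (U : DGSpace.{u, w} k)
    (ℓ : ∀ n, DGSpace.Multi V V n) (q : ∀ n, DGSpace.Multi V k n)
    (hV : DGSpace.IsUnimodularLInfty V ℓ q)
    (f : U →ₗ[k] V) (g : V →ₗ[k] U) (h : V →ₗ[k] V)
    (hf : DGSpace.IsChainMap U V f) (hg : DGSpace.IsChainMap V U g)
    (hh : DGSpace.IsHomogeneous V V (-1) h)
    (hfg : ∀ x : V, f (g x) - x = V.d (h x) + h (V.d x)) :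
    IsDGMorphism U.shift (DGSpace.transferEll ℓ f g h) (DGSpace.transferQ ℓ q f h) ∧
      ∃ (ℓU : ∀ n, DGSpace.Multi U U n) (qU : ∀ n, DGSpace.Multi U k n),
        DGSpace.IsUnimodularLInfty U ℓU qU ∧
        (∀ n, 2 ≤ n → DGSpace.tilde (ℓU n) = DGSpace.transferEll ℓ f g h n) ∧
        (∀ n, 1 ≤ n → DGSpace.tildeScalar (qU n) = DGSpace.transferQ ℓ q f h n) := by
  have H := hV.isSymmetricULInfty.transferred (DGSpace.isHomogeneous_shiftMap hh) hf.shiftMap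
    hg.shiftMap (DGSpace.shiftMap_homotopy hfg)
  have hE := DGSpace.transferEll_eq ℓ f g h
  have hQ : ∀ n, 1 ≤ n → _ := fun n hn => DGSpace.transferQ_eq ℓ q f h (n := n) hn
  refine ⟨H.isDGMorphism (fun n _ => hE n) hQ, ?_⟩
  obtain ⟨ℓU, qU, h1, h2, h3, h4⟩ := DGSpace.exists_shifted_eq H.ell_zero H.ell_one H.q_zero
  refine ⟨ℓU, qU, DGSpace.IsSymmetricULInfty.isUnimodularLInfty (by rwa [h3, h4]),
    fun n _ => (h1 n).trans (hE n).symm, fun n hn => (h2 n).trans (hQ n hn).symm⟩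

end
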